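/- **Syntax.** Fix a signature $K$ of constants $k:\mathrm{dom}(k)\to\mathrm{cod}(k)$ with $\mathrm{dom}(k),\mathrm{cod}(k)\in\mathbb N$, and an infinite set $\mathbb A$ of names. Terms are $$M::=k\mid 0\mid i\mid\gamma\mid M;M\mid M\otimes M\mid x\mid\overline{xy}.M\qquad(x,y\in\mathbb A),$$ where the link $\overline{xy}.M$ binds $x$ and $y$ in $M$ (its scope extends as far right as possible). Put $1=i$; the identity at $n\ge 1$ is $i\otimes\cdots\otimes i$ and that at $0$ is $0$, and it is again written $n$. The symmetries $\gamma_{m,n}$ (swap a block of $m$ wires with a block of $n$ wires) are built from $\gamma=\gamma_{1,1}$ and identities in the usual way, with $\gamma_{m,0}=m$, $\gamma_{0,n}=n$ up to provable equality. **Typing.** Judgements are $\Gamma\mid\Delta\vdash M:m\to n\mid R$ with $\Gamma$ (input variables) and $\Delta$ (output variables) disjoint finite sets of names and $R$ (the anchor) a partial order on $\Gamma\uplus\Delta$; $[\,\cdot\,]$ denotes transitive and reflexive closure. The rules are: * $x\mid-\vdash x:0\to1\mid\{(x,x)\}$; $\;-\mid x\vdash x:1\to0\mid\{(x,x)\}$;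 and, with empty contexts and empty anchor, $0:0\to 0$, $i:1\to1$, $\gamma:2\to2$, $k:\mathrm{dom}(k)\to\mathrm{cod}(k)$. * From $\Gamma\mid\Delta\vdash M:m\to k\mid R$ and $\Gamma'\mid\Delta'\vdash N:k\to n\mid R'$ with $\Gamma\cup\Delta$ and $\Gamma'\cup\Delta'$ disjoint: $\Gamma\uplus\Gamma'\mid\Delta\uplus\Delta'\vdash M;N:m\to n\mid[R\cup R'\cup(\Gamma\uplus\Delta)\times(\Gamma'\uplus\Delta')]$. * From $\Gamma\mid\Delta\vdash M:m_1\to m_2\mid R$ and $\Gamma'\mid\Delta'\vdash N:n_1\to n_2\mid R'$, with the same disjointness: $\Gamma\uplus\Gamma'\mid\Delta\uplus\Delta'\vdash M\otimes N:m_1+n_1\to m_2+n_2\mid[R\cup R']$. * From $\Gamma\mid\Delta\vdash M:m\to n\mid R$ and $x,y\in\Gamma\uplus\Delta$: $\Gamma\mid\Delta\vdash M:m\to n\mid[R\cup\{(x,y)\}]$, provided this is a partial order. * From $\Gamma,y\mid\Delta,x\vdash M:m\to n\mid R$ with $(x,y)\in R$ and $x\neq y$ not in $\Gamma\cup\Delta$: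 $\Gamma\mid\Delta\vdash\overline{xy}.M:m\to n\mid\{(a,b)\in R: a,b\notin\{x,y\}\}$. Write $\Gamma\mid\Delta\vdash M:m\to n$ if this holds for some anchor $R$. **Diagrams.** A labelled interfaced DAG is a finite directed acyclic graph, some of whose vertices are labelled by names (each name at most once), constants, or input/output ports of constants, with a list of $m$ input and a list of $n$ output vertices, all unlabelled. A wire is an edge that does not join a constant to one of its ports. A framed-point DAG (uniflow diagram) is an equivalence class of labelled interfaced DAGs under the equivalence generated by graph isomorphism (respecting labels and interfaces) and insertion, or removal, of an unlabelled vertex along a wire. A derivation of $\Gamma\mid\Delta\vdash M:m\to n\mid R$ denotes a framed-point DAG: * an input variable $x$ denotes a vertex labelled $x$ with an edge to the single output; an output variable $x$ denotes the single input with an edge to a vertex labelled $x$; * $0$ denotes the empty graph, $i$ an edge from input to output, $\gamma$ two crossing such edges; * $k$ denotes a vertex labelled $k$ with, for each $p$, an edge from input $p$ to a vertex labelled "input port $p$ of $k$" and from there to $k$, and for each $q$ an edge from $k$ to a vertex labelled "output port $q$ of $k$" and from there to output $q$; * $M;N$ denotes the disjoint union with an edge from the $j$-th output of $M$ to the $j$-th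 input of $N$ for every $j$; $M\otimes N$ denotes the disjoint union with the interface lists concatenated; * anchor strengthening does not change the diagram; * $\overline{xy}.M$ denotes the diagram of $M$ with an edge added from the vertex labelled $x$ to the vertex labelled $y$, after which these two labels are removed. **Equations.** Let $\Gamma\mid\Delta\vdash M\equiv N$ (at type $m\to n$) be the least equivalence relation on the terms with $\Gamma\mid\Delta\vdash M:m\to n$ that is a congruence for $;$, $\otimes$ and $\overline{xy}.(-)$, relating only well-typed terms, and contains every instance of the following whose sides are both well-typed (with $M_j:m_j\to n_j$ in the symmetry law): $$(M_1;M_2);M_3\equiv M_1;(M_2;M_3),\quad m;M\equiv M\equiv M;n\ \ (M:m\to n),\quad (M;M')\otimes(N;N')\equiv(M\otimes N);(M'\otimes N'),$$ $$(M_1\otimes M_2)\otimes M_3\equiv M_1\otimes(M_2\otimes M_3),\quad M\otimes0\equiv M\equiv 0\otimes M,$$ $$(M_1\otimes M_2);\gamma_{n_1,n_2}\equiv\gamma_{m_1,m_2};(M_2\otimes M_1),\quad\gamma_{0,1}\equiv1\equiv\gamma_{1,0},\quad\gamma_{m,n+p}\equiv(\gamma_{m,n}\otimes p);(n\otimes\gamma_{m,p}),$$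 $$\overline{xy}.M\equiv\overline{x'y'}.M\{x'y'/xy\}\ \ (x',y'\text{ fresh and distinct}),$$ $$\overline{xy}.(M;N)\equiv(\overline{xy}.M);N\ \ (x,y\notin\mathrm{fv}(N)),\quad\overline{xy}.(M;N)\equiv M;\overline{xy}.N\ \ (x,y\notin\mathrm{fv}(M)),$$ $$\overline{xy}.(M\otimes N)\equiv M\otimes\overline{xy}.N\ \ (x,y\notin\mathrm{fv}(M)),\qquad\overline{xy}.(x;y)\equiv1\ \ (x\ne y).$$ **Theorem.** This equational theory is sound and complete for uniflow diagrams: for all $\Gamma,\Delta,m,n$ and all terms $M,N$ with derivations of $\Gamma\mid\Delta\vdash M:m\to n\mid R$ and $\Gamma\mid\Delta\vdash N:m\to n\mid R'$ (with possibly different anchors $R,R'$), $$\Gamma\mid\Delta\vdash M\equiv N\iff\text{the two derivations denote the same framed-point DAG.}$$ -/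

import Mathlib

universe u v

namespace LinkSyntax

/-! ### Terms -/

/-- A signature: constants `k : dom k → cod k` between natural numbers. -/
structure Signature where
  Const : Type u
  dom : Const → ℕ
  cod : Const → ℕ

/-- Raw terms `M ::= k | 0 | i | γ | M ; M | M ⊗ M | x | \overline{xy}.M`
over constants `K` and names `A`; `0` is the identity of the monoidal unit. -/
inductive Term (K : Type u) (A : Type v) : Type (max u v)
  | const (k : K) : Term K A
  | zero : Term K A
  | one : Term K A
  | sym : Term K A
  | seq (M N : Term K A) : Term K A
  | tensor (M N : Term K A) : Term K A
  | var (x : A) : Term K A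
  | link (x y : A) (M : Term K A) : Term K A

infixr:60 " ⨟ " => Term.seq
infixr:70 " ⊠ₜ " => Term.tensor

namespace Term

variable {K : Type u} {A : Type v}

/-- Free variables. -/
def fv [DecidableEq A] : Term K A → Finset A
  | const _ => ∅
  | zero => ∅
  | one => ∅
  | sym => ∅
  | seq M N => M.fv ∪ N.fv
  | tensor M N => M.fv ∪ N.fv
  | var x => {x}
  | link x y M => M.fv \ {x, y}

/-- All names occurring in a term, free, bound or binding. -/
def names [DecidableEq A] : Term K A → Finset A
  | const _ => ∅
  | zero => ∅
  | one => ∅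
  | sym => ∅
  | seq M N => M.names ∪ N.names
  | tensor M N => M.names ∪ N.names
  | var x => {x}
  | link x y M => M.names ∪ {x, y}

/-- Renaming of the free variables along `ρ`. It is only used with names that do not occur in the
term, so that no capture is possible. -/
def rename [DecidableEq A] : (A → A) → Term K A → Term K A
  | _, const k => const k
  | _, zero => zero
  | _, one => one
  | _, sym => sym
  | ρ, seq M N => seq (M.rename ρ) (N.rename ρ)
  | ρ, tensor M N => tensor (M.rename ρ) (N.rename ρ)
  | ρ, var x => var (ρ x)
  | ρ, link x y M => link x y (M.rename fun a => if a = x ∨ a = y then a else ρ a)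

/-- `M{x'y'/xy}`. -/
def rename₂ [DecidableEq A] (x y x' y' : A) (M : Term K A) : Term K A :=
  M.rename fun a => if a = x then x' else if a = y then y' else a

/-- The identity `n : n → n`, written with `0` and `i = 1`. -/
def ident : ℕ → Term K A
  | 0 => zero
  | 1 => one
  | n + 2 => ident (n + 1) ⊠ₜ one

/-- The symmetry `γ_{m,1} : m + 1 → 1 + m`, written with `γ = γ_{1,1}`. -/
def symOne : ℕ → Term K A
  | 0 => one
  | 1 => sym
  | m + 2 => (ident (m + 1) ⊠ₜ sym) ⨟ (symOne (m + 1) ⊠ₜ one)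

/-- The symmetry `γ_{m,n} : m + n → n + m`, written with `γ = γ_{1,1}`. -/
def symm (m : ℕ) : ℕ → Term K A
  | 0 => ident m
  | 1 => symOne m
  | n + 2 => (symm m (n + 1) ⊠ₜ one) ⨟ (ident (n + 1) ⊠ₜ symOne m)

end Term

/-! ### Typing -/

section Typing

variable {A : Type v}

/-- `R` is a partial order on the finite set `X`. -/
structure IsAnchor (X : Finset A) (R : A → A → Prop) : Prop where
  mem_left : ∀ a b, R a b → a ∈ X
  mem_right : ∀ a b, R a b → b ∈ X
  refl : ∀ a ∈ X, R a a
  antisymm : ∀ a b, R a b → R b a → a = b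
  trans : ∀ a b c, R a b → R b c → R a c

/-- The closure `[R]`. In the typing rules all reflexive pairs are already in the relation, so that
the transitive closure is the transitive and reflexive closure on the set of variables. -/
abbrev anchorClosure (R : A → A → Prop) : A → A → Prop := Relation.TransGen R

/-- `R ∪ S`. -/
def anchorUnion (R S : A → A → Prop) : A → A → Prop := fun a b => R a b ∨ S a b

/-- `R ∪ S ∪ (X × Y)`. -/
def anchorSeq (X Y : Finset A) (R S : A → A → Prop) : A → A → Prop :=
  fun a b => R a b ∨ S a b ∨ (a ∈ X ∧ b ∈ Y)

/-- `R ∪ {(x, y)}`. -/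
def anchorInsert (x y : A) (R : A → A → Prop) : A → A → Prop :=
  fun a b => R a b ∨ (a = x ∧ b = y)

/-- `R \ {x, y}`. -/
def anchorErase (x y : A) (R : A → A → Prop) : A → A → Prop :=
  fun a b => R a b ∧ (a ≠ x ∧ a ≠ y) ∧ (b ≠ x ∧ b ≠ y)

/-- Derivations of the judgement `Γ ∣ Δ ⊢ M : m → n ∣ R`. `Γ` is the set of input variables
(`x : 0 → 1`), `Δ` the set of output variables (`x : 1 → 0`), and `R` is the anchor. In a link
`\overline{xy}.M` the wire runs from the output variable `x` to the input variable `y`. -/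
inductive Deriv (S : Signature.{u}) [DecidableEq A] :
    Finset A → Finset A → Term S.Const A → ℕ → ℕ → (A → A → Prop) → Type (max u v)
  | inVar (x : A) : Deriv S {x} ∅ (.var x) 0 1 (fun a b => a = x ∧ b = x)
  | outVar (x : A) : Deriv S ∅ {x} (.var x) 1 0 (fun a b => a = x ∧ b = x)
  | const (k : S.Const) : Deriv S ∅ ∅ (.const k) (S.dom k) (S.cod k) (fun _ _ => False)
  | zero : Deriv S ∅ ∅ .zero 0 0 (fun _ _ => False)
  | one : Deriv S ∅ ∅ .one 1 1 (fun _ _ => False)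
  | sym : Deriv S ∅ ∅ .sym 2 2 (fun _ _ => False)
  | seq {Γ Δ Γ' Δ' : Finset A} {M N : Term S.Const A} {m k n : ℕ} {R R' : A → A → Prop}
      (d : Deriv S Γ Δ M m k R) (d' : Deriv S Γ' Δ' N k n R')
      (disj : Disjoint (Γ ∪ Δ) (Γ' ∪ Δ')) :
      Deriv S (Γ ∪ Γ') (Δ ∪ Δ') (M ⨟ N) m n
        (anchorClosure (anchorSeq (Γ ∪ Δ) (Γ' ∪ Δ') R R'))
  | tensor {Γ Δ Γ' Δ' : Finset A} {M N : Term S.Const A} {m₁ m₂ n₁ n₂ : ℕ}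
      {R R' : A → A → Prop}
      (d : Deriv S Γ Δ M m₁ m₂ R) (d' : Deriv S Γ' Δ' N n₁ n₂ R')
      (disj : Disjoint (Γ ∪ Δ) (Γ' ∪ Δ')) :
      Deriv S (Γ ∪ Γ') (Δ ∪ Δ') (M ⊠ₜ N) (m₁ + n₁) (m₂ + n₂)
        (anchorClosure (anchorUnion R R'))
  | strengthen {Γ Δ : Finset A} {M : Term S.Const A} {m n : ℕ} {R : A → A → Prop} (x y : A)
      (d : Deriv S Γ Δ M m n R) (hx : x ∈ Γ ∪ Δ) (hy : y ∈ Γ ∪ Δ)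
      (hR : IsAnchor (Γ ∪ Δ) (anchorClosure (anchorInsert x y R))) :
      Deriv S Γ Δ M m n (anchorClosure (anchorInsert x y R))
  | link {Γ Δ : Finset A} {M : Term S.Const A} {m n : ℕ} {R : A → A → Prop} (x y : A)
      (d : Deriv S (insert y Γ) (insert x Δ) M m n R)
      (hx : x ∉ Γ ∪ Δ) (hy : y ∉ Γ ∪ Δ) (hne : x ≠ y) (hxy : R x y) :
      Deriv S Γ Δ (.link x y M) m n (anchorErase x y R)

/-- `Γ ∣ Δ ⊢ M : m → n`, for some anchor. -/
def HasType (S : Signature.{u}) [DecidableEq A] (Γ Δ : Finset A) (M : Term S.Const A)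
    (m n : ℕ) : Prop :=
  ∃ R : A → A → Prop, Nonempty (Deriv S Γ Δ M m n R)

end Typing

/-! ### Uniflow diagrams -/

/-- Labels of vertices. A constant `k` is drawn as one vertex `box k`, with one vertex for each of
its input and output ports. -/
inductive Label (K : Type u) (A : Type v) : Type (max u v)
  | name (x : A) : Label K A
  | box (k : K) : Label K A
  | inPort (k : K) (i : ℕ) : Label K A
  | outPort (k : K) (j : ℕ) : Label K A

/-- Labelled directed graphs with a list of `m` input and a list of `n` output vertices. -/
structure Diagram (K : Type u) (A : Type v) (m n : ℕ) where
  V : Type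
  Edge : V → V → Prop
  lab : V → Option (Label K A)
  inp : Fin m → V
  out : Fin n → V

/-- Labelled interfaced DAGs: finite acyclic labelled graphs in which a variable labels at most one
vertex and the input and output vertices are unlabelled. -/
structure LIDAG (K : Type u) (A : Type v) (m n : ℕ) extends Diagram K A m n where
  finite : Finite V
  acyclic : ∀ a, ¬ Relation.TransGen Edge a a
  name_inj : ∀ a b x, lab a = some (.name x) → lab b = some (.name x) → a = b
  inp_unlabelled : ∀ i, lab (inp i) = none
  out_unlabelled : ∀ j, lab (out j) = none

namespace LIDAG

variable {K : Type u} {A : Type v} {m n : ℕ}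

/-- Graph isomorphism: `H` is `G` with its vertices renamed. -/
def Iso (G H : LIDAG K A m n) : Prop :=
  ∃ e : H.V ≃ G.V,
    (∀ a b, H.Edge a b ↔ G.Edge (e a) (e b)) ∧
    (∀ a, H.lab a = G.lab (e a)) ∧
    (∀ i, e (H.inp i) = G.inp i) ∧ (∀ j, e (H.out j) = G.out j)

/-- An edge is (part of) a wire unless it joins a constant to one of its own ports. -/
def IsWire (G : LIDAG K A m n) (u v : G.V) : Prop :=
  G.Edge u v ∧ (∀ k, G.lab u ≠ some (.box k)) ∧ (∀ k, G.lab v ≠ some (.box k))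

/-- The edges after the edge `u → v` is replaced with `u → w → v`, where `w = none` is new. -/
def subdivide (G : LIDAG K A m n) (u v : G.V) : Option G.V → Option G.V → Prop
  | some a, some b => G.Edge a b ∧ ¬ (a = u ∧ b = v)
  | some a, none => a = u
  | none, some b => b = v
  | none, none => False

/-- `H` is `G` with one new unlabelled vertex inserted along a wire. -/
def WireInsertion (G H : LIDAG K A m n) : Prop :=
  ∃ (u v : G.V) (e : H.V ≃ Option G.V), G.IsWire u v ∧
    (∀ a b, H.Edge a b ↔ G.subdivide u v (e a) (e b)) ∧
    (∀ a, H.lab a = (e a).elim none G.lab) ∧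
    (∀ i, e (H.inp i) = some (G.inp i)) ∧ (∀ j, e (H.out j) = some (G.out j))

/-- Equality up to renaming of vertices and wire homeomorphism: the equivalence relation generated
by isomorphism and the insertion (hence also the removal) of unlabelled vertices along wires. -/
def homeo (K : Type u) (A : Type v) (m n : ℕ) : Setoid (LIDAG K A m n) :=
  Relation.EqvGen.setoid fun G H => G.Iso H ∨ G.WireInsertion H

end LIDAG

/-- Uniflow diagrams, i.e. framed point DAGs. -/
def UniflowDiagram (K : Type u) (A : Type v) (m n : ℕ) : Type (max 1 u v) :=
  Quotient (LIDAG.homeo K A m n)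

/-! ### Interpretation -/

/-- Vertices of the diagram of a constant `m → n`: input `i`, port of input `i`, the constant,
port of output `j`, output `j`. -/
inductive ConstVertex (m n : ℕ) : Type
  | inp (i : Fin m) : ConstVertex m n
  | inPort (i : Fin m) : ConstVertex m n
  | box : ConstVertex m n
  | outPort (j : Fin n) : ConstVertex m n
  | out (j : Fin n) : ConstVertex m n

inductive ConstEdge {m n : ℕ} : ConstVertex m n → ConstVertex m n → Prop
  | inp (i : Fin m) : ConstEdge (.inp i) (.inPort i)
  | inPort (i : Fin m) : ConstEdge (.inPort i) .box
  | outPort (j : Fin n) : ConstEdge .box (.outPort j)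
  | out (j : Fin n) : ConstEdge (.outPort j) (.out j)

def constLab {K : Type u} {A : Type v} {m n : ℕ} (k : K) :
    ConstVertex m n → Option (Label K A)
  | .inp _ => none
  | .inPort i => some (.inPort k i)
  | .box => some (.box k)
  | .outPort j => some (.outPort k j)
  | .out _ => none

namespace Diagram

variable {K : Type u} {A : Type v}

/-- The labelled vertex `false`, with an edge to the output `true`. -/
def inVar (x : A) : Diagram K A 0 1 where
  V := Bool
  Edge a b := a = false ∧ b = true
  lab a := if a then none else some (.name x)
  inp := Fin.elim0
  out _ := true

/-- The input `false`, with an edge to the labelled vertex `true`. -/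
def outVar (x : A) : Diagram K A 1 0 where
  V := Bool
  Edge a b := a = false ∧ b = true
  lab a := if a then some (.name x) else none
  inp _ := false
  out := Fin.elim0

def const (k : K) (m n : ℕ) : Diagram K A m n where
  V := ConstVertex m n
  Edge := ConstEdge
  lab := constLab k
  inp := .inp
  out := .out

/-- The empty diagram. -/
def zero : Diagram K A 0 0 where
  V := Empty
  Edge _ _ := False
  lab _ := none
  inp := Fin.elim0
  out := Fin.elim0

/-- The input `false`, with an edge to the output `true`. -/
def one : Diagram K A 1 1 where
  V := Bool
  Edge a b := a = false ∧ b = true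
  lab _ := none
  inp _ := false
  out _ := true

/-- Inputs `inl 0, inl 1`, outputs `inr 0, inr 1`, and crossing edges. -/
def sym : Diagram K A 2 2 where
  V := Fin 2 ⊕ Fin 2
  Edge
    | .inl i, .inr j => i ≠ j
    | _, _ => False
  lab _ := none
  inp := .inl
  out := .inr

/-- Sequential composition: an edge from the `i`-th output to the `i`-th input, for every `i`. -/
def seq {m k n : ℕ} (D : Diagram K A m k) (D' : Diagram K A k n) : Diagram K A m n where
  V := D.V ⊕ D'.V
  Edge
    | .inl a, .inl b => D.Edge a b
    | .inr a, .inr b => D'.Edge a b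
    | .inl a, .inr b => ∃ i, a = D.out i ∧ b = D'.inp i
    | .inr _, .inl _ => False
  lab := Sum.elim D.lab D'.lab
  inp := Sum.inl ∘ D.inp
  out := Sum.inr ∘ D'.out

/-- Parallel composition: disjoint union. -/
def tensor {m₁ m₂ n₁ n₂ : ℕ} (D : Diagram K A m₁ m₂) (D' : Diagram K A n₁ n₂) :
    Diagram K A (m₁ + n₁) (m₂ + n₂) where
  V := D.V ⊕ D'.V
  Edge
    | .inl a, .inl b => D.Edge a b
    | .inr a, .inr b => D'.Edge a b
    | _, _ => False
  lab := Sum.elim D.lab D'.lab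
  inp := Fin.append (Sum.inl ∘ D.inp) (Sum.inr ∘ D'.inp)
  out := Fin.append (Sum.inl ∘ D.out) (Sum.inr ∘ D'.out)

open Classical in
/-- An edge from the vertex labelled `x` to the vertex labelled `y` is added, and both labels are
removed. -/
noncomputable def link {m n : ℕ} (x y : A) (D : Diagram K A m n) : Diagram K A m n where
  V := D.V
  Edge a b := D.Edge a b ∨ (D.lab a = some (.name x) ∧ D.lab b = some (.name y))
  lab a := if D.lab a = some (.name x) ∨ D.lab a = some (.name y) then none else D.lab a
  inp := D.inp
  out := D.out

theorem seq_path {m k n : ℕ} (D : Diagram K A m k) (D' : Diagram K A k n)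
    (p q : (D.seq D').V) (h : Relation.TransGen (D.seq D').Edge p q) :
    (∃ a b, p = Sum.inl a ∧ q = Sum.inl b ∧ Relation.TransGen D.Edge a b) ∨
    (∃ a b, p = Sum.inr a ∧ q = Sum.inr b ∧ Relation.TransGen D'.Edge a b) ∨
    (∃ a b, p = Sum.inl a ∧ q = Sum.inr b) := by
  induction h with
  | @single q h =>
    rcases p with a | a <;> rcases q with b | b
    · exact .inl ⟨a, b, rfl, rfl, .single h⟩
    · exact .inr (.inr ⟨a, b, rfl, rfl⟩)
    · exact h.elim
    · exact .inr (.inl ⟨a, b, rfl, rfl, .single h⟩)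
  | @tail q r _ h ih =>
    rcases r with c | c
    · rcases ih with ⟨a, b, rfl, rfl, ih⟩ | ⟨a, b, rfl, rfl, ih⟩ | ⟨a, b, rfl, rfl⟩
      · exact .inl ⟨a, c, rfl, rfl, ih.tail h⟩
      · exact h.elim
      · exact h.elim
    · rcases ih with ⟨a, b, rfl, rfl, ih⟩ | ⟨a, b, rfl, rfl, ih⟩ | ⟨a, b, rfl, rfl⟩
      · exact .inr (.inr ⟨a, c, rfl, rfl⟩)
      · exact .inr (.inl ⟨a, c, rfl, rfl, ih.tail h⟩)
      · exact .inr (.inr ⟨a, c, rfl, rfl⟩)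

theorem tensor_path {m₁ m₂ n₁ n₂ : ℕ} (D : Diagram K A m₁ m₂)
    (D' : Diagram K A n₁ n₂) (p q : (D.tensor D').V)
    (h : Relation.TransGen (D.tensor D').Edge p q) :
    (∃ a b, p = Sum.inl a ∧ q = Sum.inl b ∧ Relation.TransGen D.Edge a b) ∨
    (∃ a b, p = Sum.inr a ∧ q = Sum.inr b ∧ Relation.TransGen D'.Edge a b) := by
  induction h with
  | @single q h =>
    rcases p with a | a <;> rcases q with b | b
    · exact .inl ⟨a, b, rfl, rfl, .single h⟩
    · exact h.elim
    · exact h.elim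
    · exact .inr ⟨a, b, rfl, rfl, .single h⟩
  | @tail q r _ h ih =>
    rcases ih with ⟨a, b, rfl, rfl, ih⟩ | ⟨a, b, rfl, rfl, ih⟩ <;> rcases r with c | c
    · exact .inl ⟨a, c, rfl, rfl, ih.tail h⟩
    · exact h.elim
    · exact h.elim
    · exact .inr ⟨a, c, rfl, rfl, ih.tail h⟩

theorem link_path {m n : ℕ} (x y : A) (D : Diagram K A m n)
    (a b : D.V) (h : Relation.TransGen (D.link x y).Edge a b) :
    Relation.TransGen D.Edge a b ∨ ∃ s t, D.lab s = some (.name x) ∧ D.lab t = some (.name y) ∧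
      Relation.ReflTransGen D.Edge a s ∧ ∃ t', D.lab t' = some (.name y) ∧
      Relation.ReflTransGen D.Edge t' b := by
  induction h with
  | single h =>
    rcases h with h | h
    · exact .inl (.single h)
    · exact .inr ⟨_, _, h.1, h.2, .refl, _, h.2, .refl⟩
  | tail _ h ih =>
    rcases ih with ih | ⟨s, t, hs, ht, hp, t', ht', hq⟩ <;> rcases h with h | h
    · exact .inl (ih.tail h)
    · exact .inr ⟨_, _, h.1, h.2, ih.to_reflTransGen, _, h.2, .refl⟩
    · exact .inr ⟨s, t, hs, ht, hp, t', ht', hq.tail h⟩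
    · exact .inr ⟨s, t, hs, ht, hp, _, h.2, .refl⟩

end Diagram

section Semantics

variable {A : Type v} [DecidableEq A] {S : Signature.{u}}

/-- The interpretation, by recursion on the derivation. -/
noncomputable def Deriv.diagram {Γ Δ : Finset A} {M : Term S.Const A} {m n : ℕ}
    {R : A → A → Prop} : Deriv S Γ Δ M m n R → Diagram S.Const A m n
  | .inVar x => Diagram.inVar x
  | .outVar x => Diagram.outVar x
  | .const k => Diagram.const k (S.dom k) (S.cod k)
  | .zero => Diagram.zero
  | .one => Diagram.one
  | .sym => Diagram.sym
  | .seq d d' _ => d.diagram.seq d'.diagram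
  | .tensor d d' _ => d.diagram.tensor d'.diagram
  | .strengthen _ _ d _ _ _ => d.diagram
  | .link x y d _ _ _ _ => d.diagram.link x y

theorem IsAnchor.closure_sum {X Y : Finset A} {R R' Q : A → A → Prop} (hR : IsAnchor X R)
    (hR' : IsAnchor Y R') (hd : Disjoint X Y) (h1 : ∀ a b, R a b → Q a b)
    (h2 : ∀ a b, R' a b → Q a b) (h3 : ∀ a b, Q a b → R a b ∨ R' a b ∨ (a ∈ X ∧ b ∈ Y))
    (ht : ∀ a b c, Q a b → Q b c → Q a c) : IsAnchor (X ∪ Y) (anchorClosure Q) := by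
  have hQ : ∀ a b, anchorClosure Q a b → Q a b := by
    intro a b h
    induction h with
    | single h => exact h
    | tail _ h ih => exact ht _ _ _ ih h
  have hXY : ∀ a, a ∈ X → a ∈ Y → False := fun a h h' => Finset.disjoint_left.1 hd h h'
  refine ⟨fun a b h => ?_, fun a b h => ?_, fun a h => ?_, fun a b h h' => ?_,
    fun a b c h h' => h.trans h'⟩
  · have := hR.mem_left a b; have := hR'.mem_left a b
    rcases h3 _ _ (hQ _ _ h) with h | h | h <;> simp_all
  · have := hR.mem_right a b; have := hR'.mem_right a b
    rcases h3 _ _ (hQ _ _ h) with h | h | h <;> simp_all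
  · rcases Finset.mem_union.1 h with h | h
    · exact .single (h1 _ _ (hR.refl a h))
    · exact .single (h2 _ _ (hR'.refl a h))
  · rcases h3 _ _ (hQ _ _ h) with e | e | e <;> rcases h3 _ _ (hQ _ _ h') with e' | e' | e'
    · exact hR.antisymm _ _ e e'
    · exact (hXY _ (hR.mem_left _ _ e) (hR'.mem_right _ _ e')).elim
    · exact (hXY _ (hR.mem_left _ _ e) e'.2).elim
    · exact (hXY _ (hR.mem_right _ _ e') (hR'.mem_left _ _ e)).elim
    · exact hR'.antisymm _ _ e e'
    · exact (hXY _ e'.1 (hR'.mem_right _ _ e)).elim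
    · exact (hXY _ (hR.mem_left _ _ e') e.2).elim
    · exact (hXY _ e.1 (hR'.mem_right _ _ e')).elim
    · exact (hXY _ e.1 e'.2).elim

/-- The anchor of a derivation is a partial order on the variables. -/
theorem Deriv.isAnchor {Γ Δ : Finset A} {M : Term S.Const A} {m n : ℕ} {R : A → A → Prop}
    (d : Deriv S Γ Δ M m n R) : IsAnchor (Γ ∪ Δ) R := by
  induction d with
  | inVar x => constructor <;> simp_all
  | outVar x => constructor <;> simp_all
  | const k => constructor <;> simp_all
  | zero => constructor <;> simp_all
  | one => constructor <;> simp_all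
  | sym => constructor <;> simp_all
  | seq d d' disj ih ih' =>
    rw [Finset.union_union_union_comm]
    refine ih.closure_sum ih' disj (fun a b h => Or.inl h)
      (fun a b h => Or.inr (Or.inl h)) (fun a b h => h) (fun a b c h h' => ?_)
    rcases h with e | e | e <;> rcases h' with e' | e' | e'
    · exact .inl (ih.trans _ _ _ e e')
    · exact .inr (.inr ⟨ih.mem_left _ _ e, ih'.mem_right _ _ e'⟩)
    · exact .inr (.inr ⟨ih.mem_left _ _ e, e'.2⟩)
    · exact (Finset.disjoint_left.1 disj (ih.mem_left _ _ e') (ih'.mem_right _ _ e)).elim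
    · exact .inr (.inl (ih'.trans _ _ _ e e'))
    · exact (Finset.disjoint_left.1 disj e'.1 (ih'.mem_right _ _ e)).elim
    · exact (Finset.disjoint_left.1 disj (ih.mem_left _ _ e') e.2).elim
    · exact .inr (.inr ⟨e.1, ih'.mem_right _ _ e'⟩)
    · exact .inr (.inr ⟨e.1, e'.2⟩)
  | tensor d d' disj ih ih' =>
    rw [Finset.union_union_union_comm]
    refine ih.closure_sum ih' disj (fun a b h => Or.inl h)
      (fun a b h => Or.inr h) (fun a b h => h.elim Or.inl (fun h => Or.inr (Or.inl h)))
      (fun a b c h h' => ?_)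
    rcases h with e | e <;> rcases h' with e' | e'
    · exact .inl (ih.trans _ _ _ e e')
    · exact (Finset.disjoint_left.1 disj (ih.mem_right _ _ e) (ih'.mem_left _ _ e')).elim
    · exact (Finset.disjoint_left.1 disj (ih.mem_left _ _ e') (ih'.mem_right _ _ e)).elim
    · exact .inr (ih'.trans _ _ _ e e')
  | strengthen x y d hx hy hR ih => exact hR
  | link x y d hx hy hne hxy ih =>
    refine ⟨fun a b h => ?_, fun a b h => ?_, fun a h => ?_, fun a b h h' => ?_,
      fun a b c h h' => ?_⟩
    · have := ih.mem_left a b h.1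
      have := h.2
      simp at *; tauto
    · have := ih.mem_right a b h.1
      have := h.2
      simp at *; tauto
    · have h1 : a ≠ x := by rintro rfl; exact hx h
      have h2 : a ≠ y := by rintro rfl; exact hy h
      refine ⟨ih.refl a ?_, ⟨h1, h2⟩, h1, h2⟩
      simp at *; tauto
    · exact ih.antisymm a b h.1 h'.1
    · exact ⟨ih.trans a b c h.1 h'.1, h.2.1, h'.2.2⟩

/-- The properties of a diagram with anchor `R` that make it a labelled interfaced DAG: in addition
to the fields of `LIDAG`, paths between variables are contained in the anchor. -/
structure Anchored {m n : ℕ} (X : Finset A) (R : A → A → Prop) (D : Diagram S.Const A m n) :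
    Prop where
  finite : Finite D.V
  acyclic : ∀ a, ¬ Relation.TransGen D.Edge a a
  name_inj : ∀ a b x, D.lab a = some (.name x) → D.lab b = some (.name x) → a = b
  inp_unlabelled : ∀ i, D.lab (D.inp i) = none
  out_unlabelled : ∀ j, D.lab (D.out j) = none
  name_mem : ∀ a x, D.lab a = some (.name x) → x ∈ X
  path : ∀ a b x y, D.lab a = some (.name x) → D.lab b = some (.name y) →
    Relation.TransGen D.Edge a b → R x y

theorem path_of_rank {V : Type} {E : V → V → Prop} (f : V → ℕ) (hf : ∀ a b, E a b → f a < f b)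
    {a b : V} (h : Relation.TransGen E a b) : f a < f b := by
  induction h with
  | single h => exact hf _ _ h
  | tail _ h ih => exact ih.trans (hf _ _ h)

instance (m n : ℕ) : Finite (ConstVertex m n) := by
  refine Finite.of_surjective
    (fun p : Fin m ⊕ Fin m ⊕ Unit ⊕ Fin n ⊕ Fin n => match p with
      | .inl i => ConstVertex.inp i
      | .inr (.inl i) => .inPort i
      | .inr (.inr (.inl _)) => .box
      | .inr (.inr (.inr (.inl j))) => .outPort j
      | .inr (.inr (.inr (.inr j))) => .out j) ?_
  rintro (i | i | _ | j | j)
  · exact ⟨.inl i, rfl⟩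
  · exact ⟨.inr (.inl i), rfl⟩
  · exact ⟨.inr (.inr (.inl ())), rfl⟩
  · exact ⟨.inr (.inr (.inr (.inl j))), rfl⟩
  · exact ⟨.inr (.inr (.inr (.inr j))), rfl⟩

theorem Deriv.anchored {Γ Δ : Finset A} {M : Term S.Const A} {m n : ℕ} {R : A → A → Prop}
    (d : Deriv S Γ Δ M m n R) : Anchored (Γ ∪ Δ) R d.diagram := by
  induction d with
  | inVar x =>
    have hE : ∀ a b, (Diagram.inVar (K := S.Const) x).Edge a b → (Bool.toNat a < Bool.toNat b) := by
      rintro _ _ ⟨rfl, rfl⟩; decide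
    refine ⟨inferInstanceAs (Finite Bool), fun a h => (path_of_rank _ hE h).false, ?_,
      fun i => i.elim0, fun _ => rfl, ?_, ?_⟩
    · rintro (a | a) (b | b) z <;> simp [Deriv.diagram, Diagram.inVar]
    · rintro (a | a) z <;> simp [Deriv.diagram, Diagram.inVar, eq_comm]
    · rintro (a | a) (b | b) z w <;> simp [Deriv.diagram, Diagram.inVar, eq_comm]
      simp +contextual
  | outVar x =>
    have hE : ∀ a b, (Diagram.outVar (K := S.Const) x).Edge a b →
        (Bool.toNat a < Bool.toNat b) := by
      rintro _ _ ⟨rfl, rfl⟩; decide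
    refine ⟨inferInstanceAs (Finite Bool), fun a h => (path_of_rank _ hE h).false, ?_,
      fun _ => rfl, fun i => i.elim0, ?_, ?_⟩
    · rintro (a | a) (b | b) z <;> simp [Deriv.diagram, Diagram.outVar]
    · rintro (a | a) z <;> simp [Deriv.diagram, Diagram.outVar, eq_comm]
    · rintro (a | a) (b | b) z w <;> simp [Deriv.diagram, Diagram.outVar, eq_comm]
      simp +contextual
  | const k =>
    let f : ConstVertex (S.dom k) (S.cod k) → ℕ
      | .inp _ => 0
      | .inPort _ => 1
      | .box => 2
      | .outPort _ => 3
      | .out _ => 4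
    have hE : ∀ a b, (Diagram.const (A := A) k (S.dom k) (S.cod k)).Edge a b → f a < f b := by
      rintro _ _ (_ | _ | _ | _) <;> simp [f]
    have hl : ∀ a z, (Diagram.const (A := A) k (S.dom k) (S.cod k)).lab a ≠ some (.name z) := by
      rintro (_ | _ | _ | _ | _) z <;> simp [Diagram.const, constLab]
    exact ⟨inferInstanceAs (Finite (ConstVertex _ _)), fun a h => (path_of_rank f hE h).false,
      fun a b z h => (hl a z h).elim, fun _ => rfl, fun _ => rfl, fun a z h => (hl a z h).elim,
      fun a b z w h => (hl a z h).elim⟩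
  | zero =>
    exact ⟨inferInstanceAs (Finite Empty), fun a => a.elim, fun a => a.elim, fun i => i.elim0,
      fun i => i.elim0, fun a => a.elim, fun a => a.elim⟩
  | one =>
    have hE : ∀ a b, (Diagram.one (K := S.Const) (A := A)).Edge a b →
        (Bool.toNat a < Bool.toNat b) := by
      rintro _ _ ⟨rfl, rfl⟩; decide
    exact ⟨inferInstanceAs (Finite Bool), fun a h => (path_of_rank _ hE h).false,
      fun a b z h => (Option.some_ne_none _ h.symm).elim, fun _ => rfl, fun _ => rfl,
      fun a z h => (Option.some_ne_none _ h.symm).elim,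
      fun a b z w h => (Option.some_ne_none _ h.symm).elim⟩
  | sym =>
    have hE : ∀ a b, (Diagram.sym (K := S.Const) (A := A)).Edge a b →
        (Sum.elim (fun _ => 0) (fun _ => 1) a < Sum.elim (fun _ => 0) (fun _ => 1) b) := by
      rintro (a | a) (b | b) h <;> simp_all [Diagram.sym]
    exact ⟨inferInstanceAs (Finite (Fin 2 ⊕ Fin 2)), fun a h => (path_of_rank _ hE h).false,
      fun a b z h => (Option.some_ne_none _ h.symm).elim, fun _ => rfl, fun _ => rfl,
      fun a z h => (Option.some_ne_none _ h.symm).elim,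
      fun a b z w h => (Option.some_ne_none _ h.symm).elim⟩
  | seq d d' disj ih ih' =>
    refine ⟨?_, ?_, ?_, ih.inp_unlabelled, ih'.out_unlabelled, ?_, ?_⟩
    · have := ih.finite; have := ih'.finite
      exact inferInstanceAs (Finite (d.diagram.V ⊕ d'.diagram.V))
    · intro p h
      rcases Diagram.seq_path _ _ _ _ h with ⟨a, b, e, e', h⟩ | ⟨a, b, e, e', h⟩ | ⟨a, b, e, e'⟩
      · obtain rfl := Sum.inl.inj (e.symm.trans e')
        exact ih.acyclic _ h
      · obtain rfl := Sum.inr.inj (e.symm.trans e')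
        exact ih'.acyclic _ h
      · exact Sum.inl_ne_inr (e.symm.trans e')
    · rintro (a | a) (b | b) x ha hb
      · exact congrArg _ (ih.name_inj a b x ha hb)
      · exact (Finset.disjoint_left.1 disj (ih.name_mem _ _ ha) (ih'.name_mem _ _ hb)).elim
      · exact (Finset.disjoint_left.1 disj (ih.name_mem _ _ hb) (ih'.name_mem _ _ ha)).elim
      · exact congrArg _ (ih'.name_inj a b x ha hb)
    · rw [Finset.union_union_union_comm]
      rintro (a | a) x ha
      · exact Finset.mem_union_left _ (ih.name_mem _ _ ha)
      · exact Finset.mem_union_right _ (ih'.name_mem _ _ ha)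
    · intro p q x y hp hq h
      rcases Diagram.seq_path _ _ _ _ h with ⟨a, b, rfl, rfl, h'⟩ | ⟨a, b, rfl, rfl, h'⟩ |
        ⟨a, b, rfl, rfl⟩
      · exact .single (.inl (ih.path _ _ _ _ hp hq h'))
      · exact .single (.inr (.inl (ih'.path _ _ _ _ hp hq h')))
      · exact .single (.inr (.inr ⟨ih.name_mem _ _ hp, ih'.name_mem _ _ hq⟩))
  | tensor d d' disj ih ih' =>
    refine ⟨?_, ?_, ?_, ?_, ?_, ?_, ?_⟩
    · have := ih.finite; have := ih'.finite
      exact inferInstanceAs (Finite (d.diagram.V ⊕ d'.diagram.V))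
    · intro p h
      rcases Diagram.tensor_path _ _ _ _ h with ⟨a, b, e, e', h⟩ | ⟨a, b, e, e', h⟩
      · obtain rfl := Sum.inl.inj (e.symm.trans e')
        exact ih.acyclic _ h
      · obtain rfl := Sum.inr.inj (e.symm.trans e')
        exact ih'.acyclic _ h
    · rintro (a | a) (b | b) x ha hb
      · exact congrArg _ (ih.name_inj a b x ha hb)
      · exact (Finset.disjoint_left.1 disj (ih.name_mem _ _ ha) (ih'.name_mem _ _ hb)).elim
      · exact (Finset.disjoint_left.1 disj (ih.name_mem _ _ hb) (ih'.name_mem _ _ ha)).elim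
      · exact congrArg _ (ih'.name_inj a b x ha hb)
    · intro i
      refine Fin.addCases (fun i => ?_) (fun i => ?_) i
      · simpa [Deriv.diagram, Diagram.tensor] using ih.inp_unlabelled i
      · simpa [Deriv.diagram, Diagram.tensor] using ih'.inp_unlabelled i
    · intro i
      refine Fin.addCases (fun i => ?_) (fun i => ?_) i
      · simpa [Deriv.diagram, Diagram.tensor] using ih.out_unlabelled i
      · simpa [Deriv.diagram, Diagram.tensor] using ih'.out_unlabelled i
    · rw [Finset.union_union_union_comm]
      rintro (a | a) x ha
      · exact Finset.mem_union_left _ (ih.name_mem _ _ ha)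
      · exact Finset.mem_union_right _ (ih'.name_mem _ _ ha)
    · intro p q x y hp hq h
      rcases Diagram.tensor_path _ _ _ _ h with ⟨a, b, rfl, rfl, h'⟩ | ⟨a, b, rfl, rfl, h'⟩
      · exact .single (.inl (ih.path _ _ _ _ hp hq h'))
      · exact .single (.inr (ih'.path _ _ _ _ hp hq h'))
  | strengthen x y d hx hy hR ih =>
    exact ⟨ih.finite, ih.acyclic, ih.name_inj, ih.inp_unlabelled, ih.out_unlabelled, ih.name_mem,
      fun a b x y ha hb h => .single (.inl (ih.path a b x y ha hb h))⟩
  | @link Γ Δ M m n R₀ x y d hx hy hne hxy ih =>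
    have hA := d.isAnchor
    have hlab : ∀ {a z}, (d.diagram.link x y).lab a = some (.name z) →
        d.diagram.lab a = some (.name z) ∧ z ≠ x ∧ z ≠ y := by
      intro a z h
      simp only [Diagram.link] at h
      split_ifs at h with h'
      refine ⟨h, ?_, ?_⟩ <;> rintro rfl <;> simp_all
    have hnone : ∀ {a}, d.diagram.lab a = none → (d.diagram.link x y).lab a = none := by
      intro a h
      simp [Diagram.link, h]
    refine ⟨ih.finite, ?_, ?_, fun i => hnone (ih.inp_unlabelled i),
      fun i => hnone (ih.out_unlabelled i), ?_, ?_⟩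
    · intro a h
      rcases Diagram.link_path _ _ _ _ _ h with h | ⟨s, t, hs, ht, hp, t', ht', hq⟩
      · exact ih.acyclic _ h
      · rcases Relation.reflTransGen_iff_eq_or_transGen.1 (hq.trans hp) with e | h
        · subst e
          rw [hs] at ht'
          exact hne (by simpa using ht')
        · exact hne (hA.antisymm _ _ hxy (ih.path _ _ _ _ ht' hs h))
    · intro a b z ha hb
      exact ih.name_inj a b z (hlab ha).1 (hlab hb).1
    · intro a z ha
      have h1 := ih.name_mem a z (hlab ha).1
      have h2 := (hlab ha).2
      simp at h1 ⊢
      tauto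
    · intro a b z w ha hb h
      refine ⟨?_, (hlab ha).2, (hlab hb).2⟩
      rcases Diagram.link_path _ _ _ _ _ h with h | ⟨s, t, hs, ht, hp, t', ht', hq⟩
      · exact ih.path _ _ _ _ (hlab ha).1 (hlab hb).1 h
      · have h1 : R₀ z x := by
          rcases Relation.reflTransGen_iff_eq_or_transGen.1 hp with e | h
          · subst e
            have := hs.symm.trans (hlab ha).1
            exact ((hlab ha).2.1 (by simpa [eq_comm] using this)).elim
          · exact ih.path _ _ _ _ (hlab ha).1 hs h
        have h2 : R₀ y w := by
          rcases Relation.reflTransGen_iff_eq_or_transGen.1 hq with e | h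
          · subst e
            have := ht'.symm.trans (hlab hb).1
            exact ((hlab hb).2.2 (by simpa [eq_comm] using this)).elim
          · exact ih.path _ _ _ _ ht' (hlab hb).1 h
        exact hA.trans _ _ _ (hA.trans _ _ _ h1 hxy) h2

/-- The labelled interfaced DAG of a derivation. -/
noncomputable def Deriv.lidag {Γ Δ : Finset A} {M : Term S.Const A} {m n : ℕ}
    {R : A → A → Prop} (d : Deriv S Γ Δ M m n R) : LIDAG S.Const A m n where
  toDiagram := d.diagram
  finite := d.anchored.finite
  acyclic := d.anchored.acyclic
  name_inj := d.anchored.name_inj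
  inp_unlabelled := d.anchored.inp_unlabelled
  out_unlabelled := d.anchored.out_unlabelled

/-- The uniflow diagram denoted by a derivation (without its anchor). -/
noncomputable def Deriv.interp {Γ Δ : Finset A} {M : Term S.Const A} {m n : ℕ}
    {R : A → A → Prop} (d : Deriv S Γ Δ M m n R) : UniflowDiagram S.Const A m n :=
  Quotient.mk _ d.lidag

/-! ### The equational theory -/

open Term in
/-- `EqThy S Γ Δ m n M N` is the provable equality `Γ ∣ Δ ⊢ M ≡ N` of terms of type `m → n`: the
congruence on well-typed terms generated by the equations of strict symmetric monoidal categories,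
alpha-equivalence, scope extrusion and link identity. -/
inductive EqThy (S : Signature.{u}) :
    Finset A → Finset A → ℕ → ℕ → Term S.Const A → Term S.Const A → Prop
  -- equivalence
  | refl {Γ Δ m n M} : HasType S Γ Δ M m n → EqThy S Γ Δ m n M M
  | symm {Γ Δ m n M N} : EqThy S Γ Δ m n M N → EqThy S Γ Δ m n N M
  | trans {Γ Δ m n M N P} :
      EqThy S Γ Δ m n M N → EqThy S Γ Δ m n N P → EqThy S Γ Δ m n M P
  -- congruence
  | seq_congr {Γ Δ Γ' Δ' m k n M M' N N'} : Disjoint (Γ ∪ Δ) (Γ' ∪ Δ') →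
      EqThy S Γ Δ m k M M' → EqThy S Γ' Δ' k n N N' →
      EqThy S (Γ ∪ Γ') (Δ ∪ Δ') m n (M ⨟ N) (M' ⨟ N')
  | tensor_congr {Γ Δ Γ' Δ' m₁ m₂ n₁ n₂ M M' N N'} : Disjoint (Γ ∪ Δ) (Γ' ∪ Δ') →
      EqThy S Γ Δ m₁ m₂ M M' → EqThy S Γ' Δ' n₁ n₂ N N' →
      EqThy S (Γ ∪ Γ') (Δ ∪ Δ') (m₁ + n₁) (m₂ + n₂) (M ⊠ₜ N) (M' ⊠ₜ N')
  | link_congr {Γ Δ m n x y M N} :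
      HasType S Γ Δ (link x y M) m n → HasType S Γ Δ (link x y N) m n →
      EqThy S (insert y Γ) (insert x Δ) m n M N →
      EqThy S Γ Δ m n (link x y M) (link x y N)
  -- associativity of composition
  | seq_assoc {Γ Δ m n M₁ M₂ M₃} :
      HasType S Γ Δ ((M₁ ⨟ M₂) ⨟ M₃) m n → HasType S Γ Δ (M₁ ⨟ M₂ ⨟ M₃) m n →
      EqThy S Γ Δ m n ((M₁ ⨟ M₂) ⨟ M₃) (M₁ ⨟ M₂ ⨟ M₃)
  -- identity
  | ident_seq {Γ Δ m n M} : HasType S Γ Δ M m n → EqThy S Γ Δ m n (ident m ⨟ M) M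
  | seq_ident {Γ Δ m n M} : HasType S Γ Δ M m n → EqThy S Γ Δ m n (M ⨟ ident n) M
  -- tensor functoriality
  | tensor_seq {Γ Δ m n M M' N N'} :
      HasType S Γ Δ ((M ⨟ M') ⊠ₜ (N ⨟ N')) m n → HasType S Γ Δ ((M ⊠ₜ N) ⨟ (M' ⊠ₜ N')) m n →
      EqThy S Γ Δ m n ((M ⨟ M') ⊠ₜ (N ⨟ N')) ((M ⊠ₜ N) ⨟ (M' ⊠ₜ N'))
  -- strictness
  | tensor_assoc {Γ Δ m n M₁ M₂ M₃} :
      HasType S Γ Δ ((M₁ ⊠ₜ M₂) ⊠ₜ M₃) m n → HasType S Γ Δ (M₁ ⊠ₜ M₂ ⊠ₜ M₃) m n →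
      EqThy S Γ Δ m n ((M₁ ⊠ₜ M₂) ⊠ₜ M₃) (M₁ ⊠ₜ M₂ ⊠ₜ M₃)
  | tensor_zero {Γ Δ m n M} : HasType S Γ Δ M m n → EqThy S Γ Δ m n (M ⊠ₜ zero) M
  | zero_tensor {Γ Δ m n M} : HasType S Γ Δ M m n → EqThy S Γ Δ m n (zero ⊠ₜ M) M
  -- symmetry
  | symmetry {Γ₁ Δ₁ Γ₂ Δ₂ m₁ n₁ m₂ n₂ M₁ M₂} : Disjoint (Γ₁ ∪ Δ₁) (Γ₂ ∪ Δ₂) →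
      HasType S Γ₁ Δ₁ M₁ m₁ n₁ → HasType S Γ₂ Δ₂ M₂ m₂ n₂ →
      EqThy S (Γ₁ ∪ Γ₂) (Δ₁ ∪ Δ₂) (m₁ + m₂) (n₂ + n₁)
        ((M₁ ⊠ₜ M₂) ⨟ Term.symm n₁ n₂) (Term.symm m₁ m₂ ⨟ (M₂ ⊠ₜ M₁))
  -- strict symmetry
  | symm_zero_one : EqThy S ∅ ∅ 1 1 (Term.symm 0 1) one
  | symm_one_zero : EqThy S ∅ ∅ 1 1 (Term.symm 1 0) one
  | symm_add (m n p : ℕ) :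
      EqThy S ∅ ∅ (m + (n + p)) ((n + p) + m) (Term.symm m (n + p))
        ((Term.symm m n ⊠ₜ ident p) ⨟ (ident n ⊠ₜ Term.symm m p))
  -- alpha-equivalence
  | alpha {Γ Δ m n x y x' y' M} : x' ∉ M.names → y' ∉ M.names → x' ≠ y' →
      HasType S Γ Δ (link x y M) m n → HasType S Γ Δ (link x' y' (M.rename₂ x y x' y')) m n →
      EqThy S Γ Δ m n (link x y M) (link x' y' (M.rename₂ x y x' y'))
  -- scope extrusion
  | extrude_seq_left {Γ Δ m n x y M N} : x ∉ N.fv → y ∉ N.fv →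
      HasType S Γ Δ (link x y (M ⨟ N)) m n → HasType S Γ Δ (link x y M ⨟ N) m n →
      EqThy S Γ Δ m n (link x y (M ⨟ N)) (link x y M ⨟ N)
  | extrude_seq_right {Γ Δ m n x y M N} : x ∉ M.fv → y ∉ M.fv →
      HasType S Γ Δ (link x y (M ⨟ N)) m n → HasType S Γ Δ (M ⨟ link x y N) m n →
      EqThy S Γ Δ m n (link x y (M ⨟ N)) (M ⨟ link x y N)
  | extrude_tensor_right {Γ Δ m n x y M N} : x ∉ M.fv → y ∉ M.fv →
      HasType S Γ Δ (link x y (M ⊠ₜ N)) m n → HasType S Γ Δ (M ⊠ₜ link x y N) m n →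
      EqThy S Γ Δ m n (link x y (M ⊠ₜ N)) (M ⊠ₜ link x y N)
  -- link identity
  | link_ident {x y} : x ≠ y → EqThy S ∅ ∅ 1 1 (link x y (var x ⨟ var y)) one

end Semantics

end LinkSyntax

/-!
Provable equality is compared with equality of diagrams through two intermediate notions.

*Skeletons.* A diagram up to insertion of unlabelled vertices along wires is determined by its
labelled vertices, by the edges between constants and their ports, and by the relation "a wire leads
from here to there" on labelled vertices and interface positions. This data is a `Skeleton`.
Composition, tensor product and links make sense for skeletons; two diagrams that come from
derivations are homeomorphic exactly when their skeletons are isomorphic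
(`LIDAG.homeo_iff_skel_iso`): every such diagram contracts to one without superfluous unlabelled
vertices, and there an isomorphism of skeletons is an isomorphism of graphs. The skeleton of the
diagram of a derivation depends on the term only (`Deriv.skel_iso`), and every equation holds for
skeletons (`EqThy.skel`). This is soundness.

*Schedules.* Anchors are replaced by times: `Timed S π t M m n` says that `M : m → n`, with input
and output variables given by the polarity `π`, is compatible with a function `t` from names to
rational numbers. A finite partial order extends to a linear one, so a term is typable exactly when
it has a schedule (`Deriv.timed`, `Timed.deriv`), and density of the rationals leaves room for fresh
names between given ones. `Eqv` is provable equality at a polarity.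

Completeness rests on one geometric fact: a term can be cut at a moment of its schedule into a part
that happens before and a part that happens after (`Timed.exists_delay`, `Timed.exists_advance`,
`Timed.exists_slice`, `Timed.exists_cut`). It shows that two links can be exchanged
(`Eqv.link_comm`), that the symmetry is an involution (`Eqv.sym_sym`), and that a composite along a
list of variables is a family of links (`Eqv.linkAll_cut`). Attaching fresh variables to all inputs
and outputs loses nothing (`Eqv.of_closed`), and by induction on size every term closed in this way
equals a normal form (`hasNF_closed`): a family of links over a tensor product of atoms, each atom
being one constant, or one bare wire, with variables at all its ports. A link that ends in a bare
wire can be absorbed (`Eqv.link_atom_wire`, `Eqv.link_wire_atom`), so that bare wires join free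
variables only (`Good.exists_reduced`).

In the skeleton of a reduced normal form, atoms and links can be read off: an isomorphism between
two such skeletons matches the atoms, and the matching gives a renaming of the bound names that
carries the links of one to those of the other (`IsIso.exists_renaming`). Normal forms are invariant
under renaming of bound names (`Good.alpha`) and under permutation of links and atoms
(`Good.eqv_perm`), whence normal forms with isomorphic skeletons are provably equal
(`Good.eqv_of_iso`), and then so are the terms themselves (`Eqv.of_skel`).
-/

set_option linter.unusedSectionVars false

universe w w' w''

namespace LinkSyntax

open Function (update update_of_ne)
open Finset (mem_union sdiff_subset mem_insert mem_sdiff disjoint_left disjoint_right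
  mem_singleton mem_union_left mem_union_right mem_image_of_mem mem_filter disjoint_union_left
  disjoint_union_right filter_union filter_singleton singleton_subset_iff mem_image)
open List (mem_toFinset mem_cons mem_append nodup_cons mem_of_getElem?
  disjoint_toFinset_iff_disjoint disjoint_of_nodup_append cons_append of_mem_zip)

/-! ### Schedules -/

section Schedules

variable {A : Type v} [DecidableEq A]

attribute [grind =] Finset.disjoint_left Finset.subset_iff mem_toFinset Term.fv

/-- The input variables of `s`, for the polarity `π` (`true` marks input variables). -/
def ins (π : A → Bool) (s : Finset A) : Finset A := s.filter fun a => π a = true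

/-- The output variables of `s`, for the polarity `π`. -/
def outs (π : A → Bool) (s : Finset A) : Finset A := s.filter fun a => π a = false

/-- `Timed S π t M m n`: the term `M` has type `m → n` when its free variables have the polarity `π`
and occur at the times `t`. A composite requires everything on the left to happen before everything
on the right, and a link from `x` to `y` requires times with `x` before `y` for the bound pair.
Times replace anchors: a term has a schedule if and only if it is typable. -/
def Timed (S : Signature.{u}) : (A → Bool) → (A → ℚ) → Term S.Const A → ℕ → ℕ → Prop
  | _, _, .const k, m, n => m = S.dom k ∧ n = S.cod k
  | _, _, .zero, m, n => m = 0 ∧ n = 0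
  | _, _, .one, m, n => m = 1 ∧ n = 1
  | _, _, .sym, m, n => m = 2 ∧ n = 2
  | π, t, .seq M N, m, n =>
    ∃ k, Timed S π t M m k ∧ Timed S π t N k n ∧ ∀ a ∈ M.fv, ∀ b ∈ N.fv, t a < t b
  | π, t, .tensor M N, m, n =>
    ∃ m₁ m₂ n₁ n₂, m = m₁ + m₂ ∧ n = n₁ + n₂ ∧ Timed S π t M m₁ n₁ ∧ Timed S π t N m₂ n₂ ∧
      Disjoint M.fv N.fv
  | π, _, .var x, m, n => (π x = true ∧ m = 0 ∧ n = 1) ∨ (π x = false ∧ m = 1 ∧ n = 0)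
  | π, t, .link x y M, m, n =>
    x ≠ y ∧ x ∈ M.fv ∧ y ∈ M.fv ∧ ∃ p q : ℚ, p < q ∧
      Timed S (update (update π x false) y true) (update (update t x p) y q) M m n

variable {S : Signature.{u}} {π : A → Bool} {t : A → ℚ}

@[grind =] theorem mem_ins {s : Finset A} {a : A} : a ∈ ins π s ↔ a ∈ s ∧ π a = true :=
    by simp [ins]

@[grind =] theorem mem_outs {s : Finset A} {a : A} : a ∈ outs π s ↔ a ∈ s ∧ π a = false :=
    by simp [outs]

theorem ins_union (s s' : Finset A) : ins π (s ∪ s') = ins π s ∪ ins π s' :=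
  filter_union _ _ _

theorem outs_union (s s' : Finset A) : outs π (s ∪ s') = outs π s ∪ outs π s' :=
  filter_union _ _ _

theorem ins_union_outs (s : Finset A) : ins π s ∪ outs π s = s := by grind

theorem ins_congr {π' : A → Bool} {s : Finset A} (h : ∀ a ∈ s, π a = π' a) :
    ins π s = ins π' s :=
  Finset.filter_congr fun a ha => by rw [h a ha]

theorem outs_congr {π' : A → Bool} {s : Finset A} (h : ∀ a ∈ s, π a = π' a) :
    outs π s = outs π' s :=
  Finset.filter_congr fun a ha => by rw [h a ha]

theorem ins_update_link {s : Finset A} {x y : A} (hxy : x ≠ y) (hy : y ∈ s) :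
    ins (update (update π x false) y true) s = insert y (ins π (s \ {x, y})) := by
  ext a
  by_cases hay : a = y
  · subst hay; simp [mem_ins, hy]
  by_cases hax : a = x
  · subst hax; simp [mem_ins, hay]
  · simp [mem_ins, hay, hax]

theorem outs_update_link {s : Finset A} {x y : A} (hxy : x ≠ y) (hx : x ∈ s) :
    outs (update (update π x false) y true) s = insert x (outs π (s \ {x, y})) := by
  ext a
  by_cases hay : a = y
  · subst hay; simp [mem_outs, Ne.symm hxy]
  by_cases hax : a = x
  · subst hax; simp [mem_outs, hx, hxy]
  · simp [mem_outs, hay, hax]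

/-- Times for a new pair of names, below and above given finite sets of names. -/
theorem exists_link_times (t : A → ℚ) {lx ux ly uy : Finset A}
    (hx : ∀ a ∈ lx, ∀ b ∈ ux, t a < t b) (hy : ∀ a ∈ ly, ∀ b ∈ uy, t a < t b) (hu : uy ⊆ ux) :
    ∃ p q : ℚ, p < q ∧ (∀ a ∈ lx, t a < p) ∧ (∀ b ∈ ux, p < t b) ∧ (∀ a ∈ ly, t a < q) ∧
      ∀ b ∈ uy, q < t b := by
  obtain ⟨p, hp1, hp2⟩ := Order.exists_between_finsets (lo := lx.image t) (hi := ux.image t)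
    (by simpa using hx)
  obtain ⟨q, hq1, hq2⟩ := Order.exists_between_finsets (lo := insert p (ly.image t))
    (hi := uy.image t) (by
      simp only [mem_insert, mem_image, forall_eq_or_imp, forall_exists_index, and_imp,
        forall_apply_eq_imp_iff₂]
      exact ⟨fun b hb => hp2 _ (mem_image_of_mem t (hu hb)), hy⟩)
  exact ⟨p, q, hq1 _ (Finset.mem_insert_self _ _), fun a ha => hp1 _ (mem_image_of_mem t ha),
    fun a ha => hp2 _ (mem_image_of_mem t ha),
    fun a ha => hq1 _ (Finset.mem_insert_of_mem (mem_image_of_mem t ha)),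
    fun a ha => hq2 _ (mem_image_of_mem t ha)⟩

/-- Schedules only matter on the free variables, and there only the order of the times matters. -/
theorem Timed.mono {M : Term S.Const A} {m n : ℕ} {π' : A → Bool} {t' : A → ℚ}
    (h : Timed S π t M m n) (hπ : ∀ a ∈ M.fv, π a = π' a)
    (ht : ∀ a ∈ M.fv, ∀ b ∈ M.fv, t a < t b → t' a < t' b) : Timed S π' t' M m n := by
  induction M generalizing π t π' t' m n with
  | const k => exact h
  | zero => exact h
  | one => exact h
  | sym => exact h
  | var x => simpa [Timed, hπ x (by simp [Term.fv])] using h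
  | seq M N ihM ihN =>
    obtain ⟨k, hM, hN, hlt⟩ := h
    simp only [Term.fv, mem_union] at hπ ht
    exact ⟨k, ihM hM (fun a ha => hπ a (.inl ha)) fun a ha b hb => ht a (.inl ha) b (.inl hb),
      ihN hN (fun a ha => hπ a (.inr ha)) fun a ha b hb => ht a (.inr ha) b (.inr hb),
      fun a ha b hb => ht a (.inl ha) b (.inr hb) (hlt a ha b hb)⟩
  | tensor M N ihM ihN =>
    obtain ⟨m1, m2, n1, n2, rfl, rfl, hM, hN, hdisj⟩ := h
    simp only [Term.fv, mem_union] at hπ ht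
    exact ⟨m1, m2, n1, n2, rfl, rfl,
      ihM hM (fun a ha => hπ a (.inl ha)) fun a ha b hb => ht a (.inl ha) b (.inl hb),
      ihN hN (fun a ha => hπ a (.inr ha)) fun a ha b hb => ht a (.inr ha) b (.inr hb), hdisj⟩
  | link x y M ih =>
    obtain ⟨hxy, hx, hy, p, q, hpq, h⟩ := h
    simp only [Term.fv, mem_sdiff, mem_insert, mem_singleton, not_or] at hπ ht
    obtain ⟨p', q', hpq', h1, h2, h3, h4⟩ := exists_link_times t'
      (lx := (M.fv \ {x, y}).filter fun a => t a < p)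
      (ux := (M.fv \ {x, y}).filter fun a => p < t a)
      (ly := (M.fv \ {x, y}).filter fun a => t a < q)
      (uy := (M.fv \ {x, y}).filter fun a => q < t a)
      (by
        simp only [mem_filter, mem_sdiff, mem_insert, mem_singleton,
          not_or]
        exact fun a ha b hb => ht a ha.1 b hb.1 (ha.2.trans hb.2))
      (by
        simp only [mem_filter, mem_sdiff, mem_insert, mem_singleton,
          not_or]
        exact fun a ha b hb => ht a ha.1 b hb.1 (ha.2.trans hb.2))
      (fun a ha => by
        simp only [mem_filter] at ha ⊢
        exact ⟨ha.1, hpq.trans ha.2⟩)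
    simp only [mem_filter, mem_sdiff, mem_insert, mem_singleton,
      not_or] at h1 h2 h3 h4
    refine ⟨hxy, hx, hy, p', q', hpq', ih h (fun a ha => ?_) fun a ha b hb hab => ?_⟩
    · by_cases hay : a = y
      all_goals grind
    · by_cases hay : a = y
      · subst hay
        by_cases hby : b = a
        all_goals grind
      by_cases hax : a = x
      · subst hax
        by_cases hby : b = y
        all_goals grind
      by_cases hby : b = y
      · grind
      by_cases hbx : b = x
      all_goals grind

theorem Timed.congr {M : Term S.Const A} {m n : ℕ} {π' : A → Bool} {t' : A → ℚ}
    (h : Timed S π t M m n) (hπ : ∀ a ∈ M.fv, π a = π' a)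
    (ht : ∀ a ∈ M.fv, t a = t' a) : Timed S π' t' M m n :=
  h.mono hπ fun a ha b hb hab => by rwa [← ht a ha, ← ht b hb]

/-- The partial order on `X` given by the times `t`. -/
def timeOrder (t : A → ℚ) (X : Finset A) (a b : A) : Prop :=
  a ∈ X ∧ b ∈ X ∧ (a = b ∨ t a < t b)

theorem isAnchor_timeOrder (t : A → ℚ) (X : Finset A) : IsAnchor X (timeOrder t X) where
  mem_left _ _ h := h.1
  mem_right _ _ h := h.2.1
  refl a h := ⟨h, h, .inl rfl⟩
  antisymm a b := by
    rintro ⟨-, -, h | h⟩ ⟨-, -, h' | h'⟩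
    all_goals grind
  trans a b c := by
    rintro ⟨ha, -, h | h⟩ ⟨-, hc, h' | h'⟩
    · exact ⟨ha, hc, .inl (h.trans h')⟩
    · exact ⟨ha, hc, .inr (h ▸ h')⟩
    · exact ⟨ha, hc, .inr (h' ▸ h)⟩
    · exact ⟨ha, hc, .inr (h.trans h')⟩

theorem anchorClosure_le {X : Finset A} {Q R : A → A → Prop} (hR : IsAnchor X R)
    (h : ∀ a b, Q a b → R a b) {a b : A} (hab : anchorClosure Q a b) : R a b := by
  induction hab with
  | single h' => exact h _ _ h'
  | tail _ h' ih => exact hR.trans _ _ _ ih (h _ _ h')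

/-- Anchors can be replaced with larger partial orders. -/
theorem Deriv.enlarge {Γ Δ : Finset A} {M : Term S.Const A} {m n : ℕ} {R R' : A → A → Prop}
    (d : Deriv S Γ Δ M m n R) (hR' : IsAnchor (Γ ∪ Δ) R') (h : ∀ a b, R a b → R' a b) :
    Nonempty (Deriv S Γ Δ M m n R') := by
  classical
  have key : ∀ l : List (A × A), (∀ p ∈ l, R' p.1 p.2) → ∃ R1, Nonempty (Deriv S Γ Δ M m n R1) ∧
      (∀ a b, R1 a b → R' a b) ∧ ∀ p ∈ l, R1 p.1 p.2 := by
    intro l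
    induction l with
    | nil => exact fun _ => ⟨R, ⟨d⟩, h, by simp⟩
    | cons p l ih =>
      intro hl
      obtain ⟨R1, ⟨d1⟩, h1, h2⟩ := ih fun q hq => hl q (List.mem_cons_of_mem _ hq)
      have hp := hl p List.mem_cons_self
      have hle : ∀ a b, anchorClosure (anchorInsert p.1 p.2 R1) a b → R' a b := by
        intro a b hab
        refine anchorClosure_le hR' ?_ hab
        rintro a b (h' | ⟨rfl, rfl⟩)
        all_goals simp_all
      refine ⟨_, ⟨d1.strengthen p.1 p.2 (hR'.mem_left _ _ hp) (hR'.mem_right _ _ hp)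
        ⟨fun a b hab => hR'.mem_left _ _ (hle _ _ hab), fun a b hab => hR'.mem_right _ _
            (hle _ _ hab),
          fun a ha => .single (.inl (d1.isAnchor.refl a ha)),
          fun a b hab hba => hR'.antisymm _ _ (hle _ _ hab) (hle _ _ hba),
          fun a b c hab hbc => hab.trans hbc⟩⟩, hle, ?_⟩
      intro q hq
      rcases mem_cons.1 hq with rfl | hq
      · exact .single (.inr ⟨rfl, rfl⟩)
      · exact .single (.inl (h2 q hq))
  obtain ⟨R1, ⟨d1⟩, h1, h2⟩ := key
    (((Γ ∪ Δ) ×ˢ (Γ ∪ Δ)).filter fun p => R' p.1 p.2).toList (by simp)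
  have : R1 = R' := by
    funext a b
    refine propext ⟨h1 a b, fun hab => h2 (a, b) ?_⟩
    have h3 := hR'.mem_left _ _ hab
    have h4 := hR'.mem_right _ _ hab
    simp only [Finset.mem_toList, mem_filter, Finset.mem_product]
    exact ⟨⟨h3, h4⟩, hab⟩
  exact this ▸ ⟨d1⟩

/-- A scheduled term is typable, with the order of the times as its anchor. -/
theorem Timed.deriv {M : Term S.Const A} : ∀ {π : A → Bool} {t : A → ℚ} {m n : ℕ},
    Timed S π t M m n →
    Nonempty (Deriv S (ins π M.fv) (outs π M.fv) M m n (timeOrder t M.fv)) := by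
  have hempty : ∀ t : A → ℚ, timeOrder t ∅ = fun _ _ => False := by
    intro t; funext a b; simp [timeOrder]
  induction M with
  | const k =>
    rintro π t m n ⟨rfl, rfl⟩
    have := Deriv.const (S := S) (A := A) k
    rw [← hempty t] at this
    exact ⟨this⟩
  | zero =>
    rintro π t m n ⟨rfl, rfl⟩
    have := Deriv.zero (S := S) (A := A)
    rw [← hempty t] at this
    exact ⟨this⟩
  | one =>
    rintro π t m n ⟨rfl, rfl⟩
    have := Deriv.one (S := S) (A := A)
    rw [← hempty t] at this
    exact ⟨this⟩
  | sym =>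
    rintro π t m n ⟨rfl, rfl⟩
    have := Deriv.sym (S := S) (A := A)
    rw [← hempty t] at this
    exact ⟨this⟩
  | var x =>
    have h2 : ∀ t : A → ℚ, timeOrder t {x} = fun a b => a = x ∧ b = x := by
      intro t; funext a b; simp +contextual [timeOrder]
    rintro π t m n (⟨h, rfl, rfl⟩ | ⟨h, rfl, rfl⟩)
    · have := Deriv.inVar (S := S) x
      rw [← h2 t] at this
      have e1 : ins π {x} = {x} := by simp [ins, filter_singleton, h]
      have e2 : outs π {x} = ∅ := by simp [outs, filter_singleton, h]
      simp only [Term.fv]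
      rw [e1, e2]
      exact ⟨this⟩
    · have := Deriv.outVar (S := S) x
      rw [← h2 t] at this
      have e1 : outs π {x} = {x} := by simp [outs, filter_singleton, h]
      have e2 : ins π {x} = ∅ := by simp [ins, filter_singleton, h]
      simp only [Term.fv]
      rw [e1, e2]
      exact ⟨this⟩
  | seq M N ihM ihN =>
    rintro π t m n ⟨k, hM, hN, hlt⟩
    obtain ⟨dM⟩ := ihM hM
    obtain ⟨dN⟩ := ihN hN
    have hdisj : Disjoint M.fv N.fv :=
      disjoint_left.2 fun a h h' => (hlt a h a h').false
    have d := dM.seq dN (by rwa [ins_union_outs, ins_union_outs])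
    rw [← ins_union, ← outs_union] at d
    refine d.enlarge (by rw [ins_union_outs]; exact isAnchor_timeOrder t (M.fv ∪ N.fv)) ?_
    intro a b hab
    refine anchorClosure_le (isAnchor_timeOrder t (M.fv ∪ N.fv)) ?_ hab
    rw [ins_union_outs, ins_union_outs]
    rintro a b (⟨ha, hb, h⟩ | ⟨ha, hb, h⟩ | ⟨ha, hb⟩)
    · exact ⟨mem_union_left _ ha, mem_union_left _ hb, h⟩
    · exact ⟨mem_union_right _ ha, mem_union_right _ hb, h⟩
    · exact ⟨mem_union_left _ ha, mem_union_right _ hb, .inr (hlt a ha b hb)⟩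
  | tensor M N ihM ihN =>
    rintro π t m n ⟨m1, m2, n1, n2, rfl, rfl, hM, hN, hdisj⟩
    obtain ⟨dM⟩ := ihM hM
    obtain ⟨dN⟩ := ihN hN
    have d := dM.tensor dN (by rwa [ins_union_outs, ins_union_outs])
    rw [← ins_union, ← outs_union] at d
    refine d.enlarge (by rw [ins_union_outs]; exact isAnchor_timeOrder t (M.fv ∪ N.fv)) ?_
    intro a b hab
    refine anchorClosure_le (isAnchor_timeOrder t (M.fv ∪ N.fv)) ?_ hab
    rintro a b (⟨ha, hb, h⟩ | ⟨ha, hb, h⟩)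
    · exact ⟨mem_union_left _ ha, mem_union_left _ hb, h⟩
    · exact ⟨mem_union_right _ ha, mem_union_right _ hb, h⟩
  | link x y M ih =>
    rintro π t m n ⟨hxy, hx, hy, p, q, hpq, h⟩
    obtain ⟨d⟩ := ih h
    rw [ins_update_link hxy hy, outs_update_link hxy hx] at d
    have d' := d.link x y (by rw [ins_union_outs]; simp) (by rw [ins_union_outs]; simp) hxy
      ⟨hx, hy, .inr (by simpa [hxy] using hpq)⟩
    refine d'.enlarge (by rw [ins_union_outs]; exact isAnchor_timeOrder t (M.fv \ {x, y})) ?_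
    rintro a b ⟨⟨ha, hb, h⟩, ⟨h1, h2⟩, h3, h4⟩
    rw [update_of_ne h2, update_of_ne h1, update_of_ne h4,
      update_of_ne h3] at h
    exact ⟨mem_sdiff.2 ⟨ha, by simp [h1, h2]⟩, mem_sdiff.2 ⟨hb, by simp [h3, h4]⟩, h⟩

theorem Deriv.union_eq {Γ Δ : Finset A} {M : Term S.Const A} {m n : ℕ} {R : A → A → Prop}
    (d : Deriv S Γ Δ M m n R) : Γ ∪ Δ = M.fv := by
  induction d with
  | inVar x => simp [Term.fv]
  | outVar x => simp [Term.fv]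
  | const k => simp [Term.fv]
  | zero => simp [Term.fv]
  | one => simp [Term.fv]
  | sym => simp [Term.fv]
  | seq d d' disj ih ih' => rw [Finset.union_union_union_comm, ih, ih', Term.fv]
  | tensor d d' disj ih ih' => rw [Finset.union_union_union_comm, ih, ih', Term.fv]
  | strengthen x y d hx hy hR ih => exact ih
  | @link Γ Δ M m n R x y d hx hy hne hxy ih =>
    grind

theorem Deriv.disjoint {Γ Δ : Finset A} {M : Term S.Const A} {m n : ℕ} {R : A → A → Prop}
    (d : Deriv S Γ Δ M m n R) : Disjoint Γ Δ := by
  induction d with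
  | inVar x => simp
  | outVar x => simp
  | const k => simp
  | zero => simp
  | one => simp
  | sym => simp
  | seq d d' disj ih ih' =>
    simp only [disjoint_union_left, disjoint_union_right] at disj ⊢
    grind
  | tensor d d' disj ih ih' =>
    simp only [disjoint_union_left, disjoint_union_right] at disj ⊢
    grind
  | strengthen x y d hx hy hR ih => exact ih
  | link x y d hx hy hne hxy ih =>
    grind

/-- The polarity with input variables `Γ` and output variables `Δ`. -/
def Polarized (π : A → Bool) (Γ Δ : Finset A) : Prop :=
  (∀ a ∈ Γ, π a = true) ∧ ∀ a ∈ Δ, π a = false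

/-- Times compatible with the anchor of a derivation are a schedule. -/
theorem Deriv.timed {Γ Δ : Finset A} {M : Term S.Const A} {m n : ℕ} {R : A → A → Prop}
    (d : Deriv S Γ Δ M m n R) : ∀ {π : A → Bool} {t : A → ℚ}, Polarized π Γ Δ →
    (∀ a b, R a b → a = b ∨ t a < t b) → Timed S π t M m n := by
  classical
  induction d with
  | inVar x => exact fun hπ _ => .inl ⟨hπ.1 x (by simp), rfl, rfl⟩
  | outVar x => exact fun hπ _ => .inr ⟨hπ.2 x (by simp), rfl, rfl⟩
  | const k => exact fun _ _ => ⟨rfl, rfl⟩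
  | zero => exact fun _ _ => ⟨rfl, rfl⟩
  | one => exact fun _ _ => ⟨rfl, rfl⟩
  | sym => exact fun _ _ => ⟨rfl, rfl⟩
  | seq d d' disj ih ih' =>
    intro π t hπ ht
    simp only [Polarized, mem_union] at hπ
    refine ⟨_, ih ⟨fun a ha => hπ.1 a (.inl ha), fun a ha => hπ.2 a (.inl ha)⟩
        fun a b hab => ht a b (.single (.inl hab)),
      ih' ⟨fun a ha => hπ.1 a (.inr ha), fun a ha => hπ.2 a (.inr ha)⟩
        fun a b hab => ht a b (.single (.inr (.inl hab))), ?_⟩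
    rw [← d.union_eq, ← d'.union_eq]
    intro a ha b hb
    refine (ht a b (.single (.inr (.inr ⟨ha, hb⟩)))).resolve_left ?_
    rintro rfl
    grind
  | tensor d d' disj ih ih' =>
    intro π t hπ ht
    simp only [Polarized, mem_union] at hπ
    exact ⟨_, _, _, _, rfl, rfl,
      ih ⟨fun a ha => hπ.1 a (.inl ha), fun a ha => hπ.2 a (.inl ha)⟩
        fun a b hab => ht a b (.single (.inl hab)),
      ih' ⟨fun a ha => hπ.1 a (.inr ha), fun a ha => hπ.2 a (.inr ha)⟩
        fun a b hab => ht a b (.single (.inr hab)), by rwa [← d.union_eq, ← d'.union_eq]⟩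
  | strengthen x y d hx hy hR ih =>
    exact fun hπ ht => ih hπ fun a b hab => ht a b (.single (.inl hab))
  | @link Γ Δ M m n R x y d hx hy hne hxy ih =>
    intro π t hπ ht
    have hR := d.isAnchor
    have hfv := d.union_eq
    have key : ∀ a b, (a ≠ x ∧ a ≠ y) → (b ≠ x ∧ b ≠ y) → a ≠ b → R a b → t a < t b :=
      fun a b ha hb hab h => (ht a b ⟨h, ha, hb⟩).resolve_left hab
    obtain ⟨p, q, hpq, h1, h2, h3, h4⟩ := exists_link_times t
      (lx := (M.fv \ {x, y}).filter fun a => R a x)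
      (ux := (M.fv \ {x, y}).filter fun a => R x a)
      (ly := (M.fv \ {x, y}).filter fun a => R a y)
      (uy := (M.fv \ {x, y}).filter fun a => R y a)
      (by
        simp only [mem_filter, mem_sdiff, mem_insert, mem_singleton,
          not_or]
        refine fun a ha b hb => key a b ha.1.2 hb.1.2 ?_ (hR.trans _ _ _ ha.2 hb.2)
        rintro rfl
        exact ha.1.2.1 (hR.antisymm _ _ ha.2 hb.2))
      (by
        simp only [mem_filter, mem_sdiff, mem_insert, mem_singleton,
          not_or]
        refine fun a ha b hb => key a b ha.1.2 hb.1.2 ?_ (hR.trans _ _ _ ha.2 hb.2)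
        rintro rfl
        exact ha.1.2.2 (hR.antisymm _ _ ha.2 hb.2))
      (fun a ha => by
        simp only [mem_filter] at ha ⊢
        exact ⟨ha.1, hR.trans _ _ _ hxy ha.2⟩)
    simp only [mem_filter, mem_sdiff, mem_insert, mem_singleton,
      not_or] at h1 h2 h3 h4
    have hmem : ∀ a, a ∈ insert y Γ ∪ insert x Δ → a ∈ M.fv := fun a ha => hfv ▸ ha
    refine ⟨hne, hmem x (by simp), hmem y (by simp), p, q, hpq, ih ⟨fun a ha => ?_, fun a ha => ?_⟩
      fun a b hab => ?_⟩
    · rcases mem_insert.1 ha with rfl | ha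
      · simp
      · have hax : a ≠ x := by rintro rfl; exact hx (mem_union_left _ ha)
        by_cases hay : a = y
        · simp [hay]
        · simpa [hax, hay] using hπ.1 a ha
    · rcases mem_insert.1 ha with rfl | hb
      · simp [hne]
      · have hax : a ≠ x := fun h => hx (mem_union_right _ (h ▸ hb))
        have hay : a ≠ y := fun h => hy (mem_union_right _ (h ▸ hb))
        simpa [hax, hay] using hπ.2 a hb
    · rw [or_iff_not_imp_left]
      intro hne'
      have ha := hmem a (hR.mem_left _ _ hab)
      have hb := hmem b (hR.mem_right _ _ hab)
      by_cases hay : a = y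
      · subst hay
        by_cases hbx : b = x
        · subst hbx; exact (hne (hR.antisymm _ _ hxy hab)).elim
        all_goals grind
      grind

theorem polarized_ins_outs (s : Finset A) : Polarized π (ins π s) (outs π s) :=
  ⟨fun _ h => (mem_ins.1 h).2, fun _ h => (mem_outs.1 h).2⟩

theorem Polarized.eq_ins {Γ Δ s : Finset A} (h : Polarized π Γ Δ) (hs : Γ ∪ Δ = s) :
    Γ = ins π s ∧ Δ = outs π s := by
  subst hs
  constructor <;> ext a <;> have h1 := h.1 a <;> have h2 := h.2 a <;> cases h3 : π a <;>
    simp [mem_ins, mem_outs, h3] <;> simp_all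

theorem Timed.hasType {M : Term S.Const A} {m n : ℕ} (h : Timed S π t M m n) :
    HasType S (ins π M.fv) (outs π M.fv) M m n :=
  ⟨_, h.deriv⟩

theorem Deriv.exists_polarized {Γ Δ : Finset A} {M : Term S.Const A} {m n : ℕ}
    {R : A → A → Prop} (d : Deriv S Γ Δ M m n R) : ∃ π : A → Bool, Polarized π Γ Δ := by
  refine ⟨fun a => decide (a ∈ Γ), fun a ha => by simpa using ha, fun a ha => ?_⟩
  simpa using disjoint_right.1 d.disjoint ha

theorem HasType.timed {Γ Δ : Finset A} {M : Term S.Const A} {m n : ℕ} (h : HasType S Γ Δ M m n)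
    (hπ : Polarized π Γ Δ) : ∃ t : A → ℚ, Timed S π t M m n := by
  classical
  obtain ⟨R, ⟨d⟩⟩ := h
  have hR := d.isAnchor
  -- the time of `a` is the number of its predecessors
  refine ⟨fun a => (((Γ ∪ Δ).filter fun b => R b a).card : ℚ), d.timed hπ fun a b hab => ?_⟩
  rw [or_iff_not_imp_left]
  intro hne
  refine Nat.cast_lt.2 (Finset.card_lt_card ⟨fun c hc => ?_, fun hle => ?_⟩)
  · simp only [mem_filter] at hc ⊢
    exact ⟨hc.1, hR.trans _ _ _ hc.2 hab⟩
  · have hb := hR.mem_right _ _ hab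
    have := hle (mem_filter.2 ⟨hb, hR.refl b hb⟩)
    exact hne (hR.antisymm _ _ hab (mem_filter.1 this).2)

end Schedules

/-! ### Provable equality of scheduled terms -/

section Eqv

variable {A : Type v} [DecidableEq A] {S : Signature.{u}} {π π' : A → Bool} {t t' : A → ℚ}
  {m n k l m₁ m₂ m₃ n₁ n₂ n₃ k₁ k₂ : ℕ} {M M' N N' P M₁ M₂ M₃ : Term S.Const A} {x y : A}

open Term

attribute [simp] Term.fv

/-- All names in `s` come before all names in `s'`. -/
@[grind =] def Before (t : A → ℚ) (s s' : Finset A) : Prop := ∀ a ∈ s, ∀ b ∈ s', t a < t b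

@[simp] theorem before_empty_left (s : Finset A) : Before t ∅ s := by simp [Before]

@[simp] theorem before_empty_right (s : Finset A) : Before t s ∅ := by simp [Before]

@[simp] theorem before_union_left {s s' u : Finset A} :
    Before t (s ∪ s') u ↔ Before t s u ∧ Before t s' u := by
  simp [Before, or_imp, forall_and]

@[simp] theorem before_union_right {s u u' : Finset A} :
    Before t s (u ∪ u') ↔ Before t s u ∧ Before t s u' := by
  simp [Before, or_imp, forall_and]

@[simp] theorem before_insert_left {s u : Finset A} {a : A} :
    Before t (insert a s) u ↔ Before t {a} u ∧ Before t s u := by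
  simp [Before]

@[simp] theorem before_insert_right {s u : Finset A} {a : A} :
    Before t s (insert a u) ↔ Before t s {a} ∧ Before t s u := by
  simp [Before, forall_and]

@[simp] theorem before_singleton {a b : A} : Before t {a} {b} ↔ t a < t b := by simp [Before]

@[grind →] theorem Before.disjoint {s u : Finset A} (h : Before t s u) : Disjoint s u :=
  disjoint_left.2 fun a ha ha' => (h a ha a ha').false

theorem Before.subset {s u s' u' : Finset A} (h : Before t s u) (hs : s' ⊆ s) (hu : u' ⊆ u) :
    Before t s' u' :=
  fun a ha b hb => h a (hs ha) b (hu hb)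

theorem Timed.seq (hM : Timed S π t M m k) (hN : Timed S π t N k n)
    (h : Before t M.fv N.fv := by grind) : Timed S π t (M ⨟ N) m n := ⟨k, hM, hN, h⟩

theorem Timed.tensor (hM : Timed S π t M m₁ n₁) (hN : Timed S π t N m₂ n₂)
    (h : Disjoint M.fv N.fv := by grind) (hm : m = m₁ + m₂ := by first | rfl | omega)
        (hn : n = n₁ + n₂ := by first | rfl | omega) :
    Timed S π t (M ⊠ₜ N) m n := ⟨m₁, m₂, n₁, n₂, hm, hn, hM, hN, h⟩

theorem Timed.link_of (hM : Timed S π t M m n) (hx : π x = false) (hy : π y = true)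
    (hxM : x ∈ M.fv) (hyM : y ∈ M.fv) (h : t x < t y) : Timed S π t (link x y M) m n := by
  refine ⟨by rintro rfl; simp [hx] at hy, hxM, hyM, t x, t y, h, ?_⟩
  rw [← hx, ← hy]
  simpa using hM

theorem timed_var_in (h : π x = true) : Timed S π t (.var x) 0 1 := .inl ⟨h, rfl, rfl⟩

theorem timed_var_out (h : π x = false) : Timed S π t (.var x) 1 0 := .inr ⟨h, rfl, rfl⟩

theorem timed_zero : Timed S π t .zero 0 0 := ⟨rfl, rfl⟩

theorem timed_one : Timed S π t .one 1 1 := ⟨rfl, rfl⟩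

theorem timed_sym : Timed S π t .sym 2 2 := ⟨rfl, rfl⟩

@[simp, grind =] theorem fv_ident {K : Type u} : ∀ n : ℕ, (ident n : Term K A).fv = ∅
  | 0 => rfl
  | 1 => rfl
  | n + 2 => by simp [ident, fv_ident (n + 1)]

@[simp, grind =] theorem fv_symOne {K : Type u} : ∀ n : ℕ, (symOne n : Term K A).fv = ∅
  | 0 => rfl
  | 1 => rfl
  | n + 2 => by simp [symOne, fv_symOne (n + 1)]

@[simp, grind =] theorem fv_symm {K : Type u} (m : ℕ) : ∀ n : ℕ, (Term.symm m n : Term K A).fv = ∅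
  | 0 => by simp [Term.symm]
  | 1 => by simp [Term.symm]
  | n + 2 => by simp [Term.symm, fv_symm m (n + 1)]

theorem timed_ident : ∀ n : ℕ, Timed S π t (ident n) n n
  | 0 => timed_zero
  | 1 => timed_one
  | n + 2 => (timed_ident (n + 1)).tensor timed_one

theorem timed_symOne : ∀ n : ℕ, Timed S π t (symOne n) (n + 1) (1 + n)
  | 0 => timed_one
  | 1 => timed_sym
  | n + 2 => (((timed_ident (n + 1)).tensor timed_sym).seq
      ((timed_symOne (n + 1)).tensor timed_one) :
      Timed S π t ((ident (n + 1) ⊠ₜ .sym) ⨟ (symOne (n + 1) ⊠ₜ .one)) _ _)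

theorem timed_symm (m : ℕ) : ∀ n : ℕ, Timed S π t (Term.symm m n) (m + n) (n + m)
  | 0 => by simpa [Term.symm] using timed_ident m
  | 1 => timed_symOne m
  | n + 2 => (((timed_symm m (n + 1)).tensor timed_one).seq
      ((timed_ident (n + 1)).tensor (timed_symOne m)) :
      Timed S π t ((Term.symm m (n + 1) ⊠ₜ .one) ⨟ (ident (n + 1) ⊠ₜ symOne m)) _ _)

theorem fv_subset_names (M : Term S.Const A) : M.fv ⊆ M.names := by
  induction M <;> simp [Term.names] <;> grind

/-- `M` and `N` have the same free variables and are provably equal, with the polarity `π`. -/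
def Eqv (S : Signature.{u}) (π : A → Bool) (m n : ℕ) (M N : Term S.Const A) : Prop :=
  M.fv = N.fv ∧ EqThy S (ins π M.fv) (outs π M.fv) m n M N

namespace Eqv

theorem of_timed (h : Timed S π t M m n) (h' : Timed S π t' N m n) (hfv : M.fv = N.fv)
    (key : HasType S (ins π M.fv) (outs π M.fv) M m n → HasType S (ins π M.fv) (outs π M.fv) N m n →
      EqThy S (ins π M.fv) (outs π M.fv) m n M N) : Eqv S π m n M N :=
  ⟨hfv, key h.hasType (by rw [hfv]; exact h'.hasType)⟩

theorem refl (h : Timed S π t M m n) : Eqv S π m n M M := ⟨rfl, .refl h.hasType⟩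

theorem symm (h : Eqv S π m n M N) : Eqv S π m n N M := ⟨h.1.symm, h.1 ▸ h.2.symm⟩

theorem trans (h : Eqv S π m n M N) (h' : Eqv S π m n N P) : Eqv S π m n M P :=
  ⟨h.1.trans h'.1, h.2.trans (h.1 ▸ h'.2)⟩

instance : Trans (Eqv S π m n) (Eqv S π m n) (Eqv S π m n) := ⟨trans⟩

theorem congr (h : Eqv S π m n M N) (hπ : ∀ a ∈ M.fv, π a = π' a) : Eqv S π' m n M N :=
  ⟨h.1, by rw [← ins_congr hπ, ← outs_congr hπ]; exact h.2⟩

theorem seq (h : Eqv S π m k M M') (h' : Eqv S π k n N N') (hd : Disjoint M.fv N.fv := by grind) :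
    Eqv S π m n (M ⨟ N) (M' ⨟ N') := by
  refine ⟨by simp [h.1, h'.1], ?_⟩
  rw [Term.fv, ins_union, outs_union]
  exact .seq_congr (by rwa [ins_union_outs, ins_union_outs]) h.2 h'.2

theorem tensor (h : Eqv S π m₁ n₁ M M') (h' : Eqv S π m₂ n₂ N N')
    (hd : Disjoint M.fv N.fv := by grind)
    (hm : m = m₁ + m₂ := by first | rfl | omega) (hn : n = n₁ + n₂ := by first | rfl | omega) :
    Eqv S π m n (M ⊠ₜ N) (M' ⊠ₜ N') := by
  subst hm hn
  refine ⟨by simp [h.1, h'.1], ?_⟩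
  rw [Term.fv, ins_union, outs_union]
  exact .tensor_congr (by rwa [ins_union_outs, ins_union_outs]) h.2 h'.2

theorem link (h : Eqv S (update (update π x false) y true) m n M N)
    (hM : Timed S π t (.link x y M) m n) (hN : Timed S π t' (.link x y N) m n) :
    Eqv S π m n (.link x y M) (.link x y N) := by
  refine of_timed hM hN (by simp [h.1]) fun h1 h2 => .link_congr h1 h2 ?_
  obtain ⟨hxy, hx, hy, -⟩ := hM
  have := h.2
  rwa [ins_update_link hxy hy, outs_update_link hxy hx] at this

theorem link_of (h : Eqv S π m n M N) (hM : Timed S π t (.link x y M) m n)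
    (hN : Timed S π t' (.link x y N) m n) (hx : π x = false) (hy : π y = true) :
    Eqv S π m n (.link x y M) (.link x y N) := by
  refine link ?_ hM hN
  rw [← hx, ← hy]
  simpa using h

theorem seq_assoc (h1 : Timed S π t M₁ m k) (h2 : Timed S π t M₂ k l) (h3 : Timed S π t M₃ l n)
    (h12 : Before t M₁.fv M₂.fv := by grind) (h13 : Before t M₁.fv M₃.fv := by grind)
        (h23 : Before t M₂.fv M₃.fv := by grind) :
    Eqv S π m n ((M₁ ⨟ M₂) ⨟ M₃) (M₁ ⨟ M₂ ⨟ M₃) :=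
  of_timed ((h1.seq h2).seq h3) (h1.seq (h2.seq h3))
    (by simp [Finset.union_assoc]) .seq_assoc

theorem ident_seq (h : Timed S π t M m n) : Eqv S π m n (ident m ⨟ M) M :=
  ⟨by simp, by simpa using .ident_seq h.hasType⟩

theorem seq_ident (h : Timed S π t M m n) : Eqv S π m n (M ⨟ ident n) M :=
  ⟨by simp, by simpa using .seq_ident h.hasType⟩

theorem tensor_zero (h : Timed S π t M m n) : Eqv S π m n (M ⊠ₜ .zero) M :=
  ⟨by simp, by simpa using .tensor_zero h.hasType⟩

theorem zero_tensor (h : Timed S π t M m n) : Eqv S π m n (.zero ⊠ₜ M) M :=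
  ⟨by simp, by simpa using .zero_tensor h.hasType⟩

theorem tensor_assoc (h1 : Timed S π t M₁ m₁ n₁) (h2 : Timed S π t M₂ m₂ n₂)
    (h3 : Timed S π t M₃ m₃ n₃) (h12 : Disjoint M₁.fv M₂.fv := by grind)
        (h13 : Disjoint M₁.fv M₃.fv := by grind)
    (h23 : Disjoint M₂.fv M₃.fv := by grind) (hm : m = m₁ + m₂ + m₃ := by first | rfl | omega)
    (hn : n = n₁ + n₂ + n₃ := by first | rfl | omega) :
    Eqv S π m n ((M₁ ⊠ₜ M₂) ⊠ₜ M₃) (M₁ ⊠ₜ M₂ ⊠ₜ M₃) :=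
  of_timed ((h1.tensor h2).tensor h3)
    (h1.tensor (h2.tensor h3))
    (by simp [Finset.union_assoc]) .tensor_assoc

/-- Functoriality of the tensor. -/
theorem interchange (hM : Timed S π t M m₁ k₁) (hM' : Timed S π t M' k₁ n₁)
    (hN : Timed S π t N m₂ k₂) (hN' : Timed S π t N' k₂ n₂)
    (h1 : Before t M.fv M'.fv := by grind) (h2 : Before t M.fv N'.fv := by grind)
        (h3 : Before t N.fv M'.fv := by grind)
    (h4 : Before t N.fv N'.fv := by grind) (hd : Disjoint M.fv N.fv := by grind)
        (hd' : Disjoint M'.fv N'.fv := by grind)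
    (hm : m = m₁ + m₂ := by first | rfl | omega) (hn : n = n₁ + n₂ := by first | rfl | omega) :
    Eqv S π m n ((M ⨟ M') ⊠ₜ (N ⨟ N')) ((M ⊠ₜ N) ⨟ (M' ⊠ₜ N')) := by
  have h2' := h2.disjoint
  have h3' := h3.disjoint.symm
  exact of_timed ((hM.seq hM').tensor (hN.seq hN'))
    ((hM.tensor hN).seq (hM'.tensor hN'))
    (by ext; simp; tauto) .tensor_seq

theorem symmetry (hM : Timed S π t M m₁ n₁) (hN : Timed S π t' N m₂ n₂)
    (hd : Disjoint M.fv N.fv := by grind) (hm : m = m₁ + m₂ := by first | rfl | omega)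
        (hn : n = n₂ + n₁ := by first | rfl | omega) :
    Eqv S π m n ((M ⊠ₜ N) ⨟ Term.symm n₁ n₂) (Term.symm m₁ m₂ ⨟ (N ⊠ₜ M)) := by
  subst hm hn
  refine ⟨by simp [Finset.union_comm], ?_⟩
  simp only [Term.fv, fv_symm, Finset.union_empty]
  rw [ins_union, outs_union]
  exact .symmetry (by rwa [ins_union_outs, ins_union_outs]) hM.hasType hN.hasType

theorem link_ident (hxy : x ≠ y := by grind) : Eqv S π 1 1 (.link x y (.var x ⨟ .var y)) .one := by
  have : (Term.link x y (.var x ⨟ .var y) : Term S.Const A).fv = ∅ := by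
    ext; simp
  exact ⟨by simp, by rw [this]; simpa [ins, outs] using .link_ident hxy⟩

theorem extrude_seq_left (hM : Timed S π t (.link x y M) m k) (hN : Timed S π t N k n)
    (h : Timed S π t' (.link x y (M ⨟ N)) m n) (hMN : Before t (M.fv \ {x, y}) N.fv := by grind)
    (hx : x ∉ N.fv := by grind) (hy : y ∉ N.fv := by grind) :
    Eqv S π m n (.link x y (M ⨟ N)) (.link x y M ⨟ N) :=
  of_timed h (hM.seq hN) (by ext a; simp; grind) (.extrude_seq_left hx hy)

theorem extrude_seq_right (hM : Timed S π t M m k) (hN : Timed S π t (.link x y N) k n)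
    (h : Timed S π t' (.link x y (M ⨟ N)) m n) (hMN : Before t M.fv (N.fv \ {x, y}) := by grind)
    (hx : x ∉ M.fv := by grind) (hy : y ∉ M.fv := by grind) :
    Eqv S π m n (.link x y (M ⨟ N)) (M ⨟ .link x y N) :=
  of_timed h (hM.seq hN) (by ext a; simp; grind) (.extrude_seq_right hx hy)

theorem extrude_tensor_right (hM : Timed S π t M m₁ n₁) (hN : Timed S π t (.link x y N) m₂ n₂)
    (h : Timed S π t' (.link x y (M ⊠ₜ N)) m n) (hMN : Disjoint M.fv N.fv := by grind)
    (hx : x ∉ M.fv := by grind) (hy : y ∉ M.fv := by grind)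
        (hm : m = m₁ + m₂ := by first | rfl | omega) (hn : n = n₁ + n₂ := by first | rfl | omega) :
    Eqv S π m n (.link x y (M ⊠ₜ N)) (M ⊠ₜ .link x y N) :=
  of_timed h (hM.tensor hN (hMN.mono_right sdiff_subset)) (by ext a; simp; grind)
    (.extrude_tensor_right hx hy)

end Eqv

/-! ### Renaming -/

/-- `ρ` renames the free variables of `M` injectively, without capture. -/
structure FreshFor (ρ : A → A) (M : Term S.Const A) : Prop where
  fresh : ∀ a ∈ M.fv, ρ a = a ∨ ρ a ∉ M.names
  inj : ∀ a ∈ M.fv, ∀ b ∈ M.fv, ρ a = ρ b → a = b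

theorem FreshFor.left_of_seq {ρ : A → A} (h : FreshFor ρ (M ⨟ N)) : FreshFor ρ M where
  fresh a ha := (h.fresh a (by simp [ha])).imp_right fun h' => by simp_all [Term.names]
  inj a ha b hb := h.inj a (by simp [ha]) b (by simp [hb])

theorem FreshFor.right_of_seq {ρ : A → A} (h : FreshFor ρ (M ⨟ N)) : FreshFor ρ N where
  fresh a ha := (h.fresh a (by simp [ha])).imp_right fun h' => by simp_all [Term.names]
  inj a ha b hb := h.inj a (by simp [ha]) b (by simp [hb])

theorem FreshFor.of_link {ρ : A → A} (h : FreshFor ρ (.link x y M)) :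
    FreshFor (fun a => if a = x ∨ a = y then a else ρ a) M where
  fresh a ha := by
    have := h.fresh a
    simp [Term.names] at this
    grind
  inj a ha b hb hab := by
    have h1 := h.fresh a
    have h2 := h.fresh b
    have h3 := h.inj a
    simp [Term.names] at h1 h2 h3
    grind

theorem fv_rename {ρ : A → A} (h : FreshFor ρ M) : (M.rename ρ).fv = M.fv.image ρ := by
  induction M generalizing ρ with
  | const k => simp [Term.rename]
  | zero => simp [Term.rename]
  | one => simp [Term.rename]
  | sym => simp [Term.rename]
  | var x => simp [Term.rename]
  | seq M N ihM ihN => simp [Term.rename, ihM h.left_of_seq, ihN h.right_of_seq, Finset.image_union]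
  | tensor M N ihM ihN =>
    have h' : FreshFor ρ (M ⨟ N) := ⟨h.1, h.2⟩
    simp [Term.rename, ihM h'.left_of_seq, ihN h'.right_of_seq, Finset.image_union]
  | link x y M ih =>
    have h1 := h.fresh
    simp only [Term.rename, Term.fv, ih h.of_link]
    simp [Term.names] at h1
    ext a
    simp only [mem_sdiff, mem_image, mem_insert, mem_singleton]
    grind

theorem Timed.rename {ρ : A → A} (hM : Timed S π t M m n) (h : FreshFor ρ M)
    (hπ : ∀ a ∈ M.fv, π' (ρ a) = π a) (ht : ∀ a ∈ M.fv, t' (ρ a) = t a) :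
    Timed S π' t' (M.rename ρ) m n := by
  induction M generalizing ρ π π' t t' m n with
  | const k => exact hM
  | zero => exact hM
  | one => exact hM
  | sym => exact hM
  | var x => simpa [Timed, Term.rename, hπ x (by simp)] using hM
  | seq M N ihM ihN =>
    obtain ⟨k, h1, h2, h3⟩ := hM
    simp only [Term.fv, mem_union] at hπ ht
    refine (ihM h1 h.left_of_seq (fun a ha => hπ a (.inl ha)) fun a ha => ht a (.inl ha)).seq
      (ihN h2 h.right_of_seq (fun a ha => hπ a (.inr ha)) fun a ha => ht a (.inr ha)) ?_
    rw [fv_rename h.left_of_seq, fv_rename h.right_of_seq]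
    intro a ha b hb
    grind
  | tensor M N ihM ihN =>
    have h' : FreshFor ρ (M ⨟ N) := ⟨h.1, h.2⟩
    obtain ⟨m1, m2, n1, n2, rfl, rfl, h1, h2, h3⟩ := hM
    simp only [Term.fv, mem_union] at hπ ht
    refine (ihM h1 h'.left_of_seq (fun a ha => hπ a (.inl ha)) fun a ha => ht a (.inl ha)).tensor
      (ihN h2 h'.right_of_seq (fun a ha => hπ a (.inr ha)) fun a ha => ht a (.inr ha)) ?_
    rw [fv_rename h'.left_of_seq, fv_rename h'.right_of_seq]
    rw [disjoint_left]
    intro c ha hb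
    obtain ⟨a, ha', rfl⟩ := mem_image.1 ha
    obtain ⟨b, hb', hab⟩ := mem_image.1 hb
    have := h.inj b (by simp [hb']) a (by simp [ha']) hab
    grind
  | link x y M ih =>
    obtain ⟨hxy, hx, hy, p, q, hpq, h1⟩ := hM
    have h2 := h.fresh
    simp [Term.names] at h2 hπ ht
    refine ⟨hxy, ?_, ?_, p, q, hpq, ih h1 h.of_link ?_ ?_⟩
    · rw [fv_rename h.of_link]
      grind
    · rw [fv_rename h.of_link]
      grind
    all_goals grind

theorem freshFor_rename₂ {x' y' : A} (hx' : x' ∉ M.names) (hy' : y' ∉ M.names) (h : x' ≠ y') :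
    FreshFor (fun a => if a = x then x' else if a = y then y' else a) M where
  fresh a ha := by grind
  inj a ha b hb hab := by
    have := fv_subset_names M ha
    have := fv_subset_names M hb
    grind

theorem Timed.alpha {x' y' : A} (hM : Timed S π t (.link x y M) m n) (hx' : x' ∉ M.names)
    (hy' : y' ∉ M.names) (h : x' ≠ y') :
    Timed S π t (.link x' y' (M.rename₂ x y x' y')) m n := by
  obtain ⟨hxy, hx, hy, p, q, hpq, hM⟩ := hM
  have hf := freshFor_rename₂ (x := x) (y := y) hx' hy' h
  refine ⟨h, ?_, ?_, p, q, hpq, hM.rename hf ?_ ?_⟩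
  · rw [rename₂, fv_rename hf]
    exact mem_image.2 ⟨x, hx, by simp⟩
  · rw [rename₂, fv_rename hf]
    exact mem_image.2 ⟨y, hy, by simp [Ne.symm hxy]⟩
  all_goals
    intro a ha
    have ha' := fv_subset_names M ha
    by_cases hax : a = x
    · subst hax; simp [hxy, h]
    by_cases hay : a = y
    · subst hay; simp [hax]
    have h1 : a ≠ x' := by rintro rfl; exact hx' ha'
    have h2 : a ≠ y' := by rintro rfl; exact hy' ha'
    simp [hax, hay, h1, h2]

theorem Eqv.alpha {x' y' : A} (hM : Timed S π t (.link x y M) m n) (hx' : x' ∉ M.names)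
    (hy' : y' ∉ M.names) (h : x' ≠ y') :
    Eqv S π m n (.link x y M) (.link x' y' (M.rename₂ x y x' y')) := by
  refine of_timed hM (hM.alpha hx' hy' h) ?_ (.alpha hx' hy' h)
  obtain ⟨hxy, hx, hy, -⟩ := hM
  rw [Term.fv, Term.fv, rename₂, fv_rename (freshFor_rename₂ hx' hy' h)]
  ext a
  have := @fv_subset_names _ _ _ M
  simp only [mem_sdiff, mem_image, mem_insert, mem_singleton]
  constructor
  · rintro ⟨ha, h'⟩
    refine ⟨⟨a, ha, ?_⟩, ?_⟩ <;> grind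
  · rintro ⟨⟨b, hb, rfl⟩, h'⟩
    grind

/-! ### Derived equations -/

variable {U V : Term S.Const A}

namespace Eqv

theorem cast (h : Eqv S π m₁ n₁ M N) (hm : m₁ = m := by omega) (hn : n₁ = n := by omega) :
    Eqv S π m n M N := by
  subst hm hn
  exact h

/-- Replacing the middle factor. -/
theorem seq_left (h : Eqv S π m k M M') (hN : Timed S π t N k n)
    (hd : Disjoint M.fv N.fv := by grind) :
    Eqv S π m n (M ⨟ N) (M' ⨟ N) :=
  h.seq (refl hN)

theorem seq_right (h : Eqv S π k n N N') (hM : Timed S π t M m k)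
    (hd : Disjoint M.fv N.fv := by grind) :
    Eqv S π m n (M ⨟ N) (M ⨟ N') :=
  (refl hM).seq h

theorem ident_tensor_one : ∀ n : ℕ, Eqv S π (n + 1) (n + 1) (ident n ⊠ₜ .one) (ident (n + 1))
  | 0 => zero_tensor (t := fun _ => 0) timed_one
  | n + 1 => refl (t := fun _ => 0) (timed_ident (n + 2))

theorem ident_tensor_ident (m : ℕ) : ∀ n : ℕ,
    Eqv S π (m + n) (m + n) (ident m ⊠ₜ ident n) (ident (m + n))
  | 0 => tensor_zero (t := fun _ => 0) (timed_ident m)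
  | 1 => ident_tensor_one m
  | n + 2 => by
    have h := ident_tensor_ident m (n + 1)
    exact (tensor_assoc (t := fun _ => 0) (timed_ident m) (timed_ident (n + 1))
        timed_one).symm.trans
        ((h.tensor (refl (t := fun _ => 0) timed_one)).trans
          (ident_tensor_one (m + (n + 1))))

theorem symm_zero_left : ∀ n : ℕ, Eqv S π n n (Term.symm 0 n) (ident n)
  | 0 => refl (t := fun _ => 0) timed_zero
  | 1 => refl (t := fun _ => 0) timed_one
  | n + 2 => by
    have h1 : Timed S π (fun _ => 0) (ident (n + 2)) (n + 2) (n + 2) := timed_ident (n + 2)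
    have h2 := ((symm_zero_left (n + 1)).tensor (m := n + 2) (n := n + 2)
      (refl (t := fun _ => 0) timed_one)).seq (refl h1)
    exact h2.trans (seq_ident h1)

/-- Scalars can be moved past any term. -/
theorem scalar_tensor_comm (hM : Timed S π t M 0 0) (hN : Timed S π t' N m n)
    (hd : Disjoint M.fv N.fv := by grind) : Eqv S π m n (M ⊠ₜ N) (N ⊠ₜ M) := by
  obtain ⟨t1, ht1⟩ : ∃ t1, Timed S π t1 (M ⊠ₜ N) m n := by
    refine ⟨fun a => if a ∈ M.fv then t a else t' a, ?_⟩
    refine Timed.tensor (hM.congr (fun _ _ => rfl) fun a ha => by simp [ha])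
      (hN.congr (fun _ _ => rfl) fun a ha => ?_)
    simp [disjoint_right.1 hd ha]
  obtain ⟨t2, ht2⟩ : ∃ t2, Timed S π t2 (N ⊠ₜ M) m n := by
    refine ⟨fun a => if a ∈ M.fv then t a else t' a, ?_⟩
    refine Timed.tensor (hN.congr (fun _ _ => rfl) fun a ha => ?_)
      (hM.congr (fun _ _ => rfl) fun a ha => by simp [ha])
    simp [disjoint_right.1 hd ha]
  calc Eqv S π m n (M ⊠ₜ N) ((M ⊠ₜ N) ⨟ ident n) := (seq_ident ht1).symm
    Eqv S π m n _ ((M ⊠ₜ N) ⨟ Term.symm 0 n) := (symm_zero_left n).symm.seq_right ht1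
    Eqv S π m n _ (Term.symm 0 m ⨟ (N ⊠ₜ M)) := symmetry hM hN
    Eqv S π m n _ (ident m ⨟ (N ⊠ₜ M)) := (symm_zero_left m).seq_left ht2
    Eqv S π m n _ (N ⊠ₜ M) := ident_seq ht2

theorem tensor_seq_left (hM : Timed S π t M m₁ n₁) (hN : Timed S π t N m₂ n₂)
    (h : Before t M.fv N.fv := by grind) (hm : m = m₁ + m₂ := by first | rfl | omega)
        (hn : n = n₁ + n₂ := by first | rfl | omega) :
    Eqv S π m n (M ⊠ₜ N) ((M ⊠ₜ ident m₂) ⨟ (ident n₁ ⊠ₜ N)) :=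
  ((seq_ident hM).symm.tensor (ident_seq hN).symm).trans
    (interchange hM (timed_ident _) (timed_ident _) hN)

theorem tensor_seq_right (hM : Timed S π t M m₁ n₁) (hN : Timed S π t N m₂ n₂)
    (h : Before t N.fv M.fv := by grind) (hm : m = m₁ + m₂ := by first | rfl | omega)
        (hn : n = n₁ + n₂ := by first | rfl | omega) :
    Eqv S π m n (M ⊠ₜ N) ((ident m₁ ⊠ₜ N) ⨟ (M ⊠ₜ ident n₂)) :=
  ((ident_seq hM).symm.tensor (seq_ident hN).symm).trans
    (interchange (timed_ident _) hM hN (timed_ident _))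

theorem var_out_tensor (hx : π x = false) (n : ℕ) :
    Eqv S π (n + 1) n (.var x ⊠ₜ ident n) (Term.symm 1 n ⨟ (ident n ⊠ₜ .var x)) := by
  have hx' : Timed S π (fun _ => 0) (.var x) 1 0 := timed_var_out hx
  have h1 : Timed S π (fun _ => 0) (.var x ⊠ₜ ident n) (n + 1) n :=
    hx'.tensor (timed_ident n)
  calc Eqv S π (n + 1) n (.var x ⊠ₜ ident n) ((.var x ⊠ₜ ident n) ⨟ ident n) := (seq_ident h1).symm
    Eqv S π (n + 1) n _ ((.var x ⊠ₜ ident n) ⨟ Term.symm 0 n) := (symm_zero_left n).symm.seq_right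
        h1
    Eqv S π (n + 1) n _ (Term.symm 1 n ⨟ (ident n ⊠ₜ .var x)) :=
        symmetry hx' (timed_ident (t := fun _ => 0) n)

theorem var_in_tensor (hy : π y = true) (n : ℕ) :
    Eqv S π n (n + 1) (.var y ⊠ₜ ident n) ((ident n ⊠ₜ .var y) ⨟ Term.symm n 1) := by
  have hy' : Timed S π (fun _ => 0) (.var y) 0 1 := timed_var_in hy
  have h1 : Timed S π (fun _ => 0) (.var y ⊠ₜ ident n) n (n + 1) :=
    hy'.tensor (timed_ident n)
  calc Eqv S π n (n + 1) (.var y ⊠ₜ ident n) (ident n ⨟ (.var y ⊠ₜ ident n)) := (ident_seq h1).symm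
    Eqv S π n (n + 1) _ ((ident n ⊠ₜ .var y) ⨟ Term.symm n 1) :=
      (symmetry (timed_ident (t := fun _ => 0) n) hy' (by simp) (by omega)).symm

end Eqv

theorem Timed.update_right (h : Timed S π t M m n) (hx : x ∉ M.fv) (c : ℚ) :
    Timed S π (update t x c) M m n :=
  h.congr (fun _ _ => rfl) fun a ha => by grind

theorem Before.update {s u : Finset A} {c : ℚ} (h : Before t s u := by grind)
    (hs : x ∉ s := by grind) (hu : x ∉ u := by grind) :
    Before (update t x c) s u := by
  intro a ha b hb
  rw [update_of_ne, update_of_ne]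
  · exact h a ha b hb
  · rintro rfl; exact hu hb
  · rintro rfl; exact hs ha

theorem exists_between (t : A → ℚ) (x : A) {s u : Finset A} (h : Before t s u := by grind)
    (hs : x ∉ s := by grind)
    (hu : x ∉ u := by grind) : ∃ c, Before (update t x c) s {x} ∧ Before (update t x c) {x} u := by
  obtain ⟨c, h1, h2⟩ := Order.exists_between_finsets (lo := s.image t) (hi := u.image t)
    (by simpa [Before] using h)
  refine ⟨c, fun a ha b hb => ?_, fun b hb a ha => ?_⟩
  all_goals
    rw [mem_singleton.1 hb, Function.update_self, update_of_ne]
    · first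
      | exact h1 _ (mem_image_of_mem t ha)
      | exact h2 _ (mem_image_of_mem t ha)
    · rintro rfl
      first | exact hs ha | exact hu ha

theorem timed_ident_tensor_out (hx : π x = false) (n : ℕ) :
    Timed S π t (ident n ⊠ₜ .var x) (n + 1) n :=
  (timed_ident n).tensor (timed_var_out hx) (by simp)

theorem timed_ident_tensor_in (hy : π y = true) (n : ℕ) :
    Timed S π t (ident n ⊠ₜ .var y) n (n + 1) :=
  (timed_ident n).tensor (timed_var_in hy) (by simp)

set_option maxHeartbeats 1000000 in
/-- An output variable can be moved to the end of a term: nothing has to happen after it. -/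
theorem Timed.exists_delay (hM : Timed S π t M m n) (hx : x ∈ M.fv) (hπ : π x = false) :
    ∃ M', Timed S π t M' m (n + 1) ∧ M'.fv = M.fv \ {x} ∧
      Eqv S π m n M (M' ⨟ (ident n ⊠ₜ .var x)) := by
  induction M generalizing π t m n with
  | const k => simp at hx
  | zero => simp at hx
  | one => simp at hx
  | sym => simp at hx
  | var z =>
    obtain rfl : x = z := by simpa using hx
    obtain ⟨h, -⟩ | ⟨-, rfl, rfl⟩ := hM
    · simp [hπ] at h
    refine ⟨.one, timed_one, by simp, ?_⟩
    have h1 : Timed S π t (.var x) 1 0 := timed_var_out hπ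
    exact (Eqv.zero_tensor h1).symm.trans
      (Eqv.ident_seq (m := 1) (n := 0) (timed_zero.tensor h1 (by simp))).symm
  | seq M N ihM ihN =>
    obtain ⟨k, hM, hN, hlt⟩ := hM
    have hlt : Before t M.fv N.fv := hlt
    rcases mem_union.1 hx with hx | hx
    · obtain ⟨M', hM', hfv, he⟩ := ihM hM hx hπ
      have hxN : x ∉ N.fv := disjoint_left.1 hlt.disjoint hx
      have hM'N : Before t M'.fv N.fv := hlt.subset (by simp [hfv]) subset_rfl
      have hxM' : x ∉ M'.fv := by simp [hfv]
      have hxt := timed_ident_tensor_out (S := S) (t := t) hπ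
      obtain ⟨c, hc1, hc2⟩ := exists_between t x hM'N
      obtain ⟨d, hd, -⟩ := exists_between t x (s := M'.fv ∪ N.fv) (u := ∅)
      rw [before_union_left] at hd
      have h1 : Timed S π t (.var x) 1 0 := timed_var_out hπ
      have hxN' : Disjoint {x} N.fv := by simpa using hxN
      refine ⟨M' ⨟ (N ⊠ₜ .one), hM'.seq (hN.tensor timed_one), ?_, ?_⟩
      · grind
      have hcN := hN.update_right hxN c
      have hdN := hN.update_right hxN d
      calc Eqv S π m n (M ⨟ N) ((M' ⨟ (ident k ⊠ₜ .var x)) ⨟ N) := he.seq_left hN hlt.disjoint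
        Eqv S π m n _ (M' ⨟ (ident k ⊠ₜ .var x) ⨟ N) := Eqv.seq_assoc (hM'.update_right hxM' c)
            (timed_ident_tensor_out hπ k) hcN (by simp [hc1]) (hM'N.update hxM')
        Eqv S π m n _ (M' ⨟ (N ⊠ₜ .one) ⨟ (ident n ⊠ₜ .var x)) := by
            refine Eqv.seq_right ?_ hM' (by simp [hfv]; exact
              (hlt.disjoint.mono_left sdiff_subset))
            calc Eqv S π (k + 1) n ((ident k ⊠ₜ .var x) ⨟ N)
                  ((ident k ⊠ₜ .var x) ⨟ (N ⊠ₜ .zero)) :=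
                (Eqv.tensor_zero hN).symm.seq_right (timed_ident_tensor_out (t := t) hπ k)
              Eqv S π (k + 1) n _ ((ident k ⨟ N) ⊠ₜ (.var x ⨟ .zero)) :=
                (Eqv.interchange (timed_ident k) hcN (timed_var_out hπ) timed_zero).symm
              Eqv S π (k + 1) n _ (N ⊠ₜ .var x) := (Eqv.ident_seq hN).tensor (Eqv.seq_ident h1)
              Eqv S π (k + 1) n _ ((N ⨟ ident n) ⊠ₜ (.one ⨟ .var x)) :=
                  (Eqv.seq_ident hN).symm.tensor
                  (Eqv.ident_seq h1).symm
              Eqv S π (k + 1) n _ ((N ⊠ₜ .one) ⨟ (ident n ⊠ₜ .var x)) :=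
                Eqv.interchange hdN (timed_ident n) timed_one (timed_var_out hπ)
                  (by simp)
        Eqv S π m n _ ((M' ⨟ (N ⊠ₜ .one)) ⨟ (ident n ⊠ₜ .var x)) :=
            (Eqv.seq_assoc (hM'.update_right hxM' d) (hdN.tensor timed_one)
              (timed_ident_tensor_out hπ n) (by simpa using hM'N.update hxM' hxN)).symm
    · obtain ⟨N', hN', hfv, he⟩ := ihN hN hx hπ
      have hxM : x ∉ M.fv := disjoint_right.1 hlt.disjoint hx
      have hMN' : Before t M.fv N'.fv := hlt.subset subset_rfl (by simp [hfv])
      have hxN' : x ∉ N'.fv := by simp [hfv]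
      obtain ⟨d, hd, -⟩ := exists_between t x (s := M.fv ∪ N'.fv) (u := ∅)
      rw [before_union_left] at hd
      refine ⟨M ⨟ N', hM.seq hN', by
        ext c; simp [hfv]; grind, ?_⟩
      exact (he.seq_right hM hlt.disjoint).trans (Eqv.seq_assoc (hM.update_right hxM d)
        (hN'.update_right hxN' d) (timed_ident_tensor_out hπ n) (hMN'.update hxM)).symm
  | tensor M N ihM ihN =>
    obtain ⟨m1, m2, n1, n2, rfl, rfl, hM, hN, hdisj⟩ := hM
    rcases mem_union.1 hx with hx | hx
    · obtain ⟨M', hM', hfv, he⟩ := ihM hM hx hπ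
      have hxN : x ∉ N.fv := disjoint_left.1 hdisj hx
      have hxM' : x ∉ M'.fv := by simp [hfv]
      have hM'N : Disjoint M'.fv N.fv := hdisj.mono_left (by simp [hfv])
      obtain ⟨d, hd, -⟩ := exists_between t x (s := M'.fv ∪ N.fv) (u := ∅)
      rw [before_union_left] at hd
      have hdM := hM'.update_right hxM' d
      have hdN := hN.update_right hxN d
      have h1 : Timed S π (update t x d) (.var x) 1 0 := timed_var_out hπ
      refine ⟨(M' ⊠ₜ N) ⨟ (ident n1 ⊠ₜ Term.symm 1 n2),
        (hM'.tensor hN).seq ((timed_ident n1).tensor (timed_symm 1 n2)), ?_, ?_⟩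
      · grind
      have h2 : Timed S π (update t x d) ((ident n1 ⊠ₜ .var x) ⊠ₜ ident n2) (n1 + 1 + n2)
          (n1 + n2) :=
        (timed_ident_tensor_out hπ n1).tensor (timed_ident n2)
      calc Eqv S π (m1 + m2) (n1 + n2) (M ⊠ₜ N) ((M' ⨟ (ident n1 ⊠ₜ .var x)) ⊠ₜ (N ⨟ ident n2)) :=
            he.tensor (Eqv.seq_ident hN).symm
        Eqv S π (m1 + m2) (n1 + n2) _ ((M' ⊠ₜ N) ⨟ ((ident n1 ⊠ₜ .var x) ⊠ₜ ident n2)) :=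
            Eqv.interchange hdM (timed_ident_tensor_out hπ n1) hdN (timed_ident n2)
        Eqv S π (m1 + m2) (n1 + n2) _
            ((M' ⊠ₜ N) ⨟ ((ident n1 ⊠ₜ Term.symm 1 n2) ⨟ (ident (n1 + n2) ⊠ₜ .var x))) := by
            refine Eqv.seq_right ?_ (hdM.tensor hdN)
            calc Eqv S π (n1 + 1 + n2) (n1 + n2) ((ident n1 ⊠ₜ .var x) ⊠ₜ ident n2)
                  (ident n1 ⊠ₜ (.var x ⊠ₜ ident n2)) :=
                Eqv.tensor_assoc (timed_ident n1) h1 (timed_ident n2)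
              Eqv S π (n1 + 1 + n2) (n1 + n2) _
                  ((ident n1 ⨟ ident n1) ⊠ₜ (Term.symm 1 n2 ⨟ (ident n2 ⊠ₜ .var x))) :=
                (Eqv.ident_seq (timed_ident (t := t) n1)).symm.tensor (Eqv.var_out_tensor hπ n2)
              Eqv S π (n1 + 1 + n2) (n1 + n2) _
                  ((ident n1 ⊠ₜ Term.symm 1 n2) ⨟ (ident n1 ⊠ₜ (ident n2 ⊠ₜ .var x))) :=
                Eqv.interchange (t := t) (timed_ident n1) (timed_ident n1) (timed_symm 1 n2)
                  (timed_ident_tensor_out hπ n2)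
              Eqv S π (n1 + 1 + n2) (n1 + n2) _
                  ((ident n1 ⊠ₜ Term.symm 1 n2) ⨟ (ident (n1 + n2) ⊠ₜ .var x)) := by
                refine Eqv.seq_right (k := n1 + n2 + 1) (t := t) ?_
                    ((timed_ident n1).tensor (timed_symm 1 n2))
                exact (Eqv.tensor_assoc (timed_ident n1) (timed_ident n2) h1).symm.trans
                    ((Eqv.ident_tensor_ident n1 n2).tensor (Eqv.refl h1))
        Eqv S π (m1 + m2) (n1 + n2) _ _ :=
            (Eqv.seq_assoc (hdM.tensor hdN) ((timed_ident n1).tensor (timed_symm 1 n2))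
            ((timed_ident_tensor_out hπ (n1 + n2)))).symm
    · obtain ⟨N', hN', hfv, he⟩ := ihN hN hx hπ
      have hxM : x ∉ M.fv := disjoint_right.1 hdisj hx
      have hxN' : x ∉ N'.fv := by simp [hfv]
      have hMN' : Disjoint M.fv N'.fv := hdisj.mono_right (by simp [hfv])
      obtain ⟨d, hd, -⟩ := exists_between t x (s := M.fv ∪ N'.fv) (u := ∅)
      rw [before_union_left] at hd
      have hdM := hM.update_right hxM d
      have hdN := hN'.update_right hxN' d
      have h1 : Timed S π (update t x d) (.var x) 1 0 := timed_var_out hπ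
      refine ⟨M ⊠ₜ N', hM.tensor hN', by
        ext c; simp [hfv]; grind, ?_⟩
      calc Eqv S π (m1 + m2) (n1 + n2) (M ⊠ₜ N) ((M ⨟ ident n1) ⊠ₜ (N' ⨟ (ident n2 ⊠ₜ .var x))) :=
            (Eqv.seq_ident hM).symm.tensor he
        Eqv S π (m1 + m2) (n1 + n2) _ ((M ⊠ₜ N') ⨟ (ident n1 ⊠ₜ (ident n2 ⊠ₜ .var x))) :=
            Eqv.interchange hdM (timed_ident n1) hdN (timed_ident_tensor_out hπ n2)
        Eqv S π (m1 + m2) (n1 + n2) _ _ :=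
            Eqv.seq_right ((Eqv.tensor_assoc (timed_ident n1) (timed_ident n2) h1).symm.trans
            ((Eqv.ident_tensor_ident n1 n2).tensor (Eqv.refl h1))) (hdM.tensor hdN)
  | link a b M ih =>
    obtain ⟨hab, ha, hb, p, q, hpq, hM⟩ := hM
    simp only [Term.fv, mem_sdiff, mem_insert, mem_singleton, not_or] at hx
    obtain ⟨hx, hxa, hxb⟩ := hx
    obtain ⟨M', hM', hfv, he⟩ := ih hM hx (by simp [hxa, hxb, hπ])
    have hxM' : x ∉ M'.fv := by simp [hfv]
    obtain ⟨d, hd, -⟩ := exists_between (update (update t a p) b q) x (s := M'.fv) (u := ∅)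
        (by simp) hxM'
    have haM' : a ∈ M'.fv := by simp [hfv, ha, Ne.symm hxa]
    have hbM' : b ∈ M'.fv := by simp [hfv, hb, Ne.symm hxb]
    have hl : Timed S π t (.link a b M') m (n + 1) := ⟨hab, haM', hbM', p, q, hpq, hM'⟩
    have h1 : Timed S π (update t x d) (.link a b (M' ⨟ (ident n ⊠ₜ .var x))) m n := by
      refine ⟨hab, by simp [haM'], by simp [hbM'], p, q, hpq, ?_⟩
      rw [Function.update_comm hxa, Function.update_comm hxb]
      exact (hM'.update_right hxM' d).seq (timed_ident_tensor_out (by simp [hxa, hxb, hπ]) n)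
        (by simpa using hd)
    refine ⟨.link a b M', hl, by ext c; simp [hfv]; grind, (he.link ⟨hab, ha, hb, p, q, hpq, hM⟩
      h1).trans ?_⟩
    refine Eqv.extrude_seq_left (hl.update_right (x := x) (by simp [hfv]) d)
        (timed_ident_tensor_out hπ n)
      h1 ?_ (by simp [Ne.symm hxa]) (by simp [Ne.symm hxb])
    intro c hc e he'
    have h2 := hd c (sdiff_subset hc) e (by simpa using he')
    simp at he' hc
    grind

set_option maxHeartbeats 1000000 in
/-- An input variable can be moved to the beginning of a term. -/
theorem Timed.exists_advance (hM : Timed S π t M m n) (hy : y ∈ M.fv) (hπ : π y = true) :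
    ∃ M', Timed S π t M' (m + 1) n ∧ M'.fv = M.fv \ {y} ∧
      Eqv S π m n M ((ident m ⊠ₜ .var y) ⨟ M') := by
  induction M generalizing π t m n with
  | const k => simp at hy
  | zero => simp at hy
  | one => simp at hy
  | sym => simp at hy
  | var z =>
    obtain rfl : y = z := by simpa using hy
    obtain ⟨-, rfl, rfl⟩ | ⟨h, -⟩ := hM
    · refine ⟨.one, timed_one, by simp, ?_⟩
      have h1 : Timed S π t (.var y) 0 1 := timed_var_in hπ
      exact (Eqv.zero_tensor h1).symm.trans
        (Eqv.seq_ident (m := 0) (n := 1) (timed_zero.tensor h1 (by simp))).symm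
    · simp [hπ] at h
  | seq M N ihM ihN =>
    obtain ⟨k, hM, hN, hlt⟩ := hM
    have hlt : Before t M.fv N.fv := hlt
    rcases mem_union.1 hy with hy | hy
    · obtain ⟨M', hM', hfv, he⟩ := ihM hM hy hπ
      have hyN : y ∉ N.fv := disjoint_left.1 hlt.disjoint hy
      have hM'N : Before t M'.fv N.fv := hlt.subset (by simp [hfv]) subset_rfl
      have hyM' : y ∉ M'.fv := by simp [hfv]
      obtain ⟨d, -, hd⟩ := exists_between t y (s := ∅) (u := M'.fv ∪ N.fv)
      rw [before_union_right] at hd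
      refine ⟨M' ⨟ N, hM'.seq hN, by ext c; simp [hfv]; grind, ?_⟩
      exact (he.seq_left hN).trans (Eqv.seq_assoc (timed_ident_tensor_in hπ m)
        (hM'.update_right hyM' d) (hN.update_right hyN d) (by simp [hd]) (by simp [hd])
        (hM'N.update hyM' hyN))
    · obtain ⟨N', hN', hfv, he⟩ := ihN hN hy hπ
      have hyM : y ∉ M.fv := disjoint_right.1 hlt.disjoint hy
      have hMN' : Before t M.fv N'.fv := hlt.subset subset_rfl (by simp [hfv])
      have hyN' : y ∉ N'.fv := by simp [hfv]
      obtain ⟨c, hc1, hc2⟩ := exists_between t y hMN'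
      obtain ⟨d, -, hd⟩ := exists_between t y (s := ∅) (u := M.fv ∪ N'.fv)
      rw [before_union_right] at hd
      have h1 : Timed S π t (.var y) 0 1 := timed_var_in hπ
      refine ⟨(M ⊠ₜ .one) ⨟ N', (hM.tensor timed_one (by simp)).seq hN', ?_, ?_⟩
      · grind
      have hcM := hM.update_right hyM c
      have hdM := hM.update_right hyM d
      calc Eqv S π m n (M ⨟ N) (M ⨟ (ident k ⊠ₜ .var y) ⨟ N') := he.seq_right hM hlt.disjoint
        Eqv S π m n _ ((M ⨟ (ident k ⊠ₜ .var y)) ⨟ N') := (Eqv.seq_assoc hcM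
            (timed_ident_tensor_in hπ k) (hN'.update_right hyN' c) (by simp [hc1])
            (hMN'.update hyM hyN')).symm
        Eqv S π m n _ (((ident m ⊠ₜ .var y) ⨟ (M ⊠ₜ .one)) ⨟ N') := by
            refine Eqv.seq_left ?_ hN' (by simp [hyN', hMN'.disjoint])
            calc Eqv S π m (k + 1) (M ⨟ (ident k ⊠ₜ .var y))
                  ((M ⊠ₜ .zero) ⨟ (ident k ⊠ₜ .var y)) :=
                (Eqv.tensor_zero hM).symm.seq_left (timed_ident_tensor_in (t := t) hπ k)
              Eqv S π m (k + 1) _ ((M ⨟ ident k) ⊠ₜ (.zero ⨟ .var y)) :=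
                (Eqv.interchange hcM (timed_ident k) timed_zero (timed_var_in hπ)).symm
              Eqv S π m (k + 1) _ (M ⊠ₜ .var y) :=
                (Eqv.seq_ident hM).tensor (Eqv.ident_seq h1)
              Eqv S π m (k + 1) _ ((ident m ⨟ M) ⊠ₜ (.var y ⨟ .one)) :=
                (Eqv.ident_seq hM).symm.tensor (Eqv.seq_ident h1).symm
              Eqv S π m (k + 1) _ ((ident m ⊠ₜ .var y) ⨟ (M ⊠ₜ .one)) :=
                Eqv.interchange (timed_ident m) hdM (timed_var_in hπ) timed_one
        Eqv S π m n _ ((ident m ⊠ₜ .var y) ⨟ (M ⊠ₜ .one) ⨟ N') :=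
            Eqv.seq_assoc (timed_ident_tensor_in hπ m) (hdM.tensor timed_one)
              (hN'.update_right hyN' d) (by simp [hd]) (by simp [hd])
              (by simpa using hMN'.update hyM hyN')
  | tensor M N ihM ihN =>
    obtain ⟨m1, m2, n1, n2, rfl, rfl, hM, hN, hdisj⟩ := hM
    rcases mem_union.1 hy with hy | hy
    · obtain ⟨M', hM', hfv, he⟩ := ihM hM hy hπ
      have hyN : y ∉ N.fv := disjoint_left.1 hdisj hy
      have hyM' : y ∉ M'.fv := by simp [hfv]
      have hM'N : Disjoint M'.fv N.fv := hdisj.mono_left (by simp [hfv])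
      obtain ⟨d, -, hd⟩ := exists_between t y (s := ∅) (u := M'.fv ∪ N.fv)
      rw [before_union_right] at hd
      have hdM := hM'.update_right hyM' d
      have hdN := hN.update_right hyN d
      have h1 : Timed S π (update t y d) (.var y) 0 1 := timed_var_in hπ
      have h3 : Timed S π (update t y d) (ident m1 ⊠ₜ Term.symm m2 1) (m1 + m2 + 1) (m1 + 1 + m2) :=
        (timed_ident m1).tensor (timed_symm m2 1)
      refine ⟨(ident m1 ⊠ₜ Term.symm m2 1) ⨟ (M' ⊠ₜ N),
        (h3.congr (fun _ _ => rfl) (by simp)).seq (hM'.tensor hN), ?_, ?_⟩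
      · grind
      calc Eqv S π (m1 + m2) (n1 + n2) (M ⊠ₜ N) (((ident m1 ⊠ₜ .var y) ⨟ M') ⊠ₜ (ident m2 ⨟ N)) :=
            he.tensor (Eqv.ident_seq hN).symm
        Eqv S π (m1 + m2) (n1 + n2) _ (((ident m1 ⊠ₜ .var y) ⊠ₜ ident m2) ⨟ (M' ⊠ₜ N)) :=
            Eqv.interchange (timed_ident_tensor_in hπ m1) hdM (timed_ident m2) hdN
        Eqv S π (m1 + m2) (n1 + n2) _ (((ident (m1 + m2) ⊠ₜ .var y) ⨟
              (ident m1 ⊠ₜ Term.symm m2 1)) ⨟ (M' ⊠ₜ N)) := by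
            refine Eqv.seq_left ?_ (hdM.tensor hdN)
            calc Eqv S π (m1 + m2) (m1 + 1 + m2) ((ident m1 ⊠ₜ .var y) ⊠ₜ ident m2)
                  (ident m1 ⊠ₜ (.var y ⊠ₜ ident m2)) :=
                Eqv.tensor_assoc (timed_ident m1) h1 (timed_ident m2)
              Eqv S π (m1 + m2) (m1 + 1 + m2) _
                  ((ident m1 ⨟ ident m1) ⊠ₜ ((ident m2 ⊠ₜ .var y) ⨟ Term.symm m2 1)) :=
                (Eqv.ident_seq (timed_ident (t := t) m1)).symm.tensor (Eqv.var_in_tensor hπ m2)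
              Eqv S π (m1 + m2) (m1 + 1 + m2) _
                  ((ident m1 ⊠ₜ (ident m2 ⊠ₜ .var y)) ⨟ (ident m1 ⊠ₜ Term.symm m2 1)) :=
                Eqv.interchange (t := t) (timed_ident m1) (timed_ident m1)
                  (timed_ident_tensor_in hπ m2) ((timed_symm m2 1))
              Eqv S π (m1 + m2) (m1 + 1 + m2) _
                  ((ident (m1 + m2) ⊠ₜ .var y) ⨟ (ident m1 ⊠ₜ Term.symm m2 1)) := by
                refine Eqv.seq_left (k := m1 + m2 + 1) ?_ h3
                exact (Eqv.tensor_assoc (timed_ident m1) (timed_ident m2) h1).symm.trans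
                    ((Eqv.ident_tensor_ident m1 m2).tensor (Eqv.refl h1))
        Eqv S π (m1 + m2) (n1 + n2) _ _ := Eqv.seq_assoc ((timed_ident_tensor_in hπ (m1 + m2)))
            h3 (hdM.tensor hdN)
    · obtain ⟨N', hN', hfv, he⟩ := ihN hN hy hπ
      have hyM : y ∉ M.fv := disjoint_right.1 hdisj hy
      have hyN' : y ∉ N'.fv := by simp [hfv]
      have hMN' : Disjoint M.fv N'.fv := hdisj.mono_right (by simp [hfv])
      obtain ⟨d, -, hd⟩ := exists_between t y (s := ∅) (u := M.fv ∪ N'.fv)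
      rw [before_union_right] at hd
      have hdM := hM.update_right hyM d
      have hdN := hN'.update_right hyN' d
      have h1 : Timed S π (update t y d) (.var y) 0 1 := timed_var_in hπ
      refine ⟨M ⊠ₜ N', hM.tensor hN', by ext c; simp [hfv]; grind, ?_⟩
      calc Eqv S π (m1 + m2) (n1 + n2) (M ⊠ₜ N) ((ident m1 ⨟ M) ⊠ₜ ((ident m2 ⊠ₜ .var y) ⨟ N')) :=
            (Eqv.ident_seq hM).symm.tensor he
        Eqv S π (m1 + m2) (n1 + n2) _ ((ident m1 ⊠ₜ (ident m2 ⊠ₜ .var y)) ⨟ (M ⊠ₜ N')) :=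
            Eqv.interchange (timed_ident m1) hdM (timed_ident_tensor_in hπ m2) hdN
        Eqv S π (m1 + m2) (n1 + n2) _ _ := Eqv.seq_left ((Eqv.tensor_assoc (timed_ident m1)
              (timed_ident m2) h1).symm.trans
                ((Eqv.ident_tensor_ident m1 m2).tensor (Eqv.refl h1)))
              (hdM.tensor hdN)
  | link a b M ih =>
    obtain ⟨hab, ha, hb, p, q, hpq, hM⟩ := hM
    simp only [Term.fv, mem_sdiff, mem_insert, mem_singleton, not_or] at hy
    obtain ⟨hy, hya, hyb⟩ := hy
    obtain ⟨M', hM', hfv, he⟩ := ih hM hy (by simp [hya, hyb, hπ])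
    have hyM' : y ∉ M'.fv := by simp [hfv]
    obtain ⟨d, -, hd⟩ := exists_between (update (update t a p) b q) y (s := ∅) (u := M'.fv)
    have haM' : a ∈ M'.fv := by simp [hfv, ha, Ne.symm hya]
    have hbM' : b ∈ M'.fv := by simp [hfv, hb, Ne.symm hyb]
    have hl : Timed S π t (.link a b M') (m + 1) n := ⟨hab, haM', hbM', p, q, hpq, hM'⟩
    have h1 : Timed S π (update t y d) (.link a b ((ident m ⊠ₜ .var y) ⨟ M')) m n := by
      refine ⟨hab, by simp [haM'], by simp [hbM'], p, q, hpq, ?_⟩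
      rw [Function.update_comm hya, Function.update_comm hyb]
      exact (timed_ident_tensor_in (by simp [hya, hyb, hπ]) m).seq (hM'.update_right hyM' d)
    refine ⟨.link a b M', hl, by ext c; simp [hfv]; grind, (he.link ⟨hab, ha, hb, p, q, hpq, hM⟩
      h1).trans ?_⟩
    refine Eqv.extrude_seq_right (timed_ident_tensor_in hπ m)
      (hl.update_right (x := y) (by simp [hfv]) d) h1 ?_
    intro e he' c hc
    have h2 := hd e (by simpa using he') c (sdiff_subset hc)
    simp at he' hc
    grind

/-- A link between an output variable and an input variable that is used immediately afterwards is
a plain wire. -/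
theorem Eqv.link_cut (hxy : x ≠ y) (hU : Timed S π t U m (k + 1)) (hV : Timed S π t V (k + 1) n)
    (h : Before t U.fv V.fv) (hxU : x ∉ U.fv) (hxV : x ∉ V.fv) (hyU : y ∉ U.fv) (hyV : y ∉ V.fv) :
    (∃ t', Timed S π t' (.link x y ((U ⨟ (ident k ⊠ₜ .var x)) ⨟ (ident k ⊠ₜ .var y) ⨟ V)) m n) ∧
    Eqv S π m n (.link x y ((U ⨟ (ident k ⊠ₜ .var x)) ⨟ (ident k ⊠ₜ .var y) ⨟ V)) (U ⨟ V) := by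
  obtain ⟨c, hc1, hc2⟩ := exists_between t x h
  obtain ⟨d, hd1, hd2⟩ := exists_between (update t x c) y (s := U.fv ∪ {x}) (u := V.fv)
    (by simp [hc2, h.update hxU])
  rw [before_union_left] at hd1
  obtain ⟨hd1, hd3⟩ := hd1
  set π1 := update (update π x false) y true with hπ1
  set t1 := update (update t x c) y d with ht1
  have hcd : t1 x < t1 y := hd3 x (by simp) y (by simp)
  have hpU : ∀ a ∈ U.fv, π a = π1 a := by grind
  have hpV : ∀ a ∈ V.fv, π a = π1 a := by grind
  have hπx : π1 x = false := by simp [hπ1, hxy]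
  have hπy : π1 y = true := by simp [hπ1]
  have hU1 : Timed S π1 t1 U m (k + 1) :=
    ((hU.update_right hxU c).update_right hyU d).congr hpU fun _ _ => rfl
  have hV1 : Timed S π1 t1 V (k + 1) n :=
    ((hV.update_right hxV c).update_right hyV d).congr hpV fun _ _ => rfl
  have hX : Timed S π1 t1 (ident k ⊠ₜ .var x) (k + 1) k := timed_ident_tensor_out hπx k
  have hY : Timed S π1 t1 (ident k ⊠ₜ .var y) k (k + 1) := timed_ident_tensor_in hπy k
  have hUx : Before t1 U.fv {x} := hc1.update
  have hUy : Before t1 U.fv {y} := hd1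
  have hxV1 : Before t1 {x} V.fv := hc2.update
  have hyV1 : Before t1 {y} V.fv := hd2
  have hUV : Before t1 U.fv V.fv := (h.update).update
  have hxy1 : Timed S π1 t1 (.var x ⨟ .var y) 1 1 :=
    (timed_var_out hπx).seq (timed_var_in hπy)
  have hXY : Timed S π1 t1 (ident k ⊠ₜ (.var x ⨟ .var y)) (k + 1) (k + 1) :=
    (timed_ident k).tensor hxy1
  have hlxy : Timed S π1 t1 (.link x y (.var x ⨟ .var y)) 1 1 :=
    hxy1.link_of hπx hπy (by simp) (by simp) hcd
  have hlXY : Timed S π1 t1 (.link x y (ident k ⊠ₜ (.var x ⨟ .var y))) (k + 1) (k + 1) :=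
    hXY.link_of hπx hπy (by simp) (by simp) hcd
  have hXYV : Timed S π1 t1 ((ident k ⊠ₜ (.var x ⨟ .var y)) ⨟ V) (k + 1) n :=
    hXY.seq hV1
  have hlXYV : Timed S π1 t1 (.link x y ((ident k ⊠ₜ (.var x ⨟ .var y)) ⨟ V)) (k + 1) n :=
    hXYV.link_of hπx hπy (by simp) (by simp) hcd
  have hall : Timed S π1 t1 (U ⨟ (ident k ⊠ₜ (.var x ⨟ .var y)) ⨟ V) m n :=
    hU1.seq hXYV
  have hUX := hU1.seq hX
  have hYV := hY.seq hV1
  have hlhs : Timed S π1 t1 ((U ⨟ (ident k ⊠ₜ .var x)) ⨟ (ident k ⊠ₜ .var y) ⨟ V) m n :=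
    hUX.seq hYV
  have hempty : (Term.link x y (ident k ⊠ₜ (.var x ⨟ .var y)) : Term S.Const A).fv = ∅ := by
    ext; simp
  have key : Eqv S π1 m n ((U ⨟ (ident k ⊠ₜ .var x)) ⨟ (ident k ⊠ₜ .var y) ⨟ V)
      (U ⨟ (ident k ⊠ₜ (.var x ⨟ .var y)) ⨟ V) := by
    refine (Eqv.seq_assoc hU1 hX hYV).trans (Eqv.seq_right ?_ hU1 ?_)
    · refine (Eqv.seq_assoc hX hY hV1).symm.trans (Eqv.seq_left ?_ hV1 ?_)
      · exact (Eqv.interchange (timed_ident k) (timed_ident k) (timed_var_out hπx)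
          (timed_var_in hπy) (by simp) (by simp) (by simp) (by simpa using hcd)).symm.trans
              ((Eqv.ident_seq (timed_ident (t := t1) k)).tensor
            (Eqv.refl hxy1))
      · simp [hxV, hyV]
    · simp [hxU, hyU, hUV.disjoint]
  have h1 := hlhs.link_of hπx hπy (by simp) (by simp) hcd
  have h2 := hall.link_of hπx hπy (by simp) (by simp) hcd
  have hfin : Eqv S π1 m n (.link x y ((U ⨟ (ident k ⊠ₜ .var x)) ⨟ (ident k ⊠ₜ .var y) ⨟ V))
      (U ⨟ V) := by
    refine (key.link_of h1 h2 hπx hπy).trans ((Eqv.extrude_seq_right hU1 hlXYV h2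
      (hUV.subset subset_rfl (by intro a; simp; tauto))).trans (Eqv.seq_right ?_ hU1
        (hUV.disjoint.mono_right (by intro a; simp; tauto))))
    refine (Eqv.extrude_seq_left hlXY hV1 hlXYV).trans
      ((Eqv.seq_left ?_ hV1).trans (Eqv.ident_seq hV1))
    exact (Eqv.extrude_tensor_right (timed_ident k) hlxy hlXY).trans
      (((Eqv.refl (timed_ident (t := t1) k)).tensor (Eqv.link_ident)).trans
        (Eqv.ident_tensor_one k))
  have hfv : ∀ a ∈ (Term.link x y ((U ⨟ (ident k ⊠ₜ .var x)) ⨟ (ident k ⊠ₜ .var y) ⨟ V)).fv,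
      π1 a = π a := by
    intro a ha
    have h3 : a ≠ x ∧ a ≠ y := by simp_all
    simp [hπ1, h3]
  exact ⟨⟨t1, h1.congr hfv fun _ _ => rfl⟩, hfin.congr hfv⟩

/-! ### Cutting terms along time, and exchanging links -/

variable {a b : A}

set_option maxHeartbeats 1000000 in
/-- Every term is a composite of a part that happens until time `c` and a part that happens after
time `c`. -/
theorem Timed.exists_slice (hM : Timed S π t M m n) (c : ℚ) :
    ∃ k U V, Timed S π t U m k ∧ Timed S π t V k n ∧ U.fv = M.fv.filter (fun a => t a ≤ c) ∧
      V.fv = M.fv.filter (fun a => c < t a) ∧ Eqv S π m n M (U ⨟ V) := by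
  have closed : ∀ {π : A → Bool} {t : A → ℚ} {m n : ℕ} {M : Term S.Const A}, Timed S π t M m n →
      (∀ a ∈ M.fv, t a ≤ c) →
      ∃ k U V, Timed S π t U m k ∧ Timed S π t V k n ∧ U.fv = M.fv.filter (fun a => t a ≤ c) ∧
        V.fv = M.fv.filter (fun a => c < t a) ∧ Eqv S π m n M (U ⨟ V) := by
    intro π t m n M hM h
    refine ⟨n, M, ident n, hM, timed_ident n, (Finset.filter_true_of_mem h).symm, ?_,
      (Eqv.seq_ident hM).symm⟩
    rw [fv_ident, Finset.filter_false_of_mem fun a ha => (h a ha).not_gt]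
  have slice_before : ∀ {t : A → ℚ} {U V M N : Term S.Const A},
      U.fv = M.fv.filter (fun a => t a ≤ c) → V.fv = N.fv.filter (fun a => c < t a) →
      Before t U.fv V.fv := by
    intro t U V M N hU hV a ha b hb
    rw [hU] at ha
    rw [hV] at hb
    exact (mem_filter.1 ha).2.trans_lt (mem_filter.1 hb).2
  induction M generalizing π t m n with
  | const k => exact closed hM (by simp)
  | zero => exact closed hM (by simp)
  | one => exact closed hM (by simp)
  | sym => exact closed hM (by simp)
  | var x =>
    rcases le_or_gt (t x) c with h | h
    · grind
    · refine ⟨m, ident m, .var x, timed_ident m, hM, ?_, ?_, (Eqv.ident_seq hM).symm⟩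
      all_goals grind
  | seq M N ihM ihN =>
    obtain ⟨k, hM, hN, hlt⟩ := hM
    have hlt : Before t M.fv N.fv := hlt
    by_cases h : ∀ a ∈ M.fv, t a ≤ c
    · obtain ⟨j, U, V, hU, hV, hU', hV', he⟩ := ihN hN
      have hMU : Before t M.fv U.fv := hlt.subset subset_rfl (by simp [hU'])
      have hMV : Before t M.fv V.fv := hlt.subset subset_rfl (by simp [hV'])
      refine ⟨j, M ⨟ U, V, hM.seq hU, hV, ?_, ?_, (he.seq_right hM).trans
        (Eqv.seq_assoc hM hU hV).symm⟩
      · simp [hU', filter_union, Finset.filter_true_of_mem h]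
      · simp [hV', filter_union, Finset.filter_false_of_mem fun a ha => (h a ha).not_gt]
    · push Not at h
      obtain ⟨a, ha, hac⟩ := h
      have h : ∀ b ∈ N.fv, c < t b := fun b hb => hac.trans (hlt a ha b hb)
      obtain ⟨j, U, V, hU, hV, hU', hV', he⟩ := ihM hM
      have hUN : Before t U.fv N.fv := hlt.subset (by simp [hU']) subset_rfl
      have hVN : Before t V.fv N.fv := hlt.subset (by simp [hV']) subset_rfl
      refine ⟨j, U, V ⨟ N, hU, hV.seq hN, ?_, ?_, (he.seq_left hN).trans
        (Eqv.seq_assoc hU hV hN)⟩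
      · grind
      · simp [hV', filter_union, Finset.filter_true_of_mem h]
  | tensor M N ihM ihN =>
    obtain ⟨m1, m2, n1, n2, rfl, rfl, hM, hN, hdisj⟩ := hM
    obtain ⟨j, U, V, hU, hV, hU', hV', he⟩ := ihM hM
    obtain ⟨j', U', V', hU1, hV1, hU1', hV1', he'⟩ := ihN hN
    have h1 : Disjoint U.fv U'.fv := hdisj.mono (by simp [hU']) (by simp [hU1'])
    have h2 : Disjoint V.fv V'.fv := hdisj.mono (by simp [hV']) (by simp [hV1'])
    refine ⟨j + j', U ⊠ₜ U', V ⊠ₜ V', hU.tensor hU1, hV.tensor hV1, ?_, ?_,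
      (he.tensor he').trans (Eqv.interchange hU hV hU1 hV1)⟩
    · simp [hU', hU1', filter_union]
    · simp [hV', hV1', filter_union]
  | link x y M ih =>
    have hlM := hM
    obtain ⟨hxy, hx, hy, p, q, hpq, hM⟩ := hM
    obtain ⟨k, U, V, hU, hV, hU', hV', he⟩ := ih hM
    have hUV := slice_before hU' hV'
    -- away from the bound pair, the two time functions agree
    have hout : ∀ a, a ≠ x → a ≠ y → update (update t x p) y q a = t a := by simp_all
    rcases le_or_gt q c with hqc | hqc
    · have hxU : x ∈ U.fv := by simp [hU', hx, hxy, (hpq.trans_le hqc).le]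
      have hyU : y ∈ U.fv := by simp [hU', hy, hqc]
      have hxV : x ∉ V.fv := disjoint_left.1 hUV.disjoint hxU
      have hyV : y ∉ V.fv := disjoint_left.1 hUV.disjoint hyU
      have hV1 : Timed S π t V k n := hV.congr
        (fun a ha => by
          have : a ≠ x := by rintro rfl; exact hxV ha
          have : a ≠ y := by rintro rfl; exact hyV ha
          simp [*])
        (fun a ha => by
          have : a ≠ x := by rintro rfl; exact hxV ha
          have : a ≠ y := by rintro rfl; exact hyV ha
          simp [*])
      have hlU : Timed S π t (.link x y U) m k := ⟨hxy, hxU, hyU, p, q, hpq, hU⟩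
      have hlUV : Timed S π t (.link x y (U ⨟ V)) m n :=
        ⟨hxy, by simp [hxU], by simp [hyU], p, q, hpq, hU.seq hV⟩
      have hU2 : (Term.link x y U).fv = (Term.link x y M).fv.filter (fun a => t a ≤ c) := by grind
      have hV2 : V.fv = (Term.link x y M).fv.filter (fun a => c < t a) := by
        ext a
        have := hout a
        have : a = x → a ∉ V.fv := by rintro rfl; exact hxV
        grind
      exact ⟨k, _, V, hlU, hV1, hU2, hV2, (he.link hlM hlUV).trans
        (Eqv.extrude_seq_left hlU hV1 hlUV (slice_before hU2 hV2))⟩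
    rcases le_or_gt p c with hpc | hpc
    · have hxU : x ∈ U.fv := by simp [hU', hx, hxy, hpc]
      have hyV : y ∈ V.fv := by simp [hV', hy, hqc]
      have hxV : x ∉ V.fv := disjoint_left.1 hUV.disjoint hxU
      have hyU : y ∉ U.fv := disjoint_right.1 hUV.disjoint hyV
      obtain ⟨U1, hU1, hfU, heU⟩ := hU.exists_delay hxU (by simp [hxy])
      obtain ⟨V1, hV1, hfV, heV⟩ := hV.exists_advance hyV (by simp)
      have hU2 : Timed S π t U1 m (k + 1) := hU1.congr
        (fun a ha => by
          simp [hfU] at ha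
          have : a ≠ y := by rintro rfl; exact hyU ha.1
          simp [*])
        (fun a ha => by
          simp [hfU] at ha
          have : a ≠ y := by rintro rfl; exact hyU ha.1
          simp [*])
      have hV2 : Timed S π t V1 (k + 1) n := hV1.congr
        (fun a ha => by
          simp [hfV] at ha
          have : a ≠ x := by rintro rfl; exact hxV ha.1
          simp [*])
        (fun a ha => by
          simp [hfV] at ha
          have : a ≠ x := by rintro rfl; exact hxV ha.1
          simp [*])
      have hU3 : U1.fv = (Term.link x y M).fv.filter (fun a => t a ≤ c) := by
        ext a
        have := hout a
        simp [hfU, hU'] at hyU ⊢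
        grind
      have hV3 : V1.fv = (Term.link x y M).fv.filter (fun a => c < t a) := by
        ext a
        have := hout a
        simp [hfV, hV'] at hxV ⊢
        grind
      obtain ⟨⟨t', ht'⟩, hcut⟩ := Eqv.link_cut hxy hU2 hV2 (slice_before hU3 hV3) (by simp [hfU])
        (by simp [hfV, hxV]) (by simp [hfU, hyU]) (by simp [hfV])
      exact ⟨k + 1, U1, V1, hU2, hV2, hU3, hV3, ((he.trans (heU.seq heV)).link hlM
        ht').trans hcut⟩
    · have hyV : y ∈ V.fv := by simp [hV', hy, hqc]
      have hxV : x ∈ V.fv := by simp [hV', hx, hxy, hpc]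
      have hxU : x ∉ U.fv := disjoint_right.1 hUV.disjoint hxV
      have hyU : y ∉ U.fv := disjoint_right.1 hUV.disjoint hyV
      have hU1 : Timed S π t U m k := hU.congr
        (fun a ha => by
          have : a ≠ x := by rintro rfl; exact hxU ha
          have : a ≠ y := by rintro rfl; exact hyU ha
          simp [*])
        (fun a ha => by
          have : a ≠ x := by rintro rfl; exact hxU ha
          have : a ≠ y := by rintro rfl; exact hyU ha
          simp [*])
      have hlV : Timed S π t (.link x y V) k n := ⟨hxy, hxV, hyV, p, q, hpq, hV⟩
      have hlUV : Timed S π t (.link x y (U ⨟ V)) m n :=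
        ⟨hxy, by simp [hxV], by simp [hyV], p, q, hpq, hU.seq hV⟩
      have hV2 : (Term.link x y V).fv = (Term.link x y M).fv.filter (fun a => c < t a) := by grind
      have hU2 : U.fv = (Term.link x y M).fv.filter (fun a => t a ≤ c) := by
        ext a
        have := hout a
        have : a = x → a ∉ U.fv := by rintro rfl; exact hxU
        grind
      exact ⟨k, U, _, hU1, hlV, hU2, hV2, (he.link hlM hlUV).trans
        (Eqv.extrude_seq_right hU1 hlV hlUV (slice_before hU2 hV2))⟩

/-- A term with an output variable `x` before an input variable `y` is provably equal to a term in
which `y` is used immediately after `x`. -/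
theorem Timed.exists_cut (hM : Timed S π t M m n) (hx : x ∈ M.fv) (hy : y ∈ M.fv)
    (hπx : π x = false) (hπy : π y = true) (hlt : t x < t y) :
    ∃ k U V t1, Timed S π t1 U m (k + 1) ∧ Timed S π t1 V (k + 1) n ∧ Before t1 U.fv {x} ∧
      Before t1 {y} V.fv ∧ t1 x < t1 y ∧ (∀ a, a ≠ x → a ≠ y → t1 a = t a) ∧
      U.fv ∪ V.fv = M.fv \ {x, y} ∧
      Eqv S π m n M ((U ⨟ (ident k ⊠ₜ .var x)) ⨟ (ident k ⊠ₜ .var y) ⨟ V) := by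
  have hxy : x ≠ y := by rintro rfl; exact hlt.false
  obtain ⟨k, U, V, hU, hV, hU', hV', he⟩ := hM.exists_slice (t x)
  have hUV : Before t U.fv V.fv := by grind
  have hxU : x ∈ U.fv := by simp [hU', hx]
  have hyV : y ∈ V.fv := by simp [hV', hy, hlt]
  have hxV : x ∉ V.fv := disjoint_left.1 hUV.disjoint hxU
  have hyU : y ∉ U.fv := disjoint_right.1 hUV.disjoint hyV
  obtain ⟨U1, hU1, hfU, heU⟩ := hU.exists_delay hxU hπx
  obtain ⟨V1, hV1, hfV, heV⟩ := hV.exists_advance hyV hπy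
  have hxU1 : x ∉ U1.fv := by simp [hfU]
  have hyU1 : y ∉ U1.fv := by simp [hfU, hyU]
  have hxV1 : x ∉ V1.fv := by simp [hfV, hxV]
  have hyV1 : y ∉ V1.fv := by simp [hfV]
  have hUV1 : Before t U1.fv V1.fv := hUV.subset (by simp [hfU]) (by simp [hfV])
  obtain ⟨c, hc1, hc2⟩ := exists_between t x hUV1
  obtain ⟨d, hd1, hd2⟩ := exists_between (update t x c) y (s := U1.fv ∪ {x}) (u := V1.fv)
    (by simp [hc2, hUV1.update hxU1])
  rw [before_union_left] at hd1
  refine ⟨k, U1, V1, update (update t x c) y d, (hU1.update_right hxU1 c).update_right hyU1 d,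
    (hV1.update_right hxV1 c).update_right hyV1 d, hc1.update, hd2,
    by simpa using hd1.2, fun a h1 h2 => by simp [h1, h2], ?_,
    he.trans (heU.seq heV)⟩
  have h1 : U.fv ∪ V.fv = M.fv := by grind
  rw [hfU, hfV, ← h1]
  ext a
  have h1 : a = x → a ∉ V.fv := by rintro rfl; exact hxV
  have h2 : a = y → a ∉ U.fv := by rintro rfl; exact hyU
  simp
  tauto

theorem Eqv.sym_seq_out (hx : π x = false) :
    Eqv S π 2 1 (.sym ⨟ (ident 1 ⊠ₜ .var x)) (.var x ⊠ₜ ident 1) :=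
  (Eqv.var_out_tensor hx 1).symm

theorem Eqv.in_seq_sym (hy : π y = true) :
    Eqv S π 1 2 ((ident 1 ⊠ₜ .var y) ⨟ .sym) (.var y ⊠ₜ ident 1) :=
  (Eqv.var_in_tensor hy 1).symm

/-- The symmetry is an involution. Each of the two crossings is replaced by a link; between the two
links a scalar is left, which can be moved past the remaining wire. -/
theorem Eqv.sym_sym (hxy : x ≠ y := by grind) (hxa : x ≠ a := by grind) (hxb : x ≠ b := by grind)
    (hya : y ≠ a := by grind) (hyb : y ≠ b := by grind)
    (hab : a ≠ b := by grind) : Eqv S π 2 2 (.sym ⨟ .sym) (ident 2) := by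
  obtain ⟨π0, t, px, py, pa, pb, txy, tya, tab⟩ : ∃ (π0 : A → Bool) (t : A → ℚ), π0 x = false ∧
      π0 y = true ∧ π0 a = false ∧ π0 b = true ∧ t x < t y ∧ t y < t a ∧ t a < t b := by
    refine ⟨fun c => decide (c = y ∨ c = b),
      fun c => if c = x then 0 else if c = y then 1 else if c = a then 2 else 3, ?_⟩
    simp only [hxy, hxb, Ne.symm hxy, Ne.symm hxa, Ne.symm hya, hab, Ne.symm hxb, Ne.symm hyb,
      Ne.symm hab, if_true, if_false, or_false, or_true, decide_true, decide_false]
    norm_num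
  have txa := txy.trans tya
  have tyb := tya.trans tab
  have txb := txy.trans tyb
  have hyx := hxy.symm
  have hax := hxa.symm
  have hbx := hxb.symm
  have hay := hya.symm
  have hby := hyb.symm
  have hba := hab.symm
  have hX : Timed S π0 t (ident 1 ⊠ₜ .var x) 2 1 := timed_ident_tensor_out px 1
  have hY : Timed S π0 t (ident 1 ⊠ₜ .var y) 1 2 := timed_ident_tensor_in py 1
  have hA : Timed S π0 t (ident 1 ⊠ₜ .var a) 2 1 := timed_ident_tensor_out pa 1
  have hB : Timed S π0 t (ident 1 ⊠ₜ .var b) 1 2 := timed_ident_tensor_in pb 1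
  have hY' : Timed S π0 t (.var y ⊠ₜ ident 1) 1 2 :=
    (timed_var_in py).tensor (timed_ident 1)
  have hA' : Timed S π0 t (.var a ⊠ₜ ident 1) 2 1 :=
    (timed_var_out pa).tensor (timed_ident 1)
  have hI : Timed S π0 t (ident 2) 2 2 := timed_ident 2
  have hs : Timed S π0 t .sym 2 2 := timed_sym
  have hIX : Timed S π0 t (ident 2 ⨟ (ident 1 ⊠ₜ .var x)) 2 1 := hI.seq hX
  -- the first crossing, as a link
  have hl1 : Timed S π0 t (.link x y ((ident 1 ⊠ₜ .var x) ⨟ (.var y ⊠ₜ ident 1))) 2 2 :=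
    (hX.seq hY').link_of px py (by simp) (by simp) (by simp [*])
  have e1 : Eqv S π0 2 2 .sym (.link x y ((ident 1 ⊠ₜ .var x) ⨟ (.var y ⊠ₜ ident 1))) := by
    obtain ⟨⟨t', h'⟩, hc⟩ := Eqv.link_cut (π := π0) (k := 1) hxy hI hs (by simp) (by simp) (by simp)
      (by simp) (by simp)
    refine (Eqv.ident_seq hs).symm.trans (hc.symm.trans (Eqv.link_of ?_ h' hl1 px py))
    exact (Eqv.ident_seq hX).seq (Eqv.in_seq_sym py)
  -- the second crossing, as a link
  have hl2 : Timed S π0 t (.link a b ((.var a ⊠ₜ ident 1) ⨟ (ident 1 ⊠ₜ .var b))) 2 2 :=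
    (hA'.seq hB).link_of pa pb (by simp) (by simp) (by simp [*])
  have e2 : Eqv S π0 2 2 .sym (.link a b ((.var a ⊠ₜ ident 1) ⨟ (ident 1 ⊠ₜ .var b))) := by
    obtain ⟨⟨t', h'⟩, hc⟩ := Eqv.link_cut (π := π0) (k := 1) hab hs hI (by simp) (by simp) (by simp)
      (by simp) (by simp)
    refine (Eqv.seq_ident hs).symm.trans (hc.symm.trans (Eqv.link_of ?_ h' hl2 pa pb))
    exact (Eqv.sym_seq_out pa).seq (Eqv.seq_ident hB)
  have hXY' := hX.seq hY'
  have hAB' := hA'.seq hB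
  have hYA : Timed S π0 t (.var y ⨟ .var a) 0 0 :=
    (timed_var_in py).seq (timed_var_out pa)
  -- the scalar between the links moves past the wire
  have e3 : Eqv S π0 1 1 ((.var y ⊠ₜ ident 1) ⨟ (.var a ⊠ₜ ident 1))
      ((ident 1 ⊠ₜ .var y) ⨟ (ident 1 ⊠ₜ .var a)) := by
    refine (Eqv.interchange (t := t) (timed_var_in py) (timed_var_out pa) (timed_ident 1)
        (timed_ident 1)).symm.trans ?_
    refine Eqv.trans ?_ (Eqv.interchange (t := t) (timed_ident 1) (timed_ident 1) (timed_var_in py)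
      (timed_var_out pa))
    exact Eqv.scalar_tensor_comm hYA ((timed_ident (t := t) 1).seq (timed_ident 1))
  have hXYAB : Timed S π0 t (((ident 1 ⊠ₜ .var x) ⨟ (.var y ⊠ₜ ident 1)) ⨟
      ((.var a ⊠ₜ ident 1) ⨟ (ident 1 ⊠ₜ .var b))) 2 2 :=
    hXY'.seq hAB'
  have hXY := hX.seq hY
  have hXYA : Timed S π0 t (((ident 1 ⊠ₜ .var x) ⨟ (ident 1 ⊠ₜ .var y)) ⨟ (ident 1 ⊠ₜ .var a)) 2
      1 :=
    hXY.seq hA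
  have hXYAB' : Timed S π0 t ((((ident 1 ⊠ₜ .var x) ⨟ (ident 1 ⊠ₜ .var y)) ⨟
      (ident 1 ⊠ₜ .var a)) ⨟ (ident 1 ⊠ₜ .var b)) 2 2 :=
    hXYA.seq hB
  have e4 : Eqv S π0 2 2 (((ident 1 ⊠ₜ .var x) ⨟ (.var y ⊠ₜ ident 1)) ⨟
      ((.var a ⊠ₜ ident 1) ⨟ (ident 1 ⊠ₜ .var b)))
      ((((ident 1 ⊠ₜ .var x) ⨟ (ident 1 ⊠ₜ .var y)) ⨟
        (ident 1 ⊠ₜ .var a)) ⨟ (ident 1 ⊠ₜ .var b)) := by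
    refine (Eqv.seq_assoc hXY' hA' hB).symm.trans ?_
    refine Eqv.seq_left ?_ hB
    refine (Eqv.seq_assoc hX hY' hA').trans ?_
    refine Eqv.trans ?_ (Eqv.seq_assoc hX hY hA).symm
    exact Eqv.seq_right e3 hX
  have hlAB : ∀ {M : Term S.Const A}, Timed S π0 t M 2 2 → a ∈ M.fv → b ∈ M.fv →
      Timed S π0 t (.link a b M) 2 2 :=
    fun h h1 h2 => h.link_of pa pb h1 h2 (by simp [*])
  have hlXY : ∀ {M : Term S.Const A}, Timed S π0 t M 2 2 → x ∈ M.fv → y ∈ M.fv →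
      Timed S π0 t (.link x y M) 2 2 :=
    fun h h1 h2 => h.link_of px py h1 h2 (by simp [*])
  have hfin : Eqv S π0 2 2 (.sym ⨟ .sym) (ident 2) := by
    have hl3 : Timed S π0 t (.link x y (((ident 1 ⊠ₜ .var x) ⨟ (.var y ⊠ₜ ident 1)) ⨟
        .link a b ((.var a ⊠ₜ ident 1) ⨟ (ident 1 ⊠ₜ .var b)))) 2 2 :=
      hlXY (hXY'.seq hl2 (by simp [*])) (by simp) (by simp)
    have hl4 := hlXY (hlAB hXYAB (by simp) (by simp)) (by simp [*]) (by simp [*])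
    have hl5 := hlXY (hlAB hXYAB' (by simp) (by simp)) (by simp [*]) (by simp [*])
    refine (e1.seq e2).trans ?_
    refine (Eqv.extrude_seq_left hl1 hl2 hl3 (by simp [*]) (by simp [*]) (by simp [*])).symm.trans
        ?_
    refine (Eqv.link_of (Eqv.extrude_seq_right hXY' hl2 (hlAB hXYAB (by simp) (by simp))
        (by simp [*])
        (by simp [*]) (by simp [*])).symm
        hl3 hl4 px py).trans ?_
    refine (Eqv.link_of (Eqv.link_of e4 (hlAB hXYAB (by simp) (by simp))
      (hlAB hXYAB' (by simp) (by simp)) pa pb) hl4 hl5 px py).trans ?_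
    have hXYI : Timed S π0 t (((ident 1 ⊠ₜ .var x) ⨟ (ident 1 ⊠ₜ .var y)) ⨟ ident 2) 2 2 :=
      hXY.seq hI
    -- both links now join adjacent names
    obtain ⟨⟨t', h'⟩, hc⟩ := Eqv.link_cut (π := π0) (k := 1) hab hXY hI (by simp)
      (by simp [*]) (by simp) (by simp [*]) (by simp)
    refine (Eqv.link_of (Eqv.trans
        (Eqv.link_of (Eqv.seq_right (Eqv.seq_ident hB).symm hXYA (by simp [*]))
        (hlAB hXYAB' (by simp) (by simp)) h' pa pb) hc) hl5
        (hlXY hXYI (by simp) (by simp)) px py).trans ?_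
    obtain ⟨⟨t', h'⟩, hc⟩ := Eqv.link_cut (π := π0) (k := 1) hxy hI hI (by simp) (by simp) (by simp)
      (by simp) (by simp)
    refine Eqv.trans ?_ (hc.trans (Eqv.ident_seq hI))
    refine Eqv.link_of ?_ (hlXY hXYI (by simp) (by simp)) h' px py
    exact (Eqv.seq_ident hXY).trans ((Eqv.ident_seq hX).symm.seq (Eqv.seq_ident hY).symm)
  exact hfin.congr (by simp)

/-- The two ways of moving a wire past an output variable. -/
theorem Eqv.ident_tensor_out_out (hx : π x = false) (ha : π a = false) (hxa : x ≠ a) (k : ℕ) :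
    Eqv S π (k + 2) k ((ident (k + 1) ⊠ₜ .var a) ⨟ (ident k ⊠ₜ .var x))
      ((ident k ⊠ₜ .sym) ⨟ (ident (k + 1) ⊠ₜ .var x) ⨟ (ident k ⊠ₜ .var a)) := by
  obtain ⟨t, tax, txa⟩ : ∃ t : A → ℚ × ℚ, (t a).1 < (t x).1 ∧ (t x).2 < (t a).2 :=
    ⟨fun c => if c = a then (0, 1) else (1, 0), by simp [hxa], by simp [hxa]⟩
  set t1 : A → ℚ := fun c => (t c).1
  set t2 : A → ℚ := fun c => (t c).2
  have hax := hxa.symm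
  have hi : ∀ {t} (j : ℕ), Timed S π t (ident j) j j := fun j => timed_ident j
  have vx : ∀ {t}, Timed S π t (.var x) 1 0 := timed_var_out hx
  have va : ∀ {t}, Timed S π t (.var a) 1 0 := timed_var_out ha
  have hA : ∀ {t} (j : ℕ), Timed S π t (ident j ⊠ₜ .var a) (j + 1) j := timed_ident_tensor_out ha
  have hX : ∀ {t} (j : ℕ), Timed S π t (ident j ⊠ₜ .var x) (j + 1) j := timed_ident_tensor_out hx
  have hks : Timed S π t2 (ident k ⊠ₜ .sym) (k + 2) (k + 2) := (hi k).tensor timed_sym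
  have hxa' : Timed S π t2 (.var x ⊠ₜ .var a) 2 0 := vx.tensor va
  -- both sides equal `ident k ⊠ₜ x ⊠ₜ a`
  have e1 : Eqv S π (k + 2) k ((ident (k + 1) ⊠ₜ .var a) ⨟ (ident k ⊠ₜ .var x))
      (ident k ⊠ₜ (.var x ⊠ₜ .var a)) := by
    have h1 : Eqv S π (k + 2) k ((ident (k + 1) ⊠ₜ .var a) ⨟ ((ident k ⊠ₜ .var x) ⊠ₜ .zero))
        ((ident k ⊠ₜ .var x) ⊠ₜ .var a) :=
      (Eqv.interchange (t := t1) (hi (k + 1)) (hX k) va timed_zero (by simp) (by simp)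
        (by simpa using tax)).symm.trans
        ((Eqv.ident_seq (hX (t := t1) k)).tensor (Eqv.seq_ident (va (t := t1))))
    exact ((Eqv.tensor_zero (hX (t := t1) k)).symm.seq_right (hA (t := t1) (k + 1))).trans
        (h1.trans (Eqv.tensor_assoc (t := t1) (hi k) vx va))
  have e2 : Eqv S π (k + 2) k ((ident (k + 1) ⊠ₜ .var x) ⨟ (ident k ⊠ₜ .var a))
      (ident k ⊠ₜ (.var a ⊠ₜ .var x)) := by
    have h1 : Eqv S π (k + 2) k ((ident (k + 1) ⊠ₜ .var x) ⨟ ((ident k ⊠ₜ .var a) ⊠ₜ .zero))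
        ((ident k ⊠ₜ .var a) ⊠ₜ .var x) :=
      (Eqv.interchange (t := t2) (hi (k + 1)) (hA k) vx timed_zero (by simp) (by simp)
        (by simpa using txa)).symm.trans
        ((Eqv.ident_seq (hA (t := t2) k)).tensor (Eqv.seq_ident (vx (t := t2))))
    exact ((Eqv.tensor_zero (hA (t := t2) k)).symm.seq_right (hX (t := t2) (k + 1))).trans
        (h1.trans (Eqv.tensor_assoc (t := t2) (hi k) va vx))
  have e3 : Eqv S π 2 0 (.var x ⊠ₜ .var a) (.sym ⨟ (.var a ⊠ₜ .var x)) := by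
    refine (Eqv.seq_ident hxa').symm.trans ?_
    exact Eqv.symmetry (vx (t := t2)) (va (t := t2))
  refine e1.trans (((Eqv.ident_seq (hi (t := t2) k)).symm.tensor e3).trans ?_)
  refine (Eqv.interchange (t := t2) (hi k) (hi k) timed_sym (va.tensor vx)).trans ?_
  exact e2.symm.seq_right hks

theorem Eqv.ident_tensor_in_in (hy : π y = true) (hb : π b = true) (hyb : y ≠ b) (k : ℕ) :
    Eqv S π k (k + 2) ((ident k ⊠ₜ .var y) ⨟ (ident (k + 1) ⊠ₜ .var b))
      (((ident k ⊠ₜ .var b) ⨟ (ident (k + 1) ⊠ₜ .var y)) ⨟ (ident k ⊠ₜ .sym)) := by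
  obtain ⟨t, tyb, tby⟩ : ∃ t : A → ℚ × ℚ, (t y).1 < (t b).1 ∧ (t b).2 < (t y).2 :=
    ⟨fun c => if c = y then (0, 1) else (1, 0), by simp [hyb.symm], by simp [hyb.symm]⟩
  set t1 : A → ℚ := fun c => (t c).1
  set t2 : A → ℚ := fun c => (t c).2
  have hby := hyb.symm
  have hi : ∀ {t} (j : ℕ), Timed S π t (ident j) j j := fun j => timed_ident j
  have vy : ∀ {t}, Timed S π t (.var y) 0 1 := timed_var_in hy
  have vb : ∀ {t}, Timed S π t (.var b) 0 1 := timed_var_in hb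
  have hY : ∀ {t} (j : ℕ), Timed S π t (ident j ⊠ₜ .var y) j (j + 1) := timed_ident_tensor_in hy
  have hB : ∀ {t} (j : ℕ), Timed S π t (ident j ⊠ₜ .var b) j (j + 1) := timed_ident_tensor_in hb
  have hks : Timed S π t2 (ident k ⊠ₜ .sym) (k + 2) (k + 2) := (hi k).tensor timed_sym
  have hyb' : Timed S π t2 (.var y ⊠ₜ .var b) 0 2 := vy.tensor vb
  have e1 : Eqv S π k (k + 2) ((ident k ⊠ₜ .var y) ⨟ (ident (k + 1) ⊠ₜ .var b))
      (ident k ⊠ₜ (.var y ⊠ₜ .var b)) := by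
    have h1 : Eqv S π k (k + 2) (((ident k ⊠ₜ .var y) ⊠ₜ .zero) ⨟ (ident (k + 1) ⊠ₜ .var b))
        ((ident k ⊠ₜ .var y) ⊠ₜ .var b) :=
      (Eqv.interchange (t := t1) (hY k) (hi (k + 1)) timed_zero vb (by simp)
        (by simpa using tyb)).symm.trans
        ((Eqv.seq_ident (hY (t := t1) k)).tensor (Eqv.ident_seq (vb (t := t1))))
    exact ((Eqv.tensor_zero (hY (t := t1) k)).symm.seq_left (hB (t := t1) (k + 1))).trans
        (h1.trans (Eqv.tensor_assoc (t := t1) (hi k) vy vb))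
  have e2 : Eqv S π k (k + 2) ((ident k ⊠ₜ .var b) ⨟ (ident (k + 1) ⊠ₜ .var y))
      (ident k ⊠ₜ (.var b ⊠ₜ .var y)) := by
    have h1 : Eqv S π k (k + 2) (((ident k ⊠ₜ .var b) ⊠ₜ .zero) ⨟ (ident (k + 1) ⊠ₜ .var y))
        ((ident k ⊠ₜ .var b) ⊠ₜ .var y) :=
      (Eqv.interchange (t := t2) (hB k) (hi (k + 1)) timed_zero vy (by simp)
        (by simpa using tby)).symm.trans
        ((Eqv.seq_ident (hB (t := t2) k)).tensor (Eqv.ident_seq (vy (t := t2))))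
    exact ((Eqv.tensor_zero (hB (t := t2) k)).symm.seq_left (hY (t := t2) (k + 1))).trans
        (h1.trans (Eqv.tensor_assoc (t := t2) (hi k) vb vy))
  have e3 : Eqv S π 0 2 (.var y ⊠ₜ .var b) ((.var b ⊠ₜ .var y) ⨟ .sym) := by
    refine (Eqv.ident_seq hyb').symm.trans ?_
    exact (Eqv.symmetry (vb (t := t2)) (vy (t := t2))).symm
  refine e1.trans (((Eqv.seq_ident (hi (t := t2) k)).symm.tensor e3).trans ?_)
  refine (Eqv.interchange (t := t2) (hi k) (hi k) (vb.tensor vy) timed_sym).trans ?_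
  exact e2.symm.seq_left hks

theorem Before.trans_singleton {s u : Finset A} (h1 : Before t s {x}) (h2 : Before t {x} u) :
    Before t s u :=
  fun a ha b hb => (h1 a ha x (by simp)).trans (h2 x (by simp) b hb)

set_option maxHeartbeats 1000000 in
/-- The case of `Eqv.link_comm` in which the two wires overlap in time. -/
theorem Eqv.link_comm_overlap (hU : Timed S π t U m (k + 2)) (hV : Timed S π t V (k + 2) n)
    (px : π x = false) (py : π y = true) (pa : π a = false) (pb : π b = true)
    (hUx : Before t U.fv {x}) (txa : t x < t a) (tab : t a < t b) (tby : t b < t y)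
    (hyV : Before t {y} V.fv) :
    (∃ t', Timed S π t' (.link x y (.link a b ((U ⨟ (ident (k + 1) ⊠ₜ .var a) ⨟ (ident k ⊠ₜ .var x))
        ⨟
      ((ident k ⊠ₜ .var y) ⨟ (ident (k + 1) ⊠ₜ .var b)) ⨟ V))) m n) ∧
    Eqv S π m n (.link x y (.link a b ((U ⨟ (ident (k + 1) ⊠ₜ .var a) ⨟ (ident k ⊠ₜ .var x)) ⨟
      ((ident k ⊠ₜ .var y) ⨟ (ident (k + 1) ⊠ₜ .var b)) ⨟ V))) (U ⨟ V) := by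
  have txb := txa.trans tab
  have tay := tab.trans tby
  have txy := txa.trans tay
  have hxa : x ≠ a := fun h => by simp [h] at txa
  have hab : a ≠ b := fun h => by simp [h] at tab
  have hby : b ≠ y := fun h => by simp [h] at tby
  have hxb : x ≠ b := fun h => by simp [h] at txb
  have hay : a ≠ y := fun h => by simp [h] at tay
  have hxy : x ≠ y := fun h => by simp [h] at txy
  have hUa := hUx.trans_singleton (before_singleton.2 txa)
  have hUb := hUx.trans_singleton (before_singleton.2 txb)
  have hUy := hUx.trans_singleton (before_singleton.2 txy)
  have hxV := (before_singleton.2 txy).trans_singleton hyV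
  have haV := (before_singleton.2 tay).trans_singleton hyV
  have hbV := (before_singleton.2 tby).trans_singleton hyV
  have hUV := hUx.trans_singleton hxV
  have hxU : x ∉ U.fv := fun h => by simpa using hUx.disjoint.mono_left (singleton_subset_iff.2 h)
  have haU : a ∉ U.fv := fun h => by simpa using hUa.disjoint.mono_left (singleton_subset_iff.2 h)
  have hbU : b ∉ U.fv := fun h => by simpa using hUb.disjoint.mono_left (singleton_subset_iff.2 h)
  have hyU : y ∉ U.fv := fun h => by simpa using hUy.disjoint.mono_left (singleton_subset_iff.2 h)
  have hxV' : x ∉ V.fv := by simpa using hxV.disjoint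
  have haV' : a ∉ V.fv := by simpa using haV.disjoint
  have hbV' : b ∉ V.fv := by simpa using hbV.disjoint
  have hyV' : y ∉ V.fv := by simpa using hyV.disjoint
  have hks : Timed S π t (ident k ⊠ₜ .sym) (k + 2) (k + 2) :=
    (timed_ident k).tensor timed_sym
  have hX := timed_ident_tensor_out (S := S) (t := t) px (k + 1)
  have hA := timed_ident_tensor_out (S := S) (t := t) pa k
  have hY := timed_ident_tensor_in (S := S) (t := t) py (k + 1)
  have hB := timed_ident_tensor_in (S := S) (t := t) pb k
  have hUs := hU.seq hks
  have hsV := hks.seq hV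
  have hW := hUs.seq hX
  have hW' := hY.seq hsV
  have hWA := hW.seq hA
  have hBW := hB.seq hW'
  have hXA := hX.seq hA
  have hBY := hB.seq hY
  have hL : Timed S π t (U ⨟ (ident k ⊠ₜ .sym) ⨟ (ident (k + 1) ⊠ₜ .var x) ⨟ (ident k ⊠ₜ .var a)) m
      k :=
    hU.seq (hks.seq hXA)
  have hR : Timed S π t ((((ident k ⊠ₜ .var b) ⨟ (ident (k + 1) ⊠ₜ .var y)) ⨟ (ident k ⊠ₜ .sym)) ⨟
      V) k n :=
    (hBY.seq hks).seq hV
  have e1 : Eqv S π m k (U ⨟ (ident (k + 1) ⊠ₜ .var a) ⨟ (ident k ⊠ₜ .var x))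
      (((U ⨟ (ident k ⊠ₜ .sym)) ⨟ (ident (k + 1) ⊠ₜ .var x)) ⨟ (ident k ⊠ₜ .var a)) := by
    refine (Eqv.seq_right (Eqv.ident_tensor_out_out px pa hxa k) hU).trans ?_
    refine (Eqv.seq_assoc hU hks hXA).symm.trans ?_
    exact (Eqv.seq_assoc hUs hX hA).symm
  have e2 : Eqv S π k n (((ident k ⊠ₜ .var y) ⨟ (ident (k + 1) ⊠ₜ .var b)) ⨟ V)
      ((ident k ⊠ₜ .var b) ⨟ (ident (k + 1) ⊠ₜ .var y) ⨟ (ident k ⊠ₜ .sym) ⨟ V) := by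
    refine (Eqv.seq_left (Eqv.ident_tensor_in_in py pb hby.symm k) hV).trans ?_
    refine (Eqv.seq_assoc hBY hks hV).trans ?_
    exact Eqv.seq_assoc hB hY hsV
  -- a schedule for the left-hand side
  set τ : A → ℚ := fun c => if c = a then t x else if c = x then t a else if c = b then t y else
    if c = y then t b else t c
  have τa : τ a = t x := by simp [τ]
  have τx : τ x = t a := by simp [τ, hxa]
  have τb : τ b = t y := by simp [τ, hab.symm, hxb.symm]
  have τy : τ y = t b := by simp [τ, hay.symm, hxy.symm, hby.symm]
  have τU : ∀ c ∈ U.fv, t c = τ c := by grind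
  have τV : ∀ c ∈ V.fv, t c = τ c := by grind
  clear_value τ
  have hlhs : Timed S π τ ((U ⨟ (ident (k + 1) ⊠ₜ .var a) ⨟ (ident k ⊠ₜ .var x)) ⨟
      ((ident k ⊠ₜ .var y) ⨟ (ident (k + 1) ⊠ₜ .var b)) ⨟ V) m n := by
    have hU' := hU.congr (fun _ _ => rfl) τU
    have hV' := hV.congr (fun _ _ => rfl) τV
    have b1 : ∀ {c z}, τ c = t z → Before t U.fv {z} → Before τ U.fv {c} := by grind
    have b2 : ∀ {c z}, τ c = t z → Before t {z} V.fv → Before τ {c} V.fv := by grind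
    have b3 : Before τ U.fv V.fv := by grind
    have c1 := b1 τa hUx
    have c2 := b1 τx hUa
    have c3 := b1 τb hUy
    have c4 := b1 τy hUb
    have c5 := b2 τa hxV
    have c6 := b2 τx haV
    have c7 := b2 τb hyV
    have c8 := b2 τy hbV
    exact (hU'.seq ((timed_ident_tensor_out pa (k + 1)).seq (timed_ident_tensor_out px k))).seq
        (((timed_ident_tensor_in py k).seq
        (timed_ident_tensor_in pb (k + 1))).seq hV') (by simp [*])
  have hl1 := hlhs.link_of pa pb (by simp) (by simp) (by rw [τa, τb]; exact txy)
  have hl2 := hl1.link_of px py (by simp [*]) (by simp [hby.symm, hay.symm])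
      (by rw [τx, τy]; exact tab)
  refine ⟨⟨τ, hl2⟩, ?_⟩
  obtain ⟨⟨t1, h₁⟩, c₁⟩ := Eqv.link_cut (π := π) (k := k) hab hW hW' (by simp [*])
    (by simp [*, hxa.symm]) (by simp [*]) (by simp [*, hxb.symm]) (by simp [*])
  obtain ⟨⟨t2, h₂⟩, c₂⟩ := Eqv.link_cut (π := π) (k := k + 1) hxy hUs hsV (by simp [*])
    (by simp [*]) (by simp [*]) (by simp [*]) (by simp [*])
  refine (Eqv.link_of ((Eqv.link_of (e1.seq e2 ?_) hl1 h₁ pa pb).trans c₁) hl2 h₂ px py).trans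
    (c₂.trans ?_)
  · simp [*, hUV.disjoint, hay.symm, hxy.symm, hab.symm, hxb.symm]
  refine (Eqv.seq_assoc hU hks hsV).trans
    (Eqv.seq_right ?_ hU (by simp [hUV.disjoint]))
  refine (Eqv.seq_assoc hks hks hV).symm.trans
    ((Eqv.seq_left ?_ hV).trans (Eqv.ident_seq hV))
  exact (Eqv.interchange (t := t) (timed_ident k) (timed_ident k) timed_sym timed_sym).symm.trans
    (((Eqv.ident_seq (timed_ident (t := t) k)).tensor (Eqv.sym_sym hxy hxa hxb hay.symm
        hby.symm)).trans (Eqv.ident_tensor_ident k 2))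

set_option maxHeartbeats 600000 in
/-- Links commute. The first wire is cut, and the second wire lies on one side of the cut, or
passes it. -/
theorem Eqv.link_comm (hM : Timed S π t M m n) (px : π x = false) (py : π y = true)
    (pa : π a = false) (pb : π b = true) (hx : x ∈ M.fv) (hy : y ∈ M.fv) (ha : a ∈ M.fv)
    (hb : b ∈ M.fv) (txy : t x < t y) (tab : t a < t b) (hxa : x ≠ a) (hyb : y ≠ b) :
    Eqv S π m n (.link x y (.link a b M)) (.link a b (.link x y M)) := by
  have hxy : x ≠ y := by rintro rfl; simp [px] at py
  have hxb : x ≠ b := by rintro rfl; simp [px] at pb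
  have hay : a ≠ y := by rintro rfl; simp [pa] at py
  have hab : a ≠ b := by rintro rfl; simp [pa] at pb
  have hya := hay.symm
  have hax := hxa.symm
  have hby := hyb.symm
  have hbx := hxb.symm
  obtain ⟨k, U, V, t1, hU, hV, hUx, hyV, txy1, ht1, hfv, he⟩ := hM.exists_cut hx hy px py txy
  have tab1 : t1 a < t1 b := by rwa [ht1 a hax hay, ht1 b hbx hby]
  have hUy := hUx.trans_singleton (before_singleton.2 txy1)
  have hxV := (before_singleton.2 txy1).trans_singleton hyV
  have hUV := hUx.trans_singleton hxV
  have hxU : x ∉ U.fv := fun h => by simpa using hUx.disjoint.mono_left (singleton_subset_iff.2 h)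
  have hyU : y ∉ U.fv := fun h => by simpa using hUy.disjoint.mono_left (singleton_subset_iff.2 h)
  have hxV' : x ∉ V.fv := by simpa using hxV.disjoint
  have hyV' : y ∉ V.fv := by simpa using hyV.disjoint
  have hX := timed_ident_tensor_out (S := S) (t := t1) px k
  have hY := timed_ident_tensor_in (S := S) (t := t1) py k
  have hUX := hU.seq hX
  have hYV := hY.seq hV
  have hP := hUX.seq hYV
  have hUVt := hU.seq hV
  obtain ⟨-, hc⟩ := Eqv.link_cut (π := π) (k := k) hxy hU hV hUV hxU hxV' hyU hyV'
  have haUV : a ∈ U.fv ∨ a ∈ V.fv := by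
    rw [← mem_union, hfv]; simp [*]
  have hbUV : b ∈ U.fv ∨ b ∈ V.fv := by
    rw [← mem_union, hfv]; simp [*]
  have l1 := hM.link_of pa pb ha hb tab
  have l2 := hM.link_of px py hx hy txy
  have l3 := l1.link_of px py (by simp [*]) (by simp [*]) txy
  have l4 := l2.link_of pa pb (by simp [*]) (by simp [*]) tab
  have aP : a ∈ ((U ⨟ (ident k ⊠ₜ .var x)) ⨟ (ident k ⊠ₜ .var y) ⨟ V).fv := by simp; tauto
  have bP : b ∈ ((U ⨟ (ident k ⊠ₜ .var x)) ⨟ (ident k ⊠ₜ .var y) ⨟ V).fv := by simp; tauto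
  have q1 := hP.link_of pa pb aP bP tab1
  have q2 := hP.link_of px py (by simp) (by simp) txy1
  have q3 := q1.link_of px py (by simp [*]) (by simp [*]) txy1
  have q5 := hUVt.link_of pa pb (by simpa using haUV) (by simpa using hbUV) tab1
  have step1 := Eqv.link_of (Eqv.link_of he l1 q1 pa pb) l3 q3 px py
  have step2 := (Eqv.link_of ((Eqv.link_of he l2 q2 px py).trans hc) l4 q5 pa pb).symm
  refine step1.trans (Eqv.trans ?_ step2)
  rcases haUV with haU | haV
  · have haV : a ∉ V.fv := disjoint_left.1 hUV.disjoint haU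
    rcases hbUV with hbU | hbV
    · -- the wire `ab` lies before the cut
      have hbV : b ∉ V.fv := disjoint_left.1 hUV.disjoint hbU
      have r1 := hU.link_of pa pb haU hbU tab1
      have r2 := hUX.link_of pa pb (by simp [haU]) (by simp [hbU]) tab1
      have hsub : (Term.link a b U).fv ⊆ U.fv := sdiff_subset
      obtain ⟨⟨t2, h2⟩, c2⟩ := Eqv.link_cut (π := π) (k := k) hxy r1 hV (hUV.subset hsub subset_rfl)
        (fun h => hxU (hsub h)) hxV' (fun h => hyU (hsub h)) hyV'
      refine (Eqv.link_of ?_ q3 h2 px py).trans (c2.trans ?_)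
      · refine (Eqv.extrude_seq_left r2 hYV q1 ?_).trans
          (Eqv.seq_left (Eqv.extrude_seq_left r1 hX r2 ?_ (by simp [*])) hYV ?_)
        · exact Before.subset (s := U.fv ∪ {x}) (u := {y} ∪ V.fv) (by simp [*])
            (by intro c; simp; tauto) (by simp)
        · exact hUx.subset hsub (by simp)
        · exact Finset.disjoint_of_subset_left (u := U.fv ∪ {x}) (by intro c; simp; tauto)
            (by simp [*, hUV.disjoint, hxy.symm])
      · exact (Eqv.extrude_seq_left r1 hV q5 (hUV.subset hsub subset_rfl) haV hbV).symm
    · -- the wire `ab` passes the cut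
      have hbU : b ∉ U.fv := disjoint_right.1 hUV.disjoint hbV
      obtain ⟨U', hU', hfU, eU⟩ := hU.exists_delay haU pa
      obtain ⟨V', hV', hfV, eV⟩ := hV.exists_advance hbV pb
      have hUs : U'.fv ⊆ U.fv := by rw [hfU]; exact sdiff_subset
      have hVs : V'.fv ⊆ V.fv := by rw [hfV]; exact sdiff_subset
      have tax : t1 a < t1 x := hUx a haU x (by simp)
      have tyb : t1 y < t1 b := hyV y (by simp) b hbV
      have haU' : a ∉ U'.fv := by simp [hfU]
      have hbV'' : b ∉ V'.fv := by simp [hfV]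
      have haV'' : a ∉ V'.fv := fun h => haV (hVs h)
      have hbU'' : b ∉ U'.fv := fun h => hbU (hUs h)
      -- the end points of the wire `ab` are moved next to the cut
      obtain ⟨p, hp1, hp2⟩ := _root_.exists_between txy1
      obtain ⟨q, hq1, hq2⟩ := _root_.exists_between hp2
      set τ := update (update t1 a p) b q with hτ
      have τa : τ a = p := by simp [τ, hab]
      have τb : τ b = q := by simp [τ]
      have τc : ∀ c, c ≠ a → c ≠ b → τ c = t1 c := fun c h h' => by simp [τ, h, h']
      obtain ⟨⟨t2, h2⟩, c2⟩ := Eqv.link_comm_overlap (t := τ) (k := k)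
        ((hU'.update_right haU' p).update_right hbU'' q)
        ((hV'.update_right haV'' p).update_right hbV'' q) px py pa pb
        (((hUx.subset hUs subset_rfl).update).update)
        (by rw [τa, τc x hxa hxb]; exact hp1) (by rw [τa, τb]; exact hq1)
        (by rw [τb, τc y hya hyb]; exact hq2)
        (((hyV.subset subset_rfl hVs).update).update)
      have hA := timed_ident_tensor_out (S := S) (t := t1) pa (k + 1)
      have hB := timed_ident_tensor_in (S := S) (t := t1) pb (k + 1)
      have hU'a : Disjoint U'.fv {a} := by simpa using haU'
      obtain ⟨c, hc1, hc2⟩ := exists_between t1 a (s := U'.fv) (u := {x})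
          (hUx.subset hUs subset_rfl)
      obtain ⟨d, hd1, hd2⟩ := exists_between t1 b (s := {y}) (u := V'.fv)
          (hyV.subset subset_rfl hVs)
      have eL : Eqv S π m k (U ⨟ (ident k ⊠ₜ .var x))
          (U' ⨟ (ident (k + 1) ⊠ₜ .var a) ⨟ (ident k ⊠ₜ .var x)) :=
        (eU.seq_left hX (by simpa using hxU)).trans (Eqv.seq_assoc (hU'.update_right haU' c)
          (timed_ident_tensor_out pa (k + 1)) (timed_ident_tensor_out px k) (by simpa using hc1)
          (by simpa using (hUx.subset hUs subset_rfl).update haU' (by simp [hax])))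
      have eR : Eqv S π k n ((ident k ⊠ₜ .var y) ⨟ V)
          (((ident k ⊠ₜ .var y) ⨟ (ident (k + 1) ⊠ₜ .var b)) ⨟ V') :=
        (eV.seq_right hY).trans (Eqv.seq_assoc
          (timed_ident_tensor_in py k) (timed_ident_tensor_in pb (k + 1))
          (hV'.update_right hbV'' d) (by simpa using hd1)
          (by simpa using (hyV.subset subset_rfl hVs).update (by simp [hby]) hbV'')).symm
      obtain ⟨-, hxl, hyl, p', q', hpq', hin⟩ := h2
      obtain ⟨t3, h3⟩ : ∃ t3, Timed S π t3 (.link a b ((U' ⨟ (ident (k + 1) ⊠ₜ .var a) ⨟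
          (ident k ⊠ₜ .var x)) ⨟ ((ident k ⊠ₜ .var y) ⨟ (ident (k + 1) ⊠ₜ .var b)) ⨟ V')) m n := by
        rw [← px, ← py] at hin
        simp only [Function.update_eq_self] at hin
        exact ⟨_, hin⟩
      have h2' : Timed S π t2 (.link x y (.link a b ((U' ⨟ (ident (k + 1) ⊠ₜ .var a) ⨟
          (ident k ⊠ₜ .var x)) ⨟ ((ident k ⊠ₜ .var y) ⨟ (ident (k + 1) ⊠ₜ .var b)) ⨟ V'))) m n :=
        ⟨hxy, hxl, hyl, p', q', hpq', hin⟩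
      obtain ⟨⟨t4, h4⟩, c4⟩ := Eqv.link_cut (π := π) (k := k + 1) hab hU' hV'
        (hUV.subset hUs hVs) haU' haV'' hbU'' hbV''
      refine (Eqv.link_of (Eqv.link_of (eL.seq eR ?_) q1 h3 pa pb) q3 h2' px py).trans (c2.trans ?_)
      · simp [*, hUV.disjoint, hxy.symm]
      exact c4.symm.trans (Eqv.link_of (eU.symm.seq eV.symm (by
        rw [← eU.1, ← eV.1]; exact hUV.disjoint)) h4 q5 pa pb)
  · have haU : a ∉ U.fv := disjoint_right.1 hUV.disjoint haV
    rcases hbUV with hbU | hbV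
    · exact absurd (hUV b hbU a haV) tab1.not_gt
    · -- the wire `ab` lies after the cut
      have hbU : b ∉ U.fv := disjoint_right.1 hUV.disjoint hbV
      have r1 := hV.link_of pa pb haV hbV tab1
      have r2 := hYV.link_of pa pb (by simp [haV]) (by simp [hbV]) tab1
      have hsub : (Term.link a b V).fv ⊆ V.fv := sdiff_subset
      obtain ⟨⟨t2, h2⟩, c2⟩ := Eqv.link_cut (π := π) (k := k) hxy hU r1 (hUV.subset subset_rfl hsub)
        hxU (fun h => hxV' (hsub h)) hyU (fun h => hyV' (hsub h))
      refine (Eqv.link_of ?_ q3 h2 px py).trans (c2.trans ?_)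
      · refine (Eqv.extrude_seq_right hUX r2 q1 ?_).trans
          (Eqv.seq_right (Eqv.extrude_seq_right hY r1 r2 ?_) hUX ?_)
        · exact Before.subset (s := U.fv ∪ {x}) (u := {y} ∪ V.fv) (by simp [*])
            (by simp) (by intro c; simp; tauto)
        · exact hyV.subset (by simp) hsub
        · exact Finset.disjoint_of_subset_right (u := {y} ∪ V.fv) (by intro c; simp; tauto)
            (by simp [*, hUV.disjoint, hxy.symm])
      · exact (Eqv.extrude_seq_right hU r1 q5 (hUV.subset subset_rfl hsub)).symm

/-! ### Families of variables and of links -/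

variable {Q : Term S.Const A} {L L' : List (A × A)}

/-- The tensor product of a list of variables. -/
def vars {K : Type u} : List A → Term K A
  | [] => .zero
  | x :: l => .var x ⊠ₜ vars l

@[simp, grind =] theorem fv_vars {K : Type u} (l : List A) : (vars l : Term K A).fv = l.toFinset :=
    by
  induction l with
  | nil => simp [vars]
  | cons x l ih => ext; simp [vars, ih]

theorem timed_vars_in {l : List A} (hl : l.Nodup) (h : ∀ y ∈ l, π y = true) :
    Timed S π t (vars l) 0 l.length := by
  induction l with
  | nil => exact timed_zero
  | cons x l ih =>
    simp only [nodup_cons, mem_cons, forall_eq_or_imp] at hl h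
    exact (timed_var_in h.1).tensor (ih hl.2 h.2) (by simpa using hl.1) (by rfl)
      (by simp [add_comm])

theorem timed_vars_out {l : List A} (hl : l.Nodup) (h : ∀ x ∈ l, π x = false) :
    Timed S π t (vars l) l.length 0 := by
  induction l with
  | nil => exact timed_zero
  | cons x l ih =>
    simp only [nodup_cons, mem_cons, forall_eq_or_imp] at hl h
    exact (timed_var_out h.1).tensor (ih hl.2 h.2) (by simpa using hl.1) (by simp [add_comm])

theorem timed_ident_vars_in {l : List A} (hl : l.Nodup) (h : ∀ y ∈ l, π y = true) (j : ℕ)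
    (hk : k = j + l.length) : Timed S π t (ident j ⊠ₜ vars l) j k :=
  (timed_ident j).tensor (timed_vars_in hl h)

theorem timed_ident_vars_out {l : List A} (hl : l.Nodup) (h : ∀ x ∈ l, π x = false) (j : ℕ)
    (hk : k = j + l.length) : Timed S π t (ident j ⊠ₜ vars l) k j :=
  (timed_ident j).tensor (timed_vars_out hl h)

theorem Eqv.ident_vars_out_cons {l : List A} (hl : (x :: l).Nodup) (h : ∀ a ∈ x :: l, π a = false)
    (j : ℕ) (hk : k = j + (l.length + 1)) : Eqv S π k j (ident j ⊠ₜ vars (x :: l))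
      ((ident (j + 1) ⊠ₜ vars l) ⨟ (ident j ⊠ₜ .var x)) := by
  simp only [nodup_cons, mem_cons, forall_eq_or_imp] at hl h
  set τ : A → ℚ := fun c => if c = x then 1 else 0 with hτ
  have hlx : Before τ l.toFinset {x} := by grind
  have hX := timed_var_out (S := S) (t := τ) h.1
  have hL := timed_vars_out (S := S) (t := τ) hl.2 h.2
  have h1L : Timed S π τ (ident 1 ⊠ₜ vars l) (1 + l.length) 1 :=
    (timed_ident 1).tensor hL
  have e1 : Eqv S π (1 + l.length) 0 (.var x ⊠ₜ vars l) ((ident 1 ⊠ₜ vars l) ⨟ .var x) :=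
    (Eqv.tensor_seq_right hX hL).trans
      (Eqv.seq_right (Eqv.tensor_zero hX) h1L)
  refine ((Eqv.ident_seq (timed_ident (t := τ) j)).symm.tensor e1 (by simp) (m := k) (n := j)).trans
      ?_
  refine (Eqv.interchange (timed_ident j) (timed_ident j) h1L hX).trans ?_
  refine Eqv.seq_left (k := j + 1) ?_ (timed_ident_tensor_out (t := τ) h.1 j)
  exact (Eqv.tensor_assoc (timed_ident j) (timed_ident 1) hL).symm.trans
      ((Eqv.ident_tensor_one j).tensor (Eqv.refl hL))

theorem Eqv.ident_vars_in_cons {l : List A} (hl : (y :: l).Nodup) (h : ∀ a ∈ y :: l, π a = true)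
    (j : ℕ) (hk : k = j + (l.length + 1)) : Eqv S π j k (ident j ⊠ₜ vars (y :: l))
      ((ident j ⊠ₜ .var y) ⨟ (ident (j + 1) ⊠ₜ vars l)) := by
  simp only [nodup_cons, mem_cons, forall_eq_or_imp] at hl h
  set τ : A → ℚ := fun c => if c = y then 0 else 1 with hτ
  have hly : Before τ {y} l.toFinset := by grind
  have hY := timed_var_in (S := S) (t := τ) h.1
  have hL := timed_vars_in (S := S) (t := τ) hl.2 h.2
  have h1L : Timed S π τ (ident 1 ⊠ₜ vars l) 1 (1 + l.length) :=
    (timed_ident 1).tensor hL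
  have e1 : Eqv S π 0 (1 + l.length) (.var y ⊠ₜ vars l) (.var y ⨟ (ident 1 ⊠ₜ vars l)) :=
    (Eqv.tensor_seq_left hY hL).trans
      (Eqv.seq_left (Eqv.tensor_zero hY) h1L)
  refine ((Eqv.ident_seq (timed_ident (t := τ) j)).symm.tensor e1 (by simp) (m := j) (n := k)).trans
      ?_
  refine (Eqv.interchange (timed_ident j) (timed_ident j) hY h1L).trans ?_
  refine Eqv.seq_right (k := j + 1) ?_ (timed_ident_tensor_in (t := τ) h.1 j)
  exact (Eqv.tensor_assoc (timed_ident j) (timed_ident 1) hL).symm.trans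
      ((Eqv.ident_tensor_one j).tensor (Eqv.refl hL) (by simp) (by omega))

/-- A list of links; the first one is the innermost. -/
def linkAll {K : Type u} (L : List (A × A)) (P : Term K A) : Term K A :=
  L.foldl (fun P p => .link p.1 p.2 P) P

@[simp] theorem linkAll_nil : linkAll [] P = P := rfl

@[simp] theorem linkAll_cons {p : A × A} : linkAll (p :: L) P = linkAll L (.link p.1 p.2 P) := rfl

theorem linkAll_append : linkAll (L ++ L') P = linkAll L' (linkAll L P) := by
  simp [linkAll]

/-- The names bound by a list of links. -/
def linkNames (L : List (A × A)) : List A := L.flatMap fun p => [p.1, p.2]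

@[simp, grind =] theorem linkNames_nil : linkNames ([] : List (A × A)) = [] := rfl

@[simp, grind =] theorem linkNames_cons {p : A × A} : linkNames (p :: L) = p.1 :: p.2 :: linkNames
    L := rfl

@[simp, grind =] theorem linkNames_append : linkNames (L ++ L') = linkNames L ++ linkNames L' := by
  simp [linkNames]

theorem mem_linkNames : a ∈ linkNames L ↔ ∃ p ∈ L, a = p.1 ∨ a = p.2 := by
  simp [linkNames]

theorem linkNames_perm (h : L.Perm L') : (linkNames L).Perm (linkNames L') := h.flatMap_right _

@[simp, grind =] theorem fv_linkAll : (linkAll L P).fv = P.fv \ (linkNames L).toFinset := by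
  induction L generalizing P with
  | nil => simp
  | cons p L ih => ext; simp [ih]; tauto

/-- The links `L` join variables in `s`, and are compatible with the polarity `π` and the schedule
`t`. -/
structure Links (π : A → Bool) (t : A → ℚ) (s : Finset A) (L : List (A × A)) : Prop where
  nodup : (linkNames L).Nodup
  fst_mem : ∀ p ∈ L, p.1 ∈ s
  snd_mem : ∀ p ∈ L, p.2 ∈ s
  fst_out : ∀ p ∈ L, π p.1 = false
  snd_in : ∀ p ∈ L, π p.2 = true
  lt : ∀ p ∈ L, t p.1 < t p.2

theorem Links.nil {s : Finset A} : Links π t s [] :=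
  ⟨by simp, by simp, by simp, by simp, by simp, by simp⟩

theorem Links.tail {s : Finset A} {p : A × A} (h : Links π t s (p :: L)) :
    Links π t (s \ {p.1, p.2}) L := by
  obtain ⟨h1, h2, h3, h4, h5, h6⟩ := h
  simp only [linkNames_cons, nodup_cons, mem_cons, not_or] at h1
  have hne : ∀ q ∈ L, (q.1 ≠ p.1 ∧ q.1 ≠ p.2) ∧ (q.2 ≠ p.1 ∧ q.2 ≠ p.2) := by
    intro q hq
    have m1 : q.1 ∈ linkNames L := mem_linkNames.2 ⟨q, hq, .inl rfl⟩
    have m2 : q.2 ∈ linkNames L := mem_linkNames.2 ⟨q, hq, .inr rfl⟩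
    grind
  refine ⟨h1.2.2, fun q hq => ?_, fun q hq => ?_, fun q hq => h4 q (by simp [hq]),
    fun q hq => h5 q (by simp [hq]), fun q hq => h6 q (by simp [hq])⟩
  · simp [h2 q (by simp [hq]), hne q hq]
  · simp [h3 q (by simp [hq]), hne q hq]

theorem Links.mono {s s' : Finset A} (h : Links π t s L) (hs : s ⊆ s') : Links π t s' L :=
  { h with fst_mem := fun p hp => hs (h.fst_mem p hp), snd_mem := fun p hp => hs (h.snd_mem p hp) }

theorem Links.perm {s : Finset A} (h : Links π t s L) (hL : L.Perm L') : Links π t s L' :=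
  ⟨(linkNames_perm hL).nodup h.nodup, fun p hp => h.fst_mem p (hL.mem_iff.2 hp),
    fun p hp => h.snd_mem p (hL.mem_iff.2 hp), fun p hp => h.fst_out p (hL.mem_iff.2 hp),
    fun p hp => h.snd_in p (hL.mem_iff.2 hp), fun p hp => h.lt p (hL.mem_iff.2 hp)⟩

theorem Links.names_subset {s : Finset A} (h : Links π t s L) : ∀ a ∈ linkNames L, a ∈ s := by
  intro a ha
  obtain ⟨p, hp, rfl | rfl⟩ := mem_linkNames.1 ha
  exacts [h.fst_mem p hp, h.snd_mem p hp]

theorem Links.congr {s : Finset A} (h : Links π t s L) (hπ : ∀ a ∈ linkNames L, π a = π' a)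
    (ht : ∀ a ∈ linkNames L, t a = t' a) : Links π' t' s L := by
  have m1 : ∀ q ∈ L, q.1 ∈ linkNames L := fun q hq => mem_linkNames.2 ⟨q, hq, .inl rfl⟩
  have m2 : ∀ q ∈ L, q.2 ∈ linkNames L := fun q hq => mem_linkNames.2 ⟨q, hq, .inr rfl⟩
  refine ⟨h.nodup, h.fst_mem, h.snd_mem, fun p hp => ?_, fun p hp => ?_, fun p hp => ?_⟩
  · rw [← hπ _ (m1 p hp)]; exact h.fst_out p hp
  · rw [← hπ _ (m2 p hp)]; exact h.snd_in p hp
  · rw [← ht _ (m1 p hp), ← ht _ (m2 p hp)]; exact h.lt p hp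

theorem Timed.linkAll (hP : Timed S π t P m n) (hL : Links π t P.fv L) :
    Timed S π t (linkAll L P) m n := by
  induction L generalizing P with
  | nil => exact hP
  | cons p L ih =>
    refine ih ?_ hL.tail
    exact hP.link_of (hL.fst_out p (by simp)) (hL.snd_in p (by simp)) (hL.fst_mem p (by simp))
      (hL.snd_mem p (by simp)) (hL.lt p (by simp))

theorem Timed.of_linkAll (hP : Timed S π t (LinkSyntax.linkAll L P) m n)
    (h1 : ∀ p ∈ L, π p.1 = false) (h2 : ∀ p ∈ L, π p.2 = true) : ∃ t', Timed S π t' P m n := by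
  induction L generalizing P with
  | nil => exact ⟨t, hP⟩
  | cons p L ih =>
    obtain ⟨t', -, -, -, c, d, -, h⟩ := ih hP (fun q hq => h1 q (by simp [hq]))
      fun q hq => h2 q (by simp [hq])
    rw [← h1 p (by simp), ← h2 p (by simp), Function.update_eq_self, Function.update_eq_self] at h
    exact ⟨_, h⟩

theorem Eqv.linkAll (h : Eqv S π m n P Q) (hP : Timed S π t (linkAll L P) m n)
    (hQ : Timed S π t' (LinkSyntax.linkAll L Q) m n)
    (h1 : ∀ p ∈ L, π p.1 = false) (h2 : ∀ p ∈ L, π p.2 = true) :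
    Eqv S π m n (LinkSyntax.linkAll L P) (LinkSyntax.linkAll L Q) := by
  induction L generalizing P Q with
  | nil => exact h
  | cons p L ih =>
    obtain ⟨t1, ht1⟩ := Timed.of_linkAll (L := L) hP (fun q hq => h1 q (by simp [hq]))
      fun q hq => h2 q (by simp [hq])
    obtain ⟨t2, ht2⟩ := Timed.of_linkAll (L := L) hQ (fun q hq => h1 q (by simp [hq]))
      fun q hq => h2 q (by simp [hq])
    exact ih (h.link_of ht1 ht2 (h1 p (by simp)) (h2 p (by simp))) hP hQ
      (fun q hq => h1 q (by simp [hq])) fun q hq => h2 q (by simp [hq])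

theorem links_zip : ∀ {xs ys : List A} {s : Finset A}, xs.length = ys.length → (xs ++ ys).Nodup →
    (∀ x ∈ xs, π x = false) → (∀ y ∈ ys, π y = true) → Before t xs.toFinset ys.toFinset →
    (∀ a ∈ xs ++ ys, a ∈ s) → Links π t s (xs.zip ys)
  | [], _, s, _, _, _, _, _, _ => by simpa using Links.nil
  | _ :: _, [], s, h, _, _, _, _, _ => by simp at h
  | x :: xs, y :: ys, s, hl, hn, hx, hy, ht, hs => by
    have hn' : (xs ++ ys).Nodup := by grind
    have ih := links_zip (s := s) (by simpa using hl) hn' (fun a ha => hx a (by simp [ha]))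
      (fun a ha => hy a (by simp [ha])) (ht.subset (by simp) (by simp))
      (fun a ha => hs a (by simp at ha ⊢; tauto))
    have hmem : ∀ a, a ∈ linkNames (xs.zip ys) → a ∈ xs ∨ a ∈ ys := by
      intro a ha
      obtain ⟨p, hp, rfl | rfl⟩ := mem_linkNames.1 ha
      · exact .inl (of_mem_zip hp).1
      · exact .inr (of_mem_zip hp).2
    simp only [cons_append, nodup_cons, List.nodup_append, mem_append,
        mem_cons, not_or] at hn
    refine ⟨?_, ?_, ?_, ?_, ?_, ?_⟩
    · simp only [List.zip_cons_cons, linkNames_cons, nodup_cons, mem_cons, not_or]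
      refine ⟨⟨hn.1.2.1, fun h => ?_⟩, fun h => ?_, ih.nodup⟩
      all_goals grind
    · simpa [hs x (by simp)] using fun a b h => ih.fst_mem (a, b) h
    · simpa [hs y (by simp)] using fun a b h => ih.snd_mem (a, b) h
    · simpa [hx x (by simp)] using fun a b h => ih.fst_out (a, b) h
    · simpa [hy y (by simp)] using fun a b h => ih.snd_in (a, b) h
    · simpa [ht x (by simp) y (by simp)] using fun a b h => ih.lt (a, b) h

/-- Linking the variables `xs`, at the end of `U`, with the variables `ys`, at the start of `V`,
composes `U` and `V`. -/
theorem Eqv.linkAll_cut : ∀ {xs ys : List A} {U V : Term S.Const A} {j : ℕ},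
    xs.length = ys.length → (xs ++ ys).Nodup → (∀ x ∈ xs, π x = false) → (∀ y ∈ ys, π y = true) →
    k = j + xs.length → Timed S π t U m k → Timed S π t V k n → Before t U.fv xs.toFinset →
    Before t U.fv ys.toFinset → Before t U.fv V.fv → Before t xs.toFinset ys.toFinset →
    Before t xs.toFinset V.fv → Before t ys.toFinset V.fv →
    Eqv S π m n (LinkSyntax.linkAll (xs.zip ys) ((U ⨟ (ident j ⊠ₜ vars xs)) ⨟ (ident j ⊠ₜ vars ys) ⨟
        V))
      (U ⨟ V)
  | [], ys, U, V, j, hl, hn, hx, hy, hk, hU, hV, _, _, hUV, _, _, _ => by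
    obtain rfl : ys = [] := by simpa [eq_comm] using hl
    obtain rfl : k = j := by simpa using hk
    have h0 := Eqv.tensor_zero (π := π) (timed_ident (S := S) (t := t) k)
    exact ((h0.seq_right hU (by simp)).trans (Eqv.seq_ident hU)).seq
      ((h0.seq_left hV (by simp)).trans (Eqv.ident_seq hV)) (by simpa [vars] using hUV.disjoint)
  | x :: xs, [], _, _, _, h, _, _, _, _, _, _, _, _, _, _, _, _ => by simp at h
  | x :: xs, y :: ys, U, V, j, hl, hn, hx, hy, hk, hU, hV, hUx, hUy, hUV, hxy, hxV, hyV => by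
    have hl' : xs.length = ys.length := by simpa using hl
    have hnx : (x :: xs).Nodup := hn.of_append_left
    have hny : (y :: ys).Nodup := hn.of_append_right
    have hdxy : (x :: xs).Disjoint (y :: ys) := disjoint_of_nodup_append hn
    have hn' : (xs ++ ys).Nodup := List.nodup_append.2 ⟨hnx.of_cons, hny.of_cons, by
      rintro a ha b hb rfl
      exact hdxy (List.mem_cons_of_mem _ ha) (List.mem_cons_of_mem _ hb)⟩
    have hx' : ∀ a ∈ xs, π a = false := fun a ha => hx a (by simp [ha])
    have hy' : ∀ a ∈ ys, π a = true := fun a ha => hy a (by simp [ha])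
    have pπx := hx x (by simp)
    have pπy := hy y (by simp)
    have hk' : k = (j + 1) + xs.length := by simp at hk; omega
    have hky : k = j + (y :: ys).length := by rw [hk, hl]
    have hlinks : Links π t ((U ⨟ (ident j ⊠ₜ vars (x :: xs))) ⨟
        (ident j ⊠ₜ vars (y :: ys)) ⨟ V).fv ((x :: xs).zip (y :: ys)) :=
      links_zip hl hn hx hy hxy (by intro a; simp; tauto)
    have sx : xs.toFinset ⊆ (x :: xs).toFinset := by simp
    have sy : ys.toFinset ⊆ (y :: ys).toFinset := by simp
    have sx' : {x} ⊆ (x :: xs).toFinset := by simp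
    have sy' : {y} ⊆ (y :: ys).toFinset := by simp
    -- the remaining factors
    have hX := timed_ident_vars_out (S := S) (t := t) hnx.of_cons hx' (j + 1) hk'
    have hY := timed_ident_vars_in (S := S) (t := t) hny.of_cons hy' (j + 1)
        (hk'.trans (by rw [hl']))
    have hUX := hU.seq hX
    have hYV := hY.seq hV
    have hXY' : Before t xs.toFinset ys.toFinset := hxy.subset sx sy
    have hUXYV : Before t (U ⨟ (ident (j + 1) ⊠ₜ vars xs)).fv
        ((ident (j + 1) ⊠ₜ vars ys) ⨟ V).fv := by
      simp [hXY', hUy.subset subset_rfl sy, hUV, hxV.subset sx subset_rfl]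
    have xU : x ∉ U.fv := disjoint_right.1 hUx.disjoint (by simp)
    have yU : y ∉ U.fv := disjoint_right.1 hUy.disjoint (by simp)
    have xV : x ∉ V.fv := disjoint_left.1 hxV.disjoint (by simp)
    have yV : y ∉ V.fv := disjoint_left.1 hyV.disjoint (by simp)
    have xx : x ∉ xs := (nodup_cons.1 hnx).1
    have yy : y ∉ ys := (nodup_cons.1 hny).1
    have xny : x ≠ y := fun e => hdxy (List.mem_cons_self ..) (e ▸ List.mem_cons_self ..)
    have xys : x ∉ ys := fun h => hdxy (List.mem_cons_self ..) (List.mem_cons_of_mem _ h)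
    have yxs : y ∉ xs := fun h => hdxy (List.mem_cons_of_mem _ h) (List.mem_cons_self ..)
    obtain ⟨⟨t1, h1⟩, c1⟩ := Eqv.link_cut (π := π) xny hUX hYV hUXYV (by simp [*]) (by simp [*])
      (by simp [*]) (by simp [*])
    obtain ⟨c, hc, -⟩ := exists_between t x (s := U.fv ∪ xs.toFinset) (u := ∅)
    obtain ⟨d, -, hd⟩ := exists_between t y (s := ∅) (u := ys.toFinset ∪ V.fv)
    rw [before_union_left] at hc
    rw [before_union_right] at hd
    have e1 : Eqv S π m j (U ⨟ (ident j ⊠ₜ vars (x :: xs)))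
        ((U ⨟ (ident (j + 1) ⊠ₜ vars xs)) ⨟ (ident j ⊠ₜ .var x)) :=
      (Eqv.seq_right (Eqv.ident_vars_out_cons hnx hx j (by simpa using hk)) hU
        (by simpa using hUx.disjoint)).trans (Eqv.seq_assoc (hU.update_right xU c)
          (hX.update_right (by simpa using xx) c) (timed_ident_tensor_out pπx j)
          (by simpa using (hUx.subset subset_rfl sx).update xU)).symm
    have e2 : Eqv S π j n ((ident j ⊠ₜ vars (y :: ys)) ⨟ V)
        ((ident j ⊠ₜ .var y) ⨟ (ident (j + 1) ⊠ₜ vars ys) ⨟ V) :=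
      (Eqv.seq_left (Eqv.ident_vars_in_cons hny hy j (by simpa using hky)) hV
        (by simpa using hyV.disjoint)).trans (Eqv.seq_assoc (timed_ident_tensor_in pπy j)
          (hY.update_right (by simpa using yy) d) (hV.update_right yV d)
          (by simpa using hd.1) (by simpa using hd.2)
          (by simpa using (hyV.subset sy subset_rfl).update (by simpa using yy) yV))
    have hXX := timed_ident_vars_out (S := S) (t := t) hnx hx j hk
    have hYY := timed_ident_vars_in (S := S) (t := t) hny hy j hky
    have bU : Before t U.fv (ident j ⊠ₜ vars (x :: xs) : Term S.Const A).fv := by simpa using hUx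
    have bV : Before t (ident j ⊠ₜ vars (y :: ys) : Term S.Const A).fv V.fv := by simpa using hyV
    have bUV : Before t (U ⨟ (ident j ⊠ₜ vars (x :: xs))).fv ((ident j ⊠ₜ vars (y :: ys)) ⨟ V).fv :=
        by simp_all
    have hP := (hU.seq hXX).seq (hYY.seq hV)
    have hPl := hP.link_of pπx pπy (by simp) (by simp) (hxy x (by simp) y (by simp))
    have e3 := (Eqv.link_of (e1.seq e2) hPl h1 pπx pπy).trans c1
    have hlz : Links π t ((U ⨟ (ident (j + 1) ⊠ₜ vars xs)) ⨟
        (ident (j + 1) ⊠ₜ vars ys) ⨟ V).fv (xs.zip ys) :=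
      links_zip hl' hn' hx' hy' hXY' (by intro a; simp; tauto)
    exact (Eqv.linkAll e3 (hP.linkAll hlinks) ((hUX.seq hYV).linkAll hlz) hlz.fst_out
      hlz.snd_in).trans (Eqv.linkAll_cut hl' hn' hx' hy' hk' hU hV (hUx.subset subset_rfl sx)
        (hUy.subset subset_rfl sy) hUV hXY' (hxV.subset sx subset_rfl) (hyV.subset sy subset_rfl))

/-- Links can be moved past a scalar. -/
theorem Eqv.tensor_linkAll (hM : Timed S π t M 0 0) (hP : Timed S π t P m n) (hL : Links π t P.fv L)
    (hd : Disjoint M.fv P.fv) :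
    Eqv S π m n (M ⊠ₜ LinkSyntax.linkAll L P) (LinkSyntax.linkAll L (M ⊠ₜ P)) := by
  have hm : m = 0 + m := (zero_add m).symm
  have hn : n = 0 + n := (zero_add n).symm
  induction L generalizing P with
  | nil => exact Eqv.refl (hM.tensor hP)
  | cons p L ih =>
    have px := hL.fst_out p (by simp)
    have py := hL.snd_in p (by simp)
    have hlt := hL.lt p (by simp)
    have h1 := hP.link_of px py (hL.fst_mem p (by simp)) (hL.snd_mem p (by simp)) hlt
    have h2 := hM.tensor hP hd hm hn
    have hL' : Links π t (M ⊠ₜ P).fv (p :: L) := hL.mono (by simp)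
    have h3 := h2.link_of px py (by simp [hL.fst_mem p (by simp)])
      (by simp [hL.snd_mem p (by simp)]) hlt
    have hd' : Disjoint M.fv (Term.link p.1 p.2 P).fv := hd.mono_right sdiff_subset
    refine (ih h1 hL.tail hd').trans (Eqv.linkAll (Eqv.extrude_tensor_right hM h1 h3 hd ?_ ?_).symm
      ((hM.tensor h1).linkAll (hL.tail.mono (by simp))) (h3.linkAll hL'.tail)
      hL.tail.fst_out hL.tail.snd_in)
    · exact disjoint_right.1 hd (hL.fst_mem p (by simp))
    · exact disjoint_right.1 hd (hL.snd_mem p (by simp))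

/-- A permutation of a list of links. -/
theorem Eqv.linkAll_perm (hL : L.Perm L') : ∀ {P : Term S.Const A}, Timed S π t P m n →
    Links π t P.fv L → Eqv S π m n (LinkSyntax.linkAll L P) (LinkSyntax.linkAll L' P) := by
  induction hL with
  | nil => exact fun hP _ => Eqv.refl hP
  | cons p _ ih =>
    intro P hP h
    exact ih (hP.link_of (h.fst_out p (by simp)) (h.snd_in p (by simp)) (h.fst_mem p (by simp))
      (h.snd_mem p (by simp)) (h.lt p (by simp))) h.tail
  | swap p q L =>
    intro P hP h
    have h' : Links π t P.fv (p :: q :: L) := h.perm (List.Perm.swap _ _ _)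
    have hn := h.nodup
    simp only [linkNames_cons, nodup_cons, mem_cons, not_or] at hn
    refine Eqv.linkAll (L := L) (Eqv.link_comm hP (h.fst_out p (by simp)) (h.snd_in p (by simp))
      (h.fst_out q (by simp)) (h.snd_in q (by simp)) (h.fst_mem p (by simp)) (h.snd_mem p (by simp))
      (h.fst_mem q (by simp)) (h.snd_mem q (by simp)) (h.lt p (by simp)) (h.lt q (by simp)) ?_ ?_)
      (hP.linkAll h) (hP.linkAll h') h.tail.tail.fst_out h.tail.tail.snd_in
    all_goals grind
  | trans h1 h2 ih1 ih2 =>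
    intro P hP h
    exact (ih1 hP h).trans (ih2 hP (h.perm h1))

/-! ### Normal forms -/

variable {F : Finset A}

/-- A constant, or a bare wire (`body = none`), all of whose ports carry variables. -/
structure Atom (K : Type u) (A : Type v) where
  body : Option K
  ins : List A
  outs : List A

/-- The term of the body of an atom: a wire is the identity. -/
def bodyTerm {K : Type u} : Option K → Term K A
  | none => .one
  | some k => .const k

/-- The number of inputs of the body of an atom. -/
def Signature.bodyDom (S : Signature.{u}) : Option S.Const → ℕ
  | none => 1
  | some k => S.dom k

/-- The number of outputs of the body of an atom. -/
def Signature.bodyCod (S : Signature.{u}) : Option S.Const → ℕ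
  | none => 1
  | some k => S.cod k

@[simp, grind =] theorem fv_bodyTerm (o : Option S.Const) : (bodyTerm o : Term S.Const A).fv = ∅ :=
    by
  cases o <;> rfl

theorem timed_bodyTerm (o : Option S.Const) :
    Timed S π t (bodyTerm o) (S.bodyDom o) (S.bodyCod o) := by
  cases o <;> exact ⟨rfl, rfl⟩

/-- The scalar in which all ports of `M` are connected to variables. -/
def closed {K : Type u} (as : List A) (M : Term K A) (bs : List A) : Term K A :=
  vars as ⨟ M ⨟ vars bs

@[simp, grind =] theorem fv_closed {as bs : List A} :
    (closed as M bs).fv = as.toFinset ∪ (M.fv ∪ bs.toFinset) := by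
  simp [closed]

namespace Atom

variable {K : Type u}

/-- The term of an atom. -/
def term (a : Atom K A) : Term K A := closed a.ins (bodyTerm a.body) a.outs

/-- The variables of an atom. -/
def names (a : Atom K A) : List A := a.ins ++ a.outs

/-- The atom has the correct number of ports, and its variables are distinct and compatible with the
polarity and the schedule. -/
structure Ok (S : Signature.{u}) (π : A → Bool) (t : A → ℚ) (a : Atom S.Const A) : Prop where
  dom : a.ins.length = S.bodyDom a.body
  cod : a.outs.length = S.bodyCod a.body
  nodup : a.names.Nodup
  ins_in : ∀ y ∈ a.ins, π y = true
  outs_out : ∀ x ∈ a.outs, π x = false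
  before : Before t a.ins.toFinset a.outs.toFinset

@[simp, grind =] theorem fv_term (a : Atom S.Const A) : a.term.fv = a.names.toFinset := by
  simp [term, names]

theorem Ok.timed {a : Atom S.Const A} (h : a.Ok S π t) : Timed S π t a.term 0 0 := by
  refine (h.dom ▸ timed_vars_in h.nodup.of_append_left h.ins_in).seq
    ((timed_bodyTerm a.body).seq (h.cod ▸ timed_vars_out h.nodup.of_append_right h.outs_out))
        (by simpa using h.before)

theorem Ok.congr {a : Atom S.Const A} (h : a.Ok S π t) (hπ : ∀ c ∈ a.names, π c = π' c)
    (ht : ∀ c ∈ a.names, t c = t' c) : a.Ok S π' t' := by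
  simp only [names, mem_append] at hπ ht
  refine ⟨h.dom, h.cod, h.nodup, fun y hy => ?_, fun x hx => ?_, fun y hy x hx => ?_⟩
  · rw [← hπ y (.inl hy)]; exact h.ins_in y hy
  · rw [← hπ x (.inr hx)]; exact h.outs_out x hx
  · rw [← ht y (.inl (by simpa using hy)), ← ht x (.inr (by simpa using hx))]
    exact h.before y hy x hx

end Atom

/-- The tensor product of a list of atoms. -/
def atomsTerm {K : Type u} : List (Atom K A) → Term K A
  | [] => .zero
  | a :: As => a.term ⊠ₜ atomsTerm As

/-- The variables of a list of atoms. -/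
def atomNames {K : Type u} (As : List (Atom K A)) : List A := As.flatMap Atom.names

section AtomLists

variable {As Bs : List (Atom S.Const A)}

@[simp, grind =] theorem atomNames_nil {K : Type u} : atomNames ([] : List (Atom K A)) = [] := rfl

@[simp, grind =] theorem atomNames_cons {K : Type u} (a : Atom K A) (As : List (Atom K A)) :
    atomNames (a :: As) = a.names ++ atomNames As := rfl

@[simp, grind =] theorem atomNames_append {K : Type u} (As Bs : List (Atom K A)) :
    atomNames (As ++ Bs) = atomNames As ++ atomNames Bs := by
  simp [atomNames]

@[simp, grind =] theorem fv_atomsTerm (As : List (Atom S.Const A)) :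
    (atomsTerm As).fv = (atomNames As).toFinset := by
  induction As with
  | nil => rfl
  | cons a As ih => ext; simp [atomsTerm, ih]

/-- The atoms are correct and have distinct variables. -/
structure AtomsOk (S : Signature.{u}) (π : A → Bool) (t : A → ℚ) (As : List (Atom S.Const A)) :
    Prop where
  ok : ∀ a ∈ As, a.Ok S π t
  nodup : (atomNames As).Nodup

theorem AtomsOk.nil : AtomsOk S π t [] := ⟨by simp, by simp⟩

theorem atomsOk_cons {a : Atom S.Const A} : AtomsOk S π t (a :: As) ↔
    a.Ok S π t ∧ AtomsOk S π t As ∧ a.names.Disjoint (atomNames As) := by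
  constructor
  · rintro ⟨h1, h2⟩
    rw [atomNames_cons] at h2
    exact ⟨h1 a (by simp), ⟨fun b hb => h1 b (by simp [hb]), h2.of_append_right⟩,
      disjoint_of_nodup_append h2⟩
  · rintro ⟨h1, h2, h3⟩
    refine ⟨by simpa using ⟨h1, h2.ok⟩, ?_⟩
    rw [atomNames_cons]
    exact h1.nodup.append h2.nodup h3

theorem AtomsOk.append (h : AtomsOk S π t As) (h' : AtomsOk S π t Bs)
    (hd : (atomNames As).Disjoint (atomNames Bs)) : AtomsOk S π t (As ++ Bs) :=
  ⟨fun a ha => (mem_append.1 ha).elim (h.ok a) (h'.ok a), by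
    rw [atomNames_append]; exact h.nodup.append h'.nodup hd⟩

theorem AtomsOk.perm (h : AtomsOk S π t As) (hp : As.Perm Bs) : AtomsOk S π t Bs :=
  ⟨fun a ha => h.ok a (hp.mem_iff.2 ha), (hp.flatMap_right _).nodup h.nodup⟩

theorem AtomsOk.congr (h : AtomsOk S π t As) (hπ : ∀ c ∈ atomNames As, π c = π' c)
    (ht : ∀ c ∈ atomNames As, t c = t' c) : AtomsOk S π' t' As :=
  ⟨fun a ha => (h.ok a ha).congr (fun c hc => hπ c (List.mem_flatMap.2 ⟨a, ha, hc⟩))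
    fun c hc => ht c (List.mem_flatMap.2 ⟨a, ha, hc⟩), h.nodup⟩

theorem AtomsOk.timed (h : AtomsOk S π t As) : Timed S π t (atomsTerm As) 0 0 := by
  induction As with
  | nil => exact timed_zero
  | cons a As ih =>
    obtain ⟨h1, h2, h3⟩ := atomsOk_cons.1 h
    exact h1.timed.tensor (ih h2) (by simp_all)

theorem Eqv.atomsTerm_append (h : AtomsOk S π t (As ++ Bs)) :
    Eqv S π 0 0 (atomsTerm (As ++ Bs)) (atomsTerm As ⊠ₜ atomsTerm Bs) := by
  induction As with
  | nil => exact (Eqv.zero_tensor h.timed).symm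
  | cons a As ih =>
    rw [cons_append] at h
    obtain ⟨h1, h2, h3⟩ := atomsOk_cons.1 h
    have hAB := disjoint_of_nodup_append (by simpa using h2.nodup)
    have hA : AtomsOk S π t As := ⟨fun b hb => h2.ok b (by simp [hb]), by
      have := h2.nodup; rw [atomNames_append] at this; exact this.of_append_left⟩
    have hB : AtomsOk S π t Bs := ⟨fun b hb => h2.ok b (by simp [hb]), by
      have := h2.nodup; rw [atomNames_append] at this; exact this.of_append_right⟩
    rw [atomNames_append, List.disjoint_append_right] at h3
    refine ((Eqv.refl h1.timed).tensor (ih h2) ?_).trans (Eqv.tensor_assoc h1.timed hA.timed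
      hB.timed ?_ ?_ ?_).symm
    all_goals simp_all

/-- The order of the atoms is irrelevant, since they are scalars. -/
theorem Eqv.atomsTerm_perm (hp : As.Perm Bs) :
    AtomsOk S π t As → Eqv S π 0 0 (atomsTerm As) (atomsTerm Bs) := by
  induction hp with
  | nil => exact fun h => Eqv.refl h.timed
  | cons a hp ih =>
    intro h
    obtain ⟨h1, h2, h3⟩ := atomsOk_cons.1 h
    exact (Eqv.refl h1.timed).tensor (ih h2) (by simp_all)
  | swap a b As =>
    intro h
    obtain ⟨h1, h2, h3⟩ := atomsOk_cons.1 h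
    obtain ⟨h4, h5, h6⟩ := atomsOk_cons.1 h2
    rw [atomNames_cons, List.disjoint_append_right] at h3
    have hab : Disjoint b.term.fv a.term.fv := by simp_all
    have hbA : Disjoint b.term.fv (atomsTerm As).fv := by simp_all
    have haA : Disjoint a.term.fv (atomsTerm As).fv := by simp_all
    exact (Eqv.tensor_assoc h1.timed h4.timed h5.timed).symm.trans
      (((Eqv.scalar_tensor_comm h1.timed h4.timed).tensor (Eqv.refl h5.timed)).trans
          (Eqv.tensor_assoc h4.timed h1.timed h5.timed))
  | trans h1 h2 ih1 ih2 => exact fun h => (ih1 h).trans (ih2 (h.perm h1))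

end AtomLists

/-- Normal forms of scalars: atoms, some of whose variables are linked. -/
def nf {K : Type u} (L : List (A × A)) (As : List (Atom K A)) : Term K A := linkAll L (atomsTerm As)

/-- The normal form is compatible with the polarity and the schedule, which extend to the bound
names. -/
structure Good (S : Signature.{u}) (π : A → Bool) (t : A → ℚ) (L : List (A × A))
    (As : List (Atom S.Const A)) : Prop where
  atoms : AtomsOk S π t As
  links : Links π t (atomNames As).toFinset L

theorem Good.timed {As : List (Atom S.Const A)} (h : Good S π t L As) :
    Timed S π t (nf L As) 0 0 :=
  h.atoms.timed.linkAll (by simpa using h.links)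

@[simp, grind =] theorem fv_nf (As : List (Atom S.Const A)) :
    (nf L As).fv = (atomNames As).toFinset \ (linkNames L).toFinset := by
  simp [nf]

/-- `P` has a normal form whose bound names are not in `F`. -/
def HasNF (S : Signature.{u}) (π : A → Bool) (t : A → ℚ) (F : Finset A) (P : Term S.Const A) :
    Prop :=
  ∃ L As π' t', (∀ a ∈ P.fv, π a = π' a ∧ t a = t' a) ∧ Good S π' t' L As ∧
    Eqv S π' 0 0 P (nf L As) ∧ ∀ c ∈ linkNames L, c ∉ F

theorem HasNF.congr (h : HasNF S π t F P) (hc : ∀ a ∈ P.fv, π a = π' a ∧ t a = t' a) :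
    HasNF S π' t' F P := by
  obtain ⟨L, As, π1, t1, h1, h2⟩ := h
  exact ⟨L, As, π1, t1, fun a ha => ⟨(hc a ha).1.symm.trans (h1 a ha).1,
    (hc a ha).2.symm.trans (h1 a ha).2⟩, h2⟩

theorem HasNF.of_eqv (h : HasNF S π t F Q) (he : Eqv S π 0 0 P Q) : HasNF S π t F P := by
  obtain ⟨L, As, π1, t1, h1, h2, h3, h4⟩ := h
  rw [← he.1] at h1
  exact ⟨L, As, π1, t1, h1, h2, (he.congr fun a ha => (h1 a ha).1).trans h3, h4⟩

theorem AtomsOk.hasNF {As : List (Atom S.Const A)} (h : AtomsOk S π t As) :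
    HasNF S π t F (atomsTerm As) :=
  ⟨[], As, π, t, fun _ _ => ⟨rfl, rfl⟩, ⟨h, Links.nil⟩, Eqv.refl h.timed, by simp⟩

theorem HasNF.tensor (hP : ∀ F, HasNF S π t F P) (hQ : ∀ F, HasNF S π t F Q)
    (hd : Disjoint P.fv Q.fv) (F : Finset A) : HasNF S π t F (P ⊠ₜ Q) := by
  obtain ⟨L, As, π1, t1, hc, hg, he, hF⟩ := hP (F ∪ Q.fv)
  obtain ⟨L', As', π2, t2, hc', hg', he', hF'⟩ := hQ (F ∪ P.fv ∪ (linkNames L).toFinset)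
  have hfP := he.1
  have hfQ := he'.1
  rw [fv_nf] at hfP hfQ
  -- a variable of either normal form is free or bound
  have mP : ∀ c ∈ atomNames As, c ∈ P.fv ∨ c ∈ linkNames L := by grind
  have mQ : ∀ c ∈ atomNames As', c ∈ Q.fv ∨ c ∈ linkNames L' := by grind
  have hPA : ∀ c ∈ P.fv, c ∈ atomNames As := by simp_all
  have hQA : ∀ c ∈ Q.fv, c ∈ atomNames As' := by simp_all
  have hLA : ∀ c ∈ linkNames L, c ∈ atomNames As := fun c hc => by
    simpa using hg.links.names_subset c hc
  have hLA' : ∀ c ∈ linkNames L', c ∈ atomNames As' := fun c hc => by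
    simpa using hg'.links.names_subset c hc
  have hdis : (atomNames As').Disjoint (atomNames As) := by
    intro c h' h
    grind
  set π3 : A → Bool := fun c => if c ∈ atomNames As then π1 c else π2 c with hπ3
  set t3 : A → ℚ := fun c => if c ∈ atomNames As then t1 c else t2 c with ht3
  have p1 : ∀ c ∈ atomNames As, π1 c = π3 c := fun c hc => by simp [hπ3, hc]
  have q1 : ∀ c ∈ atomNames As, t1 c = t3 c := fun c hc => by simp [ht3, hc]
  have p2 : ∀ c ∈ atomNames As', π2 c = π3 c := fun c hc => (if_neg fun h => hdis hc h).symm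
  have q2 : ∀ c ∈ atomNames As', t2 c = t3 c := fun c hc => (if_neg fun h => hdis hc h).symm
  have hA := hg.atoms.congr p1 q1
  have hA' := hg'.atoms.congr p2 q2
  have hL := hg.links.congr (fun c hc => p1 c (hLA c hc)) fun c hc => q1 c (hLA c hc)
  have hL' := hg'.links.congr (fun c hc => p2 c (hLA' c hc)) fun c hc => q2 c (hLA' c hc)
  have hAA := hA'.append hA hdis
  have hd1 : Disjoint (atomsTerm As').fv (atomsTerm As).fv := by
    simpa [disjoint_toFinset_iff_disjoint] using hdis
  have hd2 : Disjoint (atomsTerm As').fv (nf L As).fv := by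
    rw [fv_nf, ← fv_atomsTerm]; exact hd1.mono_right sdiff_subset
  have hn : (linkNames (L ++ L')).Nodup := by
    rw [linkNames_append]
    exact hL.nodup.append hL'.nodup fun c h h' => hdis (hLA' c h') (hLA c h)
  have hLL : Links π3 t3 (atomNames (As' ++ As)).toFinset (L ++ L') := by
    have i1 : (atomNames As).toFinset ⊆ (atomNames (As' ++ As)).toFinset := by simp
    have i2 : (atomNames As').toFinset ⊆ (atomNames (As' ++ As)).toFinset := by simp
    refine ⟨hn, ?_, ?_, ?_, ?_, ?_⟩ <;> intro p hp <;> rcases mem_append.1 hp with h | h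
    exacts [i1 (hL.fst_mem p h), i2 (hL'.fst_mem p h), i1 (hL.snd_mem p h), i2 (hL'.snd_mem p h),
      hL.fst_out p h, hL'.fst_out p h, hL.snd_in p h, hL'.snd_in p h, hL.lt p h, hL'.lt p h]
  have hcP : ∀ c ∈ P.fv, π c = π3 c ∧ t c = t3 c := fun c h =>
    ⟨(hc c h).1.trans (p1 c (hPA c h)), (hc c h).2.trans (q1 c (hPA c h))⟩
  have hcQ : ∀ c ∈ Q.fv, π c = π3 c ∧ t c = t3 c := fun c h =>
    ⟨(hc' c h).1.trans (p2 c (hQA c h)), (hc' c h).2.trans (q2 c (hQA c h))⟩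
  have hnfL : Timed S π3 t3 (nf L As) 0 0 := Good.timed ⟨hA, hL⟩
  have hT : Timed S π3 t3 (atomsTerm As' ⊠ₜ atomsTerm As) 0 0 := hA'.timed.tensor hA.timed
  have hTn : Timed S π3 t3 (atomsTerm As' ⊠ₜ nf L As) 0 0 := hA'.timed.tensor hnfL hd2
  have hnT : Timed S π3 t3 (nf L As ⊠ₜ atomsTerm As') 0 0 := hnfL.tensor hA'.timed hd2.symm
  have hLl : Links π3 t3 (atomsTerm As' ⊠ₜ nf L As).fv L' := hL'.mono (by simp)
  have hLr : Links π3 t3 (nf L As ⊠ₜ atomsTerm As').fv L' := hL'.mono (by simp)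
  have hLT : Links π3 t3 (atomsTerm As' ⊠ₜ atomsTerm As).fv L := hL.mono (by simp)
  have e1 : Eqv S π3 0 0 (atomsTerm As' ⊠ₜ nf L As) (linkAll L (atomsTerm (As' ++ As))) :=
    (Eqv.tensor_linkAll hA'.timed hA.timed (by simpa using hL) hd1).trans
      (Eqv.linkAll (Eqv.atomsTerm_append hAA).symm (hT.linkAll hLT)
        (hAA.timed.linkAll (hL.mono (by simp))) hL.fst_out hL.snd_in)
  refine ⟨L ++ L', As' ++ As, π3, t3, ?_, ⟨hAA, hLL⟩, ?_, ?_⟩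
  · intro c h
    rcases mem_union.1 h with h | h
    exacts [hcP c h, hcQ c h]
  · refine ((he.congr fun c h => (hc c h).1.symm.trans (hcP c h).1).tensor
      (he'.congr fun c h => (hc' c h).1.symm.trans (hcQ c h).1) hd).trans ?_
    refine (Eqv.tensor_linkAll hnfL hA'.timed (by simpa using hL') hd2.symm).trans ?_
    refine (Eqv.linkAll (t' := t3) ((Eqv.scalar_tensor_comm hnfL hA'.timed hd2.symm).trans e1)
      (hnT.linkAll hLr) ?_ hL'.fst_out hL'.snd_in).trans
          (?_ : Eqv S π3 0 0 _ (nf (L ++ L') (As' ++ As)))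
    · have := Good.timed ⟨hAA, hLL⟩
      rwa [nf, linkAll_append] at this
    · rw [nf, linkAll_append]
      refine Eqv.refl (t := t3) ?_
      have := Good.timed ⟨hAA, hLL⟩
      rwa [nf, linkAll_append] at this
  · intro c h
    rw [linkNames_append, mem_append] at h
    rcases h with h | h
    · exact fun h' => hF c h (by simp [h'])
    · exact fun h' => hF' c h (by simp [h'])

theorem HasNF.linkAll (hP : ∀ F, HasNF S π t F P) (ht : Timed S π t P 0 0) (hL : Links π t P.fv L)
    (hF : ∀ c ∈ linkNames L, c ∉ F) : HasNF S π t F (linkAll L P) := by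
  obtain ⟨L', As, π1, t1, hc, hg, he, hF'⟩ := hP (F ∪ P.fv)
  have hfP := he.1
  rw [fv_nf] at hfP
  have hLP : ∀ c ∈ linkNames L, c ∈ P.fv := hL.names_subset
  have hL1 := hL.congr (fun c h => (hc c (hLP c h)).1) fun c h => (hc c (hLP c h)).2
  have hPA : P.fv ⊆ (atomNames As).toFinset := by rw [hfP]; exact sdiff_subset
  have hL2 := hL1.mono hPA
  have hLL : Links π1 t1 (atomNames As).toFinset (L' ++ L) := by
    refine ⟨?_, ?_, ?_, ?_, ?_, ?_⟩
    · rw [linkNames_append]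
      exact hg.links.nodup.append hL.nodup fun c h h' => hF' c h (by simp [hLP c h'])
    all_goals
      intro p hp
      rcases mem_append.1 hp with h | h
    exacts [hg.links.fst_mem p h, hL2.fst_mem p h, hg.links.snd_mem p h, hL2.snd_mem p h,
      hg.links.fst_out p h, hL2.fst_out p h, hg.links.snd_in p h, hL2.snd_in p h,
      hg.links.lt p h, hL2.lt p h]
  refine ⟨L' ++ L, As, π1, t1, fun c h => hc c ?_, ⟨hg.atoms, hLL⟩, ?_, ?_⟩
  · rw [fv_linkAll] at h; exact sdiff_subset h
  · rw [nf, linkAll_append]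
    refine Eqv.linkAll he ((ht.congr (fun c h => (hc c h).1) fun c h => (hc c h).2).linkAll hL1)
      (t' := t1) ?_ hL1.fst_out hL1.snd_in
    have := Good.timed ⟨hg.atoms, hLL⟩
    rwa [nf, linkAll_append] at this
  · intro c h
    rw [linkNames_append, mem_append] at h
    rcases h with h | h
    · exact fun h' => hF' c h (by simp [h'])
    · exact hF c h

theorem exists_fresh_list [Infinite A] (F : Finset A) (n : ℕ) :
    ∃ l : List A, l.length = n ∧ l.Nodup ∧ ∀ a ∈ l, a ∉ F := by
  induction n with
  | zero => exact ⟨[], by simp⟩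
  | succ n ih =>
    obtain ⟨l, h1, h2, h3⟩ := ih
    obtain ⟨a, ha⟩ := Infinite.exists_notMem_finset (F ∪ l.toFinset)
    simp only [mem_union, mem_toFinset, not_or] at ha
    exact ⟨a :: l, by simp [h1], by simp [h2, ha], by simpa [ha] using h3⟩

/-- A link can be scheduled between given sets of names. -/
theorem Timed.link_within (h : Timed S π t (.link x y M) m n) {s u : Finset A}
    (hs : Before t s (Term.link x y M).fv) (hu : Before t (Term.link x y M).fv u)
    (hsu : Before t s u) :
    ∃ p q, p < q ∧ Timed S (update (update π x false) y true) (update (update t x p) y q) M m n ∧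
      (∀ a ∈ s, t a < p) ∧ ∀ b ∈ u, q < t b := by
  obtain ⟨hxy, hx, hy, p, q, hpq, hM⟩ := h
  set W := (Term.link x y M).fv with hW
  have hmem : ∀ c, c ∈ W ↔ c ∈ M.fv ∧ c ≠ x ∧ c ≠ y := by intro c; simp [hW]
  obtain ⟨p', q', hpq', h1, h2, h3, h4⟩ := exists_link_times t
    (lx := s ∪ W.filter fun a => t a < p) (ux := u ∪ W.filter fun a => p < t a)
    (ly := s ∪ W.filter fun a => t a < q) (uy := u ∪ W.filter fun a => q < t a)
    (by
      intro a ha b hb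
      simp only [mem_union, mem_filter] at ha hb
      rcases ha with ha | ha <;> rcases hb with hb | hb
      exacts [hsu a ha b hb, hs a ha b hb.1, hu a ha.1 b hb, ha.2.trans hb.2])
    (by
      intro a ha b hb
      simp only [mem_union, mem_filter] at ha hb
      rcases ha with ha | ha <;> rcases hb with hb | hb
      exacts [hsu a ha b hb, hs a ha b hb.1, hu a ha.1 b hb, ha.2.trans hb.2])
    (by
      intro a ha
      simp only [mem_union, mem_filter] at ha ⊢
      exact ha.imp_right fun h => ⟨h.1, hpq.trans h.2⟩)
  refine ⟨p', q', hpq', hM.mono (fun _ _ => rfl) ?_, fun a ha => h1 a (by simp [ha]),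
    fun b hb => h4 b (by simp [hb])⟩
  intro a ha b hb hab
  by_cases hay : a = y
  · by_cases hby : b = y
    · simp [hay, hby] at hab
    by_cases hbx : b = x
    · simp [hay, hbx, hxy] at hab
      exact absurd hab hpq.not_gt
    simp only [hay, Function.update_self, update_of_ne hby, update_of_ne hbx] at hab ⊢
    exact h4 b (by simp [hmem, hb, hbx, hby, hab])
  · by_cases hax : a = x
    · by_cases hby : b = y
      · simp [hax, hby, hxy, hpq']
      by_cases hbx : b = x
      · simp [hax, hbx] at hab
      simp only [hax, Function.update_self, update_of_ne hxy, update_of_ne hby,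
        update_of_ne hbx] at hab ⊢
      exact h2 b (by simp [hmem, hb, hbx, hby, hab])
    simp only [update_of_ne hax, update_of_ne hay] at hab ⊢
    by_cases hby : b = y
    · simp only [hby, Function.update_self] at hab ⊢
      exact h3 a (by simp [hmem, ha, hax, hay, hab])
    by_cases hbx : b = x
    · simp only [hbx, Function.update_self, update_of_ne hxy] at hab ⊢
      exact h1 a (by simp [hmem, ha, hax, hay, hab])
    simpa only [update_of_ne hbx, update_of_ne hby] using hab

/-! ### Existence of normal forms -/

variable {as bs as' bs' : List A}

/-- The variables `as` and `bs` can be attached to the inputs and the outputs of a term with free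
variables `s`. -/
structure Attach (π : A → Bool) (t : A → ℚ) (as bs : List A) (s : Finset A) : Prop where
  nodup_in : as.Nodup
  nodup_out : bs.Nodup
  ins_in : ∀ a ∈ as, π a = true
  outs_out : ∀ b ∈ bs, π b = false
  ins_before : Before t as.toFinset s
  ins_outs : Before t as.toFinset bs.toFinset
  before_outs : Before t s bs.toFinset

theorem Attach.timed (h : Attach π t as bs M.fv) (hM : Timed S π t M m n) (ha : as.length = m)
    (hb : bs.length = n) : Timed S π t (closed as M bs) 0 0 :=
  (ha ▸ timed_vars_in h.nodup_in h.ins_in).seq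
    (hM.seq (hb ▸ timed_vars_out h.nodup_out h.outs_out) (by simpa using h.before_outs))
    (by simpa using ⟨h.ins_before, h.ins_outs⟩)

theorem Eqv.vars_append_in (hl : (as ++ as').Nodup) (h : ∀ a ∈ as ++ as', π a = true) :
    Eqv S π 0 (as.length + as'.length) (vars (as ++ as')) (vars as ⊠ₜ vars as') := by
  have h' := timed_vars_in (S := S) (t := fun _ => 0) hl h
  induction as with
  | nil => exact (Eqv.zero_tensor h').symm.cast (by simp) (by simp)
  | cons a as ih =>
    rw [cons_append] at hl h h'
    have hl' := hl.of_cons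
    have ha := (nodup_cons.1 hl).1
    have ha' : a ∉ as ∧ a ∉ as' := by simpa using ha
    have hp : ∀ c ∈ as ++ as', π c = true :=
        fun c hc => h c (by simp only [mem_cons]; exact .inr hc)
    have hd := disjoint_of_nodup_append hl'
    have t1 : Timed S π (fun _ => 0) (.var a) 0 1 := timed_var_in (h a (by simp))
    have t2 : Timed S π (fun _ => 0) (vars as) 0 as.length :=
      timed_vars_in hl'.of_append_left fun c hc => hp c (by simp [hc])
    have t3 : Timed S π (fun _ => 0) (vars as') 0 as'.length :=
      timed_vars_in hl'.of_append_right fun c hc => hp c (by simp [hc])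
    refine ((Eqv.refl t1).tensor (ih hl' hp (timed_vars_in hl' hp)) (by simpa using ha')
      (m := 0) (n := (a :: as).length + as'.length) rfl (by simp; omega)).trans
      (Eqv.tensor_assoc t1 t2 t3 (by simpa using ha'.1) (by simpa using ha'.2)
        (by simpa [disjoint_toFinset_iff_disjoint] using hd) rfl (by simp; omega)).symm

theorem Eqv.vars_append_out (hl : (as ++ as').Nodup) (h : ∀ a ∈ as ++ as', π a = false) :
    Eqv S π (as.length + as'.length) 0 (vars (as ++ as')) (vars as ⊠ₜ vars as') := by
  have h' := timed_vars_out (S := S) (t := fun _ => 0) hl h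
  induction as with
  | nil => exact (Eqv.zero_tensor h').symm.cast (by simp) (by simp)
  | cons a as ih =>
    rw [cons_append] at hl h h'
    have hl' := hl.of_cons
    have ha := (nodup_cons.1 hl).1
    have ha' : a ∉ as ∧ a ∉ as' := by simpa using ha
    have hp : ∀ c ∈ as ++ as', π c = false :=
        fun c hc => h c (by simp only [mem_cons]; exact .inr hc)
    have hd := disjoint_of_nodup_append hl'
    have t1 : Timed S π (fun _ => 0) (.var a) 1 0 := timed_var_out (h a (by simp))
    have t2 : Timed S π (fun _ => 0) (vars as) as.length 0 :=
      timed_vars_out hl'.of_append_left fun c hc => hp c (by simp [hc])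
    have t3 : Timed S π (fun _ => 0) (vars as') as'.length 0 :=
      timed_vars_out hl'.of_append_right fun c hc => hp c (by simp [hc])
    refine ((Eqv.refl t1).tensor (ih hl' hp (timed_vars_out hl' hp)) (by simpa using ha')
      (n := 0) (m := (a :: as).length + as'.length) (by simp; omega)).trans
      (Eqv.tensor_assoc t1 t2 t3 (by simpa using ha'.1) (by simpa using ha'.2)
        (by simpa [disjoint_toFinset_iff_disjoint] using hd) (by simp; omega)).symm

theorem HasNF.closed_atom {o : Option S.Const} (h : Attach π t as bs ∅)
    (ha : as.length = S.bodyDom o) (hb : bs.length = S.bodyCod o) :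
    HasNF S π t F (closed as (bodyTerm o) bs) := by
  have hok : Atom.Ok S π t ⟨o, as, bs⟩ :=
    ⟨ha, hb, h.nodup_in.append h.nodup_out (by
      simpa [disjoint_toFinset_iff_disjoint] using h.ins_outs.disjoint), h.ins_in, h.outs_out,
      h.ins_outs⟩
  have : AtomsOk S π t [⟨o, as, bs⟩] := atomsOk_cons.2 ⟨hok, AtomsOk.nil, by simp⟩
  exact (this.hasNF (F := F)).of_eqv (Eqv.tensor_zero hok.timed).symm

theorem HasNF.closed_var_in (h : Attach π t [] bs {x}) (hx : π x = true) (hb : bs.length = 1) :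
    HasNF S π t F (closed [] (.var x) bs) := by
  obtain ⟨b, rfl⟩ := List.length_eq_one_iff.1 hb
  have hxb : t x < t b := by simpa using h.before_outs
  have hne : x ≠ b := by rintro rfl; exact hxb.false
  have h1 : Timed S π t (vars [b]) 1 0 := timed_vars_out h.nodup_out h.outs_out
  have h2 : Timed S π t (.var x) 0 1 := timed_var_in hx
  have hA : Attach π t [x] [b] ∅ := ⟨by simp, by simp, by simp [hx], h.outs_out, by simp,
    by simpa using hxb, by simp⟩
  refine (HasNF.closed_atom (o := none) hA rfl rfl).of_eqv ?_
  refine (Eqv.ident_seq (h2.seq h1)).trans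
    ((Eqv.tensor_zero h2).symm.seq (Eqv.ident_seq h1).symm)

theorem HasNF.closed_var_out (h : Attach π t as [] {x}) (hx : π x = false) (ha : as.length = 1) :
    HasNF S π t F (closed as (.var x) []) := by
  obtain ⟨a, rfl⟩ := List.length_eq_one_iff.1 ha
  have hax : t a < t x := by simpa using h.ins_before
  have hne : a ≠ x := by rintro rfl; exact hax.false
  have h1 : Timed S π t (vars [a]) 0 1 := timed_vars_in h.nodup_in h.ins_in
  have h2 : Timed S π t (.var x) 1 0 := timed_var_out hx
  have h3 : Timed S π t (vars [x]) 1 0 := timed_vars_out (by simp) (by simp [hx])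
  have hA : Attach π t [a] [x] ∅ := ⟨by simp, by simp, h.ins_in, by simp [hx], by simp,
    by simpa using hax, by simp⟩
  refine (HasNF.closed_atom (o := none) hA rfl rfl).of_eqv ?_
  refine Eqv.seq_right (k := 1) ?_ h1
  exact (Eqv.seq_ident h2).trans ((Eqv.tensor_zero h2).symm.trans (Eqv.ident_seq h3).symm)

theorem HasNF.closed_sym (h : Attach π t as bs ∅) (ha : as.length = 2) (hb : bs.length = 2) :
    HasNF S π t F (closed as .sym bs) := by
  obtain ⟨a, a', rfl⟩ := List.length_eq_two.1 ha
  obtain ⟨b, b', rfl⟩ := List.length_eq_two.1 hb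
  have ha := h.ins_in
  have hb := h.outs_out
  have hn := h.nodup_in
  have hn' := h.nodup_out
  have ht := h.ins_outs
  simp at ha hb hn hn'
  simp at ht
  have t1 : Timed S π t (.var a) 0 1 := timed_var_in ha.1
  have t2 : Timed S π t (vars [a']) 0 1 := timed_vars_in (by simp) (by simp [ha.2])
  have t3 : Timed S π t (.var b) 1 0 := timed_var_out hb.1
  have t4 : Timed S π t (vars [b']) 1 0 := timed_vars_out (by simp) (by simp [hb.2])
  have t1' : Timed S π t (vars [a]) 0 1 := timed_vars_in (by simp) (by simp [ha.1])
  have t3' : Timed S π t (vars [b]) 1 0 := timed_vars_out (by simp) (by simp [hb.1])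
  have tb : Timed S π t (vars [b'] ⊠ₜ .var b) 2 0 := t4.tensor t3 (by simp [Ne.symm hn'])
  have ta : Timed S π t (vars [a, a']) 0 2 := timed_vars_in (by simp [hn]) (by simp [ha])
  have hne : a ≠ b ∧ a ≠ b' ∧ a' ≠ b ∧ a' ≠ b' := by grind
  have ok : AtomsOk S π t [⟨none, [a], [b']⟩, ⟨none, [a'], [b]⟩] := by
    refine ⟨?_, ?_⟩
    · simp only [mem_cons, List.not_mem_nil, or_false, forall_eq_or_imp, forall_eq]
      refine ⟨⟨rfl, rfl, ?_, by simp [ha], by simp [hb], by simp [ht]⟩,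
        ⟨rfl, rfl, ?_, by simp [ha], by simp [hb], by simp [ht]⟩⟩ <;> simp [Atom.names, hne]
    · simp [Atom.names, hne, hn, Ne.symm hn']
      grind
  refine (ok.hasNF (F := F)).of_eqv ?_
  have e1 : Eqv S π 2 0 (.sym ⨟ vars [b, b']) (vars [b'] ⊠ₜ .var b) :=
    (Eqv.symmetry t4 t3 (by simp [Ne.symm hn'])).symm.trans (Eqv.seq_ident tb)
  refine (e1.seq_right ta ?_).trans ?_
  · simp [Ne.symm hne.1, Ne.symm hne.2.1, Ne.symm hne.2.2.1, Ne.symm hne.2.2.2]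
  refine (Eqv.interchange t1 t4 t2 t3 (by simp [ht]) (by simp [ht]) (by simp [ht]) (by simp [ht])
    (by simp [hn]) (by simp [Ne.symm hn'])).symm.trans ?_
  refine Eqv.tensor (m₁ := 0) (n₁ := 0) (m₂ := 0) (n₂ := 0)
    ((Eqv.tensor_zero t1).symm.seq (Eqv.ident_seq t4).symm)
    (Eqv.trans ?_ (Eqv.tensor_zero (ok.ok ⟨none, [a'], [b]⟩ (by simp)).timed).symm)
    (by simp [hne, Ne.symm hn, hn', Ne.symm hne.1])
  exact Eqv.seq_right (k := 1) ((Eqv.tensor_zero t3).symm.trans (Eqv.ident_seq t3').symm) t2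

/-- The number of constructors of a term. -/
def Term.size {K : Type u} : Term K A → ℕ
  | .const _ => 1
  | .zero => 1
  | .one => 1
  | .sym => 1
  | .seq M N => M.size + N.size + 1
  | .tensor M N => M.size + N.size + 1
  | .var _ => 1
  | .link _ _ M => M.size + 1

theorem Term.size_rename {K : Type u} (M : Term K A) (ρ : A → A) : (M.rename ρ).size = M.size := by
  induction M generalizing ρ <;> simp_all [Term.rename, Term.size]

/-- Fresh variables for the wires between two terms that are composed. -/
theorem exists_interface [Infinite A] (F : Finset A) (k : ℕ) (π : A → Bool) {s u : Finset A}
    (h : Before t s u) (hF : s ∪ u ⊆ F) : ∃ (xs ys : List A) (π' : A → Bool) (t' : A → ℚ),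
      xs.length = k ∧ ys.length = k ∧ (xs ++ ys).Nodup ∧ (∀ c ∈ xs ++ ys, c ∉ F) ∧
      (∀ c, c ∉ xs ++ ys → π' c = π c ∧ t' c = t c) ∧ (∀ x ∈ xs, π' x = false) ∧
      (∀ y ∈ ys, π' y = true) ∧ Before t' s xs.toFinset ∧ Before t' xs.toFinset ys.toFinset ∧
      Before t' ys.toFinset u ∧ Before t' s ys.toFinset ∧ Before t' xs.toFinset u ∧
      Before t' s u := by
  obtain ⟨xs, hx, hxn, hxF⟩ := exists_fresh_list F k
  obtain ⟨ys, hy, hyn, hyF⟩ := exists_fresh_list (F ∪ xs.toFinset) k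
  obtain ⟨p, hp1, hp2⟩ := Order.exists_between_finsets (lo := s.image t) (hi := u.image t)
    (by simpa [Before] using h)
  obtain ⟨q, hq1, hq2⟩ := Order.exists_between_finsets (lo := insert p (s.image t))
    (hi := u.image t) (by
      simp only [mem_insert, forall_eq_or_imp]
      exact ⟨hp2, fun a ha b hb => (hp1 a ha).trans (hp2 b hb)⟩)
  have hpq : p < q := hq1 p (by simp)
  have hps : ∀ a ∈ s, t a < p := fun a ha => hp1 _ (mem_image_of_mem t ha)
  have hqu : ∀ a ∈ u, q < t a := fun a ha => hq2 _ (mem_image_of_mem t ha)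
  have hyx : ∀ c ∈ ys, c ∉ xs := fun c hc hc' => hyF c hc (by simp [hc'])
  refine ⟨xs, ys, fun c => if c ∈ xs then false else if c ∈ ys then true else π c,
    fun c => if c ∈ xs then p else if c ∈ ys then q else t c, hx, hy, ?_⟩
  have sx : ∀ c ∈ s, c ∉ xs ∧ c ∉ ys := fun c hc =>
    ⟨fun h => hxF c h (hF (by simp [hc])), fun h => hyF c h (by simp [hF (mem_union_left u hc)])⟩
  have ux : ∀ c ∈ u, c ∉ xs ∧ c ∉ ys := fun c hc =>
    ⟨fun h => hxF c h (hF (by simp [hc])), fun h => hyF c h (by simp [hF (mem_union_right s hc)])⟩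
  refine ⟨hxn.append hyn fun c h h' => hyx c h' h, ?_, ?_, ?_, ?_, ?_, ?_, ?_, ?_, ?_, ?_⟩
  · intro c hc
    rcases mem_append.1 hc with h | h
    · exact hxF c h
    · exact fun h' => hyF c h (by simp [h'])
  · intro c hc
    simp only [mem_append, not_or] at hc
    simp [hc]
  · intro c hc; simp [hc]
  · intro c hc; simp [hc, hyx c hc]
  all_goals
    intro c hc d hd
    try simp only [mem_toFinset] at hc
    try simp only [mem_toFinset] at hd
  · simp [sx c hc, hd, hps c hc]
  · simp [hc, hyx d hd, hd, hpq]
  · simp [hyx c hc, hc, ux d hd, hqu d hd]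
  · simpa [sx c hc, hyx d hd, hd] using (hps c hc).trans hpq
  · simpa [hc, ux d hd] using hpq.trans (hqu d hd)
  · simpa [sx c hc, ux d hd] using h c hc d hd

theorem hasNF_closed_seq [Infinite A]
    (ihM : ∀ {π t as bs}, Timed S π t M m k → Attach π t as bs M.fv → as.length = m →
      bs.length = k → ∀ F, HasNF S π t F (closed as M bs))
    (ihN : ∀ {π t as bs}, Timed S π t N k n → Attach π t as bs N.fv → as.length = k →
      bs.length = n → ∀ F, HasNF S π t F (closed as N bs))
    (hM : Timed S π t M m k) (hN : Timed S π t N k n) (hMN : Before t M.fv N.fv)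
    (h : Attach π t as bs (M ⨟ N).fv) (ha : as.length = m) (hb : bs.length = n) (F : Finset A) :
    HasNF S π t F (closed as (M ⨟ N) bs) := by
  have hC := h.timed (hM.seq hN) ha hb
  obtain ⟨h1, h2, h3, h4, h5, h6, h7⟩ := h
  obtain ⟨xs, ys, π1, t1, hx, hy, hn, hF, hc, hπx, hπy, b1, b2, b3, b4, b5, b6⟩ :=
    exists_interface (t := t) (s := as.toFinset ∪ M.fv) (u := N.fv ∪ bs.toFinset)
      (F ∪ (closed as (M ⨟ N) bs).fv) k π (by
        simp only [Term.fv, before_union_right, before_union_left] at h5 h7; simp [*])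
            (by intro c; simp; tauto)
  have hc' : ∀ c ∈ (closed as (M ⨟ N) bs).fv, π c = π1 c ∧ t c = t1 c := fun c h => by grind
  simp only [fv_closed, Term.fv, mem_union, mem_toFinset] at hc'
  refine HasNF.congr (π := π1) (t := t1) ?_ (by
    intro c h
    simp only [fv_closed, Term.fv, mem_union, mem_toFinset] at h
    exact ⟨(hc' c h).1.symm, (hc' c h).2.symm⟩)
  have hM' := hM.congr (fun c h => (hc' c (.inr (.inl (.inl h)))).1)
    fun c h => (hc' c (.inr (.inl (.inl h)))).2
  have hN' := hN.congr (fun c h => (hc' c (.inr (.inl (.inr h)))).1)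
    fun c h => (hc' c (.inr (.inl (.inr h)))).2
  have pa : ∀ a ∈ as, π1 a = true := fun a h => by rw [← (hc' a (.inl h)).1]; exact h3 a h
  have pb : ∀ a ∈ bs, π1 a = false := fun a h => by grind
  have hMN' : Before t1 M.fv N.fv := b6.subset (by simp) (by simp)
  have hAM : Attach π1 t1 as xs M.fv := by
    refine ⟨h1, hn.of_append_left, pa, hπx, ?_, b1.subset (by simp) (by simp),
      b1.subset (by simp) (by simp)⟩
    intro c h d h'
    grind
  have hAN : Attach π1 t1 ys bs N.fv := by
    refine ⟨hn.of_append_right, h2, hπy, pb, b3.subset (by simp) (by simp), b3.subset (by simp)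
        (by simp), ?_⟩
    intro c h d h'
    grind
  have a1 := hAM.ins_before
  have a2 := hAM.before_outs
  have a3 := hAM.ins_outs
  have a4 := hAN.ins_before
  have a5 := hAN.before_outs
  have a6 := hAN.ins_outs
  have a7 : Before t1 as.toFinset N.fv := b6.subset (by simp) (by simp)
  have a8 : Before t1 as.toFinset bs.toFinset := b6.subset (by simp) (by simp)
  have a9 : Before t1 M.fv bs.toFinset := b6.subset (by simp) (by simp)
  have a10 : Before t1 as.toFinset ys.toFinset := b4.subset (by simp) (by simp)
  have a11 : Before t1 M.fv ys.toFinset := b4.subset (by simp) (by simp)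
  have a12 : Before t1 xs.toFinset N.fv := b5.subset (by simp) (by simp)
  have a13 : Before t1 xs.toFinset bs.toFinset := b5.subset (by simp) (by simp)
  have d1 := a1.disjoint
  have d2 := a2.disjoint
  have d3 := a3.disjoint
  have d4 := a4.disjoint
  have d5 := a5.disjoint
  have d6 := a6.disjoint
  have d7 := a7.disjoint
  have d8 := a8.disjoint
  have d9 := a9.disjoint
  have tA : Timed S π1 t1 (vars as) 0 m := ha ▸ timed_vars_in h1 pa
  have tB : Timed S π1 t1 (vars bs) n 0 := hb ▸ timed_vars_out h2 pb
  have tX : Timed S π1 t1 (vars xs) k 0 := hx ▸ timed_vars_out hAM.nodup_out hπx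
  have tY : Timed S π1 t1 (vars ys) 0 k := hy ▸ timed_vars_in hAN.nodup_in hπy
  have tU : Timed S π1 t1 (vars as ⨟ M) 0 k := tA.seq hM'
  have tV : Timed S π1 t1 (N ⨟ vars bs) k 0 := hN'.seq tB
  have tC := hAM.timed hM' ha hx
  have tD := hAN.timed hN' hy hb
  have hCD : Before t1 (closed as M xs).fv (closed ys N bs).fv := by simp [*]
  have hL : Links π1 t1 (closed as M xs ⊠ₜ closed ys N bs).fv (xs.zip ys) :=
    links_zip (by rw [hx, hy]) hn hπx hπy b2 (by intro a; simp; tauto)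
  have hlk : ∀ c ∈ linkNames (xs.zip ys), c ∉ F := by
    intro c h h'
    obtain ⟨p, hp, e⟩ := mem_linkNames.1 h
    have := of_mem_zip hp
    grind
  have hfin := HasNF.linkAll (HasNF.tensor (ihM hM' hAM ha hx) (ihN hN' hAN hy hb) hCD.disjoint)
    (tC.tensor tD) hL hlk
  refine hfin.of_eqv ?_
  -- the composite is recovered by linking
  have tI : Timed S π1 t1 .zero 0 0 := timed_zero
  have e1 : Eqv S π1 0 0 (closed as (M ⨟ N) bs) ((vars as ⨟ M) ⨟ (N ⨟ vars bs)) := by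
    refine (Eqv.seq_right (Eqv.seq_assoc hM' hN' tB) tA).trans (Eqv.seq_assoc tA hM' tV).symm
  have e2 := Eqv.linkAll_cut (π := π1) (t := t1) (xs := xs) (ys := ys) (j := 0) (by rw [hx, hy]) hn
    hπx hπy (by simp [hx]) tU tV (by simp [*]) (by simp [*]) (by simp [*]) b2 (by simp [*])
    (by simp [*])
  have e3 : Eqv S π1 0 0 (closed as M xs ⊠ₜ closed ys N bs)
      (((vars as ⨟ M) ⨟ (ident 0 ⊠ₜ vars xs)) ⨟ (ident 0 ⊠ₜ vars ys) ⨟ (N ⨟ vars bs)) := by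
    refine (Eqv.tensor_seq_left tC tD).trans (Eqv.seq (k := 0)
      ((Eqv.tensor_zero tC).trans ?_) ((Eqv.zero_tensor tD).trans ?_) ?_)
    · refine (Eqv.seq_assoc tA hM' tX).symm.trans ?_
      exact Eqv.seq_right (Eqv.zero_tensor tX).symm tU
    · exact Eqv.seq_left (Eqv.zero_tensor tY).symm tV
    · simpa using hCD.disjoint
  have tE : Timed S π1 t1 (((vars as ⨟ M) ⨟ (ident 0 ⊠ₜ vars xs)) ⨟ (ident 0 ⊠ₜ vars ys) ⨟
      (N ⨟ vars bs)) 0 0 :=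
    (tU.seq (k := k) (timed_ident_vars_out hAM.nodup_out hπx 0 (by simp [hx]))).seq
      ((timed_ident_vars_in hAN.nodup_in hπy 0 (by simp [hy])).seq tV)
  exact e1.trans (e2.symm.trans (Eqv.linkAll e3.symm (tE.linkAll (hL.mono (by
    intro c; simp [closed]; try tauto))) ((tC.tensor tD).linkAll hL) hL.fst_out hL.snd_in))

theorem hasNF_closed_tensor
    (ihM : ∀ {π t as bs}, Timed S π t M m₁ n₁ → Attach π t as bs M.fv → as.length = m₁ →
      bs.length = n₁ → ∀ F, HasNF S π t F (closed as M bs))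
    (ihN : ∀ {π t as bs}, Timed S π t N m₂ n₂ → Attach π t as bs N.fv → as.length = m₂ →
      bs.length = n₂ → ∀ F, HasNF S π t F (closed as N bs))
    (hM : Timed S π t M m₁ n₁) (hN : Timed S π t N m₂ n₂) (hMN : Disjoint M.fv N.fv)
    (h : Attach π t as bs (M ⊠ₜ N).fv) (ha : as.length = m₁ + m₂) (hb : bs.length = n₁ + n₂)
    (F : Finset A) : HasNF S π t F (closed as (M ⊠ₜ N) bs) := by
  obtain ⟨a₁, a₂, rfl, ha1, ha2⟩ : ∃ a₁ a₂, as = a₁ ++ a₂ ∧ a₁.length = m₁ ∧ a₂.length = m₂ :=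
    ⟨as.take m₁, as.drop m₁, (List.take_append_drop _ _).symm, by simp [ha], by simp [ha]⟩
  obtain ⟨b1, b2, rfl, hb1, hb2⟩ : ∃ b1 b2, bs = b1 ++ b2 ∧ b1.length = n₁ ∧ b2.length = n₂ :=
    ⟨bs.take n₁, bs.drop n₁, (List.take_append_drop _ _).symm, by simp [hb], by simp [hb]⟩
  obtain ⟨h1, h2, h3, h4, h5, h6, h7⟩ := h
  have a1 : Before t a₁.toFinset M.fv := h5.subset (by simp) (by simp)
  have a2 : Before t a₁.toFinset N.fv := h5.subset (by simp) (by simp)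
  have a3 : Before t a₂.toFinset M.fv := h5.subset (by simp) (by simp)
  have a4 : Before t a₂.toFinset N.fv := h5.subset (by simp) (by simp)
  have a5 : Before t a₁.toFinset b1.toFinset := h6.subset (by simp) (by simp)
  have a6 : Before t a₁.toFinset b2.toFinset := h6.subset (by simp) (by simp)
  have a7 : Before t a₂.toFinset b1.toFinset := h6.subset (by simp) (by simp)
  have a8 : Before t a₂.toFinset b2.toFinset := h6.subset (by simp) (by simp)
  have a9 : Before t M.fv b1.toFinset := h7.subset (by simp) (by simp)
  have a10 : Before t M.fv b2.toFinset := h7.subset (by simp) (by simp)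
  have a11 : Before t N.fv b1.toFinset := h7.subset (by simp) (by simp)
  have a12 : Before t N.fv b2.toFinset := h7.subset (by simp) (by simp)
  have i1 : ∀ a ∈ a₁, π a = true := fun a h => h3 a (by simp [h])
  have i2 : ∀ a ∈ a₂, π a = true := fun a h => h3 a (by simp [h])
  have o1 : ∀ a ∈ b1, π a = false := fun a h => h4 a (by simp [h])
  have o2 : ∀ a ∈ b2, π a = false := fun a h => h4 a (by simp [h])
  have e1 := a1.disjoint
  have e2 := a2.disjoint
  have e3 := a3.disjoint
  have e4 := a4.disjoint
  have e5 := a5.disjoint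
  have e6 := a6.disjoint
  have e7 := a7.disjoint
  have e8 := a8.disjoint
  have e9 := a9.disjoint
  have e10 := a10.disjoint
  have e11 := a11.disjoint
  have e12 := a12.disjoint
  have hAM : Attach π t a₁ b1 M.fv := ⟨h1.of_append_left, h2.of_append_left, i1, o1, a1,
    a5, a9⟩
  have hAN : Attach π t a₂ b2 N.fv := ⟨h1.of_append_right, h2.of_append_right, i2, o2, a4,
    a8, a12⟩
  have da : Disjoint a₁.toFinset a₂.toFinset := by grind
  have db : Disjoint b1.toFinset b2.toFinset := by grind
  have hd : Disjoint (closed a₁ M b1).fv (closed a₂ N b2).fv := by grind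
  refine (HasNF.tensor (ihM hM hAM ha1 hb1) (ihN hN hAN ha2 hb2) hd F).of_eqv ?_
  have tA1 : Timed S π t (vars a₁) 0 m₁ := ha1 ▸ timed_vars_in hAM.nodup_in i1
  have tA2 : Timed S π t (vars a₂) 0 m₂ := ha2 ▸ timed_vars_in hAN.nodup_in i2
  have tB1 : Timed S π t (vars b1) n₁ 0 := hb1 ▸ timed_vars_out hAM.nodup_out o1
  have tB2 : Timed S π t (vars b2) n₂ 0 := hb2 ▸ timed_vars_out hAN.nodup_out o2
  have eA : Eqv S π 0 (m₁ + m₂) (vars (a₁ ++ a₂)) (vars a₁ ⊠ₜ vars a₂) :=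
    (Eqv.vars_append_in h1 h3).cast rfl (by rw [ha1, ha2])
  have eB : Eqv S π (n₁ + n₂) 0 (vars (b1 ++ b2)) (vars b1 ⊠ₜ vars b2) :=
    (Eqv.vars_append_out h2 h4).cast (by rw [hb1, hb2]) rfl
  have tMB := hM.seq tB1
  have tNB := hN.seq tB2
  refine (eA.seq (Eqv.seq_right eB (hM.tensor hN) ?_) ?_).trans ?_
  · simp [disjoint_union_left, disjoint_union_right, *]
  · simp only [Term.fv, fv_vars, List.toFinset_append, disjoint_union_left,
      disjoint_union_right]
    and_intros <;> assumption
  have hd' : Disjoint (M ⨟ vars b1).fv (N ⨟ vars b2).fv := by simp_all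
  refine (Eqv.seq_right (k := m₁ + m₂) (Eqv.interchange hM tB1 hN tB2).symm (tA1.tensor tA2)
      ?_).trans ?_
  · simp only [Term.fv, fv_vars, disjoint_union_left, disjoint_union_right]
    and_intros <;> assumption
  exact (Eqv.interchange tA1 tMB tA2 tNB).symm

theorem hasNF_closed_link [Infinite A]
    (ih : ∀ {M' : Term S.Const A} {π t as bs}, M'.size = M.size → Timed S π t M' m n →
      Attach π t as bs M'.fv → as.length = m → bs.length = n →
      ∀ F, HasNF S π t F (closed as M' bs))
    (hM : Timed S π t (.link x y M) m n) (h : Attach π t as bs (Term.link x y M).fv)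
    (ha : as.length = m) (hb : bs.length = n) (F : Finset A) :
    HasNF S π t F (closed as (.link x y M) bs) := by
  -- the bound names are made different from all other names
  obtain ⟨c, hc, hcn, hcF⟩ := exists_fresh_list (F ∪ M.names ∪ as.toFinset ∪ bs.toFinset) 2
  obtain ⟨x', y', rfl⟩ := List.length_eq_two.1 hc
  clear hc
  simp only [nodup_cons, mem_cons, List.not_mem_nil, or_false, not_false_eq_true,
    List.nodup_nil, and_true] at hcn
  simp only [mem_cons, List.not_mem_nil, or_false, forall_eq_or_imp, forall_eq,
    mem_union, not_or, mem_toFinset] at hcF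
  obtain ⟨⟨⟨⟨xF, xM⟩, xa⟩, xb⟩, ⟨⟨yF, yM⟩, ya⟩, yb⟩ := hcF
  have e := Eqv.alpha hM xM yM hcn
  have hM' := hM.alpha xM yM hcn
  set M' := M.rename₂ x y x' y' with hM'def
  have h' : Attach π t as bs (Term.link x' y' M').fv := by rwa [e.1] at h
  obtain ⟨h1, h2, h3, h4, h5, h6, h7⟩ := h
  have tC := Attach.timed ⟨h1, h2, h3, h4, h5, h6, h7⟩ hM ha hb
  obtain ⟨p, q, hpq, hT, hp, hq⟩ := hM'.link_within h'.ins_before h'.before_outs h6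
  have hx' : x' ∈ M'.fv := hM'.2.1
  have hy' : y' ∈ M'.fv := hM'.2.2.1
  set π1 := update (update π x' false) y' true with hπ1
  set t1 := update (update t x' p) y' q with ht1
  have πx : π1 x' = false := by simp [hπ1, hcn]
  have πy : π1 y' = true := by simp [hπ1]
  have tx : t1 x' = p := by simp [ht1, hcn]
  have ty : t1 y' = q := by simp [ht1]
  have hag : ∀ c, c ≠ x' → c ≠ y' → π1 c = π c ∧ t1 c = t c := fun c h h' => by
    simp [hπ1, ht1, h, h']
  have haga : ∀ c ∈ as, π1 c = π c ∧ t1 c = t c := fun c hc =>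
    hag c (by rintro rfl; exact xa hc) (by rintro rfl; exact ya hc)
  have hagb : ∀ c ∈ bs, π1 c = π c ∧ t1 c = t c := fun c hc =>
    hag c (by rintro rfl; exact xb hc) (by rintro rfl; exact yb hc)
  have ins : ∀ c ∈ as, π1 c = true := fun c hc => by rw [(haga c hc).1]; exact h3 c hc
  have outs : ∀ c ∈ bs, π1 c = false := fun c hc => by rw [(hagb c hc).1]; exact h4 c hc
  have hA : Attach π1 t1 as bs M'.fv := by
    refine ⟨h1, h2, ins, outs, ?_, ?_, ?_⟩
    · intro c hc d hd
      have hc' : c ∈ as := by simpa using hc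
      rw [(haga c hc').2]
      by_cases dx : d = x'
      · simp_all
      by_cases dy : d = y'
      · grind
      rw [(hag d dx dy).2]
      exact h'.ins_before c hc d (by simp [hd, dx, dy])
    · grind
    · intro c hc d hd
      have hd' : d ∈ bs := by simpa using hd
      rw [(hagb d hd').2]
      by_cases cx : c = x'
      · grind
      by_cases cy : c = y'
      · simp_all
      rw [(hag c cx cy).2]
      exact h'.before_outs c (by simp [hc, cx, cy]) d hd
  have tM'B := hT.seq (hb ▸ timed_vars_out h2 outs) (by simpa using hA.before_outs)
  have tA : Timed S π1 t1 (vars as) 0 m := ha ▸ timed_vars_in h1 ins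
  have tB : Timed S π1 t1 (vars bs) n 0 := hb ▸ timed_vars_out h2 outs
  have tCl : Timed S π1 t1 (closed as M' bs) 0 0 := hA.timed hT ha hb
  have hL : Links π1 t1 (closed as M' bs).fv [(x', y')] :=
    ⟨by simp [hcn], by simp [hx'], by simp [hy'], by simp [πx], by simp [πy], by simp [tx, ty, hpq]⟩
  have hsub : (Term.link x' y' M').fv ⊆ M'.fv := sdiff_subset
  have hfvC : ∀ c ∈ (closed as (.link x y M) bs).fv, π1 c = π c ∧ t1 c = t c := by
    intro c hc
    rw [fv_closed, e.1] at hc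
    simp only [mem_union, mem_toFinset, Term.fv, mem_sdiff, mem_insert,
      mem_singleton, not_or] at hc
    grind
  refine HasNF.congr (π := π1) (t := t1) (HasNF.of_eqv (HasNF.linkAll (ih (by
    rw [hM'def, rename₂, Term.size_rename]) hT hA ha hb) tCl hL (by simp [xF, yF])) ?_) hfvC
  have l1 : Timed S π1 t1 (.link x' y' M') m n :=
    hT.link_of πx πy hx' hy' (by rw [tx, ty]; exact hpq)
  have l2 : Timed S π1 t1 (.link x' y' (M' ⨟ vars bs)) m 0 :=
    tM'B.link_of πx πy (by simp [hx']) (by simp [hy']) (by rw [tx, ty]; exact hpq)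
  have l3 : Timed S π1 t1 (.link x' y' (closed as M' bs)) 0 0 := tCl.linkAll hL
  have e0 : Eqv S π1 0 0 (closed as (.link x y M) bs) (closed as (.link x' y' M') bs) := by
    have : Eqv S π1 m n (.link x y M) (.link x' y' M') :=
      e.congr fun c hc => (hfvC c (by rw [fv_closed]; simp only [mem_union]; tauto)).1.symm
    refine Eqv.seq_right (Eqv.seq_left this tB ?_) tA ?_
    all_goals grind
  refine e0.trans ((Eqv.seq_right (Eqv.extrude_seq_left l1 tB l2 ?_).symm tA ?_).trans
      (Eqv.extrude_seq_right tA l2 l3 ?_ (by simpa using xa)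
    (by simpa using ya)).symm)
  · simpa using hA.before_outs.subset (s' := M'.fv \ {x', y'}) sdiff_subset subset_rfl
  · rw [Term.fv, fv_vars, fv_vars, disjoint_union_right]
    exact ⟨(hA.ins_before.subset subset_rfl hsub).disjoint, hA.ins_outs.disjoint⟩
  · refine Before.subset (s := as.toFinset) (u := M'.fv ∪ bs.toFinset) ?_ (by simp) ?_
    · simpa using ⟨hA.ins_before, hA.ins_outs⟩
    · simp [sdiff_subset]

/-- Every term whose ports are connected to variables has a normal form. -/
theorem hasNF_closed [Infinite A] (s : ℕ) : ∀ {M : Term S.Const A} {π t as bs m n}, M.size ≤ s →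
    Timed S π t M m n → Attach π t as bs M.fv → as.length = m → bs.length = n →
    ∀ F, HasNF S π t F (closed as M bs) := by
  induction s with
  | zero =>
    intro M _ _ _ _ _ _ h
    cases M <;> simp [Term.size] at h
  | succ s ih =>
    intro M π t as bs m n hs hM hA ha hb F
    cases M with
    | const k =>
      obtain ⟨rfl, rfl⟩ := hM
      exact HasNF.closed_atom (o := some k) hA ha hb
    | one =>
      obtain ⟨rfl, rfl⟩ := hM
      exact HasNF.closed_atom (o := none) hA ha hb
    | zero =>
      obtain ⟨rfl, rfl⟩ := hM
      obtain rfl := List.length_eq_zero_iff.1 ha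
      obtain rfl := List.length_eq_zero_iff.1 hb
      have h0 : Timed S π t .zero 0 0 := timed_zero
      exact (AtomsOk.nil.hasNF (F := F)).of_eqv ((Eqv.ident_seq (h0.seq h0)).trans
        (Eqv.ident_seq h0))
    | sym =>
      obtain ⟨rfl, rfl⟩ := hM
      exact HasNF.closed_sym hA ha hb
    | var x =>
      rcases hM with ⟨hx, rfl, rfl⟩ | ⟨hx, rfl, rfl⟩
      · obtain rfl := List.length_eq_zero_iff.1 ha
        exact HasNF.closed_var_in hA hx hb
      · obtain rfl := List.length_eq_zero_iff.1 hb
        exact HasNF.closed_var_out hA hx ha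
    | seq M N =>
      obtain ⟨k, hM, hN, hMN⟩ := hM
      simp only [Term.size] at hs
      exact hasNF_closed_seq (fun h => ih (by omega) h) (fun h => ih (by omega) h) hM hN hMN hA ha
        hb F
    | tensor M N =>
      obtain ⟨m1, m2, n1, n2, rfl, rfl, hM, hN, hMN⟩ := hM
      simp only [Term.size] at hs
      exact hasNF_closed_tensor (fun h => ih (by omega) h) (fun h => ih (by omega) h) hM hN hMN hA
        ha hb F
    | link x y M =>
      simp only [Term.size] at hs
      exact hasNF_closed_link (fun h1 h => ih (by omega) h) hM hA ha hb F

/-! ### Cancellation of attached variables -/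

variable {z : A} {xs ys : List A}

theorem exists_after (t : A → ℚ) (s : Finset A) {ys : List A} (hy : ∀ y ∈ ys, y ∉ s) :
    ∃ t' : A → ℚ, (∀ c, c ∉ ys → t' c = t c) ∧ Before t' s ys.toFinset := by
  obtain ⟨p, hp, -⟩ := Order.exists_between_finsets (lo := s.image t) (hi := ∅) (by simp)
  refine ⟨fun c => if c ∈ ys then p else t c, fun c hc => by simp [hc], fun c hc d hd => ?_⟩
  have : c ∉ ys := fun h => hy c h hc
  simp only [this, if_false, mem_toFinset.1 hd, if_true]
  exact hp _ (mem_image_of_mem t hc)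

theorem exists_before (t : A → ℚ) (s : Finset A) {xs : List A} (hx : ∀ x ∈ xs, x ∉ s) :
    ∃ t' : A → ℚ, (∀ c, c ∉ xs → t' c = t c) ∧ Before t' xs.toFinset s := by
  obtain ⟨p, -, hp⟩ := Order.exists_between_finsets (lo := ∅) (hi := s.image t) (by simp)
  refine ⟨fun c => if c ∈ xs then p else t c, fun c hc => by simp [hc], fun d hd c hc => ?_⟩
  have : c ∉ xs := fun h => hx c h hc
  simp only [this, if_false, mem_toFinset.1 hd, if_true]
  exact hp _ (mem_image_of_mem t hc)

theorem Before.congr {s u : Finset A} (h : Before t s u) (hs : ∀ c ∈ s, t' c = t c)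
    (hu : ∀ c ∈ u, t' c = t c) : Before t' s u :=
  fun c hc d hd => by rw [hs c hc, hu d hd]; exact h c hc d hd

/-- Variables attached to the outputs can be removed by linking them with fresh variables. -/
theorem Eqv.detach_out (hQ : Timed S π t Q m n) (hb : bs.length = n) (hy : ys.length = n)
    (hn : (bs ++ ys).Nodup) (hπb : ∀ b ∈ bs, π b = false) (hπy : ∀ y ∈ ys, π y = true)
    (hQb : Before t Q.fv bs.toFinset) (hyQ : ∀ y ∈ ys, y ∉ Q.fv) :
    (∃ t', Timed S π t' (LinkSyntax.linkAll (bs.zip ys) ((Q ⨟ vars bs) ⨟ vars ys)) m n) ∧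
      Eqv S π m n (LinkSyntax.linkAll (bs.zip ys) ((Q ⨟ vars bs) ⨟ vars ys)) Q := by
  have hbn := hn.of_append_left
  have hyn := hn.of_append_right
  have hby := disjoint_of_nodup_append hn
  obtain ⟨t1, ht, h1⟩ := exists_after t (Q.fv ∪ bs.toFinset) (ys := ys) (by
    intro y hy
    simp only [mem_union, mem_toFinset, not_or]
    exact ⟨hyQ y hy, fun h => hby h hy⟩)
  have h2 : Before t1 Q.fv ys.toFinset := h1.subset (by simp) subset_rfl
  have h3 : Before t1 bs.toFinset ys.toFinset := h1.subset (by simp) subset_rfl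
  have hQ1 : ∀ c ∈ Q.fv, t1 c = t c := fun c hc => ht c fun h => hyQ c h hc
  have hb1 : ∀ c ∈ bs.toFinset, t1 c = t c := fun c hc => ht c fun h => hby (by simpa using hc) h
  have hQb1 : Before t1 Q.fv bs.toFinset := hQb.congr hQ1 hb1
  have tQ : Timed S π t1 Q m n := hQ.congr (fun _ _ => rfl) fun c hc => (hQ1 c hc).symm
  have tB : Timed S π t1 (vars bs) n 0 := hb ▸ timed_vars_out hbn hπb
  have tY : Timed S π t1 (vars ys) 0 n := hy ▸ timed_vars_in hyn hπy
  have tB' := timed_ident_vars_out (S := S) (t := t1) hbn hπb 0 (k := n) (by simp [hb])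
  have tY' := timed_ident_vars_in (S := S) (t := t1) hyn hπy 0 (k := n) (by simp [hy])
  have tI : Timed S π t1 (ident n) n n := timed_ident n
  have hl : Links π t1 ((Q ⨟ vars bs) ⨟ vars ys).fv (bs.zip ys) :=
    links_zip (by rw [hb, hy]) hn hπb hπy h3 (by intro a; simp; tauto)
  have tl := ((tQ.seq tB).seq tY).linkAll hl
  refine ⟨⟨t1, tl⟩, ?_⟩
  have tl' := ((tQ.seq tB').seq (tY'.seq tI)).linkAll (L := bs.zip ys)
      (hl.mono (by intro c; simp; try tauto))
  refine (Eqv.linkAll (Eqv.seq (k := 0) ?_ ?_ ?_) tl tl' hl.fst_out hl.snd_in).trans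
    ((Eqv.linkAll_cut (by rw [hb, hy]) hn hπb hπy (by simp [hb]) tQ tI hQb1 h2 (by simp) h3
      (by simp) (by simp)).trans (Eqv.seq_ident tQ))
  · exact Eqv.seq_right (Eqv.zero_tensor tB).symm tQ (by simpa using hQb1.disjoint)
  · exact (Eqv.zero_tensor tY).symm.trans (Eqv.seq_ident tY').symm
  · rw [Term.fv.eq_5, disjoint_union_left, fv_vars, fv_vars]
    exact ⟨h2.disjoint, h3.disjoint⟩

/-- Variables attached to the inputs can be removed by linking them with fresh variables. -/
theorem Eqv.detach_in (hQ : Timed S π t Q m n) (ha : as.length = m) (hx : xs.length = m)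
    (hn : (xs ++ as).Nodup) (hπx : ∀ x ∈ xs, π x = false) (hπa : ∀ a ∈ as, π a = true)
    (hQa : Before t as.toFinset Q.fv) (hxQ : ∀ x ∈ xs, x ∉ Q.fv) :
    (∃ t', Timed S π t' (LinkSyntax.linkAll (xs.zip as) (vars xs ⨟ (vars as ⨟ Q))) m n) ∧
      Eqv S π m n (LinkSyntax.linkAll (xs.zip as) (vars xs ⨟ (vars as ⨟ Q))) Q := by
  have hxn := hn.of_append_left
  have han := hn.of_append_right
  have hxa := disjoint_of_nodup_append hn
  obtain ⟨t1, ht, h1⟩ := exists_before t (Q.fv ∪ as.toFinset) (xs := xs) (by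
    intro y hy
    simp only [mem_union, mem_toFinset, not_or]
    exact ⟨hxQ y hy, fun h => hxa hy h⟩)
  have h2 : Before t1 xs.toFinset Q.fv := h1.subset subset_rfl (by simp)
  have h3 : Before t1 xs.toFinset as.toFinset := h1.subset subset_rfl (by simp)
  have hQ1 : ∀ c ∈ Q.fv, t1 c = t c := fun c hc => ht c fun h => hxQ c h hc
  have hb1 : ∀ c ∈ as.toFinset, t1 c = t c := fun c hc => ht c fun h => hxa h (by simpa using hc)
  have hQa1 : Before t1 as.toFinset Q.fv := hQa.congr hb1 hQ1
  have tQ : Timed S π t1 Q m n := hQ.congr (fun _ _ => rfl) fun c hc => (hQ1 c hc).symm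
  have tX : Timed S π t1 (vars xs) m 0 := hx ▸ timed_vars_out hxn hπx
  have tA : Timed S π t1 (vars as) 0 m := ha ▸ timed_vars_in han hπa
  have tX' := timed_ident_vars_out (S := S) (t := t1) hxn hπx 0 (k := m) (by simp [hx])
  have tA' := timed_ident_vars_in (S := S) (t := t1) han hπa 0 (k := m) (by simp [ha])
  have tI : Timed S π t1 (ident m) m m := timed_ident m
  have hl : Links π t1 (vars xs ⨟ (vars as ⨟ Q)).fv (xs.zip as) :=
    links_zip (by rw [hx, ha]) hn hπx hπa h3 (by intro a; simp; tauto)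
  have tl := (tX.seq (tA.seq tQ)).linkAll hl
  refine ⟨⟨t1, tl⟩, ?_⟩
  have tl' := ((tI.seq tX').seq (tA'.seq tQ)).linkAll (L := xs.zip as) (hl.mono (by intro c; simp))
  refine (Eqv.linkAll (Eqv.seq (k := 0) ?_ ?_ ?_) tl tl' hl.fst_out hl.snd_in).trans
    ((Eqv.linkAll_cut (by rw [hx, ha]) hn hπx hπa (by simp [hx]) tI tQ (by simp) (by simp)
      (by simp) h3 h2 hQa1).trans (Eqv.ident_seq tQ))
  · exact (Eqv.zero_tensor tX).symm.trans (Eqv.ident_seq tX').symm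
  · exact Eqv.seq_left (Eqv.zero_tensor tA).symm tQ (by simpa using hQa1.disjoint)
  · rw [Term.fv.eq_5, disjoint_union_right, fv_vars, fv_vars]
    exact ⟨h3.disjoint, h2.disjoint⟩

/-- Terms are provably equal if they are after variables have been attached to all ports. -/
theorem Eqv.of_closed [Infinite A] (h : Eqv S π 0 0 (closed as M bs) (closed as N bs))
    (hM : Timed S π t M m n) (hN : Timed S π t' N m n) (hfv : M.fv = N.fv) (ha : as.length = m)
    (hb : bs.length = n) (hAM : Attach π t as bs M.fv) (hAN : Attach π t' as bs N.fv) :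
    Eqv S π m n M N := by
  obtain ⟨xs, hx, hxn, hxF⟩ := exists_fresh_list (M.fv ∪ as.toFinset ∪ bs.toFinset) m
  obtain ⟨ys, hy, hyn, hyF⟩ := exists_fresh_list (M.fv ∪ as.toFinset ∪ bs.toFinset ∪ xs.toFinset) n
  simp only [mem_union, mem_toFinset, not_or] at hxF hyF
  set π1 : A → Bool := fun c => if c ∈ xs then false else if c ∈ ys then true else π c with hπ1
  have hag : ∀ c, c ∉ xs → c ∉ ys → π c = π1 c := fun c h h' => by simp [hπ1, h, h']
  have hga : ∀ c ∈ as, π c = π1 c := fun c h =>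
    hag c (fun h' => (hxF c h').1.2 h) fun h' => (hyF c h').1.1.2 h
  have hgb : ∀ c ∈ bs, π c = π1 c := fun c h =>
    hag c (fun h' => (hxF c h').2 h) fun h' => (hyF c h').1.2 h
  have hgM : ∀ c ∈ M.fv, π c = π1 c := fun c h =>
    hag c (fun h' => (hxF c h').1.1 h) fun h' => (hyF c h').1.1.1 h
  have hπx : ∀ c ∈ xs, π1 c = false := fun c h => by simp [hπ1, h]
  have hπy : ∀ c ∈ ys, π1 c = true := fun c h => by grind
  have hπa : ∀ c ∈ as, π1 c = true := fun c h => by rw [← hga c h]; exact hAM.ins_in c h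
  have hπb : ∀ c ∈ bs, π1 c = false := fun c h => by rw [← hgb c h]; exact hAM.outs_out c h
  have hby : (bs ++ ys).Nodup := hAM.nodup_out.append hyn fun c h h' => (hyF c h').1.2 h
  have hxa : (xs ++ as).Nodup := hxn.append hAM.nodup_in fun c h h' => (hxF c h).1.2 h'
  have key : ∀ {t : A → ℚ} {M1 : Term S.Const A}, Timed S π t M1 m n → M1.fv = M.fv →
      Attach π t as bs M1.fv → Timed S π1 t M1 m n ∧ Timed S π1 t (vars as ⨟ M1) 0 n ∧
        Timed S π1 t (vars bs) n 0 ∧ Eqv S π1 0 0 ((vars as ⨟ M1) ⨟ vars bs) (closed as M1 bs) := by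
    intro t M1 hM hf hA
    have tM := hM.congr (fun c h => hgM c (hf ▸ h)) fun _ _ => rfl
    have tA : Timed S π1 t (vars as) 0 m := ha ▸ timed_vars_in hAM.nodup_in hπa
    have tB : Timed S π1 t (vars bs) n 0 := hb ▸ timed_vars_out hAM.nodup_out hπb
    exact ⟨tM, tA.seq tM (by simpa using hA.ins_before), tB, Eqv.seq_assoc tA tM tB
      (by simpa using hA.ins_before) (by simpa using hA.ins_outs) (by simpa using hA.before_outs)⟩
  obtain ⟨tM, tAM, tB, eM⟩ := key hM rfl hAM
  obtain ⟨tN, tAN, tB', eN⟩ := key hN hfv.symm hAN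
  have h' := h.congr (π' := π1) fun c hc => by
    rw [fv_closed] at hc
    simp only [mem_union, mem_toFinset] at hc
    grind
  have bM : Before t (vars as ⨟ M).fv bs.toFinset := by
    simpa using ⟨hAM.ins_outs, hAM.before_outs⟩
  have bN : Before t' (vars as ⨟ N).fv bs.toFinset := by
    simpa using ⟨hAN.ins_outs, hAN.before_outs⟩
  have yM : ∀ y ∈ ys, y ∉ (vars as ⨟ M).fv := fun c hc => by
    simpa using ⟨(hyF c hc).1.1.2, (hyF c hc).1.1.1⟩
  have yN : ∀ y ∈ ys, y ∉ (vars as ⨟ N).fv := fun c hc => by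
    simpa [← hfv] using ⟨(hyF c hc).1.1.2, (hyF c hc).1.1.1⟩
  -- the outputs
  obtain ⟨⟨t1, ht1⟩, d1⟩ := Eqv.detach_out tAM hb hy hby hπb hπy bM yM
  obtain ⟨⟨t2, ht2⟩, d2⟩ := Eqv.detach_out tAN hb hy hby hπb hπy bN yN
  have tY : Timed S π1 t (vars ys) 0 n := hy ▸ timed_vars_in hyn hπy
  have p1 : ∀ p ∈ bs.zip ys, π1 p.1 = false := fun p hp => hπb _ (of_mem_zip hp).1
  have p2 : ∀ p ∈ bs.zip ys, π1 p.2 = true := fun p hp => hπy _ (of_mem_zip hp).2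
  have e1 : Eqv S π1 0 n (vars as ⨟ M) (vars as ⨟ N) := by
    refine d1.symm.trans ((Eqv.linkAll (Eqv.seq_left (eM.trans (h'.trans eN.symm)) tY ?_) ht1 ht2
      p1 p2).trans d2)
    rw [disjoint_left]
    intro c hc hc'
    rw [fv_vars, mem_toFinset] at hc'
    have := hyF c hc'
    simp at hc
    tauto
  -- the inputs
  have xM : ∀ x ∈ xs, x ∉ M.fv := fun c hc => (hxF c hc).1.1
  obtain ⟨⟨t3, ht3⟩, d3⟩ := Eqv.detach_in tM ha hx hxa hπx hπa hAM.ins_before xM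
  obtain ⟨⟨t4, ht4⟩, d4⟩ := Eqv.detach_in tN ha hx hxa hπx hπa hAN.ins_before (hfv ▸ xM)
  have tX : Timed S π1 t (vars xs) m 0 := hx ▸ timed_vars_out hxn hπx
  have q1 : ∀ p ∈ xs.zip as, π1 p.1 = false := fun p hp => hπx _ (of_mem_zip hp).1
  have q2 : ∀ p ∈ xs.zip as, π1 p.2 = true := fun p hp => hπa _ (of_mem_zip hp).2
  refine Eqv.congr (π := π1) (d3.symm.trans ((Eqv.linkAll (Eqv.seq_right e1 tX ?_) ht3 ht4 q1
    q2).trans d4)) fun c hc => (hgM c hc).symm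
  rw [disjoint_left]
  intro c hc hc'
  rw [fv_vars, mem_toFinset] at hc
  have := hxF c hc
  simp at hc'
  tauto

/-! ### Elimination of wires -/

variable {l₁ l₂ : List A}

theorem timed_wire (hy : π y = true) (hz : π z = false) (h : t y < t z) :
    Timed S π t (closed [y] .one [z]) 0 0 :=
  Attach.timed ⟨by simp, by simp, by simp [hy], by simp [hz], by simp, by simpa using h, by simp⟩
    timed_one rfl rfl

/-- A wire from `y` to `z` that is linked to the output variable `x` renames it to `z`. -/
theorem Eqv.link_vars_wire (hn : (l₁ ++ x :: l₂).Nodup) (hπ : ∀ c ∈ l₁ ++ x :: l₂, π c = false)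
    (hy : π y = true) (hz : π z = false) (hzl : z ∉ l₁ ++ x :: l₂) :
    Eqv S π (l₁ ++ x :: l₂).length 0 (.link x y (vars (l₁ ++ x :: l₂) ⨟ closed [y] .one [z]))
      (vars (l₁ ++ z :: l₂)) := by
  have hyz : y ≠ z := by rintro rfl; simp [hy] at hz
  have hyl : ∀ c ∈ l₁ ++ x :: l₂, c ≠ y := by rintro c hc rfl; simp [hπ c hc] at hy
  have hxy : x ≠ y := hyl x (by simp)
  have hxz : x ≠ z := fun h => hzl (by simp [h])
  -- a schedule in which the wire comes last
  set τ : A → ℚ := fun c => if c = y then 2 else if c = z then 3 else if c = x then 1 else 0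
  have τy : τ y = 2 := by simp [τ]
  have τz : τ z = 3 := by simp [τ, hyz.symm]
  have τx : τ x = 1 := by simp [τ, hxy, hxz]
  have hlt : ∀ c ∈ l₁ ++ x :: l₂, τ c ≤ 1 := by grind
  have hlx : ∀ c ∈ l₁ ++ x :: l₂, c ≠ x → τ c = 0 := by grind
  clear_value τ
  have tW : Timed S π τ (closed [y] .one [z]) 0 0 := timed_wire hy hz (by rw [τy, τz]; norm_num)
  have hxπ := hπ x (by simp)
  have yz : τ y < τ z := by rw [τy, τz]; norm_num
  have xy : τ x < τ y := by rw [τy, τx]; norm_num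
  have xz := xy.trans yz
  induction l₁ with
  | nil =>
    simp only [List.nil_append] at hn hπ hzl hyl hlt hlx ⊢
    have hxl : x ∉ l₂ := (nodup_cons.1 hn).1
    have hl : l₂.Nodup := (nodup_cons.1 hn).2
    have hπl : ∀ c ∈ l₂, π c = false := fun c hc => hπ c (by simp [hc])
    have yl : y ∉ l₂ := fun h => hyl y (by simp [h]) rfl
    have zl : z ∉ l₂ := fun h => hzl (by simp [h])
    have blx : Before τ l₂.toFinset {x} := by grind
    have bly := blx.trans_singleton (before_singleton.2 xy)
    have blz := blx.trans_singleton (before_singleton.2 xz)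
    have tX : Timed S π τ (.var x) 1 0 := timed_var_out hxπ
    have tY : Timed S π τ (.var y) 0 1 := timed_var_in hy
    have tZ : Timed S π τ (.var z) 1 0 := timed_var_out hz
    have tZ' : Timed S π τ (vars [z]) 1 0 := timed_vars_out (by simp) (by simp [hz])
    have tL := timed_vars_out (S := S) (t := τ) hl hπl
    have tU : Timed S π τ (ident 1 ⊠ₜ vars l₂) (1 + l₂.length) 1 :=
      (timed_ident 1).tensor tL
    have tX' := timed_ident_tensor_out (S := S) (t := τ) hxπ 0
    have tXL := timed_vars_out (S := S) (t := τ) hn hπ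
    obtain ⟨⟨t₁, h₁⟩, c1⟩ := Eqv.link_cut (π := π) (k := 0) hxy tU tZ' (by simpa using blz)
      (by simpa using hxl) (by simpa using hxz) (by simpa using yl) (by simpa using hyz)
    have hlen : (x :: l₂).length = 1 + l₂.length := by simp [add_comm]
    have hlhs : Timed S π τ (.link x y (vars (x :: l₂) ⨟ closed [y] .one [z])) (x :: l₂).length 0 :=
      (tXL.seq tW).link_of hxπ hy (by simp) (by simp) xy
    rw [hlen] at hlhs ⊢
    refine (Eqv.link_of ?_ hlhs h₁ hxπ hy).trans (c1.trans ?_)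
    · refine Eqv.seq (k := 0) ?_ ?_ ?_
      · exact (Eqv.tensor_seq_right tX tL).trans (Eqv.seq_right
          ((Eqv.tensor_zero tX).trans (Eqv.zero_tensor tX).symm) tU)
      · exact ((Eqv.tensor_zero tY).trans (Eqv.zero_tensor tY).symm).seq (Eqv.ident_seq tZ')
      · simp [hxy.symm, hxz.symm, yl, zl]
    · refine (Eqv.seq_right ?_ tU).trans
        (Eqv.tensor_seq_right tZ tL).symm
      exact Eqv.refl (tZ.tensor timed_zero)
  | cons w l₁ ih =>
    rw [cons_append] at hn
    have hw := (nodup_cons.1 hn).1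
    have hn' := hn.of_cons
    have hwx : w ≠ x := fun h => hw (by simp [h])
    have hwy : w ≠ y := hyl w (by simp)
    have hwz : w ≠ z := fun h => hzl (by simp [h])
    have sub : ∀ c ∈ l₁ ++ x :: l₂, c ∈ w :: l₁ ++ x :: l₂ := fun c hc => by simp at hc ⊢; tauto
    have hπ' := fun c hc => hπ c (sub c hc)
    have ih' := ih hn' hπ' (fun h => hzl (sub z h)) (fun c hc => hyl c (sub c hc))
      (fun c hc => hlt c (sub c hc)) fun c hc => hlx c (sub c hc)
    have tw : Timed S π τ (.var w) 1 0 := timed_var_out (hπ w (by simp))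
    have tX := timed_vars_out (S := S) (t := τ) hn' hπ'
    have bXy : Before τ (l₁ ++ x :: l₂).toFinset {y} := by grind
    have bXz := bXy.trans_singleton (before_singleton.2 yz)
    have bwy : τ w < τ y := by rw [τy]; exact (hlt w (by simp)).trans_lt (by norm_num)
    have bwz := bwy.trans yz
    have hlen : ((w :: l₁) ++ x :: l₂).length = 1 + (l₁ ++ x :: l₂).length := by
      simp [add_comm]
    have dw : Disjoint (Term.var w : Term S.Const A).fv (vars (l₁ ++ x :: l₂) : Term S.Const
        A).fv := by simp_all
    have bXW : Before τ (vars (l₁ ++ x :: l₂) : Term S.Const A).fv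
        (closed [y] .one [z] : Term S.Const A).fv := by simp_all
    have bwW : Before τ (Term.var w : Term S.Const A).fv (closed [y] .one [z] : Term S.Const
        A).fv := by
      simp [bwy, bwz]
    have tXW := tX.seq tW
    have tlXW : Timed S π τ (.link x y (vars (l₁ ++ x :: l₂) ⨟ closed [y] .one [z]))
        (l₁ ++ x :: l₂).length 0 :=
      tXW.link_of hxπ hy (by simp) (by simp) xy
    have dw' : Disjoint (Term.var w : Term S.Const A).fv
        (vars (l₁ ++ x :: l₂) ⨟ closed [y] .one [z] : Term S.Const A).fv := by
      rw [Term.fv.eq_5, disjoint_union_right]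
      exact ⟨dw, bwW.disjoint⟩
    have t1 : Timed S π τ (.link x y (vars ((w :: l₁) ++ x :: l₂) ⨟ closed [y] .one [z]))
        (1 + (l₁ ++ x :: l₂).length) 0 := by
      rw [← hlen]
      refine ((timed_vars_out hn hπ).seq tW ?_).link_of hxπ hy (by simp) (by simp) xy
      rw [vars, Term.fv.eq_6, before_union_left]
      exact ⟨bwW, bXW⟩
    have t2 : Timed S π τ (.link x y (.var w ⊠ₜ (vars (l₁ ++ x :: l₂) ⨟ closed [y] .one [z])))
        (1 + (l₁ ++ x :: l₂).length) 0 :=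
      (tw.tensor tXW).link_of hxπ hy (by simp) (by simp) xy
    rw [hlen]
    refine (Eqv.link_of ?_ t1 t2 hxπ hy).trans ((Eqv.extrude_tensor_right tw tlXW t2 dw'
      (by simpa using hwx.symm) (by simpa using hwy.symm)).trans ((Eqv.refl tw).tensor ih' ?_))
    · have h0 := Eqv.interchange tw timed_zero tX tW
      refine ((Eqv.seq_right (Eqv.zero_tensor tW).symm (tw.tensor tX) ?_).trans h0.symm).trans
        ((Eqv.seq_ident tw).tensor (Eqv.refl tXW) ?_)
      all_goals grind
    all_goals simp_all

/-- A wire from `z` to `x` that is linked to the input variable `y` renames it to `z`. -/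
theorem Eqv.link_wire_vars (hn : (l₁ ++ y :: l₂).Nodup) (hπ : ∀ c ∈ l₁ ++ y :: l₂, π c = true)
    (hx : π x = false) (hz : π z = true) (hzl : z ∉ l₁ ++ y :: l₂) :
    Eqv S π 0 (l₁ ++ y :: l₂).length (.link x y (closed [z] .one [x] ⨟ vars (l₁ ++ y :: l₂)))
      (vars (l₁ ++ z :: l₂)) := by
  have hxz : x ≠ z := by rintro rfl; simp [hx] at hz
  have hxl : ∀ c ∈ l₁ ++ y :: l₂, c ≠ x := by rintro c hc rfl; simp [hπ c hc] at hx
  have hxy : x ≠ y := (hxl y (by simp)).symm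
  have hyz : y ≠ z := fun h => hzl (by simp [h])
  -- a schedule in which the wire comes first
  set τ : A → ℚ := fun c => if c = z then 0 else if c = x then 1 else if c = y then 2 else 3
  have τz : τ z = 0 := by simp [τ]
  have τx : τ x = 1 := by simp [τ, hxz]
  have τy : τ y = 2 := by simp [τ, hxy.symm, hyz]
  have hlt : ∀ c ∈ l₁ ++ y :: l₂, 2 ≤ τ c := by grind
  have hlx : ∀ c ∈ l₁ ++ y :: l₂, c ≠ y → τ c = 3 := by grind
  clear_value τ
  have tW : Timed S π τ (closed [z] .one [x]) 0 0 := timed_wire hz hx (by rw [τz, τx]; norm_num)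
  have hyπ := hπ y (by simp)
  have zx : τ z < τ x := by rw [τz, τx]; norm_num
  have xy : τ x < τ y := by rw [τy, τx]; norm_num
  have zy := zx.trans xy
  induction l₁ with
  | nil =>
    simp only [List.nil_append] at hn hπ hzl hxl hlt hlx ⊢
    have hyl : y ∉ l₂ := (nodup_cons.1 hn).1
    have hl : l₂.Nodup := (nodup_cons.1 hn).2
    have hπl : ∀ c ∈ l₂, π c = true := fun c hc => hπ c (by simp [hc])
    have xl : x ∉ l₂ := fun h => hxl x (by simp [h]) rfl
    have zl : z ∉ l₂ := fun h => hzl (by simp [h])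
    have byl : Before τ {y} l₂.toFinset := by grind
    have bxl : Before τ {x} l₂.toFinset := (before_singleton.2 xy).trans_singleton byl
    have bzl : Before τ {z} l₂.toFinset := (before_singleton.2 zy).trans_singleton byl
    have tX : Timed S π τ (.var x) 1 0 := timed_var_out hx
    have tY : Timed S π τ (.var y) 0 1 := timed_var_in hyπ
    have tZ : Timed S π τ (.var z) 0 1 := timed_var_in hz
    have tX1 : Timed S π τ (vars [x]) 1 0 := timed_vars_out (by simp) (by simp [hx])
    have tZ' : Timed S π τ (vars [z]) 0 1 := timed_vars_in (by simp) (by simp [hz])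
    have tL := timed_vars_in (S := S) (t := τ) hl hπl
    have tV : Timed S π τ (ident 1 ⊠ₜ vars l₂) 1 (1 + l₂.length) :=
      (timed_ident 1).tensor tL
    have tYL := timed_vars_in (S := S) (t := τ) hn hπ
    obtain ⟨⟨t₁, h₁⟩, c1⟩ := Eqv.link_cut (π := π) (k := 0) hxy tZ' tV (by simpa using bzl)
      (by simpa using hxz) (by simpa using xl) (by simpa using hyz) (by simpa using hyl)
    have hlen : (y :: l₂).length = 1 + l₂.length := by simp [add_comm]
    have hlhs : Timed S π τ (.link x y (closed [z] .one [x] ⨟ vars (y :: l₂))) 0 (y :: l₂).length :=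
      (tW.seq tYL).link_of hx hyπ (by simp) (by simp) xy
    rw [hlen] at hlhs ⊢
    refine (Eqv.link_of ?_ hlhs h₁ hx hyπ).trans (c1.trans ?_)
    · refine Eqv.seq (k := 0) ?_ ?_ ?_
      · exact Eqv.seq_right ((Eqv.ident_seq tX1).trans ((Eqv.tensor_zero tX).trans
          (Eqv.zero_tensor tX).symm)) tZ' (by simpa using hxz.symm)
      · exact (Eqv.tensor_seq_left tY tL).trans (Eqv.seq_left
          ((Eqv.tensor_zero tY).trans (Eqv.zero_tensor tY).symm) tV)
      all_goals simp_all
    · refine (Eqv.seq_left ?_ tV).trans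
        (Eqv.tensor_seq_left tZ tL).symm
      exact Eqv.refl (tZ.tensor timed_zero)
  | cons w l₁ ih =>
    rw [cons_append] at hn
    have hw := (nodup_cons.1 hn).1
    have hn' := hn.of_cons
    have hwy : w ≠ y := fun h => hw (by simp [h])
    have hwx : w ≠ x := hxl w (by simp)
    have sub : ∀ c ∈ l₁ ++ y :: l₂, c ∈ w :: l₁ ++ y :: l₂ := fun c hc => by simp at hc ⊢; tauto
    have hπ' := fun c hc => hπ c (sub c hc)
    have ih' := ih hn' hπ' (fun h => hzl (sub z h)) (fun c hc => hxl c (sub c hc))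
      (fun c hc => hlt c (sub c hc)) fun c hc => hlx c (sub c hc)
    have tw : Timed S π τ (.var w) 0 1 := timed_var_in (hπ w (by simp))
    have tX := timed_vars_in (S := S) (t := τ) hn' hπ'
    have bxX : Before τ {x} (l₁ ++ y :: l₂).toFinset := by grind
    have bzX : Before τ {z} (l₁ ++ y :: l₂).toFinset :=
      (before_singleton.2 zx).trans_singleton bxX
    have xw : τ x < τ w := by grind
    have zw := zx.trans xw
    have hlen : ((w :: l₁) ++ y :: l₂).length = 1 + (l₁ ++ y :: l₂).length := by
      simp [add_comm]
    have dw : Disjoint (Term.var w : Term S.Const A).fv (vars (l₁ ++ y :: l₂) : Term S.Const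
        A).fv := by simp_all
    have bXW : Before τ (closed [z] .one [x] : Term S.Const A).fv
        (vars (l₁ ++ y :: l₂) : Term S.Const A).fv := by
      rw [fv_vars]; simp [bxX, bzX, -List.toFinset_append]
    have bwW : Before τ (closed [z] .one [x] : Term S.Const A).fv
        (Term.var w : Term S.Const A).fv := by
      simp [xw, zw]
    have tXW := tW.seq tX
    have tlXW : Timed S π τ (.link x y (closed [z] .one [x] ⨟ vars (l₁ ++ y :: l₂))) 0
        (l₁ ++ y :: l₂).length :=
      tXW.link_of hx hyπ (by simp) (by simp) xy
    have dw' : Disjoint (Term.var w : Term S.Const A).fv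
        (closed [z] .one [x] ⨟ vars (l₁ ++ y :: l₂) : Term S.Const A).fv := by
      rw [Term.fv.eq_5, disjoint_union_right]
      exact ⟨bwW.disjoint.symm, dw⟩
    have t1 : Timed S π τ (.link x y (closed [z] .one [x] ⨟ vars ((w :: l₁) ++ y :: l₂))) 0
        (1 + (l₁ ++ y :: l₂).length) := by
      rw [← hlen]
      refine (tW.seq (timed_vars_in hn hπ) ?_).link_of hx hyπ (by simp) (by simp) xy
      rw [vars, Term.fv.eq_6, before_union_right]
      exact ⟨bwW, bXW⟩
    have t2 : Timed S π τ (.link x y (.var w ⊠ₜ (closed [z] .one [x] ⨟ vars (l₁ ++ y :: l₂)))) 0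
        (1 + (l₁ ++ y :: l₂).length) :=
      (tw.tensor tXW).link_of hx hyπ (by simp) (by simp) xy
    rw [hlen]
    refine (Eqv.link_of ?_ t1 t2 hx hyπ).trans ((Eqv.extrude_tensor_right tw tlXW t2 dw'
      (by simpa using hwx.symm) (by simpa using hwy.symm)).trans ((Eqv.refl tw).tensor ih' ?_))
    · have h0 := Eqv.interchange timed_zero tw tW tX
      refine ((Eqv.seq_left (Eqv.zero_tensor tW).symm (tw.tensor tX) ?_).trans h0.symm).trans
        ((Eqv.ident_seq tw).tensor (Eqv.refl tXW) ?_)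
      all_goals grind
    all_goals simp_all

/-! ### Reduction of normal forms -/

variable {o : Option S.Const}

/-- Two names can be scheduled after given names. -/
theorem exists_two_after (t : A → ℚ) (s : Finset A) (hyz : y ≠ z) (hy : y ∉ s) (hz : z ∉ s) :
    ∃ t' : A → ℚ, (∀ c ∈ s, t' c = t c) ∧ Before t' s {y} ∧ Before t' s {z} ∧ t' y < t' z := by
  obtain ⟨p, hp, -⟩ := Order.exists_between_finsets (lo := s.image t) (hi := ∅) (by simp)
  have h : ∀ c ∈ s, c ≠ y ∧ c ≠ z := fun c hc => ⟨by rintro rfl; exact hy hc, by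
    rintro rfl; exact hz hc⟩
  have h' : ∀ c ∈ s, t c < p := fun c hc => hp _ (mem_image_of_mem t hc)
  refine ⟨update (update t y p) z (p + 1), fun c hc => by simp [h c hc], fun c hc d hd => ?_,
    fun c hc d hd => ?_, by simp [hyz]⟩ <;> rw [mem_singleton.1 hd]
  · simp [h c hc, hyz, h' c hc]
  · simpa [h c hc] using (h' c hc).trans (by norm_num)

/-- Two names can be scheduled before given names. -/
theorem exists_two_before (t : A → ℚ) (s : Finset A) (hyz : y ≠ z) (hy : y ∉ s) (hz : z ∉ s) :
    ∃ t' : A → ℚ, (∀ c ∈ s, t' c = t c) ∧ Before t' {y} s ∧ Before t' {z} s ∧ t' z < t' y := by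
  obtain ⟨p, -, hp⟩ := Order.exists_between_finsets (lo := ∅) (hi := s.image t) (by simp)
  have h : ∀ c ∈ s, c ≠ y ∧ c ≠ z := fun c hc => ⟨by rintro rfl; exact hy hc, by
    rintro rfl; exact hz hc⟩
  have h' : ∀ c ∈ s, p < t c := fun c hc => hp _ (mem_image_of_mem t hc)
  refine ⟨update (update t y p) z (p - 1), fun c hc => by simp [h c hc], fun d hd c hc => ?_,
    fun d hd c hc => ?_, by simp [hyz]⟩ <;> rw [mem_singleton.1 hd]
  · simp [h c hc, hyz, h' c hc]
  · simpa [h c hc] using (by norm_num : p - 1 < p).trans (h' c hc)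

/-- A wire that is linked to an output of an atom can be removed. -/
theorem Eqv.link_atom_wire (ha : Atom.Ok S π t ⟨o, as, l₁ ++ x :: l₂⟩) (hy : π y = true)
    (hz : π z = false) (hya : y ∉ as) (hzl : z ∉ l₁ ++ x :: l₂) :
    (∃ t', Timed S π t' (.link x y (Atom.term ⟨o, as, l₁ ++ x :: l₂⟩ ⊠ₜ closed [y] .one [z])) 0 0) ∧
    Eqv S π 0 0 (.link x y (Atom.term ⟨o, as, l₁ ++ x :: l₂⟩ ⊠ₜ closed [y] .one [z]))
      (Atom.term ⟨o, as, l₁ ++ z :: l₂⟩) := by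
  have hyz : y ≠ z := by rintro rfl; simp [hy] at hz
  have hyl : y ∉ l₁ ++ x :: l₂ := fun h => by simp [ha.outs_out y h] at hy
  have hza : z ∉ as := fun h => by simp [ha.ins_in z h] at hz
  have hxa : x ∉ as := fun h => (disjoint_of_nodup_append ha.nodup) h (by simp)
  have hl : (l₁ ++ x :: l₂).Nodup := ha.nodup.of_append_right
  have hxz : x ≠ z := fun h => hzl (by simp [h])
  have hxπ : π x = false := ha.outs_out x (by simp)
  obtain ⟨τ, h0, hy1, hz1, h3⟩ := exists_two_after t (as ++ (l₁ ++ x :: l₂)).toFinset hyz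
    (by rw [mem_toFinset, mem_append, not_or]; exact ⟨hya, hyl⟩)
    (by rw [mem_toFinset, mem_append, not_or]; exact ⟨hza, hzl⟩)
  rw [List.toFinset_append] at hy1 hz1 h0
  rw [before_union_left] at hy1 hz1
  have haτ : Atom.Ok S π τ ⟨o, as, l₁ ++ x :: l₂⟩ := ha.congr (fun _ _ => rfl) fun c hc => by
    rw [← List.toFinset_append] at h0
    exact (h0 c (mem_toFinset.2 hc)).symm
  have hbef : Before τ as.toFinset (l₁ ++ x :: l₂).toFinset := haτ.before
  have hπl : ∀ c ∈ l₁ ++ x :: l₂, π c = false := ha.outs_out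
  have hla : (l₁ ++ x :: l₂).length = S.bodyCod o := ha.cod
  clear h0 ha
  have hxl : x ∈ l₁ ++ x :: l₂ := by simp
  set ls := l₁ ++ x :: l₂
  have txy : τ x < τ y := hy1.2 x (by simpa using hxl) y (by simp)
  have tI : Timed S π τ (vars as) 0 (S.bodyDom o) :=
    haτ.dom ▸ timed_vars_in haτ.nodup.of_append_left haτ.ins_in
  have tB := timed_bodyTerm (S := S) (π := π) (t := τ) o
  have tX : Timed S π τ (vars ls) (S.bodyCod o) 0 := haτ.cod ▸ timed_vars_out hl hπl
  have tW : Timed S π τ (closed [y] .one [z]) 0 0 := timed_wire hy hz h3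
  have tU : Timed S π τ (vars as ⨟ bodyTerm o) 0 (S.bodyCod o) := tI.seq tB
  have bUW : Before τ (vars as ⨟ bodyTerm o : Term S.Const A).fv
      (closed [y] .one [z] : Term S.Const A).fv := by simp [hy1, hz1]
  have bUX : Before τ (vars as ⨟ bodyTerm o : Term S.Const A).fv (vars ls : Term S.Const A).fv := by
    simpa using hbef
  have bXW : Before τ (vars ls : Term S.Const A).fv (closed [y] .one [z] : Term S.Const A).fv := by
    simp [hy1, hz1]
  have tXW := tX.seq tW
  have tlXW : Timed S π τ (.link x y (vars ls ⨟ closed [y] .one [z])) (S.bodyCod o) 0 :=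
    tXW.link_of hxπ hy (by simp [hxl]) (by simp) txy
  have bA : Before τ (Atom.term ⟨o, as, ls⟩ : Term S.Const A).fv
      (closed [y] .one [z] : Term S.Const A).fv := by
    rw [Atom.fv_term]; simp [Atom.names, hy1, hz1]
  have tA : Timed S π τ (Atom.term ⟨o, as, ls⟩) 0 0 := haτ.timed
  have t1 : Timed S π τ (.link x y (Atom.term ⟨o, as, ls⟩ ⊠ₜ closed [y] .one [z])) 0 0 :=
    (tA.tensor tW).link_of hxπ hy (by simp [Atom.names, hxl]) (by simp) txy
  have t2 : Timed S π τ (.link x y ((vars as ⨟ bodyTerm o) ⨟ (vars ls ⨟ closed [y] .one [z]))) 0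
      0 :=
    (tU.seq tXW).link_of
      hxπ hy (by simp [hxl]) (by simp) txy
  refine ⟨⟨τ, t1⟩, ?_⟩
  refine (Eqv.link_of ?_ t1 t2 hxπ hy).trans ((Eqv.extrude_seq_right tU tlXW t2
    (Before.subset (s' := (vars as ⨟ bodyTerm o : Term S.Const A).fv)
        (before_union_right.2 ⟨bUX, bUW⟩) subset_rfl sdiff_subset)).trans ?_)
  · refine (Eqv.tensor_seq_left tA tW).trans ((Eqv.seq (k := 0) (Eqv.tensor_zero tA)
      (Eqv.zero_tensor tW) (by simpa using bA.disjoint)).trans ?_)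
    exact (Eqv.seq_left (Eqv.seq_assoc tI tB tX).symm tW).trans (Eqv.seq_assoc tU tX tW)
  · have key := Eqv.link_vars_wire (S := S) hl hπl hy hz hzl
    have hzl' : (l₁ ++ z :: l₂).Nodup := by grind
    have hsub : ∀ c ∈ l₁ ++ z :: l₂, c = z ∨ c ∈ ls := by grind
    have tZ : Timed S π τ (vars (l₁ ++ z :: l₂)) (S.bodyCod o) 0 := by
      rw [← haτ.cod]
      have := timed_vars_out (S := S) (π := π) (t := τ) hzl' fun c hc => by grind
      simpa [ls] using this
    have bIZ : Before τ as.toFinset (l₁ ++ z :: l₂).toFinset := by grind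
    refine (Eqv.seq_right (Eqv.cast key (by omega) rfl) tU ?_).trans
      (Eqv.seq_assoc tI tB tZ)
    exact (before_union_right.2 ⟨bUX, bUW⟩).disjoint.mono_right sdiff_subset

/-- A wire that is linked to an input of an atom can be removed. -/
theorem Eqv.link_wire_atom (ha : Atom.Ok S π t ⟨o, l₁ ++ y :: l₂, bs⟩) (hx : π x = false)
    (hz : π z = true) (hxb : x ∉ bs) (hzl : z ∉ l₁ ++ y :: l₂) :
    (∃ t', Timed S π t' (.link x y (closed [z] .one [x] ⊠ₜ Atom.term ⟨o, l₁ ++ y :: l₂, bs⟩)) 0 0) ∧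
    Eqv S π 0 0 (.link x y (closed [z] .one [x] ⊠ₜ Atom.term ⟨o, l₁ ++ y :: l₂, bs⟩))
      (Atom.term ⟨o, l₁ ++ z :: l₂, bs⟩) := by
  have hxz : x ≠ z := by rintro rfl; simp [hx] at hz
  have hxl : x ∉ l₁ ++ y :: l₂ := fun h => by simp [ha.ins_in x h] at hx
  have hzb : z ∉ bs := fun h => by simp [ha.outs_out z h] at hz
  have hyb : y ∉ bs := fun h => (disjoint_of_nodup_append ha.nodup) (a := y) (by simp) h
  have hl : (l₁ ++ y :: l₂).Nodup := ha.nodup.of_append_left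
  have hyπ : π y = true := ha.ins_in y (by simp)
  obtain ⟨τ, h0, hx1, hz1, h3⟩ := exists_two_before t ((l₁ ++ y :: l₂) ++ bs).toFinset hxz
    (by rw [mem_toFinset, mem_append, not_or]; exact ⟨hxl, hxb⟩)
    (by rw [mem_toFinset, mem_append, not_or]; exact ⟨hzl, hzb⟩)
  have haτ : Atom.Ok S π τ ⟨o, l₁ ++ y :: l₂, bs⟩ := ha.congr (fun _ _ => rfl) fun c hc =>
    (h0 c (mem_toFinset.2 hc)).symm
  rw [List.toFinset_append, before_union_right] at hx1 hz1
  have hbef : Before τ (l₁ ++ y :: l₂).toFinset bs.toFinset := haτ.before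
  have hπl : ∀ c ∈ l₁ ++ y :: l₂, π c = true := ha.ins_in
  have hla : (l₁ ++ y :: l₂).length = S.bodyDom o := ha.dom
  clear h0 ha
  have hyl : y ∈ l₁ ++ y :: l₂ := by simp
  set ls := l₁ ++ y :: l₂
  have txy : τ x < τ y := hx1.1 x (by simp) y (by simpa using hyl)
  have tI : Timed S π τ (vars ls) 0 (S.bodyDom o) := hla ▸ timed_vars_in hl hπl
  have tB := timed_bodyTerm (S := S) (π := π) (t := τ) o
  have tX : Timed S π τ (vars bs) (S.bodyCod o) 0 :=
    haτ.cod ▸ timed_vars_out haτ.nodup.of_append_right haτ.outs_out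
  have tW : Timed S π τ (closed [z] .one [x]) 0 0 := timed_wire hz hx h3
  have tU : Timed S π τ (bodyTerm o ⨟ vars bs) (S.bodyDom o) 0 := tB.seq tX
  have bWU : Before τ (closed [z] .one [x] : Term S.Const A).fv
      (bodyTerm o ⨟ vars bs : Term S.Const A).fv := by simp [hx1, hz1]
  have bIU : Before τ (vars ls : Term S.Const A).fv (bodyTerm o ⨟ vars bs : Term S.Const A).fv := by
    simpa using hbef
  have bWI : Before τ (closed [z] .one [x] : Term S.Const A).fv (vars ls : Term S.Const A).fv := by
    simp [hx1, hz1]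
  have tWI := tW.seq tI
  have tlWI : Timed S π τ (.link x y (closed [z] .one [x] ⨟ vars ls)) 0 (S.bodyDom o) :=
    tWI.link_of hx hyπ (by simp) (by simp [hyl]) txy
  have bA : Before τ (closed [z] .one [x] : Term S.Const A).fv
      (Atom.term ⟨o, ls, bs⟩ : Term S.Const A).fv := by
    rw [Atom.fv_term]; simp [Atom.names, hx1, hz1]
  have tA : Timed S π τ (Atom.term ⟨o, ls, bs⟩) 0 0 := haτ.timed
  have t1 : Timed S π τ (.link x y (closed [z] .one [x] ⊠ₜ Atom.term ⟨o, ls, bs⟩)) 0 0 :=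
    (tW.tensor tA).link_of hx hyπ (by simp) (by simp [Atom.names, hyl]) txy
  have t2 : Timed S π τ (.link x y ((closed [z] .one [x] ⨟ vars ls) ⨟ (bodyTerm o ⨟ vars bs))) 0
      0 :=
    (tWI.seq tU).link_of
      hx hyπ (by simp) (by simp [hyl]) txy
  refine ⟨⟨τ, t1⟩, ?_⟩
  refine (Eqv.link_of ?_ t1 t2 hx hyπ).trans ((Eqv.extrude_seq_left tlWI tU t2
    (Before.subset (u' := (bodyTerm o ⨟ vars bs : Term S.Const A).fv)
        (before_union_left.2 ⟨bWU, bIU⟩) sdiff_subset subset_rfl)).trans ?_)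
  · refine (Eqv.tensor_seq_left tW tA).trans ((Eqv.seq (k := 0) (Eqv.tensor_zero tW)
      (Eqv.zero_tensor tA) (by simpa using bA.disjoint)).trans ?_)
    exact (Eqv.seq_assoc tW tI tU).symm
  · have key := Eqv.link_wire_vars (S := S) hl hπl hx hz hzl
    have hzl' : (l₁ ++ z :: l₂).Nodup := by grind
    have hsub : ∀ c ∈ l₁ ++ z :: l₂, c = z ∨ c ∈ ls := by grind
    refine Eqv.seq_left (Eqv.cast key rfl (by omega)) tU ?_
    exact (before_union_left.2 ⟨bWU, bIU⟩).disjoint.mono_left sdiff_subset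

section Steps

variable {As Bs : List (Atom S.Const A)}

theorem Good.perm (h : Good S π t L As) (hL : L.Perm L') (hA : As.Perm Bs) :
    Good S π t L' Bs :=
  ⟨h.atoms.perm hA, (h.links.perm hL).mono fun c hc => by
    rw [mem_toFinset] at hc ⊢
    exact (hA.flatMap_right _).mem_iff.1 hc⟩

/-- The order of links and atoms is irrelevant. -/
theorem Good.eqv_perm (h : Good S π t L As) (hL : L.Perm L') (hA : As.Perm Bs) :
    Eqv S π 0 0 (nf L As) (nf L' Bs) := by
  have h1 := h.perm (List.Perm.refl L) hA
  exact (Eqv.linkAll (Eqv.atomsTerm_perm hA h.atoms) h.timed h1.timed h.links.fst_out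
    h.links.snd_in).trans (Eqv.linkAll_perm hL h1.atoms.timed (by simpa using h1.links))

/-- If a link between two atoms makes them equal to one atom, then they can be replaced in a normal
form. -/
theorem Good.merge {a b c : Atom S.Const A} (h : Good S π t ((x, y) :: L) (a :: b :: As))
    (hc : c.Ok S π t) (he : Eqv S π 0 0 (.link x y (a.term ⊠ₜ b.term)) c.term)
    (hx : x ∈ a.names ++ b.names) (hy : y ∈ a.names ++ b.names) :
    Good S π t L (c :: As) ∧ Eqv S π 0 0 (nf ((x, y) :: L) (a :: b :: As)) (nf L (c :: As)) := by
  obtain ⟨ha, hbA, hd⟩ := atomsOk_cons.1 h.atoms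
  obtain ⟨hb, hA, hd'⟩ := atomsOk_cons.1 hbA
  rw [atomNames_cons, List.disjoint_append_right] at hd
  have hfv : ∀ d, d ∈ c.names ↔ (d ∈ a.names ∨ d ∈ b.names) ∧ d ≠ x ∧ d ≠ y := by
    intro d
    have := congrArg (d ∈ ·) he.1
    simp only [Term.fv, Atom.fv_term, mem_sdiff, mem_union, mem_toFinset,
      mem_insert, mem_singleton, not_or, eq_iff_iff] at this
    exact this.symm
  have hcA : c.names.Disjoint (atomNames As) := fun d h1 h2 => by
    rcases ((hfv d).1 h1).1 with h1 | h1
    exacts [hd.2 h1 h2, hd' h1 h2]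
  have hcAs : AtomsOk S π t (c :: As) := atomsOk_cons.2 ⟨hc, hA, hcA⟩
  have hL : Links π t (atomNames (c :: As)).toFinset L := h.links.tail.mono fun d hd => by grind
  have hg : Good S π t L (c :: As) := ⟨hcAs, hL⟩
  have px := h.links.fst_out (x, y) (by simp)
  have py := h.links.snd_in (x, y) (by simp)
  have txy := h.links.lt (x, y) (by simp)
  have ta := ha.timed
  have tb := hb.timed
  have tc := hc.timed
  have tA := hA.timed
  have dab : Disjoint a.term.fv b.term.fv := by simp_all
  have daA : Disjoint a.term.fv (atomsTerm As).fv := by simp_all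
  have dbA : Disjoint b.term.fv (atomsTerm As).fv := by simp_all
  have dcA : Disjoint c.term.fv (atomsTerm As).fv := by simp_all
  have dabA : Disjoint (a.term ⊠ₜ b.term).fv (atomsTerm As).fv :=
    disjoint_union_left.2 ⟨daA, dbA⟩
  have xf : x ∈ (a.term ⊠ₜ b.term).fv := by simpa using hx
  have yf : y ∈ (a.term ⊠ₜ b.term).fv := by simpa using hy
  have tab := ta.tensor tb
  have tl := tab.link_of px py xf yf txy
  have tT := tA.tensor tab
  have tl1 : Timed S π t (.link x y (atomsTerm As ⊠ₜ (a.term ⊠ₜ b.term))) 0 0 :=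
    tT.link_of px py (mem_union_right _ xf) (mem_union_right _ yf) txy
  have tl2 : Timed S π t (.link x y (atomsTerm (a :: b :: As))) 0 0 :=
    h.atoms.timed.link_of px py (by simp [atomsTerm] at hx ⊢; tauto)
      (by simp [atomsTerm] at hy ⊢; tauto) txy
  refine ⟨hg, Eqv.linkAll (L := L) ?_ h.timed hg.timed
      (fun p hp => h.links.fst_out p (by simp [hp]))
    fun p hp => h.links.snd_in p (by simp [hp])⟩
  refine (Eqv.link_of ((Eqv.tensor_assoc ta tb tA).symm.trans
    (Eqv.scalar_tensor_comm tab tA)) tl2 tl1 px py).trans ?_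
  refine (Eqv.extrude_tensor_right tA tl tl1 dabA.symm (disjoint_left.1 dabA xf)
    (disjoint_left.1 dabA yf)).trans ?_
  exact ((Eqv.refl tA).tensor he (dabA.symm.mono_right sdiff_subset)).trans
    (Eqv.scalar_tensor_comm tA tc)

theorem Atom.Ok.wire {a : Atom S.Const A} (h : a.Ok S π t) (hb : a.body = none) :
    ∃ y z, a = ⟨none, [y], [z]⟩ := by
  obtain ⟨o, as, bs⟩ := a
  subst hb
  obtain ⟨y, rfl⟩ := List.length_eq_one_iff.1 h.dom
  obtain ⟨z, rfl⟩ := List.length_eq_one_iff.1 h.cod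
  exact ⟨y, z, rfl⟩

/-- The wires of the normal form connect free variables. -/
def Reduced (L : List (A × A)) (As : List (Atom S.Const A)) : Prop :=
  ∀ a ∈ As, a.body = none → ∀ c ∈ a.names, c ∉ linkNames L

/-- Names of a list of atoms lie in one of them. -/
theorem mem_atomNames : a ∈ atomNames As ↔ ∃ c ∈ As, a ∈ c.names := List.mem_flatMap

theorem exists_perm_cons_cons {α : Type*} {a b : α} {l : List α} (ha : a ∈ l) (hb : b ∈ l)
    (h : a ≠ b) : ∃ l', l.Perm (a :: b :: l') := by
  classical
  refine ⟨(l.erase a).erase b, (List.perm_cons_erase ha).trans (.cons _ (List.perm_cons_erase ?_))⟩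
  exact (List.mem_erase_of_ne h.symm).2 hb

/-- Every wire with a bound variable can be removed from a normal form. -/
theorem Good.exists_reduced (n : ℕ) : ∀ {L : List (A × A)} {As : List (Atom S.Const A)},
    L.length = n → Good S π t L As → ∃ L' As', Good S π t L' As' ∧
      Eqv S π 0 0 (nf L As) (nf L' As') ∧ Reduced L' As' ∧
      ∀ c ∈ linkNames L', c ∈ linkNames L := by
  induction n with
  | zero =>
    intro L As hL h
    obtain rfl := List.length_eq_zero_iff.1 hL
    exact ⟨[], As, h, Eqv.refl h.timed, fun _ _ _ _ _ => by simp, fun _ => id⟩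
  | succ n ih =>
    intro L As hL h
    by_cases hr : Reduced L As
    · exact ⟨L, As, h, Eqv.refl h.timed, hr, fun _ => id⟩
    simp only [Reduced, not_forall, not_not] at hr
    obtain ⟨w, hw, hwb, c, hc, hcL⟩ := hr
    obtain ⟨y, z, rfl⟩ := (h.atoms.ok w hw).wire hwb
    have hwo := h.atoms.ok _ hw
    have πy := hwo.ins_in y (by simp)
    have πz := hwo.outs_out z (by simp)
    have tyz : t y < t z := hwo.before y (by simp) z (by simp)
    -- it suffices to merge the wire with another atom along a link
    suffices H : ∃ (p : A × A) (a b d : Atom S.Const A), p ∈ L ∧ a ∈ As ∧ b ∈ As ∧ a ≠ b ∧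
        p.1 ∈ a.names ++ b.names ∧ p.2 ∈ a.names ++ b.names ∧
        ∀ As', Good S π t (p :: L.erase p) (a :: b :: As') → d.Ok S π t ∧
          Eqv S π 0 0 (.link p.1 p.2 (a.term ⊠ₜ b.term)) d.term by
      obtain ⟨p, a, b, d, hp, ha, hb, hab, h1, h2, H⟩ := H
      obtain ⟨As', hAs⟩ := exists_perm_cons_cons ha hb hab
      have hpL := List.perm_cons_erase hp
      have hg := h.perm hpL hAs
      obtain ⟨hd, he⟩ := H As' hg
      obtain ⟨hg', he'⟩ := hg.merge hd he h1 h2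
      obtain ⟨L2, As2, i1, i2, i3, i4⟩ := ih (by
        have := hpL.length_eq; simp at this; omega) hg'
      refine ⟨L2, As2, i1, (h.eqv_perm hpL hAs).trans (he'.trans i2), i3, fun c hc => ?_⟩
      exact (linkNames_perm hpL).mem_iff.2 (by simp [i4 c hc])
    obtain ⟨p, hp, hcp⟩ := mem_linkNames.1 hcL
    have π1 := h.links.fst_out p hp
    have π2 := h.links.snd_in p hp
    have tp := h.links.lt p hp
    obtain ⟨a, ha, hpa⟩ := mem_atomNames.1 (mem_toFinset.1 (h.links.fst_mem p hp))
    obtain ⟨b, hb, hpb⟩ := mem_atomNames.1 (mem_toFinset.1 (h.links.snd_mem p hp))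
    have hao := h.atoms.ok a ha
    have hbo := h.atoms.ok b hb
    have hpa' : p.1 ∈ a.outs := (mem_append.1 hpa).resolve_left fun h' => by
      simp [hao.ins_in _ h'] at π1
    have hpb' : p.2 ∈ b.ins := (mem_append.1 hpb).resolve_right fun h' => by
      simp [hbo.outs_out _ h'] at π2
    simp only [Atom.names, cons_append, List.nil_append, mem_cons, List.not_mem_nil,
      or_false] at hc
    rcases hc with rfl | rfl
    · -- the input of the wire is bound
      have hy : c = p.2 := hcp.resolve_left fun h' => by simp [h', π1] at πy
      subst hy
      have hne : a ≠ ⟨none, [p.2], [z]⟩ := by grind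
      obtain ⟨l1, l2, hl⟩ := List.append_of_mem hpa'
      obtain ⟨o, as, bs⟩ := a
      obtain rfl : bs = l1 ++ p.1 :: l2 := hl
      refine ⟨p, _, _, ⟨o, as, l1 ++ z :: l2⟩, hp, ha, hw, hne, by simp [Atom.names],
        by simp [Atom.names], fun As' hg => ?_⟩
      obtain ⟨-, -, hd⟩ := atomsOk_cons.1 hg.atoms
      rw [atomNames_cons, List.disjoint_append_right] at hd
      have hd1 := hd.1
      have hy' : p.2 ∉ as := fun h' => hd1 (a := p.2) (by simp [Atom.names, h'])
          (by simp [Atom.names])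
      have hz1 : z ∉ as := fun h' => hd1 (a := z) (by simp [Atom.names, h']) (by simp [Atom.names])
      have hz2 : z ∉ l1 ++ p.1 :: l2 := fun h' => hd1 (a := z) (by
        simp only [Atom.names, mem_append] at h' ⊢; exact .inr h') (by simp [Atom.names])
      refine ⟨?_, (Eqv.link_atom_wire hao πy πz hy' hz2).2⟩
      have hn := hao.nodup
      have hbf := hao.before
      refine ⟨hao.dom, by simpa using hao.cod, ?_, hao.ins_in, ?_, ?_⟩
      · simp only [Atom.names, List.nodup_append, nodup_cons, mem_append, mem_cons, not_or] at hn hz2 ⊢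
        grind
      · intro d hd
        have := hao.outs_out d
        simp only [mem_append, mem_cons] at hd this
        grind
      · intro c hc d hd
        have h1 : ∀ d ∈ l1 ++ p.1 :: l2, t c < t d := fun d hd => hbf c hc d (mem_toFinset.2 hd)
        simp only [mem_toFinset, mem_append, mem_cons] at hd h1
        grind
    · -- the output of the wire is bound
      have hy : c = p.1 := hcp.resolve_right fun h' => by simp [h', π2] at πz
      subst hy
      have hne : (⟨none, [y], [p.1]⟩ : Atom S.Const A) ≠ b := by grind
      obtain ⟨l1, l2, hl⟩ := List.append_of_mem hpb'
      obtain ⟨o, as, bs⟩ := b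
      obtain rfl : as = l1 ++ p.2 :: l2 := hl
      refine ⟨p, _, _, ⟨o, l1 ++ y :: l2, bs⟩, hp, hw, hb, hne, by simp [Atom.names],
        by simp [Atom.names], fun As' hg => ?_⟩
      obtain ⟨-, -, hd⟩ := atomsOk_cons.1 hg.atoms
      rw [atomNames_cons, List.disjoint_append_right] at hd
      have hd1 := hd.1
      have hx' : p.1 ∉ bs := fun h' => hd1 (a := p.1) (by simp [Atom.names])
          (by simp [Atom.names, h'])
      have hz1 : y ∉ bs := fun h' => hd1 (a := y) (by simp [Atom.names]) (by simp [Atom.names, h'])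
      have hz2 : y ∉ l1 ++ p.2 :: l2 := fun h' => hd1 (a := y) (by simp [Atom.names]) (by
        simp only [Atom.names, mem_append] at h' ⊢; exact .inl h')
      refine ⟨?_, (Eqv.link_wire_atom hbo πz πy hx' hz2).2⟩
      have hn := hbo.nodup
      have hbf := hbo.before
      refine ⟨by simpa using hbo.dom, hbo.cod, ?_, ?_, hbo.outs_out, ?_⟩
      · simp only [Atom.names, List.nodup_append, nodup_cons, mem_append, mem_cons, not_or] at hn hz2 ⊢
        grind
      · intro d hd
        have := hbo.ins_in d
        simp only [mem_append, mem_cons] at hd this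
        grind
      · intro d hd c hc
        have h1 : ∀ d ∈ l1 ++ p.2 :: l2, t d < t c := fun d hd => hbf d (mem_toFinset.2 hd) c hc
        simp only [mem_toFinset, mem_append, mem_cons] at hd h1
        grind

end Steps

/-! ### Renaming of bound names in normal forms -/

variable {x' y' : A} {K : List (A × A)} {As Bs : List (Atom S.Const A)} {ρ σ : A → A}

/-- Renaming of the variables of an atom. -/
def Atom.map {K : Type u} (ρ : A → A) (a : Atom K A) : Atom K A :=
  ⟨a.body, a.ins.map ρ, a.outs.map ρ⟩

@[simp, grind =] theorem Atom.names_map (ρ : A → A) (a : Atom S.Const A) :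
    (a.map ρ).names = a.names.map ρ := by
  simp [Atom.names, Atom.map]

@[simp, grind =] theorem atomNames_map (ρ : A → A) (As : List (Atom S.Const A)) :
    atomNames (As.map (Atom.map ρ)) = (atomNames As).map ρ := by
  induction As <;> simp_all

@[simp, grind =] theorem linkNames_map (ρ : A → A) (L : List (A × A)) :
    linkNames (L.map (Prod.map ρ ρ)) = (linkNames L).map ρ := by
  induction L <;> simp_all

theorem nodup_map {l : List A} (h : l.Nodup) (hρ : Set.InjOn ρ {c | c ∈ l}) : (l.map ρ).Nodup :=
  (List.nodup_map_iff_inj_on h).2 fun _ hx _ hy e => hρ hx hy e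

theorem Atom.Ok.map {a : Atom S.Const A} (h : a.Ok S π t) (hρ : Set.InjOn ρ {c | c ∈ a.names})
    (hπ : ∀ c ∈ a.names, π' (ρ c) = π c) (ht : ∀ c ∈ a.names, t' (ρ c) = t c) :
    (a.map ρ).Ok S π' t' := by
  have mi : ∀ c ∈ a.ins, c ∈ a.names := fun c hc => List.mem_append_left _ hc
  have mo : ∀ c ∈ a.outs, c ∈ a.names := fun c hc => List.mem_append_right _ hc
  refine ⟨by simpa [Atom.map] using h.dom, by simpa [Atom.map] using h.cod, ?_, ?_, ?_, ?_⟩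
  · rw [Atom.names_map]; exact nodup_map h.nodup hρ
  · simp only [Atom.map, List.mem_map, forall_exists_index, and_imp, forall_apply_eq_imp_iff₂]
    exact fun c hc => (hπ c (mi c hc)).trans (h.ins_in c hc)
  · simp only [Atom.map, List.mem_map, forall_exists_index, and_imp, forall_apply_eq_imp_iff₂]
    exact fun c hc => (hπ c (mo c hc)).trans (h.outs_out c hc)
  · simp only [Atom.map, Before, mem_toFinset, List.mem_map, forall_exists_index, and_imp,
      forall_apply_eq_imp_iff₂]
    intro c hc d hd
    rw [ht c (mi c hc), ht d (mo d hd)]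
    exact h.before c (by simpa using hc) d (by simpa using hd)

theorem Good.map (h : Good S π t L As) (hρ : Set.InjOn ρ {c | c ∈ atomNames As})
    (hπ : ∀ c ∈ atomNames As, π' (ρ c) = π c) (ht : ∀ c ∈ atomNames As, t' (ρ c) = t c) :
    Good S π' t' (L.map (Prod.map ρ ρ)) (As.map (Atom.map ρ)) := by
  have mA : ∀ a ∈ As, ∀ c ∈ a.names, c ∈ atomNames As := fun a ha c hc =>
    mem_atomNames.2 ⟨a, ha, hc⟩
  have m1 : ∀ p ∈ L, p.1 ∈ atomNames As := fun p hp => mem_toFinset.1 (h.links.fst_mem p hp)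
  have m2 : ∀ p ∈ L, p.2 ∈ atomNames As := fun p hp => mem_toFinset.1 (h.links.snd_mem p hp)
  refine ⟨⟨?_, ?_⟩, ?_, ?_, ?_, ?_, ?_, ?_⟩
  · simp only [List.mem_map, forall_exists_index, and_imp, forall_apply_eq_imp_iff₂]
    exact fun a ha => (h.atoms.ok a ha).map (hρ.mono fun c hc => mA a ha c hc)
      (fun c hc => hπ c (mA a ha c hc)) fun c hc => ht c (mA a ha c hc)
  · rw [atomNames_map]; exact nodup_map h.atoms.nodup hρ
  · rw [linkNames_map]
    exact nodup_map h.links.nodup (hρ.mono fun c hc =>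
      mem_toFinset.1 (h.links.names_subset c hc))
  all_goals
    simp only [List.mem_map, forall_exists_index, and_imp, forall_apply_eq_imp_iff₂, Prod.map_fst,
      Prod.map_snd, atomNames_map, mem_toFinset]
    intro p hp
  · exact ⟨_, m1 p hp, rfl⟩
  · exact ⟨_, m2 p hp, rfl⟩
  · exact (hπ _ (m1 p hp)).trans (h.links.fst_out p hp)
  · exact (hπ _ (m2 p hp)).trans (h.links.snd_in p hp)
  · rw [ht _ (m1 p hp), ht _ (m2 p hp)]; exact h.links.lt p hp

theorem rename_vars (ρ : A → A) (l : List A) :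
    (vars l : Term S.Const A).rename ρ = vars (l.map ρ) := by
  induction l <;> simp_all [vars, Term.rename]

theorem rename_atomsTerm (ρ : A → A) (As : List (Atom S.Const A)) :
    (atomsTerm As).rename ρ = atomsTerm (As.map (Atom.map ρ)) := by
  induction As with
  | nil => rfl
  | cons a As ih =>
    have : a.term.rename ρ = (a.map ρ).term := by
      obtain ⟨o, as, bs⟩ := a
      cases o <;> simp [Atom.term, Atom.map, closed, Term.rename, rename_vars, bodyTerm]
    simp [atomsTerm, Term.rename, ih, this]

theorem rename_linkAll (h : ∀ c ∈ linkNames L, ρ c = c) :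
    (linkAll L P).rename ρ = linkAll L (P.rename ρ) := by
  induction L generalizing P with
  | nil => rfl
  | cons p L ih =>
    simp only [linkNames_cons, mem_cons, forall_eq_or_imp] at h
    rw [linkAll_cons, ih h.2.2, linkAll_cons, Term.rename]
    congr 3
    grind

theorem names_linkAll : (linkAll L P).names = P.names ∪ (linkNames L).toFinset := by
  induction L generalizing P with
  | nil => simp
  | cons p L ih =>
    rw [linkAll_cons, ih, Term.names]
    ext; simp

theorem names_atomsTerm : (atomsTerm As).names = (atomNames As).toFinset := by
  have hv : ∀ l : List A, (vars l : Term S.Const A).names = l.toFinset := by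
    intro l
    induction l with
    | nil => rfl
    | cons a l ih =>
      rw [vars, Term.names, ih]
      ext; simp [Term.names]
  induction As with
  | nil => rfl
  | cons a As ih =>
    obtain ⟨o, as, bs⟩ := a
    cases o <;>
      simp [atomsTerm, Term.names, ih, Atom.term, closed, Atom.names, bodyTerm, hv]

/-- The outermost link of a normal form can be renamed. -/
theorem Good.alpha_last (h : Good S π t (L ++ [(x, y)]) As) (hx : x' ∉ atomNames As)
    (hy : y' ∉ atomNames As) (hxy : x' ≠ y')
    (hσ : σ = fun a => if a = x then x' else if a = y then y' else a) :
    ∃ π' t', (∀ c, c ≠ x' → c ≠ y' → π c = π' c) ∧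
      Good S π' t' (L ++ [(x', y')]) (As.map (Atom.map σ)) ∧
      Eqv S π 0 0 (nf (L ++ [(x, y)]) As) (nf (L ++ [(x', y')]) (As.map (Atom.map σ))) := by
  have hn := h.links.nodup
  simp only [linkNames_append, linkNames_cons, linkNames_nil, List.nodup_append, nodup_cons,
    mem_cons, List.not_mem_nil, or_false] at hn
  have hLn : ∀ c ∈ linkNames L, c ≠ x ∧ c ≠ y := fun c hc =>
    ⟨hn.2.2 c hc x (by simp), hn.2.2 c hc y (by simp)⟩
  have hσL : ∀ c ∈ linkNames L, σ c = c := fun c hc => by simp [hσ, hLn c hc]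
  have hLmap : (L ++ [(x, y)]).map (Prod.map σ σ) = L ++ [(x', y')] := by
    have hyx : y ≠ x := fun h => hn.2.1.1 h.symm
    rw [List.map_append]
    congr 1
    · refine List.map_congr_left (g := id) (fun p hp => ?_) |>.trans (List.map_id _)
      exact Prod.ext (hσL _ (mem_linkNames.2 ⟨p, hp, .inl rfl⟩))
        (hσL _ (mem_linkNames.2 ⟨p, hp, .inr rfl⟩))
    · simp [hσ, hyx]
  have hinj : Set.InjOn σ {c | c ∈ atomNames As} := by
    intro c hc d hd hcd
    simp only [Set.mem_ofPred_eq] at hc hd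
    simp only [hσ] at hcd
    grind
  have πx : π x = false := h.links.fst_out (x, y) (by simp)
  have πy : π y = true := h.links.snd_in (x, y) (by simp)
  refine ⟨fun c => if c = x' then false else if c = y' then true else π c,
    fun c => if c = x' then t x else if c = y' then t y else t c, fun c h1 h2 => by simp [h1, h2],
    ?_, ?_⟩
  · rw [← hLmap]
    refine h.map hinj (fun c hc => ?_) fun c hc => ?_ <;> simp only [hσ] <;> grind
  · have ht := h.timed
    simp only [nf, linkAll_append, linkAll_cons, linkAll_nil] at ht ⊢
    have hnm : ∀ c, c ∉ atomNames As → c ∉ (LinkSyntax.linkAll L (atomsTerm As)).names := by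
      intro c hc
      rw [names_linkAll, names_atomsTerm, mem_union, not_or, mem_toFinset,
        mem_toFinset]
      exact ⟨hc, fun h' => hc (mem_toFinset.1 (h.links.names_subset c (by simp [h'])))⟩
    have := Eqv.alpha ht (hnm x' hx) (hnm y' hy) hxy
    rwa [rename₂, ← hσ, rename_linkAll hσL, rename_atomsTerm] at this

/-- The bound names of a normal form can be renamed to fresh names. -/
theorem Good.alpha_aux : ∀ (K : List (A × A)) {L : List (A × A)} {As : List (Atom S.Const A)}
    {π : A → Bool} {t : A → ℚ}, Good S π t (K ++ L) As →
    Set.InjOn ρ {c | c ∈ linkNames K} → (∀ c ∈ linkNames K, ρ c ∉ atomNames As) →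
    ∃ π' t', (∀ c ∈ (nf (K ++ L) As).fv, π c = π' c) ∧
      Good S π' t' (K.map (Prod.map ρ ρ) ++ L)
        (As.map (Atom.map fun c => if c ∈ linkNames K then ρ c else c)) ∧
      Eqv S π 0 0 (nf (K ++ L) As) (nf (K.map (Prod.map ρ ρ) ++ L)
        (As.map (Atom.map fun c => if c ∈ linkNames K then ρ c else c)))
  | [], L, As, π, t, h, _, _ => by
    have : As.map (Atom.map fun c => if c ∈ linkNames ([] : List (A × A)) then ρ c else c) = As :=
        by
      refine List.map_congr_left (g := id) (fun a _ => ?_) |>.trans (List.map_id _)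
      simp [Atom.map]
    rw [this]
    exact ⟨π, t, fun _ _ => rfl, h, Eqv.refl h.timed⟩
  | (x, y) :: K, L, As, π, t, h, hρ, hf => by
    have p1 : ((x, y) :: K ++ L).Perm (K ++ L ++ [(x, y)]) := by grind
    have p2 : (K ++ L ++ [(ρ x, ρ y)]).Perm (K ++ ((ρ x, ρ y) :: L)) := by grind
    have p3 : (K.map (Prod.map ρ ρ) ++ ((ρ x, ρ y) :: L)).Perm
        (((x, y) :: K).map (Prod.map ρ ρ) ++ L) := by
      simp
    have hnd := h.links.nodup
    have hxm : x ∈ atomNames As := mem_toFinset.1 (h.links.fst_mem (x, y) (by simp))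
    have hym : y ∈ atomNames As := mem_toFinset.1 (h.links.snd_mem (x, y) (by simp))
    have hKm : ∀ c ∈ linkNames K, c ∈ atomNames As := fun c hc =>
      mem_toFinset.1 (h.links.names_subset c (by simp [hc]))
    simp only [cons_append, linkNames_cons, linkNames_append, nodup_cons, mem_cons,
      mem_append, not_or] at hnd
    simp only [linkNames_cons, mem_cons, forall_eq_or_imp] at hf
    have hρ' : ∀ c d, (c = x ∨ c = y ∨ c ∈ linkNames K) → (d = x ∨ d = y ∨ d ∈ linkNames K) →
        ρ c = ρ d → c = d := fun c d hc hd e => hρ (by simpa using hc) (by simpa using hd) e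
    have hxy : ρ x ≠ ρ y := fun e => hnd.1.1 (hρ' x y (by simp) (by simp) e)
    have g1 := h.perm p1 (.refl As)
    obtain ⟨π1, t1, a1, g2, e1⟩ := g1.alpha_last hf.1 hf.2.1 hxy rfl
    have g3 := g2.perm p2 (.refl _)
    obtain ⟨π2, t2, a2, g4, e2⟩ := Good.alpha_aux K g3 (fun c hc d hd e =>
        hρ' c d (.inr (.inr hc)) (.inr (.inr hd)) e) (by
      intro c hc
      rw [atomNames_map, List.mem_map]
      rintro ⟨d, hd, hdc⟩
      have h1 := hf.2.2 c hc
      have h2 := hρ' c x (by simp [hc]) (by simp)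
      have h3 := hρ' c y (by simp [hc]) (by simp)
      grind)
    have hmap : (As.map (Atom.map fun a => if a = x then ρ x else if a = y then ρ y else a)).map
        (Atom.map fun c => if c ∈ linkNames K then ρ c else c) =
        As.map (Atom.map fun c => if c ∈ linkNames ((x, y) :: K) then ρ c else c) := by
      rw [List.map_map]
      refine List.map_congr_left fun a ha => ?_
      have hρx : ρ x ∉ linkNames K := fun h' => hf.1 (hKm _ h')
      have hρy : ρ y ∉ linkNames K := fun h' => hf.2.1 (hKm _ h')
      simp only [Function.comp, Atom.map, List.map_map]
      congr 1 <;> refine List.map_congr_left fun c hc => ?_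
      all_goals
        simp only [Function.comp, linkNames_cons, mem_cons]
        by_cases h1 : c = x
        · simp [h1, hρx]
        by_cases h2 : c = y
        · simp [h2, hρy, Ne.symm hnd.1.1]
        simp [h1, h2]
    rw [hmap] at g4 e2
    have hfv : (nf ((x, y) :: K ++ L) As).fv = (nf (K ++ L ++ [(x, y)]) As).fv :=
      (h.eqv_perm p1 (.refl As)).1
    have ag : ∀ c ∈ (nf (K ++ L ++ [(x, y)]) As).fv, π c = π1 c := by
      intro c hc
      rw [fv_nf, mem_sdiff, mem_toFinset] at hc
      exact a1 c (fun h' => hf.1 (h' ▸ hc.1)) fun h' => hf.2.1 (h' ▸ hc.1)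
    have e3 := g2.eqv_perm p2 (.refl _)
    have e4 := g4.eqv_perm p3 (.refl _)
    have ag2 : ∀ c ∈ (nf (K ++ L ++ [(x, y)]) As).fv, π1 c = π2 c := fun c hc =>
      a2 c (by rw [← e3.1, ← e1.1]; exact hc)
    refine ⟨π2, t2, fun c hc => ?_, g4.perm p3 (.refl _), ?_⟩
    · grind
    · refine (h.eqv_perm p1 (.refl As)).trans (e1.trans (Eqv.congr (e3.trans (e2.trans
        (Eqv.congr e4 (π' := π1) fun c hc => (ag2 c ?_).symm))) fun c hc => (ag c ?_).symm))
      · rw [e1.1, e3.1, e2.1]; exact hc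
      · rw [e1.1]; exact hc

/-- The bound names of a normal form can be renamed to fresh names. -/
theorem Good.alpha (h : Good S π t L As) (hρ : Set.InjOn ρ {c | c ∈ linkNames L})
    (hf : ∀ c ∈ linkNames L, ρ c ∉ atomNames As)
    (hid : ∀ c ∈ atomNames As, c ∉ linkNames L → ρ c = c) :
    Eqv S π 0 0 (nf L As) (nf (L.map (Prod.map ρ ρ)) (As.map (Atom.map ρ))) := by
  obtain ⟨-, -, -, -, h'⟩ := Good.alpha_aux (ρ := ρ) L (L := []) (by simpa using h) hρ hf
  have : As.map (Atom.map fun c => if c ∈ linkNames L then ρ c else c) = As.map (Atom.map ρ) := by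
    refine List.map_congr_left fun a ha => ?_
    simp only [Atom.map]
    congr 1 <;> refine List.map_congr_left fun c hc => ?_ <;> split_ifs with h1
    all_goals first | rfl | exact (hid c (mem_atomNames.2 ⟨a, ha, by simp [Atom.names, hc]⟩)
        h1).symm
  simpa [this] using h'

end Eqv

/-! ### Skeletons -/

section Skeletons

variable {K : Type u} {A : Type v} {x y x' y' : A}

/-- The connections in a diagram between labelled vertices, inputs and outputs: `E s t` is meant to
hold if there is a path from `s` to `t` with unlabelled interior. In the source of a connection
`Sum.inr i` is the input `i`, in its target `Sum.inr j` is the output `j`. Unlabelled vertices are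
irrelevant. -/
structure Skeleton (K : Type u) (A : Type v) where
  V : Type w
  dom : ℕ
  cod : ℕ
  lab : V → Option (Label K A)
  E : V ⊕ ℕ → V ⊕ ℕ → Prop

namespace Skeleton

/-- A partial bijection on the vertices, defined on all labelled vertices, that preserves labels and
connections. -/
structure IsIso (D : Skeleton.{u, v, w} K A) (D' : Skeleton.{u, v, w'} K A)
    (e : D.V → D'.V → Prop) : Prop where
  dom : D.dom = D'.dom
  cod : D.cod = D'.cod
  total : ∀ a, D.lab a ≠ none → ∃ b, e a b
  surj : ∀ b, D'.lab b ≠ none → ∃ a, e a b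
  lab : ∀ a b, e a b → D.lab a = D'.lab b
  inj : ∀ a b a' b', e a b → e a' b' → (a = a' ↔ b = b')
  conn : ∀ s t s' t', Sum.LiftRel e (· = ·) s s' → Sum.LiftRel e (· = ·) t t' →
    (D.E s t ↔ D'.E s' t')

/-- Isomorphism of skeletons: some relation between the vertices is one. -/
def Iso (D : Skeleton.{u, v, w} K A) (D' : Skeleton.{u, v, w'} K A) : Prop :=
  ∃ e, IsIso D D' e

theorem liftRel_swap {α : Type*} {β : Type*} {e : α → β → Prop} {s : α ⊕ ℕ} {s' : β ⊕ ℕ}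
    (h : Sum.LiftRel e (· = ·) s s') : Sum.LiftRel (fun b a => e a b) (· = ·) s' s := by
  cases h with
  | inl h => exact .inl h
  | inr h => exact .inr h.symm

theorem liftRel_inj {α β α' β' : Type*} {e : α → β → Prop} {e' : α' → β' → Prop}
    (h : ∀ a b a' b', e a b → e a' b' → (a = a' ↔ b = b'))
    (h' : ∀ a b a' b', e' a b → e' a' b' → (a = a' ↔ b = b')) (p q p' q') :
    Sum.LiftRel e e' p q → Sum.LiftRel e e' p' q' → (p = p' ↔ q = q') := by
  rintro (h1 | h1) (h2 | h2)
  · simpa using h _ _ _ _ h1 h2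
  · simp
  · simp
  · simpa using h' _ _ _ _ h1 h2

theorem Iso.symm {D : Skeleton.{u, v, w} K A} {D' : Skeleton.{u, v, w'} K A} (h : D.Iso D') :
    D'.Iso D := by
  obtain ⟨e, h⟩ := h
  exact ⟨fun b a => e a b, h.dom.symm, h.cod.symm, h.surj, h.total, fun b a hb =>
      (h.lab a b hb).symm,
    fun b a b' a' h1 h2 => (h.inj a b a' b' h1 h2).symm,
    fun s t s' t' h1 h2 => (h.conn s' t' s t (liftRel_swap h1) (liftRel_swap h2)).symm⟩

theorem Iso.trans {D : Skeleton.{u, v, w} K A} {D' : Skeleton.{u, v, w'} K A}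
    {D'' : Skeleton.{u, v, w''} K A} (h : D.Iso D') (h' : D'.Iso D'') : D.Iso D'' := by
  obtain ⟨e, h⟩ := h
  obtain ⟨e', h'⟩ := h'
  have key : ∀ {s : D.V ⊕ ℕ} {s'' : D''.V ⊕ ℕ},
      Sum.LiftRel (fun a c => ∃ b, e a b ∧ e' b c) (· = ·) s s'' →
      ∃ s', Sum.LiftRel e (· = ·) s s' ∧ Sum.LiftRel e' (· = ·) s' s'' := by
    intro s s'' hs
    cases hs with
    | inl hs => obtain ⟨b, h1, h2⟩ := hs; exact ⟨.inl b, .inl h1, .inl h2⟩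
    | inr hs => exact ⟨_, .inr rfl, .inr hs⟩
  refine ⟨fun a c => ∃ b, e a b ∧ e' b c, h.dom.trans h'.dom, h.cod.trans h'.cod, fun a ha => ?_,
    fun c hc => ?_, ?_, ?_, fun s t s'' t'' h1 h2 => ?_⟩
  · obtain ⟨b, hb⟩ := h.total a ha
    obtain ⟨c, hc⟩ := h'.total b (h.lab a b hb ▸ ha)
    exact ⟨c, b, hb, hc⟩
  · obtain ⟨b, hb⟩ := h'.surj c hc
    obtain ⟨a, ha⟩ := h.surj b (h'.lab b c hb ▸ hc)
    exact ⟨a, b, ha, hb⟩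
  · rintro a c ⟨b, h1, h2⟩
    exact (h.lab a b h1).trans (h'.lab b c h2)
  · rintro a c a' c' ⟨b, h1, h2⟩ ⟨b', h3, h4⟩
    exact (h.inj _ _ _ _ h1 h3).trans (h'.inj _ _ _ _ h2 h4)
  · obtain ⟨s', i1, i2⟩ := key h1
    obtain ⟨t', j1, j2⟩ := key h2
    exact (h.conn _ _ _ _ i1 j1).trans (h'.conn _ _ _ _ i2 j2)

/-- An injective map on the vertices that preserves labels and connections and whose image contains
all labelled vertices. -/
theorem Iso.of_fun {D : Skeleton.{u, v, w} K A} {D' : Skeleton.{u, v, w'} K A} (f : D.V → D'.V)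
    (hd : D.dom = D'.dom) (hc : D.cod = D'.cod) (hf : Function.Injective f)
    (hs : ∀ b, D'.lab b ≠ none → ∃ a, f a = b) (hl : ∀ a, D.lab a = D'.lab (f a))
    (hE : ∀ s t, D.E s t ↔ D'.E (s.map f id) (t.map f id)) : D.Iso D' := by
  refine ⟨fun a b => f a = b, hd, hc, fun a _ => ⟨_, rfl⟩, hs, ?_, ?_, ?_⟩
  · rintro a _ rfl; exact hl a
  · rintro a _ a' _ rfl rfl; exact hf.eq_iff.symm
  · rintro s t s' t' h1 h2
    have key : ∀ {s : D.V ⊕ ℕ} {s' : D'.V ⊕ ℕ}, Sum.LiftRel (fun a b => f a = b) (· = ·) s s' →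
        s' = s.map f id := by
      intro s s' h
      cases h with
      | inl h => simp [h]
      | inr h => simp [h]
    rw [key h1, key h2]
    exact hE s t

theorem Iso.refl (D : Skeleton.{u, v, w} K A) : D.Iso D :=
  .of_fun id rfl rfl Function.injective_id (fun b _ => ⟨b, rfl⟩) (fun _ => rfl) (by simp)

/-- Sequential composition: connections can pass through the common interface. -/
def seq (D D' : Skeleton.{u, v, w} K A) : Skeleton.{u, v, w} K A where
  V := D.V ⊕ D'.V
  dom := D.dom
  cod := D'.cod
  lab := Sum.elim D.lab D'.lab
  E
    | .inl (.inl a), .inl (.inl b) => D.E (.inl a) (.inl b)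
    | .inr i, .inl (.inl b) => D.E (.inr i) (.inl b)
    | .inl (.inl a), .inl (.inr b) => ∃ k, D.E (.inl a) (.inr k) ∧ D'.E (.inr k) (.inl b)
    | .inl (.inl a), .inr j => ∃ k, D.E (.inl a) (.inr k) ∧ D'.E (.inr k) (.inr j)
    | .inr i, .inl (.inr b) => ∃ k, D.E (.inr i) (.inr k) ∧ D'.E (.inr k) (.inl b)
    | .inr i, .inr j => ∃ k, D.E (.inr i) (.inr k) ∧ D'.E (.inr k) (.inr j)
    | .inl (.inr _), .inl (.inl _) => False
    | .inl (.inr a), .inl (.inr b) => D'.E (.inl a) (.inl b)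
    | .inl (.inr a), .inr j => D'.E (.inl a) (.inr j)

/-- Parallel composition. -/
def tensor (D D' : Skeleton.{u, v, w} K A) : Skeleton.{u, v, w} K A where
  V := D.V ⊕ D'.V
  dom := D.dom + D'.dom
  cod := D.cod + D'.cod
  lab := Sum.elim D.lab D'.lab
  E
    | .inl (.inl a), .inl (.inl b) => D.E (.inl a) (.inl b)
    | .inl (.inl a), .inr j => D.E (.inl a) (.inr j)
    | .inr i, .inl (.inl b) => D.E (.inr i) (.inl b)
    | .inl (.inr a), .inl (.inr b) => D'.E (.inl a) (.inl b)
    | .inl (.inr a), .inr j => D.cod ≤ j ∧ D'.E (.inl a) (.inr (j - D.cod))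
    | .inr i, .inl (.inr b) => D.dom ≤ i ∧ D'.E (.inr (i - D.dom)) (.inl b)
    | .inr i, .inr j => D.E (.inr i) (.inr j) ∨
        (D.dom ≤ i ∧ D.cod ≤ j ∧ D'.E (.inr (i - D.dom)) (.inr (j - D.cod)))
    | .inl (.inl _), .inl (.inr _) => False
    | .inl (.inr _), .inl (.inl _) => False

open Classical in
/-- Connections to the vertex `x` are joined with connections from the vertex `y`. -/
noncomputable def link (x y : A) (D : Skeleton.{u, v, w} K A) : Skeleton.{u, v, w} K A where
  V := D.V
  dom := D.dom
  cod := D.cod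
  lab a := if D.lab a = some (.name x) ∨ D.lab a = some (.name y) then none else D.lab a
  E s t := D.E s t ∨ ∃ a b, D.lab a = some (.name x) ∧ D.lab b = some (.name y) ∧
    D.E s (.inl a) ∧ D.E (.inl b) t

/-- The skeleton of an input variable. -/
def inVar (x : A) : Skeleton.{u, v, w} K A where
  V := PUnit
  dom := 0
  cod := 1
  lab _ := some (.name x)
  E s t := s.isLeft ∧ t = .inr 0

/-- The skeleton of an output variable. -/
def outVar (x : A) : Skeleton.{u, v, w} K A where
  V := PUnit
  dom := 1
  cod := 0
  lab _ := some (.name x)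
  E s t := s = .inr 0 ∧ t.isLeft

/-- The skeleton of a constant with `m` input and `n` output ports. -/
def const (k : K) (m n : ℕ) : Skeleton.{u, v, 0} K A where
  V := ConstVertex m n
  dom := m
  cod := n
  lab := constLab k
  E
    | .inr i, .inl (.inPort p) => i = p
    | .inl (.inPort _), .inl .box => True
    | .inl .box, .inl (.outPort _) => True
    | .inl (.outPort q), .inr j => j = q
    | _, _ => False

/-- Wires that connect the input `i` to the output `σ i`. -/
def wires (n : ℕ) (σ : ℕ → ℕ) : Skeleton.{u, v, w} K A where
  V := PEmpty
  dom := n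
  cod := n
  lab a := a.elim
  E
    | .inr i, .inr j => i < n ∧ j = σ i
    | _, _ => False

/-- The connections respect the numbers of inputs and outputs. -/
structure Bounded (D : Skeleton.{u, v, w} K A) : Prop where
  dom : ∀ i t, D.E (.inr i) t → i < D.dom
  cod : ∀ s j, D.E s (.inr j) → j < D.cod

section Congruence

variable {D : Skeleton.{u, v, w} K A} {D' : Skeleton.{u, v, w} K A} {D₁ : Skeleton.{u, v, w'} K A}
  {D₁' : Skeleton.{u, v, w'} K A} {D₂ D₃ D₄ : Skeleton.{u, v, w} K A}

theorem Iso.seq (h : D.Iso D₁) (h' : D'.Iso D₁') : (D.seq D').Iso (D₁.seq D₁') := by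
  obtain ⟨e, h⟩ := h
  obtain ⟨e', h'⟩ := h'
  refine ⟨Sum.LiftRel e e', h.dom, h'.cod, ?_, ?_, ?_, liftRel_inj h.inj h'.inj, ?_⟩
  · rintro (a | a) ha
    · obtain ⟨b, hb⟩ := h.total a ha; exact ⟨_, .inl hb⟩
    · obtain ⟨b, hb⟩ := h'.total a ha; exact ⟨_, .inr hb⟩
  · rintro (a | a) ha
    · obtain ⟨b, hb⟩ := h.surj a ha; exact ⟨_, .inl hb⟩
    · obtain ⟨b, hb⟩ := h'.surj a ha; exact ⟨_, .inr hb⟩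
  · rintro _ _ (hb | hb)
    exacts [h.lab _ _ hb, h'.lab _ _ hb]
  · rintro _ _ _ _ (⟨⟨h1⟩ | ⟨h1⟩⟩ | ⟨rfl⟩) (⟨⟨h2⟩ | ⟨h2⟩⟩ | ⟨rfl⟩) <;> simp only [Skeleton.seq]
    · exact h.conn _ _ _ _ (.inl h1) (.inl h2)
    · exact exists_congr fun k => and_congr (h.conn _ _ _ _ (.inl h1) (.inr rfl))
        (h'.conn _ _ _ _ (.inr rfl) (.inl h2))
    · exact exists_congr fun k => and_congr (h.conn _ _ _ _ (.inl h1) (.inr rfl))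
        (h'.conn _ _ _ _ (.inr rfl) (.inr rfl))
    · exact h'.conn _ _ _ _ (.inl h1) (.inl h2)
    · exact h'.conn _ _ _ _ (.inl h1) (.inr rfl)
    · exact h.conn _ _ _ _ (.inr rfl) (.inl h2)
    · exact exists_congr fun k => and_congr (h.conn _ _ _ _ (.inr rfl) (.inr rfl))
        (h'.conn _ _ _ _ (.inr rfl) (.inl h2))
    · exact exists_congr fun k => and_congr (h.conn _ _ _ _ (.inr rfl) (.inr rfl))
        (h'.conn _ _ _ _ (.inr rfl) (.inr rfl))

theorem Iso.tensor (h : D.Iso D₁) (h' : D'.Iso D₁') : (D.tensor D').Iso (D₁.tensor D₁') := by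
  obtain ⟨e, h⟩ := h
  obtain ⟨e', h'⟩ := h'
  refine ⟨Sum.LiftRel e e', congrArg₂ _ h.dom h'.dom, congrArg₂ _ h.cod h'.cod, ?_, ?_, ?_,
    liftRel_inj h.inj h'.inj, ?_⟩
  · rintro (a | a) ha
    · obtain ⟨b, hb⟩ := h.total a ha; exact ⟨_, .inl hb⟩
    · obtain ⟨b, hb⟩ := h'.total a ha; exact ⟨_, .inr hb⟩
  · rintro (a | a) ha
    · obtain ⟨b, hb⟩ := h.surj a ha; exact ⟨_, .inl hb⟩
    · obtain ⟨b, hb⟩ := h'.surj a ha; exact ⟨_, .inr hb⟩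
  · rintro _ _ (hb | hb)
    exacts [h.lab _ _ hb, h'.lab _ _ hb]
  · rintro _ _ _ _ (⟨⟨h1⟩ | ⟨h1⟩⟩ | ⟨rfl⟩) (⟨⟨h2⟩ | ⟨h2⟩⟩ | ⟨rfl⟩) <;>
      simp only [Skeleton.tensor, h.dom, h.cod]
    · exact h.conn _ _ _ _ (.inl h1) (.inl h2)
    · exact h.conn _ _ _ _ (.inl h1) (.inr rfl)
    · exact h'.conn _ _ _ _ (.inl h1) (.inl h2)
    · exact and_congr_right fun _ => h'.conn _ _ _ _ (.inl h1) (.inr rfl)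
    · exact h.conn _ _ _ _ (.inr rfl) (.inl h2)
    · exact and_congr_right fun _ => h'.conn _ _ _ _ (.inr rfl) (.inl h2)
    · exact or_congr (h.conn _ _ _ _ (.inr rfl) (.inr rfl)) (and_congr_right fun _ =>
        and_congr_right fun _ => h'.conn _ _ _ _ (.inr rfl) (.inr rfl))

theorem Iso.link {D₁ : Skeleton.{u, v, w'} K A} (x y : A) (h : D.Iso D₁) :
    (D.link x y).Iso (D₁.link x y) := by
  obtain ⟨e, h⟩ := h
  have hn : ∀ {a : D.V}, (D.link x y).lab a ≠ none → D.lab a ≠ none := by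
    intro a ha h0; simp [Skeleton.link, h0] at ha
  have hn' : ∀ {a : D₁.V}, (D₁.link x y).lab a ≠ none → D₁.lab a ≠ none := by
    intro a ha h0; simp [Skeleton.link, h0] at ha
  refine ⟨e, h.dom, h.cod, fun a ha => h.total a (hn ha), fun a ha => h.surj a (hn' ha), ?_, h.inj,
      ?_⟩
  · intro a b hab
    simp only [Skeleton.link, h.lab a b hab]
    congr 3 <;> rw [h.lab a b hab]
  · intro s t s' t' h1 h2
    refine or_congr (h.conn _ _ _ _ h1 h2) ⟨?_, ?_⟩
    · rintro ⟨a, b, ha, hb, h3, h4⟩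
      obtain ⟨a', ha'⟩ := h.total a (by simp [ha])
      obtain ⟨b', hb'⟩ := h.total b (by simp [hb])
      exact ⟨a', b', h.lab _ _ ha' ▸ ha, h.lab _ _ hb' ▸ hb, (h.conn _ _ _ _ h1 (.inl ha')).1 h3,
        (h.conn _ _ _ _ (.inl hb') h2).1 h4⟩
    · rintro ⟨a', b', ha, hb, h3, h4⟩
      obtain ⟨a, ha'⟩ := h.surj a' (by simp [ha])
      obtain ⟨b, hb'⟩ := h.surj b' (by simp [hb])
      exact ⟨a, b, (h.lab _ _ ha').trans ha, (h.lab _ _ hb').trans hb,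
        (h.conn _ _ _ _ h1 (.inl ha')).2 h3, (h.conn _ _ _ _ (.inl hb') h2).2 h4⟩

end Congruence

section Laws

variable {D D' D₁ D₂ D₃ D₄ : Skeleton.{u, v, w} K A} {n : ℕ} {σ τ : ℕ → ℕ}

theorem seq_assoc : ((D₁.seq D₂).seq D₃).Iso (D₁.seq (D₂.seq D₃)) := by
  refine .of_fun (Equiv.sumAssoc _ _ _) rfl rfl (Equiv.injective _)
    (fun b _ => ⟨_, Equiv.apply_symm_apply _ b⟩) (by rintro ((a | a) | a) <;> rfl) ?_
  rintro (((a | a) | a) | i) (((b | b) | b) | j) <;>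
    simp [seq, Equiv.sumAssoc] <;> grind

theorem tensor_assoc : ((D₁.tensor D₂).tensor D₃).Iso (D₁.tensor (D₂.tensor D₃)) := by
  refine .of_fun (Equiv.sumAssoc _ _ _) (Nat.add_assoc _ _ _) (Nat.add_assoc _ _ _)
    (Equiv.injective _)
    (fun b _ => ⟨_, Equiv.apply_symm_apply _ b⟩) (by rintro ((a | a) | a) <;> rfl) ?_
  rintro (((a | a) | a) | i) (((b | b) | b) | j) <;>
    simp [tensor, Equiv.sumAssoc, Nat.sub_sub] <;> grind

theorem exists_shift {P₁ P₃ Q₂ Q₄ : ℕ → Prop} {p q : Prop} {c c' : ℕ} (hP : ∀ k, P₁ k → k < c)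
    (hQ : ∀ k, Q₂ k → k < c') (h : c = c') :
    (∃ k, (P₁ k ∨ p ∧ c ≤ k ∧ P₃ (k - c)) ∧ (Q₂ k ∨ c' ≤ k ∧ q ∧ Q₄ (k - c'))) ↔
      (∃ k, P₁ k ∧ Q₂ k) ∨ p ∧ q ∧ ∃ k, P₃ k ∧ Q₄ k := by
  subst h
  constructor
  · rintro ⟨k, h1 | ⟨h1, h2, h3⟩, h4 | ⟨h4, h5, h6⟩⟩
    · exact .inl ⟨k, h1, h4⟩
    · exact absurd (hP k h1) (by omega)
    · exact absurd (hQ k h4) (by omega)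
    · exact .inr ⟨h1, h5, _, h3, h6⟩
  · rintro (⟨k, h1, h2⟩ | ⟨h1, h2, k, h3, h4⟩)
    · exact ⟨k, .inl h1, .inl h2⟩
    · exact ⟨c + k, .inr ⟨h1, by omega, by simpa using h3⟩, .inr ⟨by omega, h2, by simpa using h4⟩⟩

theorem tensor_seq (h₁ : D₁.Bounded) (h₂ : D₂.Bounded) (h3 : D₃.Bounded) (h4 : D₄.Bounded)
    (h : D₁.cod = D₂.dom) :
    ((D₁.seq D₂).tensor (D₃.seq D₄)).Iso ((D₁.tensor D₃).seq (D₂.tensor D₄)) := by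
  have a1 := h₁.cod
  have a2 := h₂.dom
  have a3 := h3.cod
  have a4 := h4.dom
  refine .of_fun (Equiv.sumSumSumComm _ _ _ _) rfl rfl (Equiv.injective _)
    (fun b _ => ⟨_, Equiv.apply_symm_apply _ b⟩) (by rintro ((a | a) | (a | a)) <;> rfl) ?_
  rintro (((a | a) | (a | a)) | i) (((b | b) | (b | b)) | j) <;>
    simp [seq, tensor, Equiv.sumSumSumComm]
  · exact fun k h1 h2 _ => by have := a1 _ _ h1; omega
  · simpa using (exists_shift (P₃ := fun _ => False) (p := False) (q := D₂.cod ≤ j)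
      (Q₄ := fun k => D₄.E (.inr k) (.inr (j - D₂.cod))) (a1 (.inl a))
      (fun k => a2 k (.inr j)) h).symm
  · exact fun k h1 _ h2 => by have := a2 _ _ h2; omega
  · simpa using (exists_shift (P₁ := fun _ => False) (Q₂ := fun _ => False) (p := True) (q := True)
      (P₃ := fun k => D₃.E (.inl a) (.inr k)) (Q₄ := fun k => D₄.E (.inr k) (.inl b))
      (by simp) (by simp) h).symm
  · simpa using (exists_shift (P₁ := fun _ => False) (p := True) (q := D₂.cod ≤ j)
      (P₃ := fun k => D₃.E (.inl a) (.inr k)) (Q₄ := fun k => D₄.E (.inr k) (.inr (j - D₂.cod)))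
      (by simp) (fun k => a2 k (.inr j)) h).symm
  · simpa using (exists_shift (p := D₁.dom ≤ i) (q := False)
      (P₃ := fun k => D₃.E (.inr (i - D₁.dom)) (.inr k)) (Q₄ := fun _ => False)
      (a1 (.inr i)) (fun k => a2 k (.inl b)) h).symm
  · simpa using (exists_shift (p := D₁.dom ≤ i) (q := True) (Q₂ := fun _ => False)
      (P₃ := fun k => D₃.E (.inr (i - D₁.dom)) (.inr k)) (Q₄ := fun k => D₄.E (.inr k) (.inl b))
      (a1 (.inr i)) (by simp) h).symm
  · exact (exists_shift (P₃ := fun k => D₃.E (.inr (i - D₁.dom)) (.inr k))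
      (Q₄ := fun k => D₄.E (.inr k) (.inr (j - D₂.cod)))
      (a1 (.inr i)) (fun k => a2 k (.inr j)) h).symm

theorem tensor_zero : (D.tensor (wires 0 id)).Iso D := by
  refine .of_fun (Sum.elim id PEmpty.elim) rfl rfl ?_ (fun b _ => ⟨.inl b, rfl⟩) ?_ ?_
  · rintro (a | a) (b | b) h <;> first | exact a.elim | exact b.elim | exact congrArg _ h
  · rintro (a | a); exacts [rfl, a.elim]
  · rintro ((a | a) | i) ((b | b) | j) <;> first | exact a.elim | exact b.elim | simp
        [tensor, wires]

theorem zero_tensor : ((wires 0 id).tensor D).Iso D := by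
  refine .of_fun (Sum.elim PEmpty.elim id) (Nat.zero_add _) (Nat.zero_add _) ?_
    (fun b _ => ⟨.inr b, rfl⟩) ?_ ?_
  · rintro (a | a) (b | b) h <;> first | exact a.elim | exact b.elim | exact congrArg _ h
  · rintro (a | a); exacts [a.elim, rfl]
  · rintro ((a | a) | i) ((b | b) | j) <;> first | exact a.elim | exact b.elim | simp
        [tensor, wires]

theorem wires_seq (h : D.Bounded) (hn : D.dom = n) : ((wires n id).seq D).Iso D := by
  have := h.dom
  refine .of_fun (Sum.elim PEmpty.elim id) hn.symm rfl ?_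
    (fun b _ => ⟨.inr b, rfl⟩) ?_ ?_
  · rintro (a | a) (b | b) h <;> first | exact a.elim | exact b.elim | exact congrArg _ h
  · rintro (a | a); exacts [a.elim, rfl]
  · rintro ((a | a) | i) ((b | b) | j) <;>
      first | exact a.elim | exact b.elim | (simp [seq, wires]; try grind)

theorem seq_wires (h : D.Bounded) (hn : D.cod = n) : (D.seq (wires n id)).Iso D := by
  have := h.cod
  refine .of_fun (Sum.elim id PEmpty.elim) rfl hn.symm ?_ (fun b _ => ⟨.inl b, rfl⟩) ?_ ?_
  · rintro (a | a) (b | b) h <;> first | exact a.elim | exact b.elim | exact congrArg _ h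
  · rintro (a | a); exacts [rfl, a.elim]
  · rintro ((a | a) | i) ((b | b) | j) <;>
      first | exact a.elim | exact b.elim | (simp [seq, wires]; try grind)

theorem wires_seq_wires (hσ : ∀ i < n, σ i < n) :
    ((wires n σ : Skeleton.{u, v, w} K A).seq (wires n τ)).Iso
      (wires n (τ ∘ σ) : Skeleton.{u, v, w} K A) := by
  refine .of_fun (Sum.elim id id) rfl rfl (by rintro (a | a) <;> exact a.elim) (fun b => b.elim)
    (by rintro (a | a) <;> exact a.elim) ?_
  rintro ((a | a) | i) ((b | b) | j) <;> first | exact a.elim | exact b.elim |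
      (simp [seq, wires]; try grind)

theorem wires_tensor_wires {m : ℕ} :
    ((wires m σ : Skeleton.{u, v, w} K A).tensor (wires n τ)).Iso (wires (m + n)
      (fun i => if i < m then σ i else m + τ (i - m)) : Skeleton.{u, v, w} K A) := by
  refine .of_fun (Sum.elim id id) rfl rfl (by rintro (a | a) <;> exact a.elim) (fun b => b.elim)
    (by rintro (a | a) <;> exact a.elim) ?_
  rintro ((a | a) | i) ((b | b) | j) <;> first | exact a.elim | exact b.elim |
      (simp [tensor, wires]; try grind)

theorem wires_congr (h : ∀ i < n, σ i = τ i) :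
    (wires n σ : Skeleton.{u, v, w} K A).Iso (wires n τ : Skeleton.{u, v, w} K A) := by
  refine .of_fun id rfl rfl Function.injective_id (fun b => b.elim) (fun b => b.elim) ?_
  rintro (a | i) (b | j) <;> first | exact a.elim | exact b.elim | (simp [wires]; try grind)

/-- The index of wire `i` after a block of `m` wires is swapped with a block of `n` wires. -/
def swap (m n : ℕ) (i : ℕ) : ℕ := if i < m then n + i else i - m

theorem symmetry {m₁ m₂ n₁ n₂ : ℕ} (h₁ : D₁.Bounded) (h₂ : D₂.Bounded) (a1 : D₁.dom = m₁)
    (a2 : D₁.cod = n₁) (b1 : D₂.dom = m₂) (b2 : D₂.cod = n₂) :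
    ((D₁.tensor D₂).seq (wires (n₁ + n₂) (swap n₁ n₂))).Iso
      ((wires (m₁ + m₂) (swap m₁ m₂)).seq (D₂.tensor D₁)) := by
  subst a1 a2 b1 b2
  have i1 := h₁.dom
  have i2 := h₁.cod
  have i3 := h₂.dom
  have i4 := h₂.cod
  refine .of_fun (Sum.elim (Sum.inr ∘ Sum.swap) PEmpty.elim) rfl (Nat.add_comm _ _) ?_ ?_ ?_ ?_
  · rintro ((a | a) | a) ((b | b) | b) h <;> first | exact a.elim | exact b.elim | (cases h <;> rfl)
  · rintro (b | b | b) _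
    exacts [b.elim, ⟨.inl (.inr b), rfl⟩, ⟨.inl (.inl b), rfl⟩]
  · rintro ((a | a) | a); exacts [rfl, rfl, a.elim]
  · rintro (((a | a) | a) | i) (((b | b) | b) | j) <;>
      first | exact a.elim | exact b.elim | simp [seq, tensor, wires, swap]
    · exact ⟨by grind, fun h => ⟨j - D₂.cod, h.2, by grind⟩⟩
    · exact ⟨by grind, fun h => ⟨j + D₁.cod, by grind⟩⟩
    · by_cases hi : i < D₁.dom <;> simp [hi] <;> grind
    · by_cases hi : i < D₁.dom <;> simp [hi] <;> grind
    · constructor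
      · rintro ⟨k, h1 | ⟨h1, h2, h3⟩, h4, rfl⟩
        · have := i1 _ _ h1; have := i2 _ _ h1; grind
        · have := i3 _ _ h3; have := i4 _ _ h3; grind
      · rintro ⟨h1, h2 | h2⟩
        · exact ⟨j + D₁.cod, by grind⟩
        · exact ⟨j - D₂.cod, by grind⟩

theorem link_seq_left (hx : ∀ a, D'.lab a ≠ some (.name x)) (hy : ∀ a, D'.lab a ≠ some (.name y)) :
    ((D.seq D').link x y).Iso ((D.link x y).seq D') := by
  refine .of_fun id rfl rfl Function.injective_id (fun b _ => ⟨b, rfl⟩) ?_ ?_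
  · rintro (a | a) <;> first | rfl | simp [link, seq, hx, hy]
  · rintro ((a | a) | i) ((b | b) | j) <;> simp [link, seq, hx, hy] <;> grind

theorem link_seq_right (hx : ∀ a, D.lab a ≠ some (.name x)) (hy : ∀ a, D.lab a ≠ some (.name y)) :
    ((D.seq D').link x y).Iso (D.seq (D'.link x y)) := by
  refine .of_fun id rfl rfl Function.injective_id (fun b _ => ⟨b, rfl⟩) ?_ ?_
  · rintro (a | a) <;> first | rfl | simp [link, seq, hx, hy]
  · rintro ((a | a) | i) ((b | b) | j) <;> simp [link, seq, hx, hy] <;> grind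

theorem link_tensor_right (hx : ∀ a, D.lab a ≠ some (.name x))
    (hy : ∀ a, D.lab a ≠ some (.name y)) :
    ((D.tensor D').link x y).Iso (D.tensor (D'.link x y)) := by
  refine .of_fun id rfl rfl Function.injective_id (fun b _ => ⟨b, rfl⟩) ?_ ?_
  · rintro (a | a) <;> first | rfl | simp [link, tensor, hx, hy]
  · rintro ((a | a) | i) ((b | b) | j) <;> simp [link, tensor, hx, hy] <;> grind

theorem link_ident (hxy : x ≠ y) : (((outVar x : Skeleton.{u, v, w} K A).seq (inVar y)).link x
    y).Iso
    (wires 1 id : Skeleton.{u, v, w} K A) := by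
  refine ⟨fun _ _ => False, rfl, rfl, ?_, fun b => b.elim, fun _ _ => False.elim,
    fun _ _ _ _ => False.elim, ?_⟩
  · rintro (a | a) h
    exacts [(h (if_pos (.inl rfl))).elim, (h (if_pos (.inr rfl))).elim]
  · rintro _ _ _ _ (⟨⟨⟩⟩ | ⟨rfl⟩) (⟨⟨⟩⟩ | ⟨rfl⟩)
    simp [link, seq, inVar, outVar, wires, hxy, hxy.symm]
    try grind

end Laws

end Skeleton

end Skeletons

/-! ### Soundness for skeletons -/

section Soundness

variable {A : Type v} [DecidableEq A] {S : Signature.{u}} {π π' : A → Bool} {t t' : A → ℚ}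
  {m n : ℕ} {M N P : Term S.Const A} {x y x' y' : A} {ρ ρ' : A → A} {Γ Δ : Finset A}

open Term Skeleton

/-- The skeleton of the diagram denoted by a term whose free variables have the polarity `π`. -/
noncomputable def Term.skel (S : Signature.{u}) :
    (A → Bool) → Term S.Const A → Skeleton.{u, v, 0} S.Const A
  | _, const k => .const k (S.dom k) (S.cod k)
  | _, zero => wires 0 id
  | _, one => wires 1 id
  | _, sym => wires 2 (swap 1 1)
  | π, seq M N => (M.skel S π).seq (N.skel S π)
  | π, tensor M N => (M.skel S π).tensor (N.skel S π)
  | π, var x => if π x then inVar x else outVar x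
  | π, .link x y M => (M.skel S (update (update π x false) y true)).link x y

theorem skel_congr (h : ∀ a ∈ M.fv, π a = π' a) : M.skel S π = M.skel S π' := by
  induction M generalizing π π' with
  | seq M N ih ih' =>
    simp only [Term.fv, mem_union] at h
    rw [Term.skel, Term.skel, ih fun a ha => h a (.inl ha), ih' fun a ha => h a (.inr ha)]
  | tensor M N ih ih' =>
    simp only [Term.fv, mem_union] at h
    rw [Term.skel, Term.skel, ih fun a ha => h a (.inl ha), ih' fun a ha => h a (.inr ha)]
  | var x => rw [Term.skel, Term.skel, h x (by simp)]
  | link x y M ih =>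
    rw [Term.skel, Term.skel, ih fun a ha => ?_]
    simp only [Term.fv, mem_sdiff, mem_insert, mem_singleton, not_or] at h
    grind
  | _ => simp [Term.skel]

theorem mem_fv_of_lab {a} (h : (M.skel S π).lab a = some (.name x)) : x ∈ M.fv := by
  induction M generalizing π with
  | const k => rcases a with _ | _ | _ | _ | _ <;> simp [Term.skel, Skeleton.const, constLab] at h
  | zero => exact a.elim
  | one => exact a.elim
  | sym => exact a.elim
  | seq M N ih ih' =>
    rcases a with a | a
    exacts [mem_union_left _ (ih h), mem_union_right _ (ih' h)]
  | tensor M N ih ih' =>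
    rcases a with a | a
    exacts [mem_union_left _ (ih h), mem_union_right _ (ih' h)]
  | var z =>
    have key : ∀ D : Skeleton.{u, v, 0} S.Const A, D = inVar z ∨ D = outVar z →
        ∀ a, D.lab a = some (.name x) → x ∈ (var z : Term S.Const A).fv := by
      rintro _ (rfl | rfl) a h <;> simpa [inVar, outVar, eq_comm] using h
    refine key _ ?_ a h
    rw [Term.skel]
    split_ifs <;> simp
  | link z w M ih =>
    simp only [Term.skel, Skeleton.link] at h
    grind

theorem Timed.skel (h : Timed S π t M m n) :
    (M.skel S π).dom = m ∧ (M.skel S π).cod = n ∧ (M.skel S π).Bounded := by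
  have hw : ∀ (n : ℕ) (σ : ℕ → ℕ), (∀ i < n, σ i < n) →
      (wires n σ : Skeleton.{u, v, 0} S.Const A).Bounded := by
    refine fun n σ h => ⟨fun i t ht => ?_, fun s j ht => ?_⟩
    · rcases t with t | t
      exacts [t.elim, ht.1]
    · rcases s with s | s
      exacts [s.elim, ht.2 ▸ h s ht.1]
  induction M generalizing π t m n with
  | const k =>
    obtain ⟨rfl, rfl⟩ := h
    refine ⟨rfl, rfl, fun i t ht => ?_, fun s j ht => ?_⟩
    · rcases t with (_ | p | _ | _ | _) | _ <;> simp [Term.skel, Skeleton.const] at ht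
      exact ht ▸ p.2
    · rcases s with (_ | _ | _ | p | _) | _ <;> simp [Term.skel, Skeleton.const] at ht
      exact ht ▸ p.2
  | zero => obtain ⟨rfl, rfl⟩ := h; exact ⟨rfl, rfl, hw _ _ (by simp)⟩
  | one => obtain ⟨rfl, rfl⟩ := h; exact ⟨rfl, rfl, hw _ _ (by simp)⟩
  | sym => obtain ⟨rfl, rfl⟩ := h; exact ⟨rfl, rfl, hw _ _ (by simp [swap]; grind)⟩
  | var x =>
    rcases h with ⟨hπ, rfl, rfl⟩ | ⟨hπ, rfl, rfl⟩ <;> simp only [Term.skel, hπ, if_true]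
    · exact ⟨rfl, rfl, fun i t h =>
          by simp [inVar] at h, fun s j h => by simp [inVar] at h; simp [inVar, h]⟩
    · exact ⟨rfl, rfl, fun s j h =>
          by simp [outVar] at h; simp [outVar, h], fun i t h => by simp [outVar] at h⟩
  | seq M N ih ih' =>
    obtain ⟨k, h1, h2, -⟩ := h
    obtain ⟨i1, -, i3⟩ := ih h1
    obtain ⟨-, j2, j3⟩ := ih' h2
    refine ⟨i1, j2, fun i t ht => ?_, fun s j ht => ?_⟩
    · rcases t with (t | t) | t
      exacts [i3.dom _ _ ht, i3.dom _ _ ht.choose_spec.1, i3.dom _ _ ht.choose_spec.1]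
    · rcases s with (s | s) | s
      exacts [j3.cod _ _ ht.choose_spec.2, j3.cod _ _ ht, j3.cod _ _ ht.choose_spec.2]
  | tensor M N ih ih' =>
    obtain ⟨m1, m2, n1, n2, rfl, rfl, h1, h2, -⟩ := h
    obtain ⟨rfl, rfl, i3⟩ := ih h1
    obtain ⟨rfl, rfl, j3⟩ := ih' h2
    refine ⟨rfl, rfl, fun i t ht => ?_, fun s j ht => ?_⟩ <;> simp only [Term.skel, Skeleton.tensor]
    · rcases t with (t | t) | t
      · have := i3.dom _ _ ht; omega
      · have := j3.dom _ _ ht.2; have := ht.1; omega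
      · rcases ht with ht | ht
        · have := i3.dom _ _ ht; omega
        · have := j3.dom _ _ ht.2.2; omega
    · rcases s with (s | s) | s
      · have := i3.cod _ _ ht; omega
      · have := j3.cod _ _ ht.2; have := ht.1; omega
      · rcases ht with ht | ht
        · have := i3.cod _ _ ht; omega
        · have := j3.cod _ _ ht.2.2; omega
  | link x y M ih =>
    obtain ⟨-, -, -, p, q, -, h⟩ := h
    obtain ⟨rfl, rfl, h3⟩ := ih h
    refine ⟨rfl, rfl, fun i t ht => ?_, fun s j ht => ?_⟩
    · rcases ht with ht | ⟨_, _, _, _, ht, _⟩ <;> exact h3.dom _ _ ht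
    · rcases ht with ht | ⟨_, _, _, _, _, ht⟩ <;> exact h3.cod _ _ ht

/-- Renaming of the variables in a label. -/
def Label.map {K : Type u} (ρ : A → A) : Label K A → Label K A
  | .name x => .name (ρ x)
  | .box k => .box k
  | .inPort k i => .inPort k i
  | .outPort k j => .outPort k j

/-- Renaming of the variables in a skeleton. -/
def Skeleton.relabel {K : Type u} (ρ : A → A) (D : Skeleton.{u, v, w} K A) :
    Skeleton.{u, v, w} K A :=
  { D with lab := fun a => (D.lab a).map (Label.map ρ) }

theorem Skeleton.link_relabel {K : Type u} {D : Skeleton.{u, v, w} K A}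
    (h : ∀ a z, D.lab a = some (.name z) → (ρ z = x' ↔ z = x) ∧ (ρ z = y' ↔ z = y) ∧
      (z ≠ x → z ≠ y → ρ z = ρ' z)) :
    (D.relabel ρ).link x' y' = (D.link x y).relabel ρ' := by
  have hx : ∀ a, (D.lab a).map (Label.map ρ) = some (.name x') ↔ D.lab a = some (.name x) := by
    intro a
    rcases hl : D.lab a with _ | ⟨z⟩ | _ | _ | _ <;> simp [Label.map]
    exact (h a z hl).1
  have hy : ∀ a, (D.lab a).map (Label.map ρ) = some (.name y') ↔ D.lab a = some (.name y) := by
    intro a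
    rcases hl : D.lab a with _ | ⟨z⟩ | _ | _ | _ <;> simp [Label.map]
    exact (h a z hl).2.1
  simp only [relabel, Skeleton.link, hx, hy, Skeleton.mk.injEq, heq_eq_eq, true_and, and_true]
  funext a
  by_cases h' : D.lab a = some (.name x) ∨ D.lab a = some (.name y)
  · rw [if_pos h']; exact if_pos ((or_congr (hx a) (hy a)).2 h')
  · rw [if_neg h']
    refine (if_neg ((or_congr (hx a) (hy a)).not.2 h')).trans ?_
    rcases hl : D.lab a with _ | ⟨z⟩ | _ | _ | _ <;> simp [Label.map]
    exact (h a z hl).2.2 (by rintro rfl; simp [hl] at h') (by rintro rfl; simp [hl] at h')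

theorem skel_rename (h : FreshFor ρ M) (hπ : ∀ a ∈ M.fv, π' (ρ a) = π a) :
    (M.rename ρ).skel S π' = (M.skel S π).relabel ρ := by
  have hw : ∀ (ρ : A → A) (n : ℕ) (σ : ℕ → ℕ), (wires n σ : Skeleton.{u, v, 0} S.Const A) =
      (wires n σ : Skeleton.{u, v, 0} S.Const A).relabel ρ := fun ρ n σ => by
    simp only [relabel, wires, Skeleton.mk.injEq, heq_eq_eq, true_and, and_true]
    exact funext fun a => a.elim
  induction M generalizing ρ π π' with
  | const k =>
    simp only [Term.rename, Term.skel, relabel, Skeleton.const, Skeleton.mk.injEq, heq_eq_eq,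
      true_and, and_true]
    funext a
    rcases a with _ | _ | _ | _ | _ <;> rfl
  | var x =>
    simp only [Term.rename, Term.skel, hπ x (by simp)]
    split_ifs <;> rfl
  | seq M N ih ih' =>
    simp only [Term.fv, mem_union] at hπ
    refine (congrArg₂ Skeleton.seq (ih h.left_of_seq fun a ha => hπ a (.inl ha))
      (ih' h.right_of_seq fun a ha => hπ a (.inr ha))).trans ?_
    simp only [Term.skel]
    simp only [relabel, Skeleton.seq, Skeleton.mk.injEq, heq_eq_eq, true_and]
    grind
  | tensor M N ih ih' =>
    have h' : FreshFor ρ (M ⨟ N) := ⟨h.1, h.2⟩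
    simp only [Term.fv, mem_union] at hπ
    refine (congrArg₂ Skeleton.tensor (ih h'.left_of_seq fun a ha => hπ a (.inl ha))
      (ih' h'.right_of_seq fun a ha => hπ a (.inr ha))).trans ?_
    simp only [Term.skel]
    simp only [relabel, Skeleton.tensor, Skeleton.mk.injEq, heq_eq_eq, true_and]
    grind
  | link x y M ih =>
    have h2 := h.fresh
    simp [Term.names] at h2 hπ
    have h3 : ∀ a ∈ M.fv, a ≠ x → a ≠ y → ρ a ≠ x ∧ ρ a ≠ y := by grind
    rw [Term.rename, Term.skel, Term.skel, ih (π := update (update π x false) y true) h.of_link]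
    · refine link_relabel fun a z hz => ?_
      have := h3 z (mem_fv_of_lab hz)
      grind
    all_goals grind
  | zero => exact hw ρ 0 id
  | one => exact hw ρ 1 id
  | sym => exact hw ρ 2 (swap 1 1)

theorem skel_ident : ∀ n : ℕ, ((ident n).skel S π).Iso (wires n id : Skeleton.{u, v, 0} S.Const A)
  | 0 => .refl _
  | 1 => .refl _
  | n + 2 => ((skel_ident (n + 1)).tensor (.refl _)).trans (wires_tensor_wires.trans
      (wires_congr (n := n + 2) fun i _ => by simp; grind))

theorem skel_symOne : ∀ m : ℕ, ((symOne m).skel S π).Iso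
    (wires (m + 1) (swap m 1) : Skeleton.{u, v, 0} S.Const A)
  | 0 => wires_congr fun i hi => by simp [swap]
  | 1 => .refl _
  | m + 2 => by
    refine (((skel_ident (m + 1)).tensor (.refl _)).trans wires_tensor_wires |>.seq
      (((skel_symOne (m + 1)).tensor (.refl _)).trans wires_tensor_wires)).trans
        ((wires_seq_wires (n := m + 3) ?_).trans (wires_congr ?_))
    all_goals intro i hi; simp [swap]; grind

theorem skel_symm (m : ℕ) : ∀ n : ℕ, ((Term.symm m n).skel S π).Iso
    (wires (m + n) (swap m n) : Skeleton.{u, v, 0} S.Const A)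
  | 0 => (skel_ident m).trans (wires_congr fun i hi => by simp [swap, hi])
  | 1 => skel_symOne m
  | n + 2 => by
    have h2 := ((skel_ident (S := S) (π := π) (n + 1)).tensor (skel_symOne (π := π) m)).trans
      wires_tensor_wires
    rw [show n + 1 + (m + 1) = m + (n + 2) by omega] at h2
    refine ((((skel_symm m (n + 1)).tensor (.refl _)).trans wires_tensor_wires).seq h2).trans
        ((wires_seq_wires (n := m + (n + 2)) ?_).trans (wires_congr ?_))
    all_goals intro i hi; simp [swap]; grind

/-- Provable equations preserve skeletons. -/
theorem EqThy.skel (h : EqThy S Γ Δ m n M N) :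
    ∀ {π : A → Bool}, Polarized π Γ Δ → (M.skel S π).Iso (N.skel S π) := by
  have pl : ∀ {π : A → Bool} {Γ Γ' Δ Δ' : Finset A}, Polarized π (Γ ∪ Γ') (Δ ∪ Δ') →
      Polarized π Γ Δ ∧ Polarized π Γ' Δ' := fun h =>
    ⟨⟨fun a ha => h.1 a (mem_union_left _ ha), fun a ha => h.2 a (mem_union_left _ ha)⟩,
      fun a ha => h.1 a (mem_union_right _ ha), fun a ha => h.2 a (mem_union_right _ ha)⟩
  have nl : ∀ {M : Term S.Const A} {π} {x : A}, x ∉ M.fv → ∀ a, (M.skel S π).lab a ≠ some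
      (.name x) :=
    fun h a ha => h (mem_fv_of_lab ha)
  have up : ∀ {M : Term S.Const A} {π : A → Bool} {x y : A}, x ∉ M.fv → y ∉ M.fv →
      M.skel S π = M.skel S (update (update π x false) y true) := fun hx hy =>
    skel_congr fun a ha => by grind
  induction h with
  | refl => exact fun _ => .refl _
  | symm _ ih => exact fun hπ => (ih hπ).symm
  | trans _ _ ih ih' => exact fun hπ => (ih hπ).trans (ih' hπ)
  | seq_congr _ _ _ ih ih' => exact fun hπ => (ih (pl hπ).1).seq (ih' (pl hπ).2)
  | tensor_congr _ _ _ ih ih' => exact fun hπ => (ih (pl hπ).1).tensor (ih' (pl hπ).2)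
  | @link_congr Γ Δ m n x y M N h1 h2 _ ih =>
    intro π hπ
    obtain ⟨t, hxy, -⟩ := h1.timed hπ
    obtain ⟨R, ⟨d⟩⟩ := h1
    have hfv := d.union_eq
    have hn : ∀ a, a ∈ Γ ∨ a ∈ Δ → a ≠ x ∧ a ≠ y := fun a ha => by
      have : a ∈ Γ ∪ Δ := by simpa using ha
      grind
    refine (ih ⟨fun a ha => ?_, fun a ha => ?_⟩).link x y
    · rcases mem_insert.1 ha with rfl | ha
      · simp
      · simp [hn a (.inl ha), hπ.1 a ha]
    · rcases mem_insert.1 ha with rfl | ha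
      · simp [hxy]
      · simp [hn a (.inr ha), hπ.2 a ha]
  | seq_assoc => exact fun _ => Skeleton.seq_assoc
  | ident_seq h =>
    intro π hπ
    obtain ⟨t, ht⟩ := h.timed hπ
    obtain ⟨h1, -, h3⟩ := ht.skel
    exact ((skel_ident _).seq (.refl _)).trans (wires_seq h3 h1)
  | seq_ident h =>
    intro π hπ
    obtain ⟨t, ht⟩ := h.timed hπ
    obtain ⟨-, h2, h3⟩ := ht.skel
    exact ((Iso.refl _).seq (skel_ident _)).trans (seq_wires h3 h2)
  | tensor_seq h _ =>
    intro π hπ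
    obtain ⟨t, _, _, _, _, -, -, ⟨k, a1, a2, -⟩, ⟨k', a3, a4, -⟩, -⟩ := h.timed hπ
    exact Skeleton.tensor_seq a1.skel.2.2 a2.skel.2.2 a3.skel.2.2 a4.skel.2.2
      (a1.skel.2.1.trans a2.skel.1.symm)
  | tensor_assoc => exact fun _ => Skeleton.tensor_assoc
  | tensor_zero => exact fun _ => Skeleton.tensor_zero
  | zero_tensor => exact fun _ => Skeleton.zero_tensor
  | symmetry _ h1 h2 =>
    intro π hπ
    obtain ⟨t, h1⟩ := h1.timed (pl hπ).1
    obtain ⟨t', h2⟩ := h2.timed (pl hπ).2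
    exact ((Iso.refl _).seq (skel_symm _ _)).trans ((Skeleton.symmetry h1.skel.2.2 h2.skel.2.2
      h1.skel.1 h1.skel.2.1 h2.skel.1 h2.skel.2.1).trans ((skel_symm _ _).symm.seq (.refl _)))
  | symm_zero_one => exact fun _ => (skel_symm 0 1).trans (wires_congr fun i _ => by simp [swap])
  | symm_one_zero =>
    exact fun _ => (skel_symm 1 0).trans (wires_congr fun i hi => by simp [swap, hi])
  | symm_add m n p =>
    intro π _
    have h2 := ((skel_ident (S := S) (π := π) n).tensor (skel_symm (π := π) m p)).trans
      wires_tensor_wires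
    rw [show n + (m + p) = m + n + p by omega] at h2
    refine (skel_symm m (n + p)).trans (Iso.symm ?_)
    refine ((((skel_symm m n).tensor (skel_ident p)).trans wires_tensor_wires).seq h2).trans
        ((wires_seq_wires ?_).trans ?_)
    · intro i hi; simp [swap]; grind
    · rw [← Nat.add_assoc]
      refine wires_congr fun i hi => ?_
      simp [swap]; grind
  | @alpha Γ Δ m n x y x' y' M hx hy hxy h1 _ =>
    intro π hπ
    obtain ⟨t, hxy', -⟩ := h1.timed hπ
    have hm := fun {π a z} (h : (M.skel S π).lab a = some (.name z)) =>
      fv_subset_names M (mem_fv_of_lab h)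
    rw [Term.skel, Term.skel, rename₂, skel_rename (π := update (update π x false) y true)
      (freshFor_rename₂ hx hy hxy), link_relabel (x := x) (y := y) (ρ' := id)]
    · have : ∀ D : Skeleton S.Const A, D.relabel id = D := fun D => by
        have : Label.map (K := S.Const) (id : A → A) = id := funext fun l => by cases l <;> rfl
        simp [relabel, this]
      rw [this]
      exact .refl _
    · grind
    · intro a ha
      have := fv_subset_names M ha
      simp only [Function.update_apply]
      grind
  | extrude_seq_left hx hy =>
    intro π _
    rw [Term.skel, Term.skel, Term.skel, Term.skel, up (π := π) hx hy]
    exact link_seq_left (nl hx) (nl hy)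
  | extrude_seq_right hx hy =>
    intro π _
    rw [Term.skel, Term.skel, Term.skel, Term.skel, up (π := π) hx hy]
    exact link_seq_right (nl hx) (nl hy)
  | extrude_tensor_right hx hy =>
    intro π _
    rw [Term.skel, Term.skel, Term.skel, Term.skel, up (π := π) hx hy]
    exact link_tensor_right (nl hx) (nl hy)
  | @link_ident x y hxy =>
    intro π _
    simp [Term.skel, hxy]
    exact Skeleton.link_ident hxy

end Soundness

/-! ### The skeleton of a diagram -/

section DiagramSkeleton

variable {K : Type u} {A : Type v} {m n k : ℕ} {x y : A} {π : A → Bool}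

/-- A skeleton endpoint other than an unlabelled vertex. -/
def Skeleton.Live (D : Skeleton.{u, v, w} K A) (s : D.V ⊕ ℕ) : Prop :=
  ∀ a, s = .inl a → D.lab a ≠ none

/-- To compare skeletons, it suffices to consider labelled vertices. -/
theorem Skeleton.Iso.of_live {D : Skeleton.{u, v, w} K A} {D' : Skeleton.{u, v, w'} K A}
    (f : D.V → D'.V) (hd : D.dom = D'.dom) (hc : D.cod = D'.cod)
    (hf : ∀ a b, D.lab a ≠ none → D.lab b ≠ none → f a = f b → a = b)
    (hs : ∀ b, D'.lab b ≠ none → ∃ a, f a = b) (hl : ∀ a, D.lab a ≠ none → D.lab a = D'.lab (f a))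
    (h : ∀ s t, D.Live s → D.Live t → (D.E s t ↔ D'.E (s.map f id) (t.map f id)))
    (hl' : ∀ a, D.lab a = none → D'.lab (f a) = none) : D.Iso D' := by
  refine ⟨fun a b => f a = b ∧ D.lab a ≠ none, hd, hc, fun a h => ⟨_, rfl, h⟩, fun b hb => ?_,
    ?_, ?_, fun s t s' t' hs ht => ?_⟩
  · obtain ⟨a, rfl⟩ := hs b hb
    exact ⟨a, rfl, fun h => hb (hl' a h)⟩
  · rintro a _ ⟨rfl, h⟩; exact hl a h
  · rintro a _ b _ ⟨rfl, h⟩ ⟨rfl, h'⟩; exact ⟨congrArg f, hf a b h h'⟩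
  · have key : ∀ {s : D.V ⊕ ℕ} {s' : D'.V ⊕ ℕ},
        Sum.LiftRel (fun a b => f a = b ∧ D.lab a ≠ none) (· = ·) s s' →
        s' = s.map f id ∧ D.Live s := by
      rintro _ _ (⟨rfl, h⟩ | rfl)
      · exact ⟨rfl, fun a ha => Sum.inl.inj ha ▸ h⟩
      · exact ⟨rfl, fun a ha => by cases ha⟩
    obtain ⟨rfl, hs'⟩ := key hs
    obtain ⟨rfl, ht'⟩ := key ht
    exact h s t hs' ht'

/-- To compare skeletons with the same vertices, it suffices to compare connections. -/
theorem Skeleton.Iso.of_conn {D : Skeleton.{u, v, w} K A} {d c : ℕ} {lab : D.V → Option (Label K A)}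
    {E : D.V ⊕ ℕ → D.V ⊕ ℕ → Prop} (hd : D.dom = d) (hc : D.cod = c) (hl : D.lab = lab)
    (h : ∀ s t, D.Live s → D.Live t → (D.E s t ↔ E s t)) : D.Iso ⟨D.V, d, c, lab, E⟩ := by
  subst hl
  exact .of_live (D' := ⟨D.V, d, c, D.lab, E⟩) id hd hc (fun _ _ _ _ h => h) (fun b _ => ⟨b, rfl⟩)
    (fun _ _ => rfl) (fun s t hs ht => by simpa using h s t hs ht) fun _ => id

namespace Diagram

/-- There is a nonempty path from `a` to `b` whose interior vertices are unlabelled. -/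
inductive Reach (D : Diagram K A m n) : D.V → D.V → Prop
  | edge {a b} : D.Edge a b → Reach D a b
  | step {a b c} : D.Edge a c → D.lab c = none → Reach D c b → Reach D a b

theorem Reach.trans {D : Diagram K A m n} {a b c : D.V} (h : D.Reach a c) (hc : D.lab c = none)
    (h' : D.Reach c b) : D.Reach a b := by
  induction h with
  | edge h => exact .step h hc h'
  | step h hl _ ih => exact .step h hl (ih hc h')

theorem Reach.exists_edge {D : Diagram K A m n} {a b : D.V} (h : D.Reach a b) :
    (∃ c, D.Edge a c) ∧ ∃ c, D.Edge c b := by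
  induction h with
  | edge h => exact ⟨⟨_, h⟩, _, h⟩
  | step h _ _ ih => exact ⟨⟨_, h⟩, ih.2⟩

theorem reach_iff_edge {D : Diagram K A m n}
    (h : ∀ a b c, D.Edge a b → D.Edge b c → D.lab b ≠ none) {a b : D.V} :
    D.Reach a b ↔ D.Edge a b := by
  refine ⟨fun h' => ?_, .edge⟩
  cases h' with
  | edge h' => exact h'
  | step h1 h2 h3 => exact (h _ _ _ h1 h3.exists_edge.1.choose_spec h2).elim

/-- `a` is the vertex `s`, or the input vertex with index `s`. -/
def IsSrc (D : Diagram K A m n) : D.V ⊕ ℕ → D.V → Prop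
  | .inl b, a => b = a
  | .inr i, a => ∃ h : i < m, D.inp ⟨i, h⟩ = a

/-- `a` is the vertex `t`, or the output vertex with index `t`. -/
def IsTgt (D : Diagram K A m n) : D.V ⊕ ℕ → D.V → Prop
  | .inl b, a => b = a
  | .inr j, a => ∃ h : j < n, D.out ⟨j, h⟩ = a

theorem isSrc_link {D : Diagram K A m n} {s : D.V ⊕ ℕ} {a : D.V} :
    (D.link x y).IsSrc s a ↔ D.IsSrc s a := by
  cases s <;> rfl

theorem isTgt_link {D : Diagram K A m n} {s : D.V ⊕ ℕ} {a : D.V} :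
    (D.link x y).IsTgt s a ↔ D.IsTgt s a := by
  cases s <;> rfl

/-- The skeleton of a diagram, in which wires are contracted to single connections. -/
def skel (D : Diagram K A m n) : Skeleton.{u, v, 0} K A where
  V := D.V
  dom := m
  cod := n
  lab := D.lab
  E s t := ∃ a b, D.IsSrc s a ∧ D.IsTgt t b ∧ D.Reach a b

theorem skel_inl_inl {D : Diagram K A m n} {a b : D.V} :
    D.skel.E (.inl a) (.inl b) ↔ D.Reach a b := by
  simp [skel, IsSrc, IsTgt]

theorem skel_inl_inr {D : Diagram K A m n} {a : D.V} {j : ℕ} :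
    D.skel.E (.inl a) (.inr j) ↔ ∃ h : j < n, D.Reach a (D.out ⟨j, h⟩) := by
  simp [skel, IsSrc, IsTgt]

theorem skel_inr_inl {D : Diagram K A m n} {b : D.V} {i : ℕ} :
    D.skel.E (.inr i) (.inl b) ↔ ∃ h : i < m, D.Reach (D.inp ⟨i, h⟩) b := by
  simp [skel, IsSrc, IsTgt]

theorem skel_inr_inr {D : Diagram K A m n} {i j : ℕ} : D.skel.E (.inr i) (.inr j) ↔
    ∃ h : i < m, ∃ h' : j < n, D.Reach (D.inp ⟨i, h⟩) (D.out ⟨j, h'⟩) := by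
  simp [skel, IsSrc, IsTgt]

theorem skel_conn_of_edge {D : Diagram K A m n} {p q : D.V} (h : ∀ a b, D.Edge a b ↔ a = p ∧ b = q)
    (hpq : p ≠ q) (s t : D.V ⊕ ℕ) : D.skel.E s t ↔ D.IsSrc s p ∧ D.IsTgt t q := by
  have hr {a b} : D.Reach a b ↔ a = p ∧ b = q :=
    (reach_iff_edge fun a b c h1 h2 =>
        (hpq (((h _ _).1 h2).1.symm.trans ((h _ _).1 h1).2)).elim).trans
      (h a b)
  constructor
  · rintro ⟨a, b, h1, h2, h3⟩
    obtain ⟨rfl, rfl⟩ := hr.1 h3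
    exact ⟨h1, h2⟩
  · exact fun h => ⟨p, q, h.1, h.2, hr.2 ⟨rfl, rfl⟩⟩

/-- The degree conditions that hold in diagrams of terms: the inputs are initial and the outputs
final, other unlabelled vertices have one predecessor and one successor, and only boxes branch. -/
structure Tidy (D : Diagram K A m n) : Prop where
  inp_unlabelled : ∀ i, D.lab (D.inp i) = none
  out_unlabelled : ∀ j, D.lab (D.out j) = none
  inp_pred : ∀ i a, ¬ D.Edge a (D.inp i)
  out_succ : ∀ j a, ¬ D.Edge (D.out j) a
  exists_pred : ∀ a, D.lab a = none → (∀ i, a ≠ D.inp i) → ∃ b, D.Edge b a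
  exists_succ : ∀ a, D.lab a = none → (∀ j, a ≠ D.out j) → ∃ b, D.Edge a b
  pred_unique : ∀ a b c, D.Edge b a → D.Edge c a → (∃ k, D.lab a = some (.box k)) ∨ b = c
  succ_unique : ∀ a b c, D.Edge a b → D.Edge a c → (∃ k, D.lab a = some (.box k)) ∨ b = c
  box_pred : ∀ a b k, D.Edge b a → D.lab a = some (.box k) → D.lab b ≠ none
  box_succ : ∀ a b k, D.Edge a b → D.lab a = some (.box k) → D.lab b ≠ none
  box_name_pred : ∀ a b k x, D.Edge b a → D.lab a = some (.box k) → D.lab b ≠ some (.name x)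
  box_name_succ : ∀ a b k x, D.Edge a b → D.lab a = some (.box k) → D.lab b ≠ some (.name x)
  inp_inj : ∀ i i', D.inp i = D.inp i' → i = i'
  out_inj : ∀ j j', D.out j = D.out j' → j = j'
  inp_ne_out : ∀ i j, D.inp i ≠ D.out j

/-- Input variables label initial vertices, output variables final ones. -/
structure Polar (π : A → Bool) (D : Diagram K A m n) : Prop where
  src : ∀ a b x, D.lab a = some (.name x) → π x = true → ¬ D.Edge b a
  snk : ∀ a b x, D.lab a = some (.name x) → π x = false → ¬ D.Edge a b
  name_succ : ∀ a x, D.lab a = some (.name x) → π x = true → ∃ b, D.Edge a b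
  name_pred : ∀ a x, D.lab a = some (.name x) → π x = false → ∃ b, D.Edge b a

theorem Tidy.seq {D : Diagram K A m k} {D' : Diagram K A k n} (h : D.Tidy) (h' : D'.Tidy) :
    (D.seq D').Tidy := by
  have e : ∀ a, (∃ i, D.out i = a) ∨ ∀ i, a ≠ D.out i := by grind
  have e' : ∀ a, (∃ i, D'.inp i = a) ∨ ∀ i, a ≠ D'.inp i := by grind
  obtain ⟨a1, a2, a3, a4, a5, a6, a7, a8, a9, a10, a11, a12, a13, a14, a15⟩ := h
  obtain ⟨b1, b2, b3, b4, b5, b6, b7, b8, b9, b10, b11, b12, b13, b14, b15⟩ := h'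
  constructor <;> simp only [Diagram.seq, Function.comp_apply, Sum.elim_inl, Sum.elim_inr,
      Sum.forall, Sum.exists, Sum.inl.injEq, Sum.inr.injEq, reduceCtorEq, Ne, not_false_iff]
  all_goals try grind

theorem Tidy.tensor {m' n' : ℕ} {D : Diagram K A m n} {D' : Diagram K A m' n'} (h : D.Tidy)
    (h' : D'.Tidy) :
    (D.tensor D').Tidy := by
  obtain ⟨a1, a2, a3, a4, a5, a6, a7, a8, a9, a10, a11, a12, a13, a14, a15⟩ := h
  obtain ⟨b1, b2, b3, b4, b5, b6, b7, b8, b9, b10, b11, b12, b13, b14, b15⟩ := h'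
  constructor <;> simp only [Diagram.tensor, Fin.forall_fin_add, Fin.append_left, Fin.append_right,
      Function.comp_apply, Sum.elim_inl, Sum.elim_inr, Sum.forall, Sum.exists, Sum.inl.injEq,
      Sum.inr.injEq, reduceCtorEq, Ne, not_false_iff]
  all_goals try grind

theorem Tidy.link {D : Diagram K A m n} (h : D.Tidy) (hp : D.Polar π) (hx : π x = false)
    (hy : π y = true) (hX : ∃ a, D.lab a = some (.name x)) (hY : ∃ a, D.lab a = some (.name y))
    (hn : ∀ a b z, D.lab a = some (.name z) → D.lab b = some (.name z) → a = b) :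
    (D.link x y).Tidy := by
  obtain ⟨a1, a2, a3, a4, a5, a6, a7, a8, a9, a10, a11, a12, a13, a14, a15⟩ := h
  obtain ⟨b1, b2, b3, b4⟩ := hp
  constructor <;> simp only [Diagram.link]
  all_goals try grind

theorem Polar.seq {D : Diagram K A m k} {D' : Diagram K A k n} (h : D.Polar π) (h' : D'.Polar π)
    (ho : ∀ j, D.lab (D.out j) = none) (hi : ∀ i, D'.lab (D'.inp i) = none) :
    (D.seq D').Polar π := by
  obtain ⟨a1, a2, a3, a4⟩ := h
  obtain ⟨b1, b2, b3, b4⟩ := h'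
  constructor <;> simp only [Diagram.seq, Sum.elim_inl, Sum.elim_inr, Sum.forall, Sum.exists]
  all_goals try grind

theorem Polar.tensor {m' n' : ℕ} {D : Diagram K A m n} {D' : Diagram K A m' n'} (h : D.Polar π)
    (h' : D'.Polar π) : (D.tensor D').Polar π := by
  obtain ⟨a1, a2, a3, a4⟩ := h
  obtain ⟨b1, b2, b3, b4⟩ := h'
  constructor <;> simp only [Diagram.tensor, Sum.elim_inl, Sum.elim_inr, Sum.forall, Sum.exists]
  all_goals try grind

theorem Polar.link {D : Diagram K A m n} {π' : A → Bool} (h : D.Polar π)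
    (hπ : ∀ z, z ≠ x → z ≠ y → π' z = π z) : (D.link x y).Polar π' := by
  obtain ⟨a1, a2, a3, a4⟩ := h
  have hl : ∀ {a z}, (D.link x y).lab a = some (.name z) →
      D.lab a = some (.name z) ∧ z ≠ x ∧ z ≠ y := by
    intro a z h
    simp only [Diagram.link] at h
    split_ifs at h with h'
    refine ⟨h, ?_, ?_⟩ <;> rintro rfl <;> simp_all
  refine ⟨fun a b z ha hz h => ?_, fun a b z ha hz h => ?_, fun a z ha hz => ?_, fun a z ha hz =>
      ?_⟩
  all_goals
    obtain ⟨h1, h2, h3⟩ := hl ha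
    rw [hπ z h2 h3] at hz
  · rcases h with h | h
    exacts [a1 a b z h1 hz h, h3 (by simpa [h1] using h.2)]
  · rcases h with h | h
    exacts [a2 a b z h1 hz h, h2 (by simpa [h1] using h.1)]
  · exact (a3 a z h1 hz).imp fun _ => .inl
  · exact (a4 a z h1 hz).imp fun _ => .inl

theorem seq_reach {D : Diagram K A m k} {D' : Diagram K A k n} (ho : ∀ j, D.lab (D.out j) = none)
    (hi : ∀ i, D'.lab (D'.inp i) = none) {p q : (D.seq D').V} : (D.seq D').Reach p q ↔
      match p, q with
      | .inl a, .inl b => D.Reach a b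
      | .inr a, .inr b => D'.Reach a b
      | .inr _, .inl _ => False
      | .inl a, .inr b => ∃ i, (a = D.out i ∨ D.Reach a (D.out i)) ∧
          (b = D'.inp i ∨ D'.Reach (D'.inp i) b) := by
  have h1 : ∀ {a b}, D.Reach a b → (D.seq D').Reach (.inl a) (.inl b) := fun h => by
    induction h with
    | edge h => exact .edge h
    | step h hl _ ih => exact .step (c := Sum.inl _) h hl ih
  have h2 : ∀ {a b}, D'.Reach a b → (D.seq D').Reach (.inr a) (.inr b) := fun h => by
    induction h with
    | edge h => exact .edge h
    | step h hl _ ih => exact .step (c := Sum.inr _) h hl ih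
  constructor
  · intro h
    induction h with
    | @edge p q h =>
      rcases p with a | a <;> rcases q with b | b
      · exact .edge h
      · exact h.imp fun i h => ⟨.inl h.1, .inl h.2⟩
      · exact h
      · exact .edge h
    | @step p q c h hl _ ih =>
      rcases p with a | a <;> rcases c with c | c <;> rcases q with b | b
      · exact .step h hl ih
      · obtain ⟨i, rfl | h1, h2⟩ := ih
        exacts [⟨i, .inr (.edge h), h2⟩, ⟨i, .inr (.step h hl h1), h2⟩]
      · exact ih.elim
      · obtain ⟨i, rfl, rfl⟩ := h
        exact ⟨i, .inl rfl, .inr ih⟩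
      · exact h
      · exact h.elim
      · exact ih.elim
      · exact .step h hl ih
  · rcases p with a | a <;> rcases q with b | b
    · exact h1
    · rintro ⟨i, h, h'⟩
      have e : (D.seq D').Edge (.inl (D.out i)) (.inr (D'.inp i)) := ⟨i, rfl, rfl⟩
      have e' : (D.seq D').Reach (.inl (D.out i)) (.inr b) := by
        rcases h' with rfl | h'
        exacts [.edge e, .step e (hi i) (h2 h')]
      rcases h with rfl | h
      exacts [e', (h1 h).trans (ho i) e']
    · exact False.elim
    · exact h2

theorem tensor_reach {m' n' : ℕ} {D : Diagram K A m n} {D' : Diagram K A m' n'}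
    {p q : (D.tensor D').V} :
    (D.tensor D').Reach p q ↔
      match p, q with
      | .inl a, .inl b => D.Reach a b
      | .inr a, .inr b => D'.Reach a b
      | _, _ => False := by
  constructor
  · intro h
    induction h with
    | @edge p q h =>
      rcases p with a | a <;> rcases q with b | b
      exacts [.edge h, h, h, .edge h]
    | @step p q c h hl _ ih =>
      rcases p with a | a <;> rcases c with c | c <;> rcases q with b | b
      exacts [.step h hl ih, ih.elim, ih.elim, h.elim, h.elim, ih.elim, ih.elim, .step h hl ih]
  · rcases p with a | a <;> rcases q with b | b
    · intro h
      induction h with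
      | edge h => exact .edge h
      | step h hl _ ih => exact .step (c := Sum.inl _) h hl ih
    · exact False.elim
    · exact False.elim
    · intro h
      induction h with
      | edge h => exact .edge h
      | step h hl _ ih => exact .step (c := Sum.inr _) h hl ih

theorem link_reach {D : Diagram K A m n} (hp : D.Polar π) (hx : π x = false) (hy : π y = true)
    {a b : D.V} (ha : D.lab a ≠ some (.name x)) (hb : D.lab b ≠ some (.name y)) :
    (D.link x y).Reach a b ↔ D.Reach a b ∨ ∃ X Y, D.lab X = some (.name x) ∧
      D.lab Y = some (.name y) ∧ D.Reach a X ∧ D.Reach Y b := by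
  have hl : ∀ c, (D.link x y).lab c = none ↔
      D.lab c = some (.name x) ∨ D.lab c = some (.name y) ∨ D.lab c = none := by
    intro c
    simp only [Diagram.link]
    grind
  have h1 : ∀ {a b}, D.Reach a b → (D.link x y).Reach a b := fun h => by
    induction h with
    | edge h => exact .edge (.inl h)
    | step h hc _ ih => exact .step (.inl h) ((hl _).2 (.inr (.inr hc))) ih
  have key : ∀ {a b}, (D.link x y).Reach a b → D.Reach a b ∨ ∃ X Y, D.lab X = some (.name x) ∧
      D.lab Y = some (.name y) ∧ (a = X ∨ D.Reach a X) ∧ (b = Y ∨ D.Reach Y b) := fun h => by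
    induction h with
    | edge h =>
      rcases h with h | h
      exacts [.inl (.edge h), .inr ⟨_, _, h.1, h.2, .inl rfl, .inl rfl⟩]
    | @step a b c h hc _ ih =>
      rcases h with h | h
      · rcases (hl c).1 hc with hc | hc | hc
        · rcases ih with ih | ⟨X, Y, hX, hY, rfl | ih, h'⟩
          · exact (hp.snk _ _ _ hc hx ih.exists_edge.1.choose_spec).elim
          · exact .inr ⟨_, Y, hX, hY, .inr (.edge h), h'⟩
          · exact (hp.snk _ _ _ hc hx ih.exists_edge.1.choose_spec).elim
        · exact (hp.src _ _ _ hc hy h).elim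
        · rcases ih with ih | ⟨X, Y, hX, hY, rfl | ih, h'⟩
          · exact .inl (.step h hc ih)
          · grind
          · exact .inr ⟨X, Y, hX, hY, .inr (.step h hc ih), h'⟩
      all_goals grind
  refine ⟨fun h => (key h).imp id ?_, ?_⟩
  · rintro ⟨X, Y, hX, hY, rfl | h1, rfl | h2⟩
    exacts [(ha hX).elim, (ha hX).elim, (hb hY).elim, ⟨X, Y, hX, hY, h1, h2⟩]
  · rintro (h | ⟨X, Y, hX, hY, h, h'⟩)
    · exact h1 h
    · exact (h1 h).trans ((hl X).2 (.inl hX)) (.step (.inr ⟨hX, hY⟩) ((hl Y).2 (.inr (.inl hY)))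
          (h1 h'))

theorem skel_seq {D : Diagram K A m k} {D' : Diagram K A k n} (h : D.Tidy) (h' : D'.Tidy) :
    (D.seq D').skel.Iso (D.skel.seq D'.skel) := by
  have a1 := h.out_unlabelled
  have b1 := h'.inp_unlabelled
  have r11 : ∀ a b, (D.seq D').Reach (.inl a) (.inl b) ↔ D.Reach a b := fun _ _ => seq_reach a1 b1
  have r21 : ∀ a b, ¬ (D.seq D').Reach (.inr a) (.inl b) := fun _ _ h => (seq_reach a1 b1).1 h
  have r22 : ∀ a b, (D.seq D').Reach (.inr a) (.inr b) ↔ D'.Reach a b := fun _ _ => seq_reach a1 b1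
  have r12 : ∀ a b, (∀ i, a ≠ D.out i) → (∀ i, D'.inp i ≠ b) →
      ((D.seq D').Reach (.inl a) (.inr b) ↔
        ∃ i, ∃ h : i < k, D.Reach a (D.out ⟨i, h⟩) ∧ D'.Reach (D'.inp ⟨i, h⟩) b) := by
    intro a b ha hb
    refine (seq_reach a1 b1).trans (Iff.trans (exists_congr fun i => ?_) (Fin.exists_iff
      (p := fun i => D.Reach a (D.out i) ∧ D'.Reach (D'.inp i) b)))
    simp [ha, (hb i).symm]
  have a2 := h.inp_ne_out
  have b2 := h'.inp_ne_out
  refine Skeleton.Iso.of_conn (D := (D.seq D').skel) rfl rfl rfl ?_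
  rintro ((a | a) | i) ((b | b) | j) hs ht <;>
    simp [Skeleton.Live, skel, Diagram.seq] at hs ht <;>
    simp only [skel, IsSrc, IsTgt] <;> simp only [Diagram.seq] at r11 r12 r21 r22 ⊢ <;> simp
        [r11, r21, r22]
  · rw [r12 _ _ (by grind) (by grind)]; grind
  · refine (exists_congr fun h => r12 _ _ (by grind) (by grind)).trans ?_; grind
  · refine (exists_congr fun h => r12 _ _ (by grind) (by grind)).trans ?_; grind
  · refine (exists_congr fun h => exists_congr fun h => r12 _ _ (by grind) (by grind)).trans ?_;
        grind

theorem skel_tensor {m' n' : ℕ} {D : Diagram K A m n} {D' : Diagram K A m' n'} :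
    (D.tensor D').skel.Iso (D.skel.tensor D'.skel) := by
  have r11 : ∀ a b, (D.tensor D').Reach (.inl a) (.inl b) ↔ D.Reach a b := fun _ _ => tensor_reach
  have r22 : ∀ a b, (D.tensor D').Reach (.inr a) (.inr b) ↔ D'.Reach a b := fun _ _ => tensor_reach
  have r12 : ∀ a b, ¬ (D.tensor D').Reach (.inl a) (.inr b) := fun _ _ h => tensor_reach.1 h
  have r21 : ∀ a b, ¬ (D.tensor D').Reach (.inr a) (.inl b) := fun _ _ h => tensor_reach.1 h
  have ap : ∀ {m m' : ℕ} (f : Fin m → D.V) (f' : Fin m' → D'.V) (i : ℕ) (c : D.V ⊕ D'.V),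
      (∃ h : i < m + m', Fin.append (Sum.inl ∘ f) (Sum.inr ∘ f') ⟨i, h⟩ = c) ↔
        (∃ h : i < m, .inl (f ⟨i, h⟩) = c) ∨
        (m ≤ i ∧ ∃ h : i - m < m', .inr (f' ⟨i - m, h⟩) = c) := by
    intro m m' f f' i c
    by_cases h : i < m
    · have e (h') : Fin.append (Sum.inl ∘ f) (Sum.inr ∘ f') ⟨i, h'⟩ = .inl (f ⟨i, h⟩) :=
        Fin.append_left _ _ ⟨i, h⟩
      simp [h, e, Nat.not_le.2 h, Nat.lt_add_right]
    · obtain ⟨p, rfl⟩ := Nat.exists_eq_add_of_le (Nat.not_lt.1 h)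
      have e (h' : m + p < m + m') : Fin.append (Sum.inl ∘ f) (Sum.inr ∘ f') ⟨m + p, h'⟩ =
        .inr (f' ⟨p, by omega⟩) := Fin.append_right _ _ ⟨p, by omega⟩
      simp [e]
  refine Skeleton.Iso.of_conn (D := (D.tensor D').skel) rfl rfl rfl ?_
  rintro ((a | a) | i) ((b | b) | j) hs ht <;>
    simp only [skel, IsSrc, IsTgt] <;> simp only [Diagram.tensor] at r11 r12 r21 r22 ⊢ <;>
    simp only [ap, Sum.exists] <;> simp [r11, r12, r21, r22]

theorem skel_link {D : Diagram K A m n} (h : D.Tidy) (hp : D.Polar π) (hx : π x = false)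
    (hy : π y = true) : (D.link x y).skel.Iso (D.skel.link x y) := by
  have hl : ∀ a, (D.link x y).lab a ≠ none ∨ D.lab a = none →
      D.lab a ≠ some (.name x) ∧ D.lab a ≠ some (.name y) := by
    intro a
    simp only [Diagram.link]
    grind
  refine Skeleton.Iso.of_conn (D := (D.link x y).skel) rfl rfl rfl fun s t hs ht => ?_
  have hs' : ∀ a, D.IsSrc s a → (D.link x y).lab a ≠ none ∨ D.lab a = none := by
    rcases s with s | s
    · rintro _ rfl; exact .inl (hs _ rfl)
    · rintro _ ⟨_, rfl⟩; exact .inr (h.inp_unlabelled _)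
  have ht' : ∀ a, D.IsTgt t a → (D.link x y).lab a ≠ none ∨ D.lab a = none := by
    rcases t with t | t
    · rintro _ rfl; exact .inl (ht _ rfl)
    · rintro _ ⟨_, rfl⟩; exact .inr (h.out_unlabelled _)
  have r := fun a b ha hb => link_reach hp hx hy (hl a (hs' a ha)).1 (hl b (ht' b hb)).2
  constructor
  · rintro ⟨a, b, h1, h2, h3⟩
    replace h1 := isSrc_link.1 h1
    replace h2 := isTgt_link.1 h2
    rcases (r a b h1 h2).1 h3 with h3 | ⟨X, Y, hX, hY, h3, h4⟩
    exacts [.inl ⟨a, b, h1, h2, h3⟩, .inr ⟨X, Y, hX, hY, ⟨a, X, h1, rfl, h3⟩, Y, b, rfl, h2, h4⟩]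
  · rintro (⟨a, b, h1, h2, h3⟩ | ⟨X, Y, hX, hY, ⟨a, _, h1, rfl, h3⟩, _, b, rfl, h2, h4⟩)
    exacts [⟨a, b, isSrc_link.2 h1, isTgt_link.2 h2, (r a b h1 h2).2 (.inl h3)⟩,
      ⟨a, b, isSrc_link.2 h1, isTgt_link.2 h2, (r a b h1 h2).2 (.inr ⟨_, _, hX, hY, h3, h4⟩)⟩]

end Diagram

variable [DecidableEq A] {S : Signature.{u}} {Γ Δ : Finset A} {M : Term S.Const A}
    {R : A → A → Prop}

/-- The diagram of a derivation is tidy, its skeleton is that of the term. -/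
theorem Deriv.skel_iso (d : Deriv S Γ Δ M m n R) : ∀ {π : A → Bool}, Polarized π Γ Δ →
    d.diagram.Tidy ∧ d.diagram.Polar π ∧ (∀ x ∈ Γ ∪ Δ, ∃ a, d.diagram.lab a = some (.name x)) ∧
      d.diagram.skel.Iso (M.skel S π) := by
  have pl : ∀ {π : A → Bool} {Γ Γ' Δ Δ' : Finset A}, Polarized π (Γ ∪ Γ') (Δ ∪ Δ') →
      Polarized π Γ Δ ∧ Polarized π Γ' Δ' := fun h =>
    ⟨⟨fun a ha => h.1 a (mem_union_left _ ha), fun a ha => h.2 a (mem_union_left _ ha)⟩,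
      fun a ha => h.1 a (mem_union_right _ ha), fun a ha => h.2 a (mem_union_right _ ha)⟩
  induction d with
  | inVar x =>
    intro π hπ
    have hx : π x = true := by simpa using hπ.1 x
    refine ⟨?_, ?_, fun z hz => ⟨false, by simpa [Deriv.diagram, Diagram.inVar, eq_comm] using hz⟩,
      .symm ?_⟩
    · constructor <;> simp [Deriv.diagram, Diagram.inVar]
    · constructor <;> simp [Deriv.diagram, Diagram.inVar, hx]
    · rw [Term.skel, if_pos hx]
      refine .of_fun (fun _ => false) rfl rfl (fun _ _ _ => rfl) ?_ (fun _ => rfl) ?_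
      · rintro (_ | _) h
        exacts [⟨⟨⟩, rfl⟩, (h rfl).elim]
      · refine fun s t => .trans ?_ (Diagram.skel_conn_of_edge (p := false) (q := true)
          (fun _ _ => .rfl) Bool.false_ne_true _ _).symm
        rcases s with s | s <;> rcases t with t | t
        · exact ⟨fun h => (nomatch h.2), fun h => (nomatch h.2)⟩
        · exact ⟨fun ⟨_, h⟩ => ⟨rfl, Sum.inr.inj h ▸ Nat.one_pos, rfl⟩,
            fun ⟨_, h, _⟩ => ⟨rfl, congrArg _ (Nat.lt_one_iff.1 h)⟩⟩
        all_goals exact ⟨fun h => (nomatch h.1), fun ⟨⟨h, _⟩, _⟩ => (Nat.not_lt_zero _ h).elim⟩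
  | outVar x =>
    intro π hπ
    have hx : π x = false := by simpa using hπ.2 x
    refine ⟨?_, ?_, fun z hz => ⟨true, by simpa [Deriv.diagram, Diagram.outVar, eq_comm] using hz⟩,
      .symm ?_⟩
    · constructor <;> simp [Deriv.diagram, Diagram.outVar]
    · constructor <;> simp [Deriv.diagram, Diagram.outVar, hx]
    · rw [Term.skel, if_neg (by simp [hx])]
      refine .of_fun (fun _ => true) rfl rfl (fun _ _ _ => rfl) ?_ (fun _ => rfl) ?_
      · rintro (_ | _) h
        exacts [(h rfl).elim, ⟨⟨⟩, rfl⟩]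
      · refine fun s t => .trans ?_ (Diagram.skel_conn_of_edge (p := false) (q := true)
          (fun _ _ => .rfl) Bool.false_ne_true _ _).symm
        rcases s with s | s <;> rcases t with t | t
        · exact ⟨fun h => (nomatch h.1), fun h => (nomatch h.1)⟩
        · exact ⟨fun h => (nomatch h.1), fun ⟨_, h, _⟩ => (Nat.not_lt_zero _ h).elim⟩
        · exact ⟨fun ⟨h, _⟩ => ⟨⟨Sum.inr.inj h ▸ Nat.one_pos, rfl⟩, rfl⟩,
            fun ⟨⟨h, _⟩, _⟩ => ⟨congrArg _ (Nat.lt_one_iff.1 h), rfl⟩⟩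
        · exact ⟨fun h => (nomatch h.2), fun ⟨_, h, _⟩ => (Nat.not_lt_zero _ h).elim⟩
  | const k =>
    intro π hπ
    have hr {a b} : (Diagram.const (A := A) k (S.dom k) (S.cod k)).Reach a b ↔ ConstEdge a b :=
      Diagram.reach_iff_edge (by rintro _ _ _ ⟨⟩ ⟨⟩ <;> simp [Diagram.const, constLab])
    refine ⟨?_, ?_, fun z hz => by simp at hz, ?_⟩
    · constructor <;> intro a <;> cases a <;> simp [Deriv.diagram, Diagram.const, constLab]
      all_goals first
        | exact ⟨_, .out _⟩
        | exact ⟨_, .inp _⟩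
        | (rintro _ _ ⟨⟩ ⟨⟩; rfl)
        | (rintro _ ⟨⟩; done)
        | (rintro _ ⟨⟩ <;> simp; done)
        | (rintro _ _ _ ⟨⟩ <;> simp)
    · constructor <;> intro a <;> cases a <;> simp [Deriv.diagram, Diagram.const, constLab]
    · refine Skeleton.Iso.of_conn (D := (Diagram.const (A := A) k (S.dom k) (S.cod k)).skel) rfl rfl
          rfl ?_
      rintro (s | i) (t | j) hs ht
      · refine (Diagram.skel_inl_inl.trans hr).trans ?_
        cases s <;> cases t <;> simp
        all_goals first
          | exact .inPort _
          | exact .outPort _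
          | exact (hs _ rfl rfl).elim
          | exact (ht _ rfl rfl).elim
          | rintro ⟨⟩
      · refine (Diagram.skel_inl_inr.trans (exists_congr fun _ => hr)).trans ?_
        cases s <;> simp
        case outPort q => exact ⟨by rintro ⟨h, ⟨⟩⟩; rfl, by rintro rfl; exact ⟨q.2, .out q⟩⟩
        all_goals first | exact (hs _ rfl rfl).elim | rintro h ⟨⟩
      · refine (Diagram.skel_inr_inl.trans (exists_congr fun _ => hr)).trans ?_
        cases t <;> simp
        case inPort q => exact ⟨by rintro ⟨h, ⟨⟩⟩; rfl, by rintro rfl; exact ⟨q.2, .inp q⟩⟩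
        all_goals rintro h ⟨⟩
      · refine (Diagram.skel_inr_inr.trans (exists_congr fun _ => exists_congr fun _ => hr)).trans
            ?_
        simp
        rintro h h' ⟨⟩
  | zero =>
    intro π hπ
    refine ⟨?_, ?_, fun z hz => by simp at hz, .symm ?_⟩
    · constructor <;> simp [Deriv.diagram, Diagram.zero]
    · constructor <;> simp [Deriv.diagram, Diagram.zero]
    · refine .of_fun (fun a => a.elim) rfl rfl (fun a => a.elim) (fun a => a.elim) (fun a => a.elim)
          ?_
      rintro (s | s) (t | t) <;> first | exact s.elim | exact t.elim |
        simp [Term.skel, Skeleton.wires, Deriv.diagram, Diagram.skel, Diagram.IsSrc, Diagram.IsTgt]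
  | one =>
    intro π hπ
    refine ⟨?_, ?_, fun z hz => by simp at hz, .symm ?_⟩
    · constructor <;> simp [Deriv.diagram, Diagram.one]
    · constructor <;> simp [Deriv.diagram, Diagram.one]
    · refine .of_fun (fun a => a.elim) rfl rfl (fun a => a.elim) (fun b h => (h rfl).elim)
          (fun a => a.elim) ?_
      refine fun s t => .trans ?_ (Diagram.skel_conn_of_edge (p := false) (q := true)
        (fun _ _ => .rfl) Bool.false_ne_true _ _).symm
      rcases s with s | s <;> rcases t with t | t <;> first | exact s.elim | exact t.elim |
        (simp [Term.skel, Skeleton.wires, Deriv.diagram, Diagram.IsSrc, Diagram.IsTgt]; simp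
            [Diagram.one]; try omega)
  | sym =>
    intro π hπ
    have hr {a b} : (Diagram.sym (K := S.Const) (A := A)).Reach a b ↔ Diagram.sym (K := S.Const)
        (A := A).Edge a b :=
      Diagram.reach_iff_edge
          (by rintro (_ | _) (_ | _) (_ | _) h h' <;> first | exact h.elim | exact h'.elim)
    refine ⟨?_, ?_, fun z hz => by simp at hz, .symm ?_⟩
    · constructor <;> simp [Deriv.diagram, Diagram.sym]
    · constructor <;> simp [Deriv.diagram, Diagram.sym]
    · refine .of_fun (fun a => a.elim) rfl rfl (fun a => a.elim) (fun b h => (h rfl).elim)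
          (fun a => a.elim) ?_
      rintro (s | s) (t | t) <;> first | exact s.elim | exact t.elim |
        (simp [Term.skel, Skeleton.wires, Deriv.diagram, Diagram.skel, Diagram.IsSrc, Diagram.IsTgt,
            hr]; simp [Diagram.sym, Skeleton.swap]; try grind)
  | seq d d' disj ih ih' =>
    intro π hπ
    obtain ⟨a1, a2, a3, a4⟩ := ih (pl hπ).1
    obtain ⟨b1, b2, b3, b4⟩ := ih' (pl hπ).2
    refine ⟨a1.seq b1, a2.seq b2 a1.out_unlabelled b1.inp_unlabelled, fun z hz => ?_,
      (Diagram.skel_seq a1 b1).trans (a4.seq b4)⟩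
    rw [Finset.union_union_union_comm] at hz
    rcases mem_union.1 hz with h | h
    exacts [⟨.inl _, (a3 z h).choose_spec⟩, ⟨.inr _, (b3 z h).choose_spec⟩]
  | tensor d d' disj ih ih' =>
    intro π hπ
    obtain ⟨a1, a2, a3, a4⟩ := ih (pl hπ).1
    obtain ⟨b1, b2, b3, b4⟩ := ih' (pl hπ).2
    refine ⟨a1.tensor b1, a2.tensor b2, fun z hz => ?_, Diagram.skel_tensor.trans (a4.tensor b4)⟩
    rw [Finset.union_union_union_comm] at hz
    rcases mem_union.1 hz with h | h
    exacts [⟨.inl _, (a3 z h).choose_spec⟩, ⟨.inr _, (b3 z h).choose_spec⟩]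
  | strengthen x y d hx hy hR ih => exact ih
  | @link Γ Δ M m n R0 x y d hx hy hne hxy ih =>
    intro π hπ
    simp only [mem_union, not_or] at hx hy
    obtain ⟨a1, a2, a3, a4⟩ := ih (π := update (update π x false) y true) ⟨fun a ha => by
        simp only [Function.update_apply]
        have := hπ.1 a
        grind, fun a ha => by
        simp only [Function.update_apply]
        have := hπ.2 a
        grind⟩
    have e : ∀ z, z ≠ x → z ≠ y → π z = update (update π x false) y true z := fun z h h' => by
      simp [h, h']
    refine ⟨a1.link a2 (by simp [hne]) (by simp) (a3 x (by simp)) (a3 y (by simp))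
      d.anchored.name_inj, a2.link e, fun z hz => ?_,
      (Diagram.skel_link a1 a2 (by simp [hne]) (by simp)).trans (a4.link x y)⟩
    obtain ⟨a, ha⟩ := a3 z (by grind)
    refine ⟨a, ?_⟩
    simp only [Deriv.diagram, Diagram.link]
    grind
end DiagramSkeleton

/-! ### Homeomorphism and skeletons -/

section Homeomorphism

variable {K : Type u} {A : Type v} {m n : ℕ}

open Diagram

theorem Diagram.skel_iso_of_map {D D' : Diagram K A m n} (f : D.V → D'.V)
    (hf : Function.Injective f) (hi : ∀ i, f (D.inp i) = D'.inp i)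
        (ho : ∀ j, f (D.out j) = D'.out j)
    (hl : ∀ a, D.lab a = D'.lab (f a)) (hs : ∀ b, D'.lab b ≠ none → ∃ a, f a = b)
    (hr : ∀ a b, D.Reach a b ↔ D'.Reach (f a) (f b)) : D.skel.Iso D'.skel := by
  have h1 : ∀ s a', D'.IsSrc (s.map f id) a' ↔ ∃ a, f a = a' ∧ D.IsSrc s a := by
    rintro (s | s) a'
    · exact ⟨fun h => ⟨s, h, rfl⟩, fun ⟨a, h, h'⟩ => (congrArg f h').trans h⟩
    · exact ⟨fun ⟨h, h'⟩ => ⟨_, (hi _).trans h', h, rfl⟩,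
        fun ⟨a, h, h', h''⟩ => ⟨h', (hi _).symm.trans ((congrArg f h'').trans h)⟩⟩
  have h2 : ∀ s a', D'.IsTgt (s.map f id) a' ↔ ∃ a, f a = a' ∧ D.IsTgt s a := by
    rintro (s | s) a'
    · exact ⟨fun h => ⟨s, h, rfl⟩, fun ⟨a, h, h'⟩ => (congrArg f h').trans h⟩
    · exact ⟨fun ⟨h, h'⟩ => ⟨_, (ho _).trans h', h, rfl⟩,
        fun ⟨a, h, h', h''⟩ => ⟨h', (ho _).symm.trans ((congrArg f h'').trans h)⟩⟩
  refine .of_fun f rfl rfl hf hs hl fun s t => ⟨?_, ?_⟩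
  · rintro ⟨a, b, ha, hb, h⟩
    exact ⟨f a, f b, (h1 _ _).2 ⟨a, rfl, ha⟩, (h2 _ _).2 ⟨b, rfl, hb⟩, (hr _ _).1 h⟩
  · rintro ⟨a, b, ha, hb, h⟩
    obtain ⟨a, rfl, ha'⟩ := (h1 _ _).1 ha
    obtain ⟨b, rfl, hb'⟩ := (h2 _ _).1 hb
    exact ⟨a, b, ha', hb', (hr _ _).2 h⟩

theorem LIDAG.Iso.skel {G H : LIDAG K A m n} (h : G.Iso H) : G.toDiagram.skel.Iso
    H.toDiagram.skel := by
  obtain ⟨e, hE, hl, hi, ho⟩ := h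
  have key : ∀ {D D' : Diagram K A m n} (f : D.V → D'.V), (∀ a b, D.Edge a b → D'.Edge (f a) (f b))
      →
      (∀ a, D.lab a = D'.lab (f a)) → ∀ a b, D.Reach a b → D'.Reach (f a) (f b) := by
    intro D D' f h1 h2 a b h
    induction h with
    | edge h => exact .edge (h1 _ _ h)
    | step h hc _ ih => exact .step (h1 _ _ h) ((h2 _).symm.trans hc) ih
  refine .symm (skel_iso_of_map e e.injective hi ho hl (fun b _ => e.surjective b) fun a b =>
    ⟨key e (fun _ _ => (hE _ _).1) hl a b, fun h => ?_⟩)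
  have := key (D := G.toDiagram) (D' := H.toDiagram) e.symm
      (fun _ _ h => (hE _ _).2 (by simpa using h))
    (fun a => by simp [hl]) _ _ h
  simpa using this

theorem LIDAG.WireInsertion.skel {G H : LIDAG K A m n} (h : G.WireInsertion H) :
    G.toDiagram.skel.Iso H.toDiagram.skel := by
  obtain ⟨u, v, e, hw, hE, hl, hi, ho⟩ := h
  set f : G.V → H.V := fun a => e.symm (some a) with hf
  have hfe : ∀ a, e (f a) = some a := fun a => e.apply_symm_apply _
  have hlf : ∀ a, G.lab a = H.lab (f a) := fun a => by simp [hl, hfe]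
  have hc : ∀ p, e p = none ∨ ∃ a, p = f a := by
    intro p
    rcases h : e p with _ | a
    exacts [.inl rfl, .inr ⟨a, by simp [hf, ← h]⟩]
  have hn : ∀ p, e p = none → H.lab p = none := fun p h => by simp [hl, h]
  have hedge : ∀ a b, G.Edge a b → H.Reach (f a) (f b) := by
    intro a b h
    by_cases hab : a = u ∧ b = v
    · obtain ⟨rfl, rfl⟩ := hab
      refine .step (c := e.symm none) ?_ (hn _ (by simp)) (.edge ?_) <;>
        simp [hE, hfe, LIDAG.subdivide]
    · exact .edge (by simpa [hE, hfe, LIDAG.subdivide, h] using hab)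
  have h1 : ∀ a b, G.Reach a b → H.Reach (f a) (f b) := by
    intro a b h
    induction h with
    | edge h => exact hedge _ _ h
    | step h hc _ ih => exact (hedge _ _ h).trans ((hlf _).symm.trans hc) ih
  have h2 : ∀ p q, H.Reach p q → ∀ b, q = f b → (∀ a, p = f a → G.Reach a b) ∧
      (e p = none → b = v ∨ G.lab v = none ∧ G.Reach v b) := by
    intro p q h b hq
    induction h with
    | edge h =>
      subst hq
      refine ⟨fun a ha => ?_, fun hp => ?_⟩
      · subst ha; simp only [hE, hfe, LIDAG.subdivide] at h; exact .edge h.1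
      · simp only [hE, hfe, hp, LIDAG.subdivide] at h; exact .inl h
    | @step p q c h hlc _ ih =>
      have ih := ih hq
      rcases hc c with hn | ⟨c, rfl⟩
      · refine ⟨fun a ha => ?_, fun hp => by simp [hE, hp, hn, LIDAG.subdivide] at h⟩
        subst ha
        simp only [hE, hfe, hn, LIDAG.subdivide] at h
        subst h
        rcases ih.2 hn with rfl | ⟨hv, h⟩
        exacts [.edge hw.1, .step hw.1 hv h]
      · refine ⟨fun a ha => ?_, fun hp => ?_⟩
        · subst ha
          simp only [hE, hfe, LIDAG.subdivide] at h
          exact .step h.1 ((hlf c).trans hlc) (ih.1 c rfl)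
        · simp only [hE, hfe, hp, LIDAG.subdivide] at h
          grind
  refine skel_iso_of_map f (fun a b h => by simpa [hfe] using congrArg e h)
    (fun i => by simp [hf, ← hi]) (fun i => by simp [hf, ← ho]) hlf (fun b hb => ?_)
    fun a b => ⟨h1 a b, fun h => (h2 _ _ h b rfl).1 a rfl⟩
  rcases hc b with h | ⟨a, rfl⟩
  exacts [(hb (hn b h)).elim, ⟨a, rfl⟩]

theorem LIDAG.skel_iso_of_homeo {G H : LIDAG K A m n} (h : LIDAG.homeo K A m n G H) :
    G.toDiagram.skel.Iso H.toDiagram.skel := by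
  induction h with
  | rel _ _ h => exact h.elim LIDAG.Iso.skel LIDAG.WireInsertion.skel
  | refl => exact .refl _
  | symm _ _ _ ih => exact ih.symm
  | trans _ _ _ _ _ ih ih' => exact ih.trans ih'

/-- Removal of an unlabelled vertex that is neither an input nor an output. -/
theorem LIDAG.exists_contract {G : LIDAG K A m n} (h : G.toDiagram.Tidy) {w : G.V}
    (hw : G.lab w = none) (hwi : ∀ i, w ≠ G.inp i) (hwo : ∀ j, w ≠ G.out j) :
    ∃ G' : LIDAG K A m n, G'.toDiagram.Tidy ∧ G'.WireInsertion G ∧ Nat.card G'.V < Nat.card G.V :=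
        by
  obtain ⟨u, hu⟩ := h.exists_pred w hw hwi
  obtain ⟨v, hv⟩ := h.exists_succ w hw hwo
  have huw : u ≠ w := by rintro rfl; exact G.acyclic _ (.single hu)
  have hvw : v ≠ w := by rintro rfl; exact G.acyclic _ (.single hv)
  have hfin := G.finite
  have hb : (∀ k, G.lab u ≠ some (.box k)) ∧ ∀ k, G.lab v ≠ some (.box k) :=
    ⟨fun k hk => h.box_succ _ _ _ hu hk hw, fun k hk => h.box_pred _ _ _ hv hk hw⟩
  let G' : LIDAG K A m n :=
    { V := {a : G.V // a ≠ w}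
      Edge := fun a b => G.Edge a b ∨ (a = u ∧ b = v)
      lab := fun a => G.lab a
      inp := fun i => ⟨G.inp i, (hwi i).symm⟩
      out := fun j => ⟨G.out j, (hwo j).symm⟩
      finite := inferInstance
      acyclic := fun a h => by
        have key : ∀ b, Relation.TransGen (fun a b : {a : G.V // a ≠ w} =>
            G.Edge a b ∨ (a = u ∧ b = v)) a b → Relation.TransGen G.Edge a b := by
          have : ∀ a b : {a : G.V // a ≠ w}, (G.Edge a b ∨ (a = u ∧ b = v)) →
              Relation.TransGen G.Edge a b := by
            rintro a b (h | ⟨h, h'⟩)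
            exacts [.single h, h ▸ h' ▸ .tail (.single hu) hv]
          intro b h
          induction h with
          | single h => exact this _ _ h
          | tail _ h ih => exact ih.trans (this _ _ h)
        exact G.acyclic _ (key a h)
      name_inj := fun a b x ha hb => Subtype.ext (G.name_inj _ _ _ ha hb)
      inp_unlabelled := fun i => G.inp_unlabelled i
      out_unlabelled := fun i => G.out_unlabelled i }
  have huv : ¬ G.Edge u v := fun h' => (h.succ_unique _ _ _ hu h').elim
    (fun ⟨k, hk⟩ => hb.1 k hk) (Ne.symm hvw)
  have hu' : ∀ a, G.Edge a w → a = u := fun a ha =>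
    (h.pred_unique _ _ _ ha hu).elim (fun ⟨k, hk⟩ => by simp [hw] at hk) id
  have hv' : ∀ a, G.Edge w a → a = v := fun a ha =>
    (h.succ_unique _ _ _ ha hv).elim (fun ⟨k, hk⟩ => by simp [hw] at hk) id
  refine ⟨G', ?_, ⟨⟨u, huw⟩, ⟨v, hvw⟩, ?_⟩, ?_⟩
  · obtain ⟨a1, a2, a3, a4, a5, a6, a7, a8, a9, a10, a11, a12, a13, a14, a15⟩ := h
    constructor <;> simp only [G', Subtype.forall, Subtype.exists, Subtype.mk.injEq, Ne]
    all_goals try grind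
  · classical
    obtain ⟨e, he, he'⟩ : ∃ e : G.V ≃ Option {a // a ≠ w}, e w = none ∧
        ∀ a (h : a ≠ w), e a = some ⟨a, h⟩ :=
      ⟨(Equiv.optionSubtypeNe w).symm, by simp, fun a h => by simp [h]⟩
    refine ⟨e, ⟨.inr ⟨rfl, rfl⟩, hb⟩, fun a b => ?_, fun a => ?_, fun i => he' _ (hwi i).symm,
      fun j => he' _ (hwo j).symm⟩
    · by_cases h1 : a = w <;> by_cases h2 : b = w
      · subst h1 h2
        rw [he]
        exact iff_false_intro fun h => G.acyclic _ (.single h)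
      · subst h1
        rw [he, he' b h2]
        exact ⟨fun h => Subtype.ext (hv' b h), fun h => (show b = v from Subtype.ext_iff.1 h) ▸ hv⟩
      · subst h2
        rw [he, he' a h1]
        exact ⟨fun h => Subtype.ext (hu' a h), fun h => (show a = u from Subtype.ext_iff.1 h) ▸ hu⟩
      · rw [he' a h1, he' b h2]
        simp only [LIDAG.subdivide, G', Subtype.mk.injEq]
        grind
    · by_cases h1 : a = w
      · subst h1; rw [he]; exact hw
      · rw [he' a h1]; rfl
  · exact Finite.card_subtype_lt (x := w) (by simp)

/-- The only unlabelled vertices are inputs and outputs. -/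
def Diagram.Compact (D : Diagram K A m n) : Prop :=
  ∀ a, D.lab a = none → (∃ i, a = D.inp i) ∨ ∃ j, a = D.out j

theorem LIDAG.exists_compact (c : ℕ) : ∀ {G : LIDAG K A m n}, Nat.card G.V = c →
    G.toDiagram.Tidy → ∃ G' : LIDAG K A m n, G'.toDiagram.Tidy ∧ G'.toDiagram.Compact ∧
      LIDAG.homeo K A m n G G' := by
  induction c using Nat.strong_induction_on with
  | _ c ih =>
    intro G hc h
    by_cases hG : G.toDiagram.Compact
    · exact ⟨G, h, hG, .refl _⟩
    · simp only [Diagram.Compact, not_forall, not_or, not_exists] at hG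
      obtain ⟨w, hw, hwi, hwo⟩ := hG
      obtain ⟨G', h1, h2, h3⟩ := exists_contract h hw hwi hwo
      obtain ⟨G'', h4, h5, h6⟩ := ih _ (hc ▸ h3) rfl h1
      exact ⟨G'', h4, h5, .trans _ _ _ (.symm _ _ (.rel _ _ (.inr h2))) h6⟩

theorem Diagram.Tidy.reach_iff {D : Diagram K A m n} (h : D.Tidy) (hD : D.Compact) {a b : D.V} :
    D.Reach a b ↔ D.Edge a b :=
  reach_iff_edge fun a b c h1 h2 hb => by
    rcases hD b hb with ⟨i, rfl⟩ | ⟨j, rfl⟩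
    exacts [h.inp_pred _ _ h1, h.out_succ _ _ h2]

theorem LIDAG.iso_of_skel_iso {G H : LIDAG K A m n} (hG : G.toDiagram.Tidy) (hH : H.toDiagram.Tidy)
    (cG : G.toDiagram.Compact) (cH : H.toDiagram.Compact)
    (h : G.toDiagram.skel.Iso H.toDiagram.skel) : H.Iso G := by
  obtain ⟨e, -, -, total, surj, lab, inj, conn⟩ := h
  let r : G.V → H.V → Prop := fun a b => (G.lab a ≠ none ∧ e a b) ∨
    (∃ i, a = G.inp i ∧ b = H.inp i) ∨ ∃ j, a = G.out j ∧ b = H.out j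
  have hlab : ∀ a b, r a b → G.lab a = H.lab b := by
    rintro a b (⟨-, h⟩ | ⟨i, rfl, rfl⟩ | ⟨j, rfl, rfl⟩)
    exacts [lab _ _ h, (G.inp_unlabelled i).trans (H.inp_unlabelled i).symm,
      (G.out_unlabelled j).trans (H.out_unlabelled j).symm]
  have hinj : ∀ a b a' b', r a b → r a' b' → (a = a' ↔ b = b') := by
    obtain ⟨a1, a2, -, -, -, -, -, -, -, -, -, -, a13, a14, a15⟩ := hG
    obtain ⟨b1, b2, -, -, -, -, -, -, -, -, -, -, b13, b14, b15⟩ := hH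
    grind
  have htot : ∀ a, ∃ b, r a b := by
    intro a
    by_cases ha : G.lab a = none
    · rcases cG a ha with ⟨i, hi⟩ | ⟨j, hj⟩
      exacts [⟨_, .inr (.inl ⟨i, hi, rfl⟩)⟩, ⟨_, .inr (.inr ⟨j, hj, rfl⟩)⟩]
    · exact (total a ha).imp fun b hb => .inl ⟨ha, hb⟩
  have hsurj : ∀ b, ∃ a, r a b := by
    intro b
    by_cases hb : H.lab b = none
    · rcases cH b hb with ⟨i, hi⟩ | ⟨j, hj⟩
      exacts [⟨_, .inr (.inl ⟨i, rfl, hi⟩)⟩, ⟨_, .inr (.inr ⟨j, rfl, hj⟩)⟩]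
    · exact (surj b hb).imp fun a ha => .inl ⟨(lab a b ha).trans_ne hb, ha⟩
  have hE : ∀ a b a' b', r a b → r a' b' → (G.Edge a a' ↔ H.Edge b b') := by
    intro a b a' b' h h'
    rw [← hG.reach_iff cG, ← hH.reach_iff cH]
    -- outputs have no successors, inputs no predecessors
    have hs : (∃ s s', Sum.LiftRel e (· = ·) s s' ∧ (∀ p, G.IsSrc s p ↔ p = a) ∧
        ∀ p, H.IsSrc s' p ↔ p = b) ∨ ∃ j, a = G.out j ∧ b = H.out j := by
      rcases h with ⟨-, h⟩ | ⟨i, rfl, rfl⟩ | h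
      · exact .inl ⟨.inl a, .inl b, .inl h, fun p => eq_comm, fun p => eq_comm⟩
      · exact .inl ⟨.inr i, .inr i, .inr rfl, fun p => by simp [IsSrc, eq_comm],
          fun p => by simp [IsSrc, eq_comm]⟩
      · exact .inr h
    have ht : (∃ t t', Sum.LiftRel e (· = ·) t t' ∧ (∀ p, G.IsTgt t p ↔ p = a') ∧
        ∀ p, H.IsTgt t' p ↔ p = b') ∨ ∃ i, a' = G.inp i ∧ b' = H.inp i := by
      rcases h' with ⟨-, h⟩ | h | ⟨j, rfl, rfl⟩
      · exact .inl ⟨.inl a', .inl b', .inl h, fun p => eq_comm, fun p => eq_comm⟩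
      · exact .inr h
      · exact .inl ⟨.inr j, .inr j, .inr rfl, fun p => by simp [IsTgt, eq_comm],
          fun p => by simp [IsTgt, eq_comm]⟩
    rcases hs with ⟨s, s', hs, h1, h2⟩ | ⟨j, rfl, rfl⟩
    · rcases ht with ⟨t, t', ht, h3, h4⟩ | ⟨i, rfl, rfl⟩
      · have := conn s t s' t' hs ht
        simpa only [skel, h1, h2, h3, h4, exists_and_left, exists_eq_left] using this
      · exact ⟨fun h => (hG.inp_pred _ _ h.exists_edge.2.choose_spec).elim,
          fun h => (hH.inp_pred _ _ h.exists_edge.2.choose_spec).elim⟩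
    · exact ⟨fun h => (hG.out_succ _ _ h.exists_edge.1.choose_spec).elim,
        fun h => (hH.out_succ _ _ h.exists_edge.1.choose_spec).elim⟩
  choose f hf using htot
  refine ⟨Equiv.ofBijective f ⟨fun a a' h => (hinj _ _ _ _ (hf a) (hf a')).2 h, fun b => ?_⟩,
    fun a b => hE _ _ _ _ (hf a) (hf b), fun a => hlab _ _ (hf a), fun i => ?_, fun j => ?_⟩
  · obtain ⟨a, ha⟩ := hsurj b
    exact ⟨a, (hinj _ _ _ _ (hf a) ha).1 rfl⟩
  · exact (hinj _ _ _ _ (hf _) (.inr (.inl ⟨i, rfl, rfl⟩))).1 rfl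
  · exact (hinj _ _ _ _ (hf _) (.inr (.inr ⟨j, rfl, rfl⟩))).1 rfl

/-- Tidy diagrams are determined up to homeomorphism by their skeletons. -/
theorem LIDAG.homeo_iff_skel_iso {G H : LIDAG K A m n} (hG : G.toDiagram.Tidy)
    (hH : H.toDiagram.Tidy) :
    LIDAG.homeo K A m n G H ↔ G.toDiagram.skel.Iso H.toDiagram.skel := by
  refine ⟨skel_iso_of_homeo, fun h => ?_⟩
  obtain ⟨G', h1, h2, h3⟩ := exists_compact _ rfl hG
  obtain ⟨H', h4, h5, h6⟩ := exists_compact _ rfl hH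
  have h7 := ((skel_iso_of_homeo h3).symm.trans h).trans (skel_iso_of_homeo h6)
  exact .trans _ _ _ h3 (.trans _ _ _ (.symm _ _ (.rel _ _ (.inl (iso_of_skel_iso h1 h4 h2 h5 h7))))
    (.symm _ _ h6))

end Homeomorphism

/-! ### Skeletons of normal forms -/

section Reading

variable {K : Type u} {A : Type v} [DecidableEq A] {S : Signature.{u}} {π π' : A → Bool}
  {t t' : A → ℚ} {L L' : List (A × A)} {As As' : List (Atom S.Const A)} {P : Term S.Const A}

open Term Skeleton

/-- The possible vertices of the skeleton of an atom: its variables, its constant, its ports. -/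
inductive Slot
  | inName (p : ℕ)
  | inPort (p : ℕ)
  | box
  | outPort (q : ℕ)
  | outName (q : ℕ)

namespace Atom

/-- The label at a slot of an atom; `none` if the atom has no such slot. -/
def lab (a : Atom K A) : Slot → Option (Label K A)
  | .inName p => a.ins[p]?.map .name
  | .inPort p => if p < a.ins.length then a.body.map (.inPort · p) else none
  | .box => a.body.map .box
  | .outPort q => if q < a.outs.length then a.body.map (.outPort · q) else none
  | .outName q => a.outs[q]?.map .name

/-- Connections within an atom. -/
def Edge (a : Atom K A) : Slot → Slot → Prop
  | .inName p, .inPort p' => p = p'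
  | .inName _, .outName _ => a.body = none
  | .inPort _, .box => True
  | .box, .outPort _ => True
  | .outPort q, .outName q' => q = q'
  | _, _ => False

/-- The skeleton of an atom. -/
def skel (a : Atom K A) : Skeleton.{u, v, 0} K A where
  V := Slot
  dom := 0
  cod := 0
  lab := a.lab
  E
    | .inl s, .inl t => a.Edge s t
    | _, _ => False

end Atom

/-- The skeleton of a list of input variables. Only the vertices below the length of the list have
labels and edges. -/
def varsIn (xs : List A) : Skeleton.{u, v, 0} K A where
  V := ℕ
  dom := 0
  cod := xs.length
  lab p := xs[p]?.map .name
  E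
    | .inl p, .inr j => p = j ∧ p < xs.length
    | _, _ => False

/-- The skeleton of a list of output variables, encoded as `varsIn`. -/
def varsOut (xs : List A) : Skeleton.{u, v, 0} K A where
  V := ℕ
  dom := xs.length
  cod := 0
  lab p := xs[p]?.map .name
  E
    | .inr i, .inl p => p = i ∧ p < xs.length
    | _, _ => False

theorem injective_elim_succ : Function.Injective (Sum.elim (fun _ => 0) Nat.succ : PUnit ⊕ ℕ → ℕ) :=
    by
  rintro (a | a) (b | b) h <;> simp_all

theorem skel_vars_in : ∀ {xs : List A}, (∀ x ∈ xs, π x = true) →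
    ((vars xs : Term S.Const A).skel S π).Iso (varsIn xs)
  | [], _ => .of_fun (fun a => a.elim) rfl rfl (fun a => a.elim) (by simp [varsIn])
      (fun a => a.elim) (by rintro (a | i) (b | j) <;> first | exact a.elim | exact b.elim | simp [vars, Term.skel, wires, varsIn])
  | x :: xs, h => by
    rw [vars, Term.skel, Term.skel, if_pos (h x (by simp))]
    refine ((Iso.refl _).tensor (skel_vars_in fun y hy => h y (by simp [hy]))).trans
      (.of_fun _ rfl (Nat.add_comm _ _) injective_elim_succ ?_ ?_ ?_)
    · rintro (_ | b) hb
      exacts [⟨.inl ⟨⟩, rfl⟩, ⟨.inr b, rfl⟩]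
    · rintro (a | a) <;> rfl
    · rintro ((a | a) | i) ((b | b) | j) <;> simp [Skeleton.tensor, inVar, varsIn] <;> grind

theorem skel_vars_out : ∀ {xs : List A}, (∀ x ∈ xs, π x = false) →
    ((vars xs : Term S.Const A).skel S π).Iso (varsOut xs)
  | [], _ => .of_fun (fun a => a.elim) rfl rfl (fun a => a.elim) (by simp [varsOut])
      (fun a => a.elim) (by rintro (a | i) (b | j) <;> first | exact a.elim | exact b.elim | simp [vars, Term.skel, wires, varsOut])
  | x :: xs, h => by
    rw [vars, Term.skel, Term.skel, if_neg (by simp [h x (by simp)])]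
    refine ((Iso.refl _).tensor (skel_vars_out fun y hy => h y (by simp [hy]))).trans
      (.of_fun _ (Nat.add_comm _ _) rfl injective_elim_succ ?_ ?_ ?_)
    · rintro (_ | b) hb
      exacts [⟨.inl ⟨⟩, rfl⟩, ⟨.inr b, rfl⟩]
    · rintro (a | a) <;> rfl
    · rintro ((a | a) | i) ((b | b) | j) <;> simp [Skeleton.tensor, outVar, varsOut] <;> grind

theorem lt_of_lab {xs : List A} {p : ℕ} (h : xs[p]?.map (Label.name (K := K)) ≠ none) :
    p < xs.length := by
  by_contra h'; simp_all

theorem Atom.Ok.skel {a : Atom S.Const A} (h : a.Ok S π t) : (a.term.skel S π).Iso a.skel := by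
  obtain ⟨o, ins, outs⟩ := a
  obtain ⟨h1, h2, -, h3, h4, -⟩ := h
  refine (((skel_vars_in h3).seq ((Iso.refl _).seq (skel_vars_out h4)))).trans ?_
  cases o with
  | none =>
    simp only [Signature.bodyDom, Signature.bodyCod] at h1 h2
    have hi : Function.Injective
        (Sum.elim .inName (Sum.elim PEmpty.elim .outName) : ℕ ⊕ PEmpty ⊕ ℕ → Slot) := by
      rintro (a | a | a) (b | b | b) h <;> first | exact a.elim | exact b.elim | simp_all
    refine .of_live _ rfl rfl (fun _ _ _ _ h => hi h) ?_ ?_ ?_ fun a h => ?_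
    · rintro (b | b | b | b | b) hb <;> simp [Atom.skel, Atom.lab] at hb
      exacts [⟨.inl b, rfl⟩, ⟨.inr (.inr b), rfl⟩]
    · rintro (a | a | a) - <;> first | exact a.elim | rfl
    · rintro ((a | a | a) | i) ((b | b | b) | j) hs ht <;>
        first
        | exact a.elim
        | exact b.elim
        | exact Iff.rfl
        | exact ⟨fun ⟨_, h, _, _, h'⟩ => by first | exact h.elim | exact h'.elim, False.elim⟩
        | skip
      have hs := lt_of_lab (hs _ rfl)
      have ht := lt_of_lab (ht _ rfl)
      exact ⟨fun _ => rfl, fun _ => ⟨a, ⟨rfl, hs⟩, a, ⟨h1 ▸ hs, rfl⟩,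
          ((Nat.lt_one_iff.1 (h2 ▸ ht)).trans (Nat.lt_one_iff.1 (h1 ▸ hs)).symm), ht⟩⟩
    · rcases a with a | a | a <;> first | exact a.elim | exact h
  | some k =>
    simp only [Signature.bodyDom, Signature.bodyCod] at h1 h2
    -- the inputs and outputs of a constant are sent to ports that do not exist
    let f : ConstVertex (S.dom k) (S.cod k) → Slot
      | .inPort p => .inPort p
      | .outPort q => .outPort q
      | .box => .box
      | .inp _ => .inPort (S.dom k)
      | .out _ => .outPort (S.cod k)
    let g : ℕ ⊕ ConstVertex (S.dom k) (S.cod k) ⊕ ℕ → Slot := Sum.elim .inName (Sum.elim f .outName)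
    have hl : ∀ a, (((varsIn ins).seq (((bodyTerm (some k)).skel S π).seq (varsOut outs))).lab a : 
        Option (Label S.Const A)) = (⟨some k, ins, outs⟩ : Atom S.Const A).skel.lab (g a) := by
      rintro (a | (a | a | a | a | a) | a) <;> first | rfl | skip
      · exact (if_neg (by simp [h1])).symm
      · exact (if_pos (by simp [h1])).symm
      · exact (if_pos (by simp [h2])).symm
      · exact (if_neg (by simp [h2])).symm
    refine .of_live g rfl rfl ?_ ?_ (fun a _ => hl a) ?_ fun a h => (hl a).symm.trans h
    · rintro (a | (a | ⟨a, _⟩ | a | ⟨a, _⟩ | a) | a) (b | (b | ⟨b, _⟩ | b | ⟨b, _⟩ | b) | b) h h' e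
      all_goals first | exact (h rfl).elim | exact (h' rfl).elim | cases e; try rfl
    · rintro (b | b | b | b | b) hb <;> simp [Atom.skel, Atom.lab] at hb
      exacts [⟨.inl b, rfl⟩, ⟨.inr (.inl (.inPort ⟨b, by omega⟩)), rfl⟩, ⟨.inr (.inl .box), rfl⟩,
        ⟨.inr (.inl (.outPort ⟨b, by omega⟩)), rfl⟩, ⟨.inr (.inr b), rfl⟩]
    · rintro ((a | (a | a | a | a | a) | a) | i) ((b | (b | b | b | b | b) | b) | j) hs ht
      all_goals first
        | exact (hs _ rfl rfl).elim
        | exact (ht _ rfl rfl).elim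
        | exact Iff.rfl
        | exact ⟨fun ⟨_, h, h'⟩ => by first | exact h.elim | exact h'.elim, False.elim⟩
        | exact ⟨fun ⟨_, _, _, h, _⟩ => h.elim, fun h => nomatch h⟩
        | skip
      · exact ⟨fun ⟨_, h, h'⟩ => h.1.trans h', fun h => ⟨a, ⟨rfl, lt_of_lab (hs _ rfl)⟩, h⟩⟩
      · exact ⟨fun ⟨_, h, h'⟩ => h.symm.trans h'.1.symm,
          fun h => ⟨_, rfl, h.symm, lt_of_lab (ht _ rfl)⟩⟩

/-- The skeleton of a list of atoms; the vertex `(i, s)` is the slot `s` of the `i`-th atom. -/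
def flat (As : List (Atom K A)) : Skeleton.{u, v, 0} K A where
  V := ℕ × Slot
  dom := 0
  cod := 0
  lab u := As[u.1]?.bind (·.lab u.2)
  E
    | .inl u, .inl w => u.1 = w.1 ∧ ∃ a, As[u.1]? = some a ∧ a.Edge u.2 w.2
    | _, _ => False

theorem skel_atomsTerm : ∀ {As : List (Atom S.Const A)}, (∀ a ∈ As, a.Ok S π t) →
    ((atomsTerm As).skel S π).Iso (flat As)
  | [], _ => .of_fun (fun a => a.elim) rfl rfl (fun a => a.elim) (by simp [flat])
      (fun a => a.elim) (by
        rintro (a | i) (b | j) <;> first | exact a.elim | exact b.elim | simp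
            [atomsTerm, Term.skel, wires, flat])
  | a :: As, h => by
    have hi : Function.Injective (Sum.elim (fun s => (0, s)) (fun u => (u.1 + 1, u.2)) :
        Slot ⊕ ℕ × Slot → ℕ × Slot) := by
      rintro (a | ⟨a, a'⟩) (b | ⟨b, b'⟩) h <;> simp_all
    refine ((h a (by simp)).skel.tensor (skel_atomsTerm fun b hb => h b (by simp [hb]))).trans
      (.of_fun _ rfl rfl hi ?_ ?_ ?_)
    · rintro ⟨_ | i, s⟩ -
      exacts [⟨.inl s, rfl⟩, ⟨.inr (i, s), rfl⟩]
    · rintro (s | ⟨i, s⟩) <;> rfl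
    · rintro ((s | ⟨i, s⟩) | p) ((s' | ⟨j, s'⟩) | q) <;>
        first
        | exact Iff.rfl
        | exact ⟨fun h => ⟨rfl, a, rfl, h⟩, fun ⟨_, _, e, h⟩ => by cases e; exact h⟩
        | exact ⟨False.elim, fun h => nomatch h.1⟩
        | exact ⟨fun ⟨e, h⟩ => ⟨congrArg _ e, h⟩, fun ⟨e, h⟩ => ⟨Nat.succ.inj e, h⟩⟩
        | simp [Skeleton.tensor, flat, Atom.skel]

/-- All links in `L` at once. -/
noncomputable def Skeleton.linkAll (D : Skeleton.{u, v, w} K A) (L : List (A × A)) :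
    Skeleton.{u, v, w} K A where
  V := D.V
  dom := D.dom
  cod := D.cod
  lab a := open Classical in if ∃ x ∈ linkNames L, D.lab a = some (.name x) then none else D.lab a
  E s t := D.E s t ∨ ∃ p ∈ L, ∃ a b, D.lab a = some (.name p.1) ∧ D.lab b = some (.name p.2) ∧
    D.E s (.inl a) ∧ D.E (.inl b) t

/-- If no connection leads from the target of a link to the source of a link, then the order of the
links is irrelevant. -/
theorem foldl_link : ∀ {L : List (A × A)} {D : Skeleton.{u, v, w} K A}, (linkNames L).Nodup →
    (∀ p ∈ L, ∀ q ∈ L, ∀ a b, D.lab a = some (.name p.2) → D.lab b = some (.name q.1) →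
      ¬ D.E (.inl a) (.inl b)) → L.foldl (fun D p => D.link p.1 p.2) D = D.linkAll L
  | [], D, _, _ => by simp [Skeleton.linkAll]
  | p :: L, D, hn, h => by
    rw [linkNames_cons] at hn
    have hm : ∀ q ∈ L, q.1 ∈ linkNames L ∧ q.2 ∈ linkNames L := fun q hq =>
      ⟨mem_linkNames.2 ⟨q, hq, .inl rfl⟩, mem_linkNames.2 ⟨q, hq, .inr rfl⟩⟩
    have hne : ∀ q ∈ L, (q.1 ≠ p.1 ∧ q.1 ≠ p.2) ∧ q.2 ≠ p.1 ∧ q.2 ≠ p.2 := by grind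
    have hl : ∀ {a} {z}, z ≠ p.1 ∧ z ≠ p.2 →
        ((D.link p.1 p.2).lab a = some (.name z) ↔ D.lab a = some (.name z)) := by
      intro a z hz
      simp only [Skeleton.link]
      grind
    rw [List.foldl_cons, foldl_link hn.tail.tail]
    · have hl1 := fun q hq a => @hl a q.1 (hne q hq).1
      have hl2 := fun q hq a => @hl a q.2 (hne q hq).2
      have hh : ∀ q ∈ L, ∀ a b, D.lab a = some (.name p.2) → D.lab b = some (.name q.1) →
        ¬ D.E (.inl a) (.inl b) := fun q hq => h p (by simp) q (by simp [hq])
      have hh' : ∀ q ∈ L, ∀ a b, D.lab a = some (.name q.2) → D.lab b = some (.name p.1) →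
        ¬ D.E (.inl a) (.inl b) := fun q hq => h q (by simp [hq]) p (by simp)
      refine (Skeleton.mk.injEq ..).mpr ⟨rfl, rfl, rfl, heq_of_eq (funext fun a => ?_),
        heq_of_eq (funext fun s => funext fun t => propext ?_)⟩
      · by_cases ha : D.lab a = some (.name p.1) ∨ D.lab a = some (.name p.2)
        · have hc : ∃ x ∈ p.1 :: p.2 :: linkNames L, D.lab a = some (.name x) := by
            simp only [mem_cons]; grind
          simp only [Skeleton.link, if_pos ha, linkNames_cons, ite_self]
          exact (if_pos hc).symm
        · have hc : (∃ x ∈ p.1 :: p.2 :: linkNames L, D.lab a = some (.name x)) ↔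
              ∃ x ∈ linkNames L, D.lab a = some (.name x) := by
            simp only [mem_cons]; grind
          have e : (D.link p.1 p.2).lab a = D.lab a := if_neg ha
          simp only [linkNames_cons]
          classical exact if_congr ((exists_congr fun x => and_congr_right fun _ =>
            iff_of_eq (congrArg (· = _) e)).trans hc.symm) rfl e
      · constructor
        · rintro ((h' | ⟨a, b, ha, hb, h1, h2⟩) | ⟨q, hq, a, b, ha, hb, h1, h2⟩)
          · exact .inl h'
          · grind
          · rw [hl1 q hq] at ha
            rw [hl2 q hq] at hb
            refine .inr ⟨q, by simp [hq], a, b, ha, hb, ?_, ?_⟩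
            · obtain h1 | ⟨_, c, -, hc, -, h1⟩ := h1
              exacts [h1, (hh q hq c a hc ha h1).elim]
            · obtain h2 | ⟨c, _, hc, -, h2, -⟩ := h2
              exacts [h2, (hh' q hq b c hb hc h2).elim]
        · rintro (h' | ⟨q, hq, a, b, ha, hb, h1, h2⟩)
          · exact .inl (.inl h')
          · obtain rfl | hq := mem_cons.1 hq
            · exact .inl (.inr ⟨a, b, ha, hb, h1, h2⟩)
            · exact .inr ⟨q, hq, a, b, (hl1 q hq a).2 ha, (hl2 q hq b).2 hb, .inl h1, .inl h2⟩
    · intro r hr q hq a b ha hb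
      rw [hl (hne r hr).2] at ha
      rw [hl (hne q hq).1] at hb
      rintro (h' | ⟨c, d, hc, hd, h1, h2⟩)
      · exact h r (by simp [hr]) q (by simp [hq]) a b ha hb h'
      · exact h r (by simp [hr]) p (by simp) a c ha hc h1

theorem skel_linkAll : ∀ {L : List (A × A)} {P : Term S.Const A}, (∀ p ∈ L, π p.1 = false) →
    (∀ p ∈ L, π p.2 = true) →
    (LinkSyntax.linkAll L P).skel S π = L.foldl (fun D p => D.link p.1 p.2) (P.skel S π)
  | [], P, _, _ => rfl
  | p :: L, P, h, h' => by
    refine (skel_linkAll (L := L) (P := .link p.1 p.2 P) (fun q hq => h q (by simp [hq])) fun q hq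
        => h' q (by simp [hq])).trans ?_
    have : (Term.link p.1 p.2 P).skel S π = (P.skel S π).link p.1 p.2 := by
      change (P.skel S (update (update π p.1 false) p.2 true)).link _ _ = _
      rw [← h p (by simp), Function.update_eq_self, ← h' p (by simp), Function.update_eq_self]
    grind

theorem Skeleton.Iso.foldl_link : ∀ {L : List (A × A)} {D D' : Skeleton.{u, v, w} K A}, D.Iso D' →
    (L.foldl (fun D p => D.link p.1 p.2) D).Iso (L.foldl (fun D p => D.link p.1 p.2) D')
  | [], _, _, h => h
  | p :: L, _, _, h => Skeleton.Iso.foldl_link (L := L) (h.link p.1 p.2)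

end Reading

/-! ### Isomorphic normal forms -/

section Comparison

variable {K : Type u} {A : Type v} [DecidableEq A] {S : Signature.{u}} {π π' : A → Bool}
  {t t' : A → ℚ} {L L' : List (A × A)} {As As' : List (Atom S.Const A)} {u w : ℕ × Slot} {x : A}

open Skeleton

theorem linkAll_lab {D : Skeleton.{u, v, w} K A} {a : D.V} {l : Label K A} :
    (D.linkAll L).lab a = some l ↔ D.lab a = some l ∧ ∀ x ∈ linkNames L, l ≠ .name x := by
  have : (D.linkAll L).lab a = open Classical in
    if ∃ x ∈ linkNames L, D.lab a = some (.name x) then none else D.lab a := rfl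
  rw [this]
  split_ifs with h
  · simp; grind
  · grind

theorem flat_lab {l : Label S.Const A} :
    (flat As).lab u = some l ↔ ∃ a, As[u.1]? = some a ∧ a.lab u.2 = some l :=
  Option.bind_eq_some_iff

theorem Atom.lab_name {a : Atom K A} {s : Slot} : a.lab s = some (.name x) ↔
    (∃ p, s = .inName p ∧ a.ins[p]? = some x) ∨ ∃ q, s = .outName q ∧ a.outs[q]? = some x := by
  cases s <;> simp [Atom.lab]

theorem mem_of_lab {a : Atom K A} {s : Slot} (h : a.lab s = some (.name x)) : x ∈ a.names := by
  obtain ⟨p, -, h⟩ | ⟨p, -, h⟩ := Atom.lab_name.1 h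
  exacts [List.mem_append_left _ (mem_of_getElem? h),
    List.mem_append_right _ (mem_of_getElem? h)]

theorem exists_lab {c : A} (h : c ∈ atomNames As) : ∃ u, (flat As).lab u = some (.name c) := by
  obtain ⟨a, ha, hc⟩ := mem_atomNames.1 h
  obtain ⟨i, hi⟩ := List.getElem?_of_mem ha
  obtain hc | hc := mem_append.1 hc <;> obtain ⟨p, hp⟩ := List.getElem?_of_mem hc
  exacts [⟨(i, .inName p), flat_lab.2 ⟨a, hi, Atom.lab_name.2 (.inl ⟨p, rfl, hp⟩)⟩⟩,
    ⟨(i, .outName p), flat_lab.2 ⟨a, hi, Atom.lab_name.2 (.inr ⟨p, rfl, hp⟩)⟩⟩]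

/-- Every name occurs in one place. -/
theorem flat_inj (h : (atomNames As).Nodup) (hu : (flat As).lab u = some (.name x))
    (hw : (flat As).lab w = some (.name x)) : u = w := by
  obtain ⟨i, s⟩ := u
  obtain ⟨j, s'⟩ := w
  obtain ⟨a, hi, ha⟩ := flat_lab.1 hu
  obtain ⟨b, hj, hb⟩ := flat_lab.1 hw
  dsimp only at *
  obtain ⟨h1, h2⟩ := List.nodup_flatMap.1 h
  have hij : i = j := by
    by_contra hij
    rw [List.pairwise_iff_getElem] at h2
    have ma := mem_of_lab ha
    have mb := mem_of_lab hb
    obtain ⟨li, rfl⟩ := List.getElem?_eq_some_iff.1 hi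
    obtain ⟨lj, rfl⟩ := List.getElem?_eq_some_iff.1 hj
    rcases Nat.lt_or_gt_of_ne hij with h | h
    exacts [h2 _ _ li lj h ma mb, h2 _ _ lj li h mb ma]
  subst hij
  obtain rfl := Option.some.inj (hi.symm.trans hj)
  have hn := h1 a (mem_of_getElem? hi)
  simp only [Atom.names, List.nodup_append] at hn
  obtain ⟨n1, n2, n3⟩ := hn
  have key : ∀ {l : List A} {p q : ℕ}, l.Nodup → l[p]? = some x → l[q]? = some x → p = q := by
    intro l p q hl hp hq
    exact (List.getElem?_inj (List.getElem?_eq_some_iff.1 hp).1 hl).1 (hp.trans hq.symm)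
  obtain ⟨p, rfl, hp⟩ | ⟨p, rfl, hp⟩ := Atom.lab_name.1 ha <;>
    obtain ⟨q, rfl, hq⟩ | ⟨q, rfl, hq⟩ := Atom.lab_name.1 hb
  · rw [key n1 hp hq]
  · exact (n3 x (mem_of_getElem? hp) x (mem_of_getElem? hq) rfl).elim
  · exact (n3 x (mem_of_getElem? hq) x (mem_of_getElem? hp) rfl).elim
  · rw [key n2 hp hq]

/-- A connection from a variable of a link leads to a port. -/
theorem Reduced.inPort_of_edge (hr : Reduced L As) (hx : x ∈ linkNames L)
    (hu : (flat As).lab u = some (.name x)) (h : (flat As).E (.inl u) (.inl w)) :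
    ∃ p, u.2 = .inName p ∧ w = (u.1, .inPort p) := by
  obtain ⟨i, s⟩ := u
  obtain ⟨j, s'⟩ := w
  obtain ⟨rfl, a, ha, h⟩ : i = j ∧ ∃ a, As[i]? = some a ∧ a.Edge s s' := h
  obtain ⟨b, hb, hx'⟩ := flat_lab.1 hu
  obtain rfl := Option.some.inj (ha.symm.trans hb)
  have := fun h0 => hr a (mem_of_getElem? ha) h0 x (mem_of_lab hx') hx
  obtain ⟨p, rfl, hp⟩ | ⟨p, rfl, hp⟩ := Atom.lab_name.1 hx' <;> cases s' <;>
    simp_all [Atom.Edge]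

theorem Reduced.outPort_of_edge (hr : Reduced L As) (hx : x ∈ linkNames L)
    (hw : (flat As).lab w = some (.name x)) (h : (flat As).E (.inl u) (.inl w)) :
    ∃ p, w.2 = .outName p ∧ u = (w.1, .outPort p) := by
  obtain ⟨i, s⟩ := u
  obtain ⟨j, s'⟩ := w
  obtain ⟨rfl, a, ha, h⟩ : i = j ∧ ∃ a, As[i]? = some a ∧ a.Edge s s' := h
  obtain ⟨b, hb, hx'⟩ := flat_lab.1 hw
  obtain rfl := Option.some.inj (ha.symm.trans hb)
  have := fun h0 => hr a (mem_of_getElem? ha) h0 x (mem_of_lab hx') hx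
  obtain ⟨p, rfl, hp⟩ | ⟨p, rfl, hp⟩ := Atom.lab_name.1 hx' <;> cases s <;>
    simp_all [Atom.Edge]

theorem Good.skel (h : Good S π t L As) (hr : Reduced L As) :
    ((nf L As).skel S π).Iso ((flat As).linkAll L) := by
  rw [nf, skel_linkAll h.links.fst_out h.links.snd_in, ← foldl_link h.links.nodup]
  · exact (skel_atomsTerm h.atoms.ok).foldl_link
  · intro p hp q hq a b ha hb he
    obtain ⟨_, _, rfl⟩ := hr.inPort_of_edge (mem_linkNames.2 ⟨p, hp, .inr rfl⟩) ha he
    obtain ⟨c, -, hc⟩ := flat_lab.1 hb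
    simpa using Atom.lab_name.1 hc

/-- The connections of a reduced normal form. -/
theorem Reduced.conn (hr : Reduced L As) : ((flat As).linkAll L).E (.inl u) (.inl w) ↔
    (flat As).E (.inl u) (.inl w) ∨ ∃ p ∈ L, ∃ q r, u.2 = .outPort q ∧ w.2 = .inPort r ∧
      (flat As).lab (u.1, .outName q) = some (.name p.1) ∧
      (flat As).lab (w.1, .inName r) = some (.name p.2) := by
  refine or_congr_right ⟨?_, ?_⟩
  · rintro ⟨p, hp, a, b, ha, hb, h1, h2⟩
    obtain ⟨q, hq, rfl⟩ := hr.outPort_of_edge (mem_linkNames.2 ⟨p, hp, .inl rfl⟩) ha h1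
    obtain ⟨r, hr, rfl⟩ := hr.inPort_of_edge (mem_linkNames.2 ⟨p, hp, .inr rfl⟩) hb h2
    exact ⟨p, hp, q, r, rfl, rfl, hq ▸ ha, hr ▸ hb⟩
  · obtain ⟨i, s⟩ := u
    obtain ⟨j, s'⟩ := w
    rintro ⟨p, hp, q, r, rfl, rfl, ha, hb⟩
    obtain ⟨a, hi, -⟩ := flat_lab.1 ha
    obtain ⟨b, hj, -⟩ := flat_lab.1 hb
    exact ⟨p, hp, _, _, ha, hb, ⟨rfl, a, hi, rfl⟩, rfl, b, hj, rfl⟩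

end Comparison

section Matching

variable {A : Type v} [DecidableEq A] {S : Signature.{u}} {π π' : A → Bool}
  {t t' : A → ℚ} {L L' : List (A × A)} {As As' : List (Atom S.Const A)} {i j p : ℕ} {x : A}
  {e : ℕ × Slot → ℕ × Slot → Prop} {a a' : Atom S.Const A}

open Skeleton

/-- The isomorphism `e` sends the atom `i` to the atom `j`. -/
def Match (As As' : List (Atom S.Const A)) (e : ℕ × Slot → ℕ × Slot → Prop) (i j : ℕ) : Prop :=
  ∃ a a', As[i]? = some a ∧ As'[j]? = some a' ∧ a.body = a'.body ∧
    (a.body = none → a = a' ∧ e (i, .inName 0) (j, .inName 0)) ∧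
    (a.body ≠ none → e (i, .box) (j, .box))

theorem lab_of_slot {l : Label S.Const A} {s : Slot} (ha : As[i]? = some a) (hs : a.lab s = some l)
    (hl : ∀ x ∈ linkNames L, l ≠ .name x) : ((flat As).linkAll L).lab (i, s) = some l :=
  linkAll_lab.2 ⟨flat_lab.2 ⟨a, ha, hs⟩, hl⟩

theorem IsIso.exists_slot (he : IsIso ((flat As).linkAll L) ((flat As').linkAll L') e)
    {l : Label S.Const A} {s : Slot} (ha : As[i]? = some a) (hs : a.lab s = some l)
    (hl : ∀ x ∈ linkNames L, l ≠ .name x) :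
    ∃ j s' a', e (i, s) (j, s') ∧ As'[j]? = some a' ∧ a'.lab s' = some l := by
  have h := lab_of_slot ha hs hl
  obtain ⟨⟨j, s'⟩, hj⟩ := he.total (i, s) (by rw [h]; simp)
  obtain ⟨a', h1, h2⟩ := flat_lab.1 (linkAll_lab.1 ((he.lab _ _ hj).symm.trans h)).1
  exact ⟨j, s', a', hj, h1, h2⟩

theorem IsIso.edge (he : IsIso ((flat As).linkAll L) ((flat As').linkAll L') e)
    {u w u' w' : ℕ × Slot} (hu : e u u') (hw : e w w') :
    ((flat As).linkAll L).E (.inl u) (.inl w) ↔ ((flat As').linkAll L').E (.inl u') (.inl w') :=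
  he.conn _ _ _ _ (.inl hu) (.inl hw)

theorem edge_of_slot {s s' : Slot} (ha : As[i]? = some a) (h : a.Edge s s') :
    ((flat As).linkAll L).E (.inl (i, s)) (.inl (i, s')) :=
  .inl ⟨rfl, a, ha, h⟩

theorem IsIso.exists_match (he : IsIso ((flat As).linkAll L) ((flat As').linkAll L') e)
    (h : Good S π t L As) (h' : Good S π' t' L' As') (hr : Reduced L As) (hr' : Reduced L' As')
    (ha : As[i]? = some a) : ∃ j, Match As As' e i j := by
  have ha' := mem_of_getElem? ha
  rcases hb : a.body with _ | k
  · obtain ⟨y, z, rfl⟩ := (h.atoms.ok a ha').wire hb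
    have hf : ∀ c ∈ [y, z], ∀ x ∈ linkNames L, Label.name (K := S.Const) c ≠ .name x := by
      rintro c hc x hx ⟨⟩
      exact hr _ ha' rfl c hc hx
    obtain ⟨j, s, b, e1, hb, hs⟩ := IsIso.exists_slot he ha (s := .inName 0) rfl (hf y (by simp))
    obtain ⟨j', s', b', e2, hb', hs'⟩ :=
      IsIso.exists_slot he ha (s := .outName 0) rfl (hf z (by simp))
    have := (IsIso.edge he e1 e2).1 (edge_of_slot ha rfl)
    rw [hr'.conn] at this
    obtain ⟨rfl, c, hc, hE⟩ | ⟨_, _, q, _, hq, _⟩ := this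
    · dsimp only at hc hE
      obtain rfl := Option.some.inj (hb.symm.trans hc)
      obtain rfl := Option.some.inj (hb'.symm.trans hc)
      obtain ⟨p, rfl, hp⟩ | ⟨p, rfl, hp⟩ := Atom.lab_name.1 hs <;>
        obtain ⟨q, rfl, hq⟩ | ⟨q, rfl, hq⟩ := Atom.lab_name.1 hs' <;>
        simp only [Atom.Edge] at hE
      obtain ⟨y', z', rfl⟩ := (h'.atoms.ok _ (mem_of_getElem? hc)).wire hE
      cases p <;> cases q <;> simp at hp hq
      subst hp hq
      exact ⟨j, _, _, ha, hc, rfl, fun _ => ⟨rfl, e1⟩, fun h => (h rfl).elim⟩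
    · dsimp only at hq
      subst hq
      simpa using Atom.lab_name.1 hs
  · obtain ⟨j, s, b, e1, hb', hs⟩ := IsIso.exists_slot he ha (s := .box) (l := .box k)
      (by simp [Atom.lab, hb]) (by simp)
    cases s <;> simp [Atom.lab] at hs
    · exact ⟨j, a, b, ha, hb', hb.trans hs.symm, by simp [hb], fun _ => e1⟩

theorem Match.inj (he : IsIso ((flat As).linkAll L) ((flat As').linkAll L') e) {i' : ℕ}
    (h : Match As As' e i j) (h' : Match As As' e i' j) : i = i' := by
  obtain ⟨a, b, ha, hb, hab, h1, h2⟩ := h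
  obtain ⟨a', b', ha', hb', hab', h1', h2'⟩ := h'
  obtain rfl := Option.some.inj (hb.symm.trans hb')
  by_cases h0 : a.body = none
  · exact congrArg Prod.fst ((he.inj _ _ _ _ (h1 h0).2 (h1' (by rw [hab', ← hab, h0])).2).2 rfl)
  · exact congrArg Prod.fst ((he.inj _ _ _ _ (h2 h0) (h2' (by rwa [hab', ← hab]))).2 rfl)

/-- Ports are sent to ports with the same number. -/
theorem Match.port (he : IsIso ((flat As).linkAll L) ((flat As').linkAll L') e)
    (hr' : Reduced L' As') (h : Match As As' e i j) (ha : As[i]? = some a) (h0 : a.body ≠ none) :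
    (p < a.ins.length → e (i, .inPort p) (j, .inPort p)) ∧
      (p < a.outs.length → e (i, .outPort p) (j, .outPort p)) := by
  obtain ⟨b, b', hb, hb', hbb, -, h2⟩ := h
  obtain rfl := Option.some.inj (ha.symm.trans hb)
  obtain ⟨k, hk⟩ := Option.ne_none_iff_exists'.1 h0
  constructor <;> intro hp
  · obtain ⟨j', s, c, e1, hc, hs⟩ := IsIso.exists_slot he ha (s := .inPort p) (l := .inPort k p)
      (by simp [Atom.lab, hk, hp]) (by simp)
    have hE := (IsIso.edge he e1 (h2 h0)).1 (edge_of_slot ha trivial)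
    rw [hr'.conn] at hE
    simp at hE
    obtain ⟨rfl, -⟩ := hE
    cases s <;> simp [Atom.lab] at hs
    obtain ⟨-, _, -, -, rfl⟩ := hs
    exact e1
  · obtain ⟨j', s, c, e1, hc, hs⟩ := IsIso.exists_slot he ha (s := .outPort p) (l := .outPort k p)
      (by simp [Atom.lab, hk, hp]) (by simp)
    have hE := (IsIso.edge he (h2 h0) e1).1 (edge_of_slot ha trivial)
    rw [hr'.conn] at hE
    simp at hE
    obtain ⟨rfl, -⟩ := hE
    cases s <;> simp [Atom.lab] at hs
    obtain ⟨-, _, -, -, rfl⟩ := hs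
    exact e1

/-- Matched atoms have the same shape, and the same free variables. -/
theorem Match.lab (he : IsIso ((flat As).linkAll L) ((flat As').linkAll L') e)
    (h : Good S π t L As) (h' : Good S π' t' L' As') (hr' : Reduced L' As')
    (hm : Match As As' e i j) {s : Slot} (hs : (flat As).lab (i, s) = some (.name x)) :
    ∃ x', (flat As').lab (j, s) = some (.name x') ∧ (x ∉ linkNames L → x' = x) := by
  have hm' := hm
  obtain ⟨a, b, ha, hb, hab, h1, h2⟩ := hm
  obtain ⟨c, hc, hs⟩ := flat_lab.1 hs
  obtain rfl := Option.some.inj (ha.symm.trans hc)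
  have ka := h.atoms.ok _ (mem_of_getElem? ha)
  have kb := h'.atoms.ok _ (mem_of_getElem? hb)
  by_cases h0 : a.body = none
  · obtain ⟨rfl, -⟩ := h1 h0
    exact ⟨x, flat_lab.2 ⟨_, hb, hs⟩, fun _ => rfl⟩
  have hx : ∃ x', (flat As').lab (j, s) = some (.name x') := by
    have e1 : a.ins.length = b.ins.length := ka.dom.trans (hab ▸ kb.dom.symm)
    have e2 : a.outs.length = b.outs.length := ka.cod.trans (hab ▸ kb.cod.symm)
    obtain ⟨p, rfl, hp⟩ | ⟨p, rfl, hp⟩ := Atom.lab_name.1 hs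
    · have := e1 ▸ (List.getElem?_eq_some_iff.1 hp).1
      exact ⟨b.ins[p], flat_lab.2 ⟨b, hb, Atom.lab_name.2 (.inl ⟨p, rfl, by simp⟩)⟩⟩
    · have := e2 ▸ (List.getElem?_eq_some_iff.1 hp).1
      exact ⟨b.outs[p], flat_lab.2 ⟨b, hb, Atom.lab_name.2 (.inr ⟨p, rfl, by simp⟩)⟩⟩
  by_cases hxL : x ∈ linkNames L
  · exact hx.imp fun _ h => ⟨h, fun h => (h hxL).elim⟩
  refine ⟨x, ?_, fun _ => rfl⟩
  obtain ⟨j', s', c, e1, hc', hs'⟩ := IsIso.exists_slot he ha hs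
    (by rintro y hy ⟨⟩; exact hxL hy)
  obtain ⟨p, rfl, hp⟩ | ⟨p, rfl, hp⟩ := Atom.lab_name.1 hs
  · have hE := (IsIso.edge he e1 ((hm'.port he hr' ha h0).1
      (List.getElem?_eq_some_iff.1 hp).1)).1 (edge_of_slot ha rfl)
    rw [hr'.conn] at hE
    obtain ⟨p', rfl, hp'⟩ | ⟨p', rfl, hp'⟩ := Atom.lab_name.1 hs' <;> simp [flat, Atom.Edge] at hE
    obtain ⟨rfl, _, -, rfl⟩ := hE
    exact flat_lab.2 ⟨_, hc', hs'⟩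
  · have hE := (IsIso.edge he ((hm'.port he hr' ha h0).2
      (List.getElem?_eq_some_iff.1 hp).1) e1).1 (edge_of_slot ha rfl)
    rw [hr'.conn] at hE
    obtain ⟨p', rfl, hp'⟩ | ⟨p', rfl, hp'⟩ := Atom.lab_name.1 hs' <;> simp [flat, Atom.Edge] at hE
    obtain ⟨rfl, _, -, rfl⟩ := hE
    exact flat_lab.2 ⟨_, hc', hs'⟩

/-- The correspondence between the atoms of isomorphic normal forms is given by a renaming of the
bound variables. -/
theorem IsIso.exists_renaming (he : IsIso ((flat As).linkAll L) ((flat As').linkAll L') e)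
    (h : Good S π t L As) (h' : Good S π' t' L' As') (hr : Reduced L As) (hr' : Reduced L' As') :
    ∃ (ρ : A → A) (g : Fin As.length → Fin As'.length), g.Injective ∧
      (∀ i, As'[g i] = As[i].map ρ) ∧ Set.InjOn ρ {c | c ∈ atomNames As} ∧
      (∀ c ∈ atomNames As, c ∉ linkNames L → ρ c = c) ∧ ∀ p ∈ L, (ρ p.1, ρ p.2) ∈ L' := by
  have hg (i : Fin As.length) : ∃ j : Fin As'.length, Match As As' e i j := by
    obtain ⟨j, hj⟩ := IsIso.exists_match he h h' hr hr' (List.getElem?_eq_getElem i.2)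
    obtain ⟨_, _, -, hb, -⟩ := id hj
    exact ⟨⟨j, (List.getElem?_eq_some_iff.1 hb).1⟩, hj⟩
  choose g hg using hg
  have hρ (c : A) : ∃ c', ∀ (i : Fin As.length) s, (flat As).lab (i.1, s) = some (.name c) →
      (flat As').lab ((g i).1, s) = some (.name c') ∧ (c ∉ linkNames L → c' = c) := by
    by_cases hc : ∃ (i : Fin As.length) (s : Slot), (flat As).lab (i.1, s) = some (.name c)
    · obtain ⟨i, s, hi⟩ := hc
      obtain ⟨c', hc'⟩ := (hg i).lab he h h' hr' hi
      refine ⟨c', fun i' s' hi' => ?_⟩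
      obtain ⟨h1, rfl⟩ := Prod.mk.inj (flat_inj h.atoms.nodup hi hi')
      obtain rfl := Fin.ext h1
      exact hc'
    · exact ⟨c, fun i s hi => (hc ⟨i, s, hi⟩).elim⟩
  choose ρ hρ using hρ
  have hex : ∀ c ∈ atomNames As, ∃ (i : Fin As.length) (s : Slot),
      (flat As).lab (i.1, s) = some (.name c) := by
    intro c hc
    obtain ⟨⟨i, s⟩, hi⟩ := exists_lab hc
    obtain ⟨a, ha, -⟩ := flat_lab.1 hi
    exact ⟨⟨i, (List.getElem?_eq_some_iff.1 ha).1⟩, s, hi⟩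
  have hgi : g.Injective := fun i i' hi => Fin.ext ((hg i).inj he (hi ▸ hg i'))
  refine ⟨ρ, g, hgi, fun i => ?_, fun c hc c' hc' hcc => ?_, fun c hc hcL => ?_, fun p hp => ?_⟩
  · obtain ⟨a, b, ha, hb, hab, -⟩ := hg i
    have ka := h.atoms.ok _ (mem_of_getElem? ha)
    have kb := h'.atoms.ok _ (mem_of_getElem? hb)
    have key : ∀ s x, a.lab s = some (.name x) → b.lab s = some (.name (ρ x)) := by
      intro s x hs
      obtain ⟨c, hc, hs'⟩ := flat_lab.1 (hρ x i s (flat_lab.2 ⟨_, ha, hs⟩)).1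
      grind
    rw [show As[i] = a from Option.some.inj ((List.getElem?_eq_getElem i.2).symm.trans ha),
      show As'[g i] = b from Option.some.inj ((List.getElem?_eq_getElem (g i).2).symm.trans hb)]
    have e1 : b.ins.length = a.ins.length := kb.dom.trans (hab ▸ ka.dom.symm)
    have e2 : b.outs.length = a.outs.length := kb.cod.trans (hab ▸ ka.cod.symm)
    have k1 : b.ins = a.ins.map ρ := List.ext_getElem (by simp [e1]) fun p h1 h2 => by
      simpa [Atom.lab, h1] using key (.inName p) (a.ins[p]'(e1 ▸ h1)) (by simp [Atom.lab])
    have k2 : b.outs = a.outs.map ρ := List.ext_getElem (by simp [e2]) fun p h1 h2 => by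
      simpa [Atom.lab, h1] using key (.outName p) (a.outs[p]'(e2 ▸ h1)) (by simp [Atom.lab])
    cases b
    simp_all [Atom.map]
  · obtain ⟨i, s, hi⟩ := hex c hc
    obtain ⟨i', s', hi'⟩ := hex c' hc'
    obtain ⟨h1, rfl⟩ := Prod.mk.inj (flat_inj h'.atoms.nodup (hρ c i s hi).1
      (hcc ▸ (hρ c' i' s' hi').1))
    obtain rfl := hgi (Fin.ext h1)
    simpa [hi'] using hi.symm
  · obtain ⟨i, s, hi⟩ := hex c hc
    exact (hρ c i s hi).2 hcL
  · have hout : ∃ (i : Fin As.length) (q : ℕ), (flat As).lab (i.1, .outName q) = some (.name p.1) ∧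
        e (i.1, .outPort q) ((g i).1, .outPort q) := by
      obtain ⟨i, s, hi⟩ := hex p.1 (by simpa using h.links.fst_mem p hp)
      obtain ⟨a, ha, hs⟩ := flat_lab.1 hi
      have hm := mem_of_getElem? ha
      obtain ⟨q, rfl, hq⟩ | ⟨q, rfl, hq⟩ := Atom.lab_name.1 hs
      · have := (h.atoms.ok a hm).ins_in _ (mem_of_getElem? hq)
        simp [h.links.fst_out p hp] at this
      · exact ⟨i, q, hi, ((hg i).port he hr' ha fun h0 => hr a hm h0 _ (mem_of_lab hs)
          (mem_linkNames.2 ⟨p, hp, .inl rfl⟩)).2 (List.getElem?_eq_some_iff.1 hq).1⟩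
    have hin : ∃ (i : Fin As.length) (q : ℕ), (flat As).lab (i.1, .inName q) = some (.name p.2) ∧
        e (i.1, .inPort q) ((g i).1, .inPort q) := by
      obtain ⟨i, s, hi⟩ := hex p.2 (by simpa using h.links.snd_mem p hp)
      obtain ⟨a, ha, hs⟩ := flat_lab.1 hi
      have hm := mem_of_getElem? ha
      obtain ⟨q, rfl, hq⟩ | ⟨q, rfl, hq⟩ := Atom.lab_name.1 hs
      · exact ⟨i, q, hi, ((hg i).port he hr' ha fun h0 => hr a hm h0 _ (mem_of_lab hs)
          (mem_linkNames.2 ⟨p, hp, .inr rfl⟩)).1 (List.getElem?_eq_some_iff.1 hq).1⟩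
      · have := (h.atoms.ok a hm).outs_out _ (mem_of_getElem? hq)
        simp [h.links.snd_in p hp] at this
    obtain ⟨i, q, h1, e1⟩ := hout
    obtain ⟨j, r, h2, e2⟩ := hin
    have hE := (IsIso.edge he e1 e2).1 (hr.conn.2 (.inr ⟨p, hp, q, r, rfl, rfl, h1, h2⟩))
    rw [hr'.conn] at hE
    obtain ⟨_, _, _, h0⟩ | ⟨p', hp', q', r', hq, hr, h3, h4⟩ := hE
    · exact h0.elim
    · cases hq
      cases hr
      have h3 := h3.symm.trans (hρ _ i _ h1).1
      have h4 := h4.symm.trans (hρ _ j _ h2).1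
      simp only [Option.some.injEq, Label.name.injEq] at h3 h4
      rwa [← h3, ← h4]

theorem nodup_of_linkNames : ∀ {L : List (A × A)}, (linkNames L).Nodup → L.Nodup
  | [], _ => .nil
  | p :: L, h => by
    rw [linkNames_cons] at h
    refine .cons (fun hp => ?_) (nodup_of_linkNames h.tail.tail)
    exact (nodup_cons.1 h).1 (List.mem_cons_of_mem _ (mem_linkNames.2 ⟨p, hp, .inl rfl⟩))

theorem subperm_of_injective {α : Type*} {l l' : List α} (g : Fin l.length → Fin l'.length)
    (hg : g.Injective) (h : ∀ i, l'[g i] = l[i]) : l.Subperm l' := by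
  have e1 : (Finset.univ.val.map fun i : Fin l.length => l[i]) = (l : Multiset α) := by
    rw [Fin.univ_val_map]; simp
  have e2 : (Finset.univ.val.map fun i : Fin l'.length => l'[i]) = (l' : Multiset α) := by
    rw [Fin.univ_val_map]; simp
  rw [← Multiset.coe_le, ← e1, ← e2]
  have : (Finset.univ.val.map fun i : Fin l.length => l[i]) =
      (Finset.univ.map ⟨g, hg⟩).val.map fun i => l'[i] := by
    rw [Finset.map_val, Multiset.map_map]
    exact Multiset.map_congr rfl fun i _ => (h i).symm
  rw [this]
  exact Multiset.map_le_map (Finset.val_le_iff.2 (Finset.subset_univ _))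

theorem Good.eqv_of_iso (h : Good S π t L As) (h' : Good S π' t' L' As') (hr : Reduced L As)
    (hr' : Reduced L' As') (he : ((nf L As).skel S π).Iso ((nf L' As').skel S π'))
    (hπ : ∀ c ∈ (nf L' As').fv, π' c = π c) (hd : ∀ c ∈ linkNames L', c ∉ atomNames As) : Eqv S π 0
        0 (nf L As) (nf L' As') := by
  obtain ⟨e, he⟩ := ((h.skel hr).symm.trans he).trans (h'.skel hr')
  obtain ⟨e', he'⟩ := (Skeleton.Iso.symm ⟨e, he⟩)
  obtain ⟨ρ, g, g1, g2, g3, g4, g5⟩ := IsIso.exists_renaming he h h' hr hr'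
  obtain ⟨ρ', f, f1, f2, f3, -, f5⟩ := IsIso.exists_renaming he' h' h hr' hr
  have sub : ∀ {π t} {L : List (A × A)} {As : List (Atom S.Const A)}, Good S π t L As →
      ∀ c ∈ linkNames L, c ∈ atomNames As := by
    intro π t L As h c hc
    obtain ⟨p, hp, rfl | rfl⟩ := mem_linkNames.1 hc
    exacts [by simpa using h.links.fst_mem p hp, by simpa using h.links.snd_mem p hp]
  have links : ∀ {π t} {L L' : List (A × A)} {As : List (Atom S.Const A)} {ρ : A → A},
      Good S π t L As → Set.InjOn ρ {c | c ∈ atomNames As} → (∀ p ∈ L, (ρ p.1, ρ p.2) ∈ L') →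
      (L.map (Prod.map ρ ρ)).Subperm L' := by
    intro π t L L' As ρ h h1 h2
    refine List.subperm_of_subset ?_ fun q hq => ?_
    · have := nodup_map h.links.nodup (h1.mono fun c hc => sub h c hc)
      rw [← linkNames_map] at this
      exact nodup_of_linkNames this
    · obtain ⟨p, hp, rfl⟩ := List.mem_map.1 hq
      exact h2 p hp
  have pL : (L.map (Prod.map ρ ρ)).Perm L' := (links h g3 g5).perm_of_length_le (by
    simpa using (links h' f3 f5).length_le)
  have pA : (As.map (Atom.map ρ)).Perm As' := by
    refine (subperm_of_injective (fun i => g (i.cast (by simp))) (fun i j hij => ?_)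
      fun i => by rw [g2]; simp).perm_of_length_le (by simpa using Fintype.card_le_of_injective f f1)
    simpa [Fin.ext_iff] using g1 hij
  have e := h.alpha (g3.mono fun c hc => sub h c hc) (fun c hc => hd _ ?_) g4
  · exact e.trans ((h'.eqv_perm pL.symm pA.symm).congr hπ).symm
  · have := List.mem_map_of_mem (f := ρ) hc
    rw [← linkNames_map] at this
    obtain ⟨p, hp, h⟩ := mem_linkNames.1 this
    exact mem_linkNames.2 ⟨p, pL.subset hp, h⟩

end Matching

/-! ### Completeness -/

section Completeness

variable {A : Type v} [DecidableEq A] {S : Signature.{u}} {π : A → Bool} {t t' : A → ℚ}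
  {M N : Term S.Const A} {m n : ℕ}

/-- There are fresh variables for all inputs and outputs. -/
theorem exists_attach [Infinite A] (π : A → Bool) (s : Finset A) (m n : ℕ) :
    ∃ (as bs : List A) (π' : A → Bool), as.length = m ∧ bs.length = n ∧ (∀ c ∈ s, π c = π' c) ∧
      ∀ t : A → ℚ, ∃ t', (∀ c ∈ s, t c = t' c) ∧ Attach π' t' as bs s := by
  obtain ⟨as, ha, ha', has⟩ := exists_fresh_list s m
  obtain ⟨bs, hb, hb', hbs⟩ := exists_fresh_list (s ∪ as.toFinset) n
  simp only [mem_union, mem_toFinset, not_or] at hbs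
  refine ⟨as, bs, fun c => if c ∈ as then true else if c ∈ bs then false else π c, ha, hb,
    by grind, fun t => ?_⟩
  obtain ⟨B, hB, hB'⟩ : ∃ B : ℚ, 0 < B ∧ ∀ c ∈ s, |t c| < B :=
    ⟨(∑ c ∈ s, |t c|) + 1, by positivity, fun c hc =>
      lt_of_le_of_lt (Finset.single_le_sum (f := fun c => |t c|) (fun _ _ => abs_nonneg _) hc)
        (by simp)⟩
  simp only [abs_lt] at hB'
  refine ⟨fun c => if c ∈ as then -B else if c ∈ bs then B else t c, by grind, ha', hb', by grind,
    by grind, ?_, ?_, ?_⟩ <;> intro a h b h' <;> simp only [mem_toFinset] at h h' <;> grind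

theorem Eqv.of_skel [Infinite A] (hM : Timed S π t M m n) (hN : Timed S π t' N m n)
    (hfv : M.fv = N.fv) (h : (M.skel S π).Iso (N.skel S π)) : Eqv S π m n M N := by
  obtain ⟨as, bs, π1, ha, hb, hπ, hA⟩ := exists_attach π M.fv m n
  obtain ⟨t1, ht, hAM⟩ := hA t
  obtain ⟨t1', ht', hAN⟩ := hA t'
  replace hM := hM.congr hπ ht
  rw [hfv] at ht' hAN
  replace hN := hN.congr (hfv ▸ hπ) ht'
  have hiso : ((closed as M bs).skel S π1).Iso ((closed as N bs).skel S π1) := by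
    rw [skel_congr hπ, skel_congr (M := N) (π' := π1) (hfv ▸ hπ)] at h
    exact (Skeleton.Iso.refl _).seq (h.seq (.refl _))
  have hcfv : (closed as M bs).fv = (closed as N bs).fv := by simp [hfv]
  have nf_of {π : A → Bool} {t : A → ℚ} {P : Term S.Const A} {F : Finset A} (h : HasNF S π t F P) :
      ∃ L As π' t', (∀ c ∈ P.fv, π c = π' c) ∧ Good S π' t' L As ∧ Reduced L As ∧
        Eqv S π' 0 0 P (nf L As) ∧ (∀ c ∈ linkNames L, c ∉ F) ∧
        (P.skel S π).Iso ((nf L As).skel S π') := by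
    obtain ⟨L, As, π', t', hc, hg, he, hF⟩ := h
    obtain ⟨L', As', hg', he', hr, hL⟩ := Good.exists_reduced _ rfl hg
    refine ⟨L', As', π', t', fun c h => (hc c h).1, hg', hr, he.trans he', fun c h => hF c (hL c h),
        ?_⟩
    rw [skel_congr fun c h => (hc c h).1]
    exact (he.trans he').2.skel (polarized_ins_outs _)
  obtain ⟨L, As, π2, t2, c2, g2, r2, e2, -, i2⟩ := nf_of (hasNF_closed _ le_rfl hM hAM ha hb ∅)
  obtain ⟨L', As', π3, t3, c3, g3, r3, e3, d3, i3⟩ :=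
    nf_of (hasNF_closed _ le_rfl hN hAN ha hb (atomNames As).toFinset)
  have e := g2.eqv_of_iso g3 r2 r3 ((i2.symm.trans hiso).trans i3) (fun c hc => ?_)
    (by simpa using d3)
  · refine .congr (.of_closed (((e2.trans e).congr fun c hc => (c2 c hc).symm).trans
      (e3.congr fun c hc => (c3 c hc).symm).symm) hM hN hfv ha hb hAM hAN) fun c hc =>
          (hπ c hc).symm
  · rw [← e3.1] at hc
    rw [← c3 c hc, ← c2 c (hcfv ▸ hc)]

end Completeness

end LinkSyntax

/-- Soundness (left to right) and completeness (right to left) of the equational theory of uniflow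
diagrams: two terms of the same type are provably equal if and only if they denote the same
framed point DAG, whatever their typing derivations and anchors. -/
theorem mainTheorem1 (S : LinkSyntax.Signature.{u}) (A : Type v) [DecidableEq A] [Infinite A]
    (Γ Δ : Finset A) (m n : ℕ) (M N : LinkSyntax.Term S.Const A) (R R' : A → A → Prop)
    (d : LinkSyntax.Deriv S Γ Δ M m n R) (d' : LinkSyntax.Deriv S Γ Δ N m n R') :
    LinkSyntax.EqThy S Γ Δ m n M N ↔ d.interp = d'.interp := by
  classical
  obtain ⟨π, hπ⟩ := d.exists_polarized
  obtain ⟨h1, -, -, h2⟩ := d.skel_iso hπ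
  obtain ⟨h1', -, -, h2'⟩ := d'.skel_iso hπ
  have key := LinkSyntax.LIDAG.homeo_iff_skel_iso (G := d.lidag) (H := d'.lidag) h1 h1'
  refine ⟨fun h => Quotient.sound (key.2 ((h2.trans (h.skel hπ)).trans h2'.symm)), fun h => ?_⟩
  have hi := (h2.symm.trans (key.1 (Quotient.exact h))).trans h2'
  obtain ⟨t, ht⟩ := LinkSyntax.HasType.timed ⟨R, ⟨d⟩⟩ hπ
  obtain ⟨t', ht'⟩ := LinkSyntax.HasType.timed ⟨R', ⟨d'⟩⟩ hπ
  obtain ⟨hΓ, hΔ⟩ := hπ.eq_ins d.union_eq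
  have := (LinkSyntax.Eqv.of_skel ht ht' (d.union_eq.symm.trans d'.union_eq) hi).2
  rwa [← hΓ, ← hΔ] at this
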